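/- Let $\mathbb F_q$ be a finite field, $A=\mathbb F_q[T]$, $k=\mathbb F_q(T)$, $\pi=1/T$, $k_\infty=\mathbb F_q((\pi))$ with $|\pi|=1/q$, $A_\infty=\mathbb F_q[[\pi]]$, and let $\mathbb C_\infty$ be the completion of an algebraic closure of $k_\infty$. Let $G\subset GL_2(k)$ be an arithmetic subgroup: for some projective $A$-submodule $Y\subset k\oplus k$ of rank two and some nonzero ideal $\mathfrak a$ of $A$, $G$ is contained in $GL(Y)$ and contains the kernel of $GL(Y)\to GL(Y/\mathfrak aY)$. Let $n\ge 2$ and $h=\lceil (n-2)/2\rceil$. *Tree.* The vertices of the Bruhat–Tits tree are the homothety classes of $A_\infty$-lattices in $k_\infty\oplus k_\infty$; an oriented edge $e$ is an ordered pair of classes $([L],[L'])$ with $L'\subset L$ and $L/L'\cong A_\infty/\pi A_\infty$ for suitable representatives; $GL_2(k_\infty)$ acts naturally. The ends of the tree (infinite paths without back-tracking up to finite initial parts) are identified with $\mathbb P^1(k_\infty)$: $\infty$ corresponds to the path $[A_\infty\oplus\pi^mA_\infty]_{m\ge 0}$, and $x\in k_\infty$ to the path $[\pi^mv_1,\,xv_1+v_2]_{m\ge0}$,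 where $v_1,v_2$ is the standard basis. $U(e)\subset\mathbb P^1(k_\infty)$ is the set of ends passing through $e$. *Cocycles.* $C_{\rm har}(G,n)$ is the space of functions $c$ on oriented edges with values in the $\mathbb C_\infty$-dual of the space of homogeneous polynomials of degree $n-2$ in $\mathbb C_\infty[X,Y]$ such that $\sum_e c(e)=0$, the sum over all edges $e$ with a given terminal vertex; $c(e)+c(\bar e)=0$ for opposite edges; and $c(\gamma e)(P(X,Y))=\det(\gamma)\,c(e)(P(aX+bY,cX+dY))$ for $\gamma=\begin{pmatrix}a&b\\c&d\end{pmatrix}\in G$. *Functions and measures.* For $l\in\mathbb Z$ put $B_a(|\pi|^l)=\{|x-a|\le|\pi|^l\}$ for $a\in k_\infty$, and $B_\infty(|\pi|^l)=\{|x|\ge|\pi|^{-l}\}\cup\{\infty\}$. On a ball in $k_\infty$ a function is $C^h$ if its $h$-th order difference quotient $\Phi_hf$, defined on tuples of distinct points, extends continuously to all tuples; its norm is $\max_{j\le h}\|\Phi_jf\|_\infty$; on $B_\infty$ the parameter $1/x$ is used. $C^h(\mathbb P^1(k_\infty))$ is the space of functions $\mathbb P^1(k_\infty)\to\mathbb C_\infty$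 that are $C^h$ on each ball of the decomposition of $\mathbb P^1(k_\infty)$ into balls of radius $|\pi|$, with the maximum of the norms; $C^h(\mathbb P^1(k_\infty))^*$ is its continuous dual. For $\mu$ in the dual, $\int_Uf\,d\mu$ denotes the value of $\mu$ at the function equal to $f$ on $U$ and $0$ elsewhere. $\mu$ is $h$-admissible if there is a constant $C$ with $\left|\int_{B_a(|\pi|^l)}(x-a)^j\,d\mu\right|\le C|\pi|^{l(j-h)}$ for all $0\le j\le h$, all sufficiently large $l$ and all $a\in\mathbb P^1(k_\infty)$, where $x-a$ is read as $1/x$ if $a=\infty$. Integrals near $\infty$ are understood as limits: for a polynomial $f$ and $U=U(e)$ or $U=\mathbb P^1(k_\infty)$ put $\int_Uf\,d\mu=\lim_{l\to\infty}\int_{U\setminus B_\infty(|\pi|^{l})}f\,d\mu$ (when the limit exists), and consider the condition $$(\ast)\qquad \int_{B_\infty(|\pi|^m)}x^{-i}\,d\mu=\lim_{l\to\infty}\int_{B_\infty(|\pi|^m)\setminus B_\infty(|\pi|^{l})}x^{-i}\,d\mu\qquad(m\in\mathbb Z,\ i\ge0).$$ **Statement.** For every $c\in C_{\rm har}(G,n)$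 there is a unique $\mu_c\in C^h(\mathbb P^1(k_\infty))^*$ which satisfies $(\ast)$ and $$\int_{U(e)}x^i\,d\mu_c=c(e)(X^iY^{n-2-i})\qquad\text{for all edges $e$ and all } 0\le i\le n-2.$$ The map $c\mapsto\mu_c$ is $\mathbb C_\infty$-linear and injective, and its image is the set of all $h$-admissible $\mu\in C^h(\mathbb P^1(k_\infty))^*$ which satisfy $(\ast)$ and, for all polynomials $f\in\mathbb C_\infty[x]$ of degree at most $n-2$, $$\int_{U(\gamma e)}f(x)\,d\mu=\int_{U(e)}\det(\gamma)\,f(\gamma x)\,(cx+d)^{n-2}\,d\mu\qquad\Bigl(\gamma=\begin{pmatrix}a&b\\c&d\end{pmatrix}\in G,\ e\text{ an edge}\Bigr),$$ $$\int_{\mathbb P^1(k_\infty)}f(x)\,d\mu=0,$$ all these limits being required to exist. -/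

import Mathlib

open scoped NNReal Topology WithZero

noncomputable section

namespace CharPMeasure

/-- The local field `k_∞ = F((π))`, `π = 1/T`: Laurent series in the variable `π`. -/
abbrev Kinf (F : Type*) [Field F] : Type _ := LaurentSeries F
/-- Its ring of integers `A_∞ = F[[π]]`. -/
abbrev Ainf (F : Type*) [Field F] : Type _ := PowerSeries F

section Fields
variable (F : Type*) [Field F]

/-- The uniformizer `π` of `k_∞`. -/
def unif : Kinf F := HahnSeries.single 1 1
/-- The element `T = π⁻¹` of `k_∞`. -/
def tInf : Kinf F := HahnSeries.single (-1) 1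

/-- The embedding `F[T] → k_∞` with `T ↦ π⁻¹`. -/
def polyEmb : Polynomial F →+* Kinf F := Polynomial.eval₂RingHom HahnSeries.C (tInf F)

theorem coeff_polyEmb (p : Polynomial F) (n : ℕ) :
    (polyEmb F p).coeff (-(n : ℤ)) = p.coeff n := by
  have hpow : ∀ k : ℕ, (tInf F) ^ k = HahnSeries.single (-(k : ℤ)) 1 := by
    intro k
    rw [tInf, HahnSeries.single_pow]; simp
  rw [polyEmb, Polynomial.coe_eval₂RingHom,
    Polynomial.eval₂_eq_sum_range' _ (n := max (p.natDegree + 1) (n + 1)) (by omega),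
    HahnSeries.coeff_sum, Finset.sum_eq_single n]
  · rw [hpow, HahnSeries.C_mul_eq_smul]; simp
  · intro b _ hb
    rw [hpow, HahnSeries.C_mul_eq_smul, HahnSeries.coeff_smul,
      HahnSeries.coeff_single_of_ne (by omega), smul_zero]
  · intro hn
    simp at hn

theorem polyEmb_injective : Function.Injective (polyEmb F) := by
  intro p p' hpp
  ext n
  rw [← coeff_polyEmb, ← coeff_polyEmb, hpp]

/-- The embedding `k = F(T) → k_∞` with `T ↦ π⁻¹`. -/
def kEmb : RatFunc F →+* Kinf F := IsFractionRing.lift (polyEmb_injective F)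

theorem kEmb_X : kEmb F RatFunc.X = tInf F := by
  rw [← RatFunc.algebraMap_X, kEmb, IsFractionRing.lift_algebraMap]
  simp [polyEmb]

variable [Fintype F]

theorem card_ne_zero : (Fintype.card F : ℝ≥0) ≠ 0 := by
  simp

theorem one_lt_card : (1 : ℝ≥0) < (Fintype.card F : ℝ≥0) := by
  exact_mod_cast Fintype.one_lt_card

/-- The valuation of `k_∞` is turned into a real absolute value with `|π| = 1/q`, `q = #F`
(see `norm_unif`). -/
instance rankOneKinf : (Valued.v : Valuation (Kinf F) ℤᵐ⁰).RankOne where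
  hom' := (WithZeroMulInt.toNNReal (card_ne_zero F)).comp
    MonoidWithZeroHom.ValueGroup₀.embedding
  strictMono' := (WithZeroMulInt.toNNReal_strictMono (one_lt_card F)).comp
    MonoidWithZeroHom.ValueGroup₀.embedding_strictMono
  exists_val_nontrivial := by
    refine ⟨unif F, ?_, ?_⟩
    · simp [unif]
    · rw [unif, LaurentSeries.valuation_single_zpow]
      rw [← WithZero.exp_zero, Ne, WithZero.exp_inj]
      norm_num

instance normedKinf : NontriviallyNormedField (Kinf F) :=
  Valued.toNontriviallyNormedField (Kinf F) ℤᵐ⁰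

instance : IsUltrametricDist (Kinf F) := inferInstanceAs (IsUltrametricDist (LaurentSeries F))
instance : CompleteSpace (Kinf F) := LaurentSeries.instLaurentSeriesComplete

theorem norm_unif : ‖unif F‖ = (Fintype.card F : ℝ)⁻¹ := by
  have h1 : (Valued.v (unif F) : ℤᵐ⁰) = WithZero.exp (-1 : ℤ) := by
    rw [unif, LaurentSeries.valuation_single_zpow]
  have h2 : MonoidWithZeroHom.ValueGroup₀.embedding
      ((Valued.v : Valuation (Kinf F) ℤᵐ⁰).restrict (unif F)) = WithZero.exp (-1 : ℤ) := by
    rw [Valuation.embedding_restrict, h1]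
  change ((WithZeroMulInt.toNNReal (card_ne_zero F) (MonoidWithZeroHom.ValueGroup₀.embedding
      ((Valued.v : Valuation (Kinf F) ℤᵐ⁰).restrict (unif F))) : ℝ≥0) : ℝ) = _
  rw [h2, WithZeroMulInt.toNNReal_neg_apply _ WithZero.exp_ne_zero]
  change (((Fintype.card F : ℝ≥0) ^ (-1 : ℤ) : ℝ≥0) : ℝ) = _
  simp

/-- The algebraic closure of `k_∞`, with the unique extension of the absolute value. -/
abbrev KinfAlg : Type _ := AlgebraicClosure (Kinf F)
instance : NormedField (KinfAlg F) := spectralNorm.normedField (Kinf F) (KinfAlg F)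
instance : NormedAlgebra (Kinf F) (KinfAlg F) := spectralNorm.normedAlgebra (Kinf F) (KinfAlg F)
/-- The field `C_∞`, the completion of the algebraic closure of `k_∞`. -/
abbrev Cinf : Type _ := UniformSpace.Completion (KinfAlg F)

theorem norm_algebraMap_Cinf (x : Kinf F) : ‖algebraMap (Kinf F) (Cinf F) x‖ = ‖x‖ := by
  simp

end Fields

section Tree

open PowerSeries

variable (F : Type*) [Field F]

/-- The space `V = k_∞ ⊕ k_∞` (column vectors). -/
abbrev Vec : Type _ := Fin 2 → Kinf F

/-- A lattice: the `A_∞`-span of a `k_∞`-basis of `V`, i.e. a free `A_∞`-submodule of rank two. -/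
def IsLattice (L : Submodule (Ainf F) (Vec F)) : Prop :=
  ∃ b : Module.Basis (Fin 2) (Kinf F) (Vec F), L = Submodule.span (Ainf F) (Set.range b)

def Lattice : Type _ := {L : Submodule (Ainf F) (Vec F) // IsLattice F L}

variable {F}

def Lattice.map (φ : Vec F ≃ₗ[Kinf F] Vec F) (L : Lattice F) : Lattice F :=
  ⟨L.1.map (φ.toLinearMap.restrictScalars (Ainf F)), by
    obtain ⟨L, b, rfl⟩ := L
    refine ⟨b.map φ, ?_⟩
    rw [Submodule.map_span, ← Set.range_comp]
    rfl⟩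

theorem Lattice.map_map (φ ψ : Vec F ≃ₗ[Kinf F] Vec F) (L : Lattice F) :
    (L.map φ).map ψ = L.map (φ.trans ψ) := by
  apply Subtype.ext
  simp only [Lattice.map, ← Submodule.map_comp]
  rfl

theorem Lattice.map_refl (L : Lattice F) : L.map (LinearEquiv.refl _ _) = L := by
  apply Subtype.ext
  exact Submodule.map_id _

def homothety (u : (Kinf F)ˣ) : Vec F ≃ₗ[Kinf F] Vec F := LinearEquiv.smulOfUnit u

theorem homothety_trans (u w : (Kinf F)ˣ) :
    (homothety u).trans (homothety w) = homothety (w * u) := by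
  ext1 v
  exact (mul_smul w u v).symm

theorem homothety_one : homothety (1 : (Kinf F)ˣ) = LinearEquiv.refl _ _ := by
  ext1 v
  exact one_smul (Kinf F)ˣ v

variable (F) in
instance latticeSetoid : Setoid (Lattice F) where
  r L L' := ∃ u : (Kinf F)ˣ, L' = L.map (homothety u)
  iseqv :=
    { refl := fun L => ⟨1, by rw [homothety_one, Lattice.map_refl]⟩
      symm := by
        rintro L _ ⟨u, rfl⟩
        exact ⟨u⁻¹, by
          rw [Lattice.map_map, homothety_trans, inv_mul_cancel, homothety_one, Lattice.map_refl]⟩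
      trans := by
        rintro L _ _ ⟨u, rfl⟩ ⟨w, rfl⟩
        exact ⟨w * u, by rw [Lattice.map_map, homothety_trans]⟩ }

variable (F) in
/-- Vertices of the tree: lattices up to homothety. -/
def Vertex : Type _ := Quotient (latticeSetoid F)

/-- `d(v, w) = 1`: there are lattices `L` in `v` and `M ⊆ L` in `w` with `L / M ≅ A_∞ / π A_∞`. -/
def IsAdj (v w : Vertex F) : Prop :=
  ∃ L M : Lattice F, (⟦L⟧ : Vertex F) = v ∧ (⟦M⟧ : Vertex F) = w ∧ M.1 ≤ L.1 ∧
    Nonempty ((L.1 ⧸ M.1.comap L.1.subtype) ≃ₗ[Ainf F]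
      (Ainf F ⧸ Ideal.span {(PowerSeries.X : Ainf F)}))

variable (F) in
/-- Oriented edges of the tree. -/
@[ext]
structure Edge where
  src : Vertex F
  tgt : Vertex F
  adj : IsAdj src tgt

/-- The natural action of `GL₂(k_∞)` on `V`. -/
def actLin (g : GL (Fin 2) (Kinf F)) : Vec F ≃ₗ[Kinf F] Vec F :=
  Matrix.toLin'OfInv (M := g⁻¹.1) (M' := g.1) (by simp) (by simp)

theorem actLin_apply (g : GL (Fin 2) (Kinf F)) (v : Vec F) : actLin g v = g.1.mulVec v := by
  simp [actLin, Matrix.toLin'OfInv]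

theorem homothety_trans_comm (u : (Kinf F)ˣ) (φ : Vec F ≃ₗ[Kinf F] Vec F) :
    (homothety u).trans φ = φ.trans (homothety u) := by
  ext1 v
  exact φ.map_smul (u : Kinf F) v

def Vertex.act (g : GL (Fin 2) (Kinf F)) : Vertex F → Vertex F :=
  Quotient.map (Lattice.map (actLin g)) (by
    rintro L _ ⟨u, rfl⟩
    exact ⟨u, by rw [Lattice.map_map, Lattice.map_map, homothety_trans_comm]⟩)

theorem IsAdj.act (g : GL (Fin 2) (Kinf F)) {v w : Vertex F} (h : IsAdj v w) :
    IsAdj (v.act g) (w.act g) := by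
  obtain ⟨L, M, rfl, rfl, hle, ⟨f⟩⟩ := h
  refine ⟨L.map (actLin g), M.map (actLin g), rfl, rfl, Submodule.map_mono hle, ⟨?_⟩⟩
  let e : L.1 ≃ₗ[Ainf F] (L.map (actLin g)).1 :=
    ((actLin g).restrictScalars (Ainf F)).submoduleMap L.1
  refine (Submodule.Quotient.equiv _ _ e ?_).symm.trans f
  ext ⟨x, hx⟩
  simp only [Submodule.mem_map, Submodule.mem_comap, Submodule.subtype_apply]
  constructor
  · rintro ⟨y, hy, hyx⟩
    exact ⟨y.1, hy, congrArg Subtype.val hyx⟩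
  · rintro ⟨y, hy, hyx⟩
    exact ⟨⟨y, hle hy⟩, hy, Subtype.ext hyx⟩

def Edge.act (g : GL (Fin 2) (Kinf F)) (e : Edge F) : Edge F :=
  ⟨e.src.act g, e.tgt.act g, e.adj.act g⟩

variable (F) in
theorem finite_Ainf_quotient [Finite F] : Finite (Ainf F ⧸ Ideal.span {(PowerSeries.X : Ainf F)}) := by
  refine Finite.of_injective
    (Ideal.Quotient.lift (Ideal.span {(PowerSeries.X : Ainf F)}) (PowerSeries.constantCoeff (R := F))
      ?_) ?_
  · intro a ha
    rw [Ideal.mem_span_singleton] at ha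
    exact PowerSeries.X_dvd_iff.mp ha
  · rw [injective_iff_map_eq_zero]
    intro a
    obtain ⟨a, rfl⟩ := Ideal.Quotient.mk_surjective a
    intro ha
    rw [Ideal.Quotient.lift_mk] at ha
    rw [Ideal.Quotient.eq_zero_iff_mem, Ideal.mem_span_singleton]
    exact PowerSeries.X_dvd_iff.mpr ha

theorem finite_between [Finite F] (L : Lattice F) :
    {N : Submodule (Ainf F) (Vec F) |
      (Ideal.span {(PowerSeries.X : Ainf F)}) • L.1 ≤ N ∧ N ≤ L.1}.Finite := by
  have := finite_Ainf_quotient F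
  have hfg : L.1.FG := by
    obtain ⟨L, b, rfl⟩ := L
    exact Submodule.fg_span (Set.finite_range b)
  have : Module.Finite (Ainf F) L.1 := Module.Finite.iff_fg.mpr hfg
  let P : Submodule (Ainf F) L.1 := (Ideal.span {(PowerSeries.X : Ainf F)}) • ⊤
  have hQ : Finite (L.1 ⧸ P) := by
    have : Finite (L.1 ⧸ (⊤ : Submodule (Ainf F) L.1)) := inferInstance
    exact Submodule.finite_quotient_smul _ Module.Finite.fg_top
  have hS : Finite (Submodule (Ainf F) (L.1 ⧸ P)) :=
    Finite.of_injective _ (SetLike.coe_injective)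
  refine Set.Finite.of_injOn (f := fun N => (N.comap L.1.subtype).map P.mkQ)
    (t := Set.univ) (fun _ _ => Set.mem_univ _) ?_ Set.finite_univ
  rintro N ⟨hN1, hN2⟩ N' ⟨hN1', hN2'⟩ h
  have key : ∀ N : Submodule (Ainf F) (Vec F),
      (Ideal.span {(PowerSeries.X : Ainf F)}) • L.1 ≤ N → P ≤ N.comap L.1.subtype := by
    intro N hN
    rw [← Submodule.map_le_iff_le_comap]
    refine le_trans ?_ hN
    rw [Submodule.map_smul'']
    simp
  have h2 := congrArg (Submodule.comap P.mkQ) h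
  simp only [Submodule.comap_map_mkQ] at h2
  rw [sup_eq_right.mpr (key N hN1), sup_eq_right.mpr (key N' hN1')] at h2
  have h3 := congrArg (Submodule.map L.1.subtype) h2
  rw [Submodule.map_comap_subtype, Submodule.map_comap_subtype, inf_eq_right.mpr hN2,
    inf_eq_right.mpr hN2'] at h3
  exact h3

theorem X_smul_eq (v : Vec F) : (PowerSeries.X : Ainf F) • v = unif F • v := by
  rw [← algebraMap_smul (Kinf F) (PowerSeries.X : Ainf F) v]
  congr 1
  exact PowerSeries.coe_X

theorem unif_ne_zero : unif F ≠ 0 := by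
  simp [unif]

theorem finite_edges_into [Finite F] (v : Vertex F) : {e : Edge F | e.tgt = v}.Finite := by
  induction v using Quotient.inductionOn with | h L0 => ?_
  let w : (Kinf F)ˣ := Units.mk0 (unif F) unif_ne_zero
  let L1 : Lattice F := L0.map (homothety w⁻¹)
  have hT : {N : Lattice F | N.1 ∈ {N : Submodule (Ainf F) (Vec F) |
      (Ideal.span {(PowerSeries.X : Ainf F)}) • L1.1 ≤ N ∧ N ≤ L1.1}}.Finite :=
    (finite_between L1).preimage (Subtype.val_injective.injOn)
  refine Set.Finite.of_finite_image (f := Edge.src)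
    ((hT.image (fun N => (⟦N⟧ : Vertex F))).subset ?_) ?_
  · rintro _ ⟨⟨s, t, hst⟩, ht, rfl⟩
    obtain ⟨L, M, rfl, rfl, hle, ⟨f⟩⟩ := hst
    obtain ⟨u, hu⟩ := Quotient.exact (ht : (⟦M⟧ : Vertex F) = ⟦L0⟧)
    have hL0N : L0.1 ≤ (L.map (homothety u)).1 := by
      rw [hu]; exact Submodule.map_mono hle
    refine ⟨L.map (homothety u), ⟨?_, ?_⟩, ?_⟩
    · refine le_trans ?_ hL0N
      rw [Submodule.smul_le]
      rintro r hr _ ⟨z, hz, rfl⟩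
      obtain ⟨s, rfl⟩ := Ideal.mem_span_singleton.mp hr
      rw [mul_comm, mul_smul, X_smul_eq]
      have : unif F • (homothety w⁻¹ z) = z := smul_inv_smul w z
      refine L0.1.smul_mem s ?_
      change unif F • (homothety w⁻¹ z) ∈ L0.1
      rw [this]; exact hz
    · rintro _ ⟨x, hx, rfl⟩
      have hx' : (PowerSeries.X : Ainf F) • x ∈ M.1 := by
        have h0 : (PowerSeries.X : Ainf F) •
            (Submodule.Quotient.mk ⟨x, hx⟩ : L.1 ⧸ M.1.comap L.1.subtype) = 0 := by
          apply f.injective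
          rw [map_smul, map_zero]
          obtain ⟨y, hy⟩ := Ideal.Quotient.mk_surjective (f (Submodule.Quotient.mk ⟨x, hx⟩))
          rw [← hy, ← Ideal.Quotient.mk_eq_mk, ← Submodule.Quotient.mk_smul,
            Submodule.Quotient.mk_eq_zero, smul_eq_mul]
          exact Ideal.mul_mem_right _ _ (Ideal.mem_span_singleton_self _)
        rw [← Submodule.Quotient.mk_smul, Submodule.Quotient.mk_eq_zero] at h0
        exact h0
      refine ⟨homothety u ((PowerSeries.X : Ainf F) • x), ?_, ?_⟩
      · rw [hu]
        exact ⟨_, hx', rfl⟩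
      · rw [X_smul_eq]
        change w⁻¹ • (u • (w • x)) = u • x
        rw [smul_comm u w x, inv_smul_smul]
    · exact Quotient.sound ⟨u⁻¹, by
        rw [Lattice.map_map, homothety_trans, inv_mul_cancel, homothety_one, Lattice.map_refl]⟩
  · rintro ⟨s, t, h⟩ ht ⟨s', t', h'⟩ ht' hs
    simp only [Set.mem_ofPred_eq] at ht ht' hs
    subst ht ht' hs
    rfl

/-- The lattice `A_∞ ⊕ A_∞`. -/
def stdLattice (F : Type*) [Field F] : Lattice F :=
  ⟨Submodule.span (Ainf F) (Set.range (Pi.basisFun (Kinf F) (Fin 2))), Pi.basisFun _ _, rfl⟩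

/-- The class of the lattice generated by the columns of `g`. -/
def vertexOf (g : GL (Fin 2) (Kinf F)) : Vertex F := Vertex.act g ⟦stdLattice F⟧

/-- The vertex `Λ_n = [A_∞ ⊕ π^n A_∞]`. -/
def cuspVertex (n : ℕ) : Vertex F :=
  vertexOf (Matrix.GeneralLinearGroup.mkOfDetNeZero !![1, 0; 0, unif F ^ n]
    (by simp [Matrix.det_fin_two, unif_ne_zero]))

/-- The vertex `[π^n v₁, x v₁ + v₂]`. -/
def pointVertex (x : Kinf F) (n : ℕ) : Vertex F :=
  vertexOf (Matrix.GeneralLinearGroup.mkOfDetNeZero !![unif F ^ n, x; 0, 1]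
    (by simp [Matrix.det_fin_two, unif_ne_zero]))

/-- The path which represents the end of the tree that corresponds to a point of `P¹(k_∞)`. -/
def stdPath : OnePoint (Kinf F) → ℕ → Vertex F
  | OnePoint.infty => cuspVertex
  | OnePoint.some x => pointVertex x

/-- Infinite paths without back-tracking. -/
structure IsRay (r : ℕ → Vertex F) : Prop where
  adj : ∀ i, IsAdj (r i) (r (i + 1))
  no_backtrack : ∀ i, r (i + 2) ≠ r i

/-- Two paths are equivalent if they agree after deleting finitely many vertices of each. -/
def SameEnd (r s : ℕ → Vertex F) : Prop := ∃ a b : ℕ, ∀ i, r (a + i) = s (b + i)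

/-- `U(e)`: the points of `P¹(k_∞)` whose ends pass through the oriented edge `e`. -/
def Edge.ends (e : Edge F) : Set (OnePoint (Kinf F)) :=
  {P | ∃ r : ℕ → Vertex F, IsRay r ∧ SameEnd r (stdPath P) ∧
    ∃ i, r i = e.src ∧ r (i + 1) = e.tgt}

end Tree

section Cocycles

variable (F : Type*) [Field F] [Fintype F]

/-- The embedding `k → C_∞`. -/
def kToC : RatFunc F →+* Cinf F := (algebraMap (Kinf F) (Cinf F)).comp (kEmb F)

variable {F}

/-- `G ⊆ GL₂(k)` is arithmetic: for some projective `F[T]`-submodule `Y` of `k ⊕ k` of rank two and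
some nonzero ideal `I`, the group `G` is contained in `GL(Y)` and contains the kernel of
`GL(Y) → GL(Y / I Y)`. -/
def IsArithmetic (G : Subgroup (GL (Fin 2) (RatFunc F))) : Prop :=
  ∃ (Y : Submodule (Polynomial F) (Fin 2 → RatFunc F)) (I : Ideal (Polynomial F)),
    Module.Finite (Polynomial F) Y ∧ Module.Projective (Polynomial F) Y ∧
    Module.finrank (Polynomial F) Y = 2 ∧ I ≠ ⊥ ∧
    (∀ g ∈ G, ∀ y, g.1.mulVec y ∈ Y ↔ y ∈ Y) ∧
    ∀ g : GL (Fin 2) (RatFunc F), (∀ y, g.1.mulVec y ∈ Y ↔ y ∈ Y) →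
      (∀ y ∈ Y, g.1.mulVec y - y ∈ I • Y) → g ∈ G

variable (F) in
def toKinf : GL (Fin 2) (RatFunc F) →* GL (Fin 2) (Kinf F) :=
  Matrix.GeneralLinearGroup.map (kEmb F)

variable (F) in
/-- Homogeneous polynomials of degree `d` in `X, Y` over `C_∞`. -/
abbrev Form (d : ℕ) : Submodule (Cinf F) (MvPolynomial (Fin 2) (Cinf F)) :=
  MvPolynomial.homogeneousSubmodule (Fin 2) (Cinf F) d

variable (F) in
/-- `X^i Y^(d-i)`. -/
def monomialForm (d i : ℕ) (hi : i ≤ d) : Form F d :=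
  ⟨MvPolynomial.X 0 ^ i * MvPolynomial.X 1 ^ (d - i), by
    have := ((MvPolynomial.isHomogeneous_X (Cinf F) (0 : Fin 2)).pow i).mul
      ((MvPolynomial.isHomogeneous_X (Cinf F) (1 : Fin 2)).pow (d - i))
    rw [MvPolynomial.mem_homogeneousSubmodule]
    convert this using 1
    omega⟩

/-- `P(X, Y) ↦ P(aX + bY, cX + dY)` for `g = (a, b; c, d)`. -/
def formSubst (d : ℕ) (g : GL (Fin 2) (RatFunc F)) : Form F d →ₗ[Cinf F] Form F d :=
  (MvPolynomial.aeval (fun i : Fin 2 =>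
    (MvPolynomial.C (kToC F (g i 0)) * MvPolynomial.X 0 +
      MvPolynomial.C (kToC F (g i 1)) * MvPolynomial.X 1 :
        MvPolynomial (Fin 2) (Cinf F)))).toLinearMap.restrict (by
    intro p hp
    rw [MvPolynomial.mem_homogeneousSubmodule] at hp ⊢
    have := hp.aeval (fun i : Fin 2 =>
    (MvPolynomial.C (kToC F (g i 0)) * MvPolynomial.X 0 +
      MvPolynomial.C (kToC F (g i 1)) * MvPolynomial.X 1 :
        MvPolynomial (Fin 2) (Cinf F))) (n := 1) (fun i => by
          refine MvPolynomial.IsHomogeneous.add ?_ ?_ <;>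
          exact (MvPolynomial.isHomogeneous_X _ _).C_mul _)
    rwa [one_mul] at this)

/-- `C_har(G, n)`: the functions `c` on oriented edges, with values in the dual of the space of forms
of degree `n - 2`, such that the sum over all (finitely many) edges with a given terminal vertex is
zero, opposite edges have opposite values, and
`c(g e)(P(X, Y)) = det g * c(e)(P(aX + bY, cX + dY))` for `g = (a, b; c, d)` in `G`. -/
def HarmonicCocycles (G : Subgroup (GL (Fin 2) (RatFunc F))) (n : ℕ) :
    Submodule (Cinf F) (Edge F → Module.Dual (Cinf F) (Form F (n - 2))) where
  carrier := {c |
    (∀ v : Vertex F, ∑ e ∈ (finite_edges_into v).toFinset, c e = 0) ∧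
    (∀ e e' : Edge F, e'.src = e.tgt → e'.tgt = e.src → c e + c e' = 0) ∧
    ∀ g ∈ G, ∀ (e : Edge F) (P : Form F (n - 2)),
      c (e.act (toKinf F g)) P = kToC F g.1.det * c e (formSubst (n - 2) g P)}
  zero_mem' := by simp
  add_mem' := by
    rintro c c' ⟨h1, h2, h3⟩ ⟨h1', h2', h3'⟩
    refine ⟨fun v => ?_, fun e e' h h' => ?_, fun g hg e P => ?_⟩
    · simp only [Pi.add_apply, Finset.sum_add_distrib, h1, h1', add_zero]
    · have := congrArg₂ (· + ·) (h2 e e' h h') (h2' e e' h h')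
      simp only [add_zero] at this
      rw [← this]
      simp only [Pi.add_apply]
      abel
    · simp only [Pi.add_apply, LinearMap.add_apply, h3 g hg, h3' g hg, mul_add]
  smul_mem' := by
    rintro a c ⟨h1, h2, h3⟩
    refine ⟨fun v => ?_, fun e e' h h' => ?_, fun g hg e P => ?_⟩
    · simp only [Pi.smul_apply, ← Finset.smul_sum, h1, smul_zero]
    · simp only [Pi.smul_apply, ← smul_add, h2 e e' h h', smul_zero]
    · simp only [Pi.smul_apply, LinearMap.smul_apply, h3 g hg, smul_eq_mul]
      ring

end Cocycles

section Differentiability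

variable {F : Type*} [Field F] [Fintype F]

/-- The difference quotient `Φ_n f` of order `n`; only its values at pairwise distinct arguments
matter. -/
def diffQuot (f : Kinf F → Cinf F) : (n : ℕ) → (Fin (n + 1) → Kinf F) → Cinf F
  | 0, x => f (x 0)
  | n + 1, x => (diffQuot f n (Fin.removeNth 1 x) - diffQuot f n (Fin.removeNth 0 x)) /
      algebraMap (Kinf F) (Cinf F) (x 0 - x 1)

theorem diffQuot_add (f g : Kinf F → Cinf F) (n : ℕ) (x : Fin (n + 1) → Kinf F) :
    diffQuot (f + g) n x = diffQuot f n x + diffQuot g n x := by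
  induction n with
  | zero => rfl
  | succ n ih => simp only [diffQuot, ih]; ring

theorem diffQuot_smul (a : Cinf F) (f : Kinf F → Cinf F) (n : ℕ) (x : Fin (n + 1) → Kinf F) :
    diffQuot (a • f) n x = a * diffQuot f n x := by
  induction n with
  | zero => rfl
  | succ n ih => simp only [diffQuot, ih]; ring

/-- `f` is `C^n` on `B`: `Φ_n f`, defined on tuples of distinct points of `B`, extends continuously to
`B^(n+1)`. -/
def IsCnOn (n : ℕ) (B : Set (Kinf F)) (f : Kinf F → Cinf F) : Prop :=
  ∃ g : (Fin (n + 1) → B) → Cinf F, Continuous g ∧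
    ∀ x : Fin (n + 1) → B, Function.Injective x → g x = diffQuot f n (fun i => (x i : Kinf F))

/-- `max_{j ≤ n} sup |Φ_j f|` over `B`. For a `C^n` function on a ball this is the maximum of the sup
norms of the continuous extensions, because tuples of distinct points are dense. -/
def cnNormOn (n : ℕ) (B : Set (Kinf F)) (f : Kinf F → Cinf F) : ℝ :=
  ⨆ p : (j : Fin (n + 1)) × (Fin (j + 1) ↪ B), ‖diffQuot f p.1 (fun i => (p.2 i : Kinf F))‖

theorem IsCnOn.add {n : ℕ} {B : Set (Kinf F)} {f g : Kinf F → Cinf F} (hf : IsCnOn n B f)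
    (hg : IsCnOn n B g) : IsCnOn n B (f + g) := by
  obtain ⟨u, hu, hu'⟩ := hf
  obtain ⟨v, hv, hv'⟩ := hg
  exact ⟨u + v, hu.add hv, fun x hx => by rw [diffQuot_add, ← hu' x hx, ← hv' x hx]; rfl⟩

theorem IsCnOn.smul {n : ℕ} {B : Set (Kinf F)} {f : Kinf F → Cinf F} (a : Cinf F)
    (hf : IsCnOn n B f) : IsCnOn n B (a • f) := by
  obtain ⟨u, hu, hu'⟩ := hf
  exact ⟨a • u, hu.const_smul a, fun x hx => by rw [diffQuot_smul, ← hu' x hx]; rfl⟩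

theorem IsCnOn.zero {n : ℕ} {B : Set (Kinf F)} : IsCnOn n B (0 : Kinf F → Cinf F) :=
  ⟨0, continuous_const, fun x _ => by
    have := diffQuot_smul (0 : Cinf F) (0 : Kinf F → Cinf F) n (fun i => (x i : Kinf F))
    rw [zero_smul, zero_mul] at this
    rw [this]; rfl⟩

/-- `P¹(k_∞) = k_∞ ∪ {∞}`. -/
abbrev P1 (F : Type*) [Field F] : Type _ := OnePoint (Kinf F)

def finiteChart (f : P1 F → Cinf F) : Kinf F → Cinf F := fun x => f (x : P1 F)

open Classical in
/-- A function near `∞` in the parameter `t = 1/x`. -/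
def inftyChart (f : P1 F → Cinf F) : Kinf F → Cinf F :=
  fun t => if t = 0 then f OnePoint.infty else f ((t⁻¹ : Kinf F) : P1 F)

variable (F) in
/-- `C^n(P¹(k_∞))`, with respect to the decomposition of `P¹(k_∞)` into closed balls of radius `|π|`:
the balls `B_a(|π|)` with `|a| ≤ 1`, and `B_∞(|π|)` with the parameter `1/x`. -/
def CnFun (n : ℕ) : Submodule (Cinf F) (P1 F → Cinf F) where
  carrier := {f |
    (∀ a : Kinf F, ‖a‖ ≤ 1 → IsCnOn n (Metric.closedBall a ‖unif F‖) (finiteChart f)) ∧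
    IsCnOn n (Metric.closedBall 0 ‖unif F‖) (inftyChart f)}
  zero_mem' := by
    refine ⟨fun a _ => IsCnOn.zero, ?_⟩
    convert IsCnOn.zero using 1
    ext t
    simp [inftyChart]
  add_mem' := by
    rintro f g ⟨h1, h2⟩ ⟨h1', h2'⟩
    refine ⟨fun a ha => (h1 a ha).add (h1' a ha), ?_⟩
    convert h2.add h2' using 1
    ext t
    simp only [inftyChart, Pi.add_apply]
    split_ifs <;> rfl
  smul_mem' := by
    rintro a f ⟨h1, h2⟩
    refine ⟨fun b hb => (h1 b hb).smul a, ?_⟩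
    convert h2.smul a using 1
    ext t
    simp only [inftyChart, Pi.smul_apply]
    split_ifs <;> rfl

/-- The norm of `C^n(P¹(k_∞))`: the maximum of the norms on the balls of the decomposition. -/
def cnNorm (n : ℕ) (f : P1 F → Cinf F) : ℝ :=
  max (⨆ a : Metric.closedBall (0 : Kinf F) 1,
      cnNormOn n (Metric.closedBall (a : Kinf F) ‖unif F‖) (finiteChart f))
    (cnNormOn n (Metric.closedBall 0 ‖unif F‖) (inftyChart f))

variable (F) in
/-- The continuous (i.e. bounded) linear functionals on `C^n(P¹(k_∞))`. -/
def CnDual (n : ℕ) : Submodule (Cinf F) (Module.Dual (Cinf F) (CnFun F n)) where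
  carrier := {μ | ∃ M : ℝ, ∀ f : CnFun F n, ‖μ f‖ ≤ M * cnNorm n f.1}
  zero_mem' := ⟨0, fun f => by simp⟩
  add_mem' := by
    rintro μ ν ⟨M, hM⟩ ⟨N, hN⟩
    refine ⟨M + N, fun f => ?_⟩
    rw [add_mul]
    exact (norm_add_le _ _).trans (add_le_add (hM f) (hN f))
  smul_mem' := by
    rintro a μ ⟨M, hM⟩
    refine ⟨‖a‖ * M, fun f => ?_⟩
    rw [mul_assoc, LinearMap.smul_apply, norm_smul]
    exact mul_le_mul_of_nonneg_left (hM f) (norm_nonneg a)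

end Differentiability

section Measures

variable {F : Type*} [Field F] [Fintype F] {h : ℕ}

open Filter Topology

open Classical in
/-- `∫ f dμ` for `f` in `C^h(P¹(k_∞))`. All functions integrated below are locally polynomial in the
local parameter, hence belong to this space; the value `0` for other functions is never used. -/
def integral (μ : CnDual F h) (f : P1 F → Cinf F) : Cinf F :=
  if hf : f ∈ CnFun F h then μ.1 ⟨f, hf⟩ else 0

open Classical in
/-- `(x - a)^j` on the ball `B_a(|π|^l)`, and zero elsewhere. -/
def kappa (a : Kinf F) (l : ℤ) (j : ℕ) : P1 F → Cinf F
  | OnePoint.infty => 0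
  | OnePoint.some x => if ‖x - a‖ ≤ ‖unif F‖ ^ l then algebraMap (Kinf F) (Cinf F) (x - a) ^ j else 0

open Classical in
/-- `(1/x)^j` on the ball `B_∞(|π|^l) = {|x| ≥ |π|^(-l)} ∪ {∞}`, and zero elsewhere. -/
def kappaInfty (l : ℤ) (j : ℕ) : P1 F → Cinf F
  | OnePoint.infty => 0 ^ j
  | OnePoint.some x => if ‖unif F‖ ^ (-l) ≤ ‖x‖ then algebraMap (Kinf F) (Cinf F) x⁻¹ ^ j else 0

/-- `h`-admissibility on `P¹(k_∞)`: the growth condition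
`|∫_{B_a(|π|^l)} (x - a)^j dμ| ≤ C |π|^(l (j - h))` for `0 ≤ j ≤ h`, all large `l` and all `a`, with
`1/x` in place of `x - a` for `a = ∞`. -/
def IsAdmissible (μ : CnDual F h) : Prop :=
  ∃ (C : ℝ) (l₀ : ℤ), ∀ l ≥ l₀, ∀ j ≤ h,
    (∀ a : Kinf F, ‖integral μ (kappa a l j)‖ ≤ C * ‖unif F‖ ^ (l * ((j : ℤ) - h))) ∧
    ‖integral μ (kappaInfty l j)‖ ≤ C * ‖unif F‖ ^ (l * ((j : ℤ) - h))

open Classical in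
/-- `x^(-i)` on `{|π|^(-m) ≤ |x| ≤ |π|^(-l)}`, and zero elsewhere. -/
def annulusPow (m l : ℤ) (i : ℕ) : P1 F → Cinf F
  | OnePoint.infty => 0
  | OnePoint.some x =>
      if ‖unif F‖ ^ (-m) ≤ ‖x‖ ∧ ‖x‖ ≤ ‖unif F‖ ^ (-l) then
        algebraMap (Kinf F) (Cinf F) x⁻¹ ^ i else 0

/-- The integrals of `x^(-i)`, `i ≥ 0`, over the balls around `∞` are the limits of the integrals over
the balls with smaller and smaller neighbourhoods of `∞` removed. -/
def HasLimitIntegralsAtInfty (μ : CnDual F h) : Prop :=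
  ∀ (m : ℤ) (i : ℕ), Tendsto (fun l : ℤ => integral μ (annulusPow m l i)) atTop
    (𝓝 (integral μ (kappaInfty m i)))

open Classical in
/-- The polynomial `f` on `U ∩ {|x| ≤ |π|^(-l)}`, and zero elsewhere. -/
def truncPoly (U : Set (P1 F)) (f : Polynomial (Cinf F)) (l : ℤ) : P1 F → Cinf F
  | OnePoint.infty => 0
  | OnePoint.some x =>
      if (x : P1 F) ∈ U ∧ ‖x‖ ≤ ‖unif F‖ ^ (-l) then
        f.eval (algebraMap (Kinf F) (Cinf F) x) else 0

/-- `∫_U f dμ = I` for a polynomial `f`. If `U` is a compact subset of `k_∞` the sequence is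
eventually constant; if `∞ ∈ U`, where `f` may have a pole, the integral is the limit of the integrals
over `U` with smaller and smaller neighbourhoods of `∞` removed. -/
def HasPolyIntegral (μ : CnDual F h) (U : Set (P1 F)) (f : Polynomial (Cinf F)) (I : Cinf F) :
    Prop :=
  Tendsto (fun l : ℤ => integral μ (truncPoly U f l)) atTop (𝓝 I)

/-- The polynomial `f(g x) (c x + d)^d'`, `g = (a, b; c, d)`, for `f` of degree at most `d'`, written
out as `∑ f_i (a x + b)^i (c x + d)^(d' - i)`. -/
def slashPoly (d : ℕ) (g : GL (Fin 2) (RatFunc F)) (f : Polynomial (Cinf F)) :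
    Polynomial (Cinf F) :=
  ∑ i ∈ Finset.range (d + 1), Polynomial.C (f.coeff i) *
    (Polynomial.C (kToC F (g 0 0)) * Polynomial.X + Polynomial.C (kToC F (g 0 1))) ^ i *
    (Polynomial.C (kToC F (g 1 0)) * Polynomial.X + Polynomial.C (kToC F (g 1 1))) ^ (d - i)

/-- `∫_{U(g e)} f(x) dμ = ∫_{U(e)} det g * f(g x) (c x + d)^(n-2) dμ` for `g` in `G`, all edges `e` and
polynomials `f` of degree at most `n - 2`. -/
def IsEquivariant (G : Subgroup (GL (Fin 2) (RatFunc F))) (n : ℕ) (μ : CnDual F h) : Prop :=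
  ∀ g ∈ G, ∀ (e : Edge F) (f : Polynomial (Cinf F)), f.natDegree ≤ n - 2 →
    ∃ I : Cinf F, HasPolyIntegral μ (e.act (toKinf F g)).ends f I ∧
      HasPolyIntegral μ e.ends (Polynomial.C (kToC F g.1.det) * slashPoly (n - 2) g f) I

/-- `∫_{P¹(k_∞)} f dμ = 0` for all polynomials `f` of degree at most `n - 2`. -/
def HasZeroTotal (n : ℕ) (μ : CnDual F h) : Prop :=
  ∀ f : Polynomial (Cinf F), f.natDegree ≤ n - 2 → HasPolyIntegral μ Set.univ f 0

/-- `μ = μ_c`: `∫_{U(e)} x^i dμ = c(e)(X^i Y^(n-2-i))` for `0 ≤ i ≤ n - 2`, and integrals of negative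
powers of `x` near `∞` are the limits of integrals over sets with a neighbourhood of `∞` removed. -/
def IsMeasureOf {n : ℕ} (c : Edge F → Module.Dual (Cinf F) (Form F (n - 2))) (μ : CnDual F h) :
    Prop :=
  (∀ (e : Edge F) (i : ℕ) (hi : i ≤ n - 2),
    HasPolyIntegral μ e.ends (Polynomial.X ^ i) (c e (monomialForm F (n - 2) i hi))) ∧
  HasLimitIntegralsAtInfty μ

end Measures

end CharPMeasure

end

open CharPMeasure

noncomputable section
set_option linter.unusedSectionVars false

namespace CharPMeasure

/-! ### Absolute values, balls and compactness in `k_∞` -/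

section NormFacts
variable {F : Type*} [Field F]

/-! Put `d = n - 2`. Every lattice has an upper triangular basis, so the vertices of the tree are
the balls of `k_∞`, the edges join a ball to one of its `q` maximal sub-balls, and `U(e)` is a ball
or the complement of a ball (`ends_downEdge`, `ends_upEdge`). Harmonicity says that the values on
the edges towards balls are additive when a ball is split (`sum_edges_into_ballVertex`). So a
cocycle is a consistent family of moments of polynomials of degree at most `d` on balls, and the
question is whether these moments integrate `C^h` functions.

Growth of the moments. `G` contains a principal congruence subgroup of `SL₂(F[T])` (`exists_level`).
Under its translations a large ball splits into `q` translates of the next smaller ball, and `∑ (X +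
b_ε)^i` has degree less than `i`, since its coefficient at `X^i` is `q = 0`. After `d + 1` such
steps the cocycle is zero near `∞` (`IsHarmonic.exists_eq_zero`), and near every other cusp because
the congruence subgroup is normal. Hence it has only finitely many nonzero values on the standard
apartment. The Euclidean algorithm moves every edge to that apartment and only finitely many classes
modulo the level occur, so the value at `g e₀`, transported back by `g`, is bounded by a constant
times `|det g|^(-d/2)` (`IsCongruenceCocycle.exists_isBoundedAt`). As `d ≤ 2h`, the moments of `(x -
b)^j` on `B_b(|π|^l)` with `l ≥ 0` are at most a constant times `|π|^(l(j-h))`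
(`IsHarmonic.isMomentData`).

Existence. Replace `f` on small balls by its interpolation polynomials with `h + 1` nodes and
integrate these by the moments. A refinement changes the sum by at most a constant times `|u - u'|
|f[T]|`, where `f[T]` is a divided difference on `h + 2` nearby points; this is a difference of two
divided differences of order `h`, hence small for `f` in `C^h`. The Riemann sums therefore converge
(`IsMomentData.tendsto_riemannSum`). Near `∞` the parameter is `t = 1/x`, and `f` is weighted by
`t^d` because `t^d p(1/t)` is the reversed polynomial of `p`.

Uniqueness. Functions that are polynomials of degree at most `h ≤ d` on small balls are dense, and
their integrals are prescribed on balls in `k_∞`. On a ball in the parameter `t` that avoids `t = 0`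
one approximates `t^h f` by polynomials of degree at most `h` in `t` and divides, which gives
polynomials in `x`. On balls around `∞` condition (∗) decides (`eq_zero_of_integral_locPoly`).

Image. If the total integral of polynomials is zero, the integral over the complement of a ball
exists and is minus that over the ball. So the integrals over the sets `U(e)` define a harmonic
function, and equivariance of the functional is the transformation law of the cocycle. -/

theorem unif_zpow (l : ℤ) : unif F ^ l = HahnSeries.single l 1 := by
  rw [unif, ← RatFunc.single_zpow l, RatFunc.single_zpow]

theorem tInf_eq : tInf F = (unif F)⁻¹ := by
  rw [← zpow_neg_one, unif_zpow, tInf]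

theorem unif_zpow_ne_zero (l : ℤ) : unif F ^ l ≠ 0 := zpow_ne_zero _ unif_ne_zero

theorem polyEmb_X : polyEmb F Polynomial.X = (unif F)⁻¹ := by
  simp [polyEmb, tInf_eq]

theorem polyEmb_C (ε : F) : polyEmb F (Polynomial.C ε) = HahnSeries.C ε := by
  simp [polyEmb]

variable [Fintype F]

theorem norm_unif_pos : 0 < ‖unif F‖ := norm_pos_iff.mpr unif_ne_zero

theorem norm_unif_lt_one : ‖unif F‖ < 1 := by
  rw [norm_unif]
  exact inv_lt_one_of_one_lt₀ (by exact_mod_cast Fintype.one_lt_card)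

theorem zpow_unif_pos (l : ℤ) : 0 < ‖unif F‖ ^ l := zpow_pos norm_unif_pos l

theorem zpow_unif_le {k l : ℤ} : ‖unif F‖ ^ k ≤ ‖unif F‖ ^ l ↔ l ≤ k :=
  zpow_le_zpow_iff_right_of_lt_one₀ norm_unif_pos norm_unif_lt_one

theorem zpow_unif_lt {k l : ℤ} : ‖unif F‖ ^ k < ‖unif F‖ ^ l ↔ l < k :=
  zpow_lt_zpow_iff_right_of_lt_one₀ norm_unif_pos norm_unif_lt_one

theorem norm_le_zpow_iff {x : Kinf F} {l : ℤ} :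
    ‖x‖ ≤ ‖unif F‖ ^ l ↔ ∀ n < l, x.coeff n = 0 := by
  rw [← norm_zpow, Valued.toNormedField.norm_le_iff, unif_zpow,
    LaurentSeries.valuation_single_zpow, LaurentSeries.valuation_le_iff_coeff_lt_eq_zero]

theorem norm_eq_zpow {x : Kinf F} (hx : x ≠ 0) : ∃ l : ℤ, ‖x‖ = ‖unif F‖ ^ l := by
  refine ⟨x.order, le_antisymm (norm_le_zpow_iff.mpr fun n hn =>
    HahnSeries.coeff_eq_zero_of_lt_order hn) ?_⟩
  by_contra hlt
  push Not at hlt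
  have h0 : x⁻¹ ≠ 0 := inv_ne_zero hx
  have h1 : ‖x⁻¹‖ ≤ ‖unif F‖ ^ (x⁻¹).order := norm_le_zpow_iff.mpr fun n hn =>
    HahnSeries.coeff_eq_zero_of_lt_order hn
  have h2 : x.order + (x⁻¹).order = 0 := by
    rw [← HahnSeries.order_mul hx h0, mul_inv_cancel₀ hx, HahnSeries.order_one]
  have h3 : ‖x‖ * ‖x⁻¹‖ = 1 := by rw [← norm_mul, mul_inv_cancel₀ hx, norm_one]
  have h4 : ‖x‖ * ‖x⁻¹‖ < ‖unif F‖ ^ x.order * ‖unif F‖ ^ (x⁻¹).order :=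
    mul_lt_mul hlt h1 (norm_pos_iff.mpr h0) (zpow_unif_pos _).le
  rw [h3, ← zpow_add₀ norm_unif_pos.ne', h2, zpow_zero] at h4
  exact lt_irrefl _ h4

theorem norm_lt_zpow_iff {x : Kinf F} {l : ℤ} :
    ‖x‖ < ‖unif F‖ ^ l ↔ ‖x‖ ≤ ‖unif F‖ ^ (l + 1) := by
  rcases eq_or_ne x 0 with rfl | hx
  · simp [zpow_unif_pos, (zpow_unif_pos _).le]
  · obtain ⟨k, hk⟩ := norm_eq_zpow hx
    rw [hk, zpow_unif_lt, zpow_unif_le]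
    omega

theorem norm_le_one_iff_range {x : Kinf F} :
    ‖x‖ ≤ 1 ↔ ∃ a : Ainf F, algebraMap (Ainf F) (Kinf F) a = x := by
  rw [Valued.toNormedField.norm_le_one_iff, LaurentSeries.val_le_one_iff_eq_coe]
  rfl

theorem norm_algebraMap_Ainf_le (a : Ainf F) : ‖algebraMap (Ainf F) (Kinf F) a‖ ≤ 1 :=
  norm_le_one_iff_range.mpr ⟨a, rfl⟩

theorem norm_C_le (ε : F) : ‖(HahnSeries.C ε : Kinf F)‖ ≤ 1 := by
  rw [← zpow_zero ‖unif F‖, norm_le_zpow_iff]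
  intro n hn
  exact HahnSeries.coeff_single_of_ne hn.ne

theorem norm_C {ε : F} (hε : ε ≠ 0) : ‖(HahnSeries.C ε : Kinf F)‖ = 1 := by
  refine le_antisymm (norm_C_le ε) ?_
  have h : ‖(HahnSeries.C ε : Kinf F)‖ * ‖(HahnSeries.C ε⁻¹ : Kinf F)‖ = 1 := by
    rw [← norm_mul, ← map_mul, mul_inv_cancel₀ hε, map_one, norm_one]
  nlinarith [norm_C_le ε, norm_C_le ε⁻¹, norm_nonneg (HahnSeries.C ε : Kinf F)]

/-- The centre `b + ε π^l` of one of the `q` maximal proper sub-balls of `B_b(|π|^l)`. -/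
def subCenter (b : Kinf F) (l : ℤ) (ε : F) : Kinf F := b + HahnSeries.C ε * unif F ^ l

theorem norm_subCenter_sub_le (b : Kinf F) (l : ℤ) (ε : F) :
    ‖subCenter b l ε - b‖ ≤ ‖unif F‖ ^ l := by
  rw [subCenter, add_sub_cancel_left, norm_mul, norm_zpow]
  exact mul_le_of_le_one_left (zpow_unif_pos l).le (norm_C_le ε)

theorem exists_norm_sub_subCenter_le {x b : Kinf F} {l : ℤ} (hx : ‖x - b‖ ≤ ‖unif F‖ ^ l) :
    ∃ ε : F, ‖x - subCenter b l ε‖ ≤ ‖unif F‖ ^ (l + 1) := by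
  refine ⟨(x - b).coeff l, ?_⟩
  rw [norm_le_zpow_iff] at hx ⊢
  intro n hn
  rw [subCenter, ← sub_sub, unif_zpow, HahnSeries.C_mul_eq_smul, HahnSeries.coeff_sub,
    HahnSeries.coeff_smul]
  rcases eq_or_ne n l with rfl | h
  · simp
  · rw [hx n (by omega), HahnSeries.coeff_single_of_ne h]
    simp

theorem norm_subCenter_sub_subCenter (b : Kinf F) (l : ℤ) {ε ε' : F} (h : ε ≠ ε') :
    ‖subCenter b l ε - subCenter b l ε'‖ = ‖unif F‖ ^ l := by
  rw [subCenter, subCenter, add_sub_add_left_eq_sub, ← sub_mul, ← map_sub, norm_mul, norm_zpow,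
    norm_C (sub_ne_zero.mpr h), one_mul]

theorem norm_sub_le_of_le {x y z : Kinf F} {r : ℝ} (h1 : ‖x - y‖ ≤ r) (h2 : ‖y - z‖ ≤ r) :
    ‖x - z‖ ≤ r := by
  rw [← sub_add_sub_cancel x y z]
  exact (IsUltrametricDist.norm_add_le_max _ _).trans (max_le h1 h2)

theorem norm_add_le_of_le' {x y : Kinf F} {r : ℝ} (h1 : ‖x‖ ≤ r) (h2 : ‖y‖ ≤ r) :
    ‖x + y‖ ≤ r :=
  (IsUltrametricDist.norm_add_le_max _ _).trans (max_le h1 h2)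

theorem eq_of_norm_sub_subCenter_le {x b : Kinf F} {l : ℤ} {ε ε' : F}
    (h : ‖x - subCenter b l ε‖ ≤ ‖unif F‖ ^ (l + 1))
    (h' : ‖x - subCenter b l ε'‖ ≤ ‖unif F‖ ^ (l + 1)) : ε = ε' := by
  by_contra hne
  have h1 := norm_subCenter_sub_subCenter b l hne
  rw [norm_sub_rev] at h
  have h2 := norm_sub_le_of_le h h'
  rw [h1, zpow_unif_le] at h2
  omega

theorem norm_sub_le_of_norm_sub_subCenter_le {x b : Kinf F} {l : ℤ} {ε : F}
    (h : ‖x - subCenter b l ε‖ ≤ ‖unif F‖ ^ (l + 1)) : ‖x - b‖ ≤ ‖unif F‖ ^ l :=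
  norm_sub_le_of_le (h.trans (zpow_unif_le.mpr (by omega))) (norm_subCenter_sub_le b l ε)

/-- The polynomial part of an element of `k_∞`. -/
theorem exists_norm_sub_polyEmb_le (x : Kinf F) : ∃ a : Polynomial F, ‖x - polyEmb F a‖ ≤ ‖unif F‖ := by
  obtain ⟨l, hl⟩ : ∃ l : ℕ, ‖x‖ ≤ ‖unif F‖ ^ (1 - l : ℤ) := by
    rcases eq_or_ne x 0 with rfl | hx
    · exact ⟨0, by simp⟩
    · obtain ⟨k, hk⟩ := norm_eq_zpow hx
      refine ⟨(1 - k).toNat, ?_⟩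
      rw [hk, zpow_unif_le]
      omega
  induction l generalizing x with
  | zero => exact ⟨0, by simpa using hl⟩
  | succ l ih =>
    have hl' : ‖x - 0‖ ≤ ‖unif F‖ ^ (-(l : ℤ)) := by
      rw [sub_zero]
      exact hl.trans_eq (congrArg _ (by push_cast; ring))
    obtain ⟨ε, hε⟩ := exists_norm_sub_subCenter_le hl'
    obtain ⟨a, ha⟩ := ih (x - subCenter 0 (-(l : ℤ)) ε) (hε.trans_eq (congrArg _ (by ring)))
    refine ⟨a + Polynomial.C ε * Polynomial.X ^ l, ?_⟩
    have h1 : polyEmb F (a + Polynomial.C ε * Polynomial.X ^ l) =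
        polyEmb F a + subCenter 0 (-(l : ℤ)) ε := by
      rw [map_add, map_mul, map_pow, polyEmb_X, polyEmb_C, subCenter, inv_pow, zpow_neg,
        zpow_natCast, zero_add]
    rw [h1, add_comm, ← sub_sub]
    exact ha

/-- Splitting a ball `k` times into `q` sub-balls covers it by finitely many balls of radius
`|π|^(l+k)`. Finiteness of `F` enters here. -/
theorem isCompact_closedBall (b : Kinf F) (l : ℤ) :
    IsCompact (Metric.closedBall b (‖unif F‖ ^ l)) := by
  refine isCompact_iff_totallyBounded_isComplete.mpr ⟨?_, Metric.isClosed_closedBall.isComplete⟩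
  have key : ∀ (k : ℕ) (b : Kinf F) (l : ℤ), ∃ t : Set (Kinf F), t.Finite ∧
      Metric.closedBall b (‖unif F‖ ^ l) ⊆ ⋃ y ∈ t, Metric.closedBall y (‖unif F‖ ^ (l + k)) := by
    intro k
    induction k with
    | zero => exact fun b l => ⟨{b}, Set.finite_singleton b, by simp⟩
    | succ k ih =>
      intro b l
      choose t ht1 ht2 using fun ε : F => ih (subCenter b l ε) (l + 1)
      refine ⟨⋃ ε, t ε, Set.finite_iUnion ht1, fun x hx => ?_⟩
      rw [mem_closedBall_iff_norm] at hx
      obtain ⟨ε, hε⟩ := exists_norm_sub_subCenter_le hx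
      have := ht2 ε (mem_closedBall_iff_norm.mpr hε)
      simp only [Set.mem_iUnion, exists_prop] at this ⊢
      obtain ⟨y, hy, hxy⟩ := this
      refine ⟨y, ⟨ε, hy⟩, ?_⟩
      convert hxy using 3
      push_cast
      ring
  rw [Metric.totallyBounded_iff]
  intro ε hε
  obtain ⟨k, hk⟩ : ∃ k : ℕ, ‖unif F‖ ^ (l + k) < ε := by
    obtain ⟨k, hk⟩ := exists_pow_lt_of_lt_one (div_pos hε (zpow_unif_pos (F := F) l))
      (norm_unif_lt_one (F := F))
    refine ⟨k, ?_⟩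
    rw [zpow_add₀ norm_unif_pos.ne', zpow_natCast, mul_comm]
    exact (lt_div_iff₀ (zpow_unif_pos l)).mp hk
  obtain ⟨t, ht1, ht2⟩ := key k b l
  exact ⟨t, ht1, ht2.trans (Set.iUnion₂_mono fun y _ => Metric.closedBall_subset_ball hk)⟩

instance : IsUltrametricDist (Cinf F) := IsUltrametricDist.of_normedAlgebra (Kinf F)

end NormFacts

/-! ### Upper triangular form of lattices -/

section Lattices
variable {F : Type*} [Field F] [Fintype F]

theorem Lattice.ext' {L M : Lattice F} (h : ∀ v, v ∈ L.1 ↔ v ∈ M.1) : L = M :=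
  Subtype.ext (Submodule.ext h)

theorem norm_smul_Ainf_le (a : Ainf F) (x : Kinf F) : ‖a • x‖ ≤ ‖x‖ := by
  rw [Algebra.smul_def, norm_mul]
  exact mul_le_of_le_one_left (norm_nonneg x) (norm_algebraMap_Ainf_le a)

theorem exists_smul_eq_of_norm_le {x y : Kinf F} (h : ‖x‖ ≤ ‖y‖) : ∃ a : Ainf F, a • y = x := by
  rcases eq_or_ne y 0 with rfl | hy
  · exact ⟨0, by rw [norm_zero, norm_le_zero_iff] at h; simp [h]⟩
  · obtain ⟨a, ha⟩ := norm_le_one_iff_range.mp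
      (show ‖x / y‖ ≤ 1 by rw [norm_div]; exact div_le_one_of_le₀ h (norm_nonneg _))
    exact ⟨a, by rw [Algebra.smul_def, ha, div_mul_cancel₀ _ hy]⟩

theorem norm_algebraMap_Ainf_le_iff {a : Ainf F} :
    ‖algebraMap (Ainf F) (Kinf F) a‖ ≤ ‖unif F‖ ↔ (PowerSeries.X : Ainf F) ∣ a := by
  rw [PowerSeries.X_dvd_iff]
  have h := norm_le_zpow_iff (x := algebraMap (Ainf F) (Kinf F) a) (l := 1)
  rw [zpow_one] at h
  rw [h, LaurentSeries.coe_algebraMap]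
  constructor
  · intro h0
    have := h0 0 (by norm_num)
    rw [PowerSeries.coeff_coe] at this
    simpa using this
  · intro h0 n hn
    rw [PowerSeries.coeff_coe]
    split_ifs with hn0
    · rfl
    · obtain rfl : n = 0 := by omega
      simpa using h0

/-- The lattice of all `v` with `‖v₀ - b v₁‖ ≤ |π|^k` and `‖v₁‖ ≤ |π|^m`. -/
def lat (b : Kinf F) (k m : ℤ) : Submodule (Ainf F) (Vec F) where
  carrier := {v | ‖v 0 - b * v 1‖ ≤ ‖unif F‖ ^ k ∧ ‖v 1‖ ≤ ‖unif F‖ ^ m}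
  zero_mem' := by simp [(zpow_unif_pos _).le]
  add_mem' := by
    rintro v w ⟨h1, h2⟩ ⟨h1', h2'⟩
    refine ⟨?_, norm_add_le_of_le' h2 h2'⟩
    rw [Pi.add_apply, Pi.add_apply, mul_add, add_sub_add_comm]
    exact norm_add_le_of_le' h1 h1'
  smul_mem' := by
    rintro a v ⟨h1, h2⟩
    refine ⟨?_, (norm_smul_Ainf_le _ _).trans h2⟩
    rw [Pi.smul_apply, Pi.smul_apply, mul_smul_comm, ← smul_sub]
    exact (norm_smul_Ainf_le _ _).trans h1

theorem mem_lat {b : Kinf F} {k m : ℤ} {v : Vec F} :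
    v ∈ lat b k m ↔ ‖v 0 - b * v 1‖ ≤ ‖unif F‖ ^ k ∧ ‖v 1‖ ≤ ‖unif F‖ ^ m := Iff.rfl

/-- Column reduction. As the second coordinate of `B 1` dominates that of `B 0`, the latter can be
cleared by an integral multiple of `B 1`. Then `|π|^m = ‖B 1 1‖`, the centre is the slope of `B 1`,
and `k` is read off from the determinant. -/
theorem span_eq_lat {B : Module.Basis (Fin 2) (Kinf F) (Vec F)}
    (h : ‖B 0 1‖ ≤ ‖B 1 1‖) : ∃ (b : Kinf F) (k m : ℤ),
    Submodule.span (Ainf F) (Set.range B) = lat b k m := by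
  have hdet : B 0 0 * B 1 1 - B 1 0 * B 0 1 ≠ 0 := by
    intro h0
    have hli := Fintype.linearIndependent_iff.mp B.linearIndependent ![B 1 1, -B 0 1] (by
      ext1 i
      fin_cases i
      · simp [Fin.sum_univ_two]; linear_combination h0
      · simp [Fin.sum_univ_two]; ring)
    have hs : B 1 1 = 0 := hli 0
    have hr : B 0 1 = 0 := by simpa using hli 1
    have hli' := Fintype.linearIndependent_iff.mp B.linearIndependent ![B 1 0, -B 0 0] (by
      ext1 i
      fin_cases i
      · simp [Fin.sum_univ_two]; ring
      · simp [Fin.sum_univ_two, hs, hr])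
    have h1 : B 1 0 = 0 := hli' 0
    refine B.ne_zero 1 ?_
    ext1 i
    fin_cases i
    · exact h1
    · exact hs
  have hs : B 1 1 ≠ 0 := by
    intro h0
    rw [h0, norm_zero] at h
    have : B 0 1 = 0 := norm_le_zero_iff.mp h
    exact hdet (by rw [h0, this]; ring)
  obtain ⟨k, hk⟩ := norm_eq_zpow (div_ne_zero hdet hs)
  obtain ⟨m, hm⟩ := norm_eq_zpow hs
  refine ⟨B 1 0 / B 1 1, k, m, le_antisymm ?_ ?_⟩
  · rw [Submodule.span_le]
    rintro _ ⟨i, rfl⟩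
    rw [SetLike.mem_coe, mem_lat]
    fin_cases i
    · refine ⟨le_of_eq ?_, by rw [← hm]; exact h⟩
      rw [← hk]
      congr 1
      simp only [Fin.zero_eta]
      field_simp
    · refine ⟨?_, by rw [← hm]; rfl⟩
      simp [div_mul_cancel₀ _ hs, (zpow_unif_pos _).le]
  · intro v hv
    obtain ⟨h1, h2⟩ := mem_lat.mp hv
    rw [← hk] at h1
    obtain ⟨x, hx⟩ := exists_smul_eq_of_norm_le h1
    have h3 : ‖v 1 - x • B 0 1‖ ≤ ‖B 1 1‖ := by
      rw [sub_eq_add_neg]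
      refine norm_add_le_of_le' (h2.trans_eq hm.symm) ?_
      rw [norm_neg]
      exact (norm_smul_Ainf_le _ _).trans h
    obtain ⟨y, hy⟩ := exists_smul_eq_of_norm_le h3
    have : v = x • B 0 + y • B 1 := by
      have h4 : v 1 = x • B 0 1 + y • B 1 1 := by rw [hy]; ring
      ext1 i
      fin_cases i
      · simp only [Fin.zero_eta, Pi.add_apply, Pi.smul_apply]
        rw [h4] at hx
        rw [Algebra.smul_def] at hx
        simp only [Algebra.smul_def] at hx ⊢
        field_simp at hx
        have h5 : B 1 1 * (v 0 - (algebraMap _ (Kinf F) x * B 0 0 +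
          algebraMap _ (Kinf F) y * B 1 0)) = 0 := by linear_combination -hx
        have := (mul_eq_zero.mp h5).resolve_left hs
        linear_combination this
      · exact h4
    rw [this]
    exact add_mem (Submodule.smul_mem _ _ (Submodule.subset_span ⟨0, rfl⟩))
      (Submodule.smul_mem _ _ (Submodule.subset_span ⟨1, rfl⟩))

theorem IsLattice.eq_lat {L : Submodule (Ainf F) (Vec F)} (hL : IsLattice F L) :
    ∃ (b : Kinf F) (k m : ℤ), L = lat b k m := by
  obtain ⟨B, rfl⟩ := hL
  rcases le_total ‖B 0 1‖ ‖B 1 1‖ with h | h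
  · exact span_eq_lat h
  · obtain ⟨b, k, m, hb⟩ := span_eq_lat (B := B.reindex (Equiv.swap 0 1)) (by simpa using h)
    exact ⟨b, k, m, by rw [← hb, Module.Basis.range_reindex]⟩

/-- The matrix `(π^k, b π^m; 0, π^m)`. -/
def latMat (b : Kinf F) (k m : ℤ) : GL (Fin 2) (Kinf F) :=
  Matrix.GeneralLinearGroup.mkOfDetNeZero !![unif F ^ k, b * unif F ^ m; 0, unif F ^ m]
    (by simp [Matrix.det_fin_two, unif_zpow_ne_zero])

theorem actLin_mul (g g' : GL (Fin 2) (Kinf F)) : actLin (g * g') = (actLin g').trans (actLin g) := by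
  ext1 v
  simp only [actLin_apply, LinearEquiv.trans_apply, Matrix.mulVec_mulVec]
  rfl

theorem mem_stdLattice {v : Vec F} : v ∈ (stdLattice F).1 ↔ ‖v 0‖ ≤ 1 ∧ ‖v 1‖ ≤ 1 := by
  constructor
  · intro hv
    have : (stdLattice F).1 ≤ lat (0 : Kinf F) 0 0 := by
      refine Submodule.span_le.mpr ?_
      rintro _ ⟨i, rfl⟩
      rw [SetLike.mem_coe, mem_lat]
      fin_cases i <;> simp
    simpa [mem_lat] using this hv
  · rintro ⟨h0, h1⟩
    obtain ⟨x, hx⟩ := norm_le_one_iff_range.mp h0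
    obtain ⟨y, hy⟩ := norm_le_one_iff_range.mp h1
    have : v = x • Pi.basisFun (Kinf F) (Fin 2) 0 + y • Pi.basisFun (Kinf F) (Fin 2) 1 := by
      ext1 i
      fin_cases i <;> simp [Algebra.smul_def, ← hx, ← hy]
    rw [this]
    exact add_mem (Submodule.smul_mem _ _ (Submodule.subset_span ⟨0, rfl⟩))
      (Submodule.smul_mem _ _ (Submodule.subset_span ⟨1, rfl⟩))

theorem Lattice.mem_map {φ : Vec F ≃ₗ[Kinf F] Vec F} {L : Lattice F} {v : Vec F} :
    v ∈ (L.map φ).1 ↔ φ.symm v ∈ L.1 := by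
  constructor
  · rintro ⟨u, hu, rfl⟩
    simpa using hu
  · intro h
    exact ⟨φ.symm v, h, by simp⟩

theorem Lattice.mem_map_actLin {g : GL (Fin 2) (Kinf F)} {L : Lattice F} {v : Vec F} :
    v ∈ (L.map (actLin g)).1 ↔ ∃ u ∈ L.1, g.1.mulVec u = v := by
  constructor
  · rintro ⟨u, hu, rfl⟩
    exact ⟨u, hu, (actLin_apply g u).symm⟩
  · rintro ⟨u, hu, rfl⟩
    exact ⟨u, hu, actLin_apply g u⟩

/-- The lattice `lat b k m` as a member of `Lattice F`. -/
def latL (b : Kinf F) (k m : ℤ) : Lattice F := ⟨lat b k m, by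
  have h : lat b k m = ((stdLattice F).map (actLin (latMat b k m))).1 := by
    ext v
    rw [Lattice.mem_map_actLin, mem_lat]
    constructor
    · rintro ⟨h1, h2⟩
      refine ⟨![(v 0 - b * v 1) * (unif F ^ k)⁻¹, v 1 * (unif F ^ m)⁻¹], mem_stdLattice.mpr ⟨?_, ?_⟩, ?_⟩
      · simp only [Matrix.cons_val_zero, norm_mul, norm_inv, norm_zpow]
        exact mul_inv_le_one_of_le₀ h1 (zpow_unif_pos _).le
      · simp only [Matrix.cons_val_one, Matrix.cons_val_zero, norm_mul, norm_inv, norm_zpow]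
        exact mul_inv_le_one_of_le₀ h2 (zpow_unif_pos _).le
      · have h3 := unif_zpow_ne_zero (F := F) k
        have h4 := unif_zpow_ne_zero (F := F) m
        ext1 i
        fin_cases i
        · simp [latMat, Matrix.mulVec, dotProduct, Fin.sum_univ_two]
          field_simp
          ring
        · simp [latMat, Matrix.mulVec, dotProduct, Fin.sum_univ_two]
          field_simp
    · rintro ⟨u, hu, rfl⟩
      rw [mem_stdLattice] at hu
      have h0 : (latMat b k m).1.mulVec u 0 - b * (latMat b k m).1.mulVec u 1 = unif F ^ k * u 0 := by
        simp [latMat, Matrix.mulVec, dotProduct, Fin.sum_univ_two]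
        ring
      have h1 : (latMat b k m).1.mulVec u 1 = unif F ^ m * u 1 := by
        simp [latMat, Matrix.mulVec, dotProduct, Fin.sum_univ_two]
      rw [h0, h1, norm_mul, norm_mul, norm_zpow, norm_zpow]
      exact ⟨mul_le_of_le_one_right (zpow_unif_pos _).le hu.1,
        mul_le_of_le_one_right (zpow_unif_pos _).le hu.2⟩
  rw [h]
  exact Subtype.property _⟩

theorem Lattice.exists_eq_latL (L : Lattice F) : ∃ (b : Kinf F) (k m : ℤ), L = latL b k m := by
  obtain ⟨b, k, m, h⟩ := L.2.eq_lat
  exact ⟨b, k, m, Subtype.ext h⟩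

/-- The inclusion is tested on the two generators `(π^k', 0)` and `(b' π^m', π^m')`. -/
theorem latL_le_latL {b b' : Kinf F} {k m k' m' : ℤ} (h : (latL b' k' m').1 ≤ (latL b k m).1) :
    k ≤ k' ∧ m ≤ m' ∧ ‖b' - b‖ ≤ ‖unif F‖ ^ (k - m') := by
  have h1 : ![unif F ^ k', 0] ∈ lat b k m := h (mem_lat.mpr (by simp [(zpow_unif_pos _).le]))
  have h2 : ![b' * unif F ^ m', unif F ^ m'] ∈ lat b k m :=
    h (mem_lat.mpr (by simp [(zpow_unif_pos _).le]))
  simp only [mem_lat, Matrix.cons_val_zero, Matrix.cons_val_one, mul_zero, sub_zero,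
    norm_zpow, zpow_unif_le, ← sub_mul, norm_mul] at h1 h2
  refine ⟨h1.1, h2.2, ?_⟩
  rw [zpow_sub₀ norm_unif_pos.ne', le_div_iff₀ (zpow_unif_pos _)]
  exact h2.1

theorem latL_eq {b b' : Kinf F} {k m : ℤ} (h : ‖b' - b‖ ≤ ‖unif F‖ ^ (k - m)) :
    latL b k m = latL b' k m := by
  have key : ∀ b b' : Kinf F, ‖b' - b‖ ≤ ‖unif F‖ ^ (k - m) → lat b k m ≤ lat b' k m := by
    intro b b' h v hv
    rw [mem_lat] at hv ⊢
    refine ⟨?_, hv.2⟩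
    have : v 0 - b' * v 1 = (v 0 - b * v 1) - (b' - b) * v 1 := by ring
    rw [this, sub_eq_add_neg]
    refine norm_add_le_of_le' hv.1 ?_
    rw [norm_neg, norm_mul]
    refine (mul_le_mul h hv.2 (norm_nonneg _) (zpow_unif_pos _).le).trans_eq ?_
    rw [← zpow_add₀ norm_unif_pos.ne', sub_add_cancel]
  exact Subtype.ext (le_antisymm (key b b' h) (key b' b (by rwa [norm_sub_rev])))

theorem latL_map_homothety (b : Kinf F) (k m : ℤ) (u : (Kinf F)ˣ) {j : ℤ}
    (hu : ‖(u : Kinf F)‖ = ‖unif F‖ ^ j) : (latL b k m).map (homothety u) = latL b (k + j) (m + j) := by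
  refine Lattice.ext' fun v => ?_
  rw [Lattice.mem_map]
  have h1 : (homothety u).symm v = (u⁻¹ : Kinf F) • v := by
    rw [LinearEquiv.symm_apply_eq]
    change v = (u : Kinf F) • _
    rw [smul_smul, mul_inv_cancel₀ u.ne_zero, one_smul]
  rw [h1]
  change _ ∈ lat b k m ↔ v ∈ lat b (k + j) (m + j)
  rw [mem_lat, mem_lat]
  have h2 : ∀ (x : Kinf F) (i : ℤ), ‖(u⁻¹ : Kinf F) * x‖ ≤ ‖unif F‖ ^ i ↔
      ‖x‖ ≤ ‖unif F‖ ^ (i + j) := by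
    intro x i
    rw [norm_mul, norm_inv, hu, zpow_add₀ norm_unif_pos.ne', inv_mul_le_iff₀ (zpow_unif_pos _),
      mul_comm]
  simp only [Pi.smul_apply, smul_eq_mul]
  rw [mul_left_comm, ← mul_sub, h2, h2]

end Lattices

/-! ### Vertices as balls, edges as inclusions of balls -/

section Vertices
variable {F : Type*} [Field F] [Fintype F]

/-- The vertex that corresponds to the ball with centre `b` and radius `|π|^l`. -/
def ballVertex (b : Kinf F) (l : ℤ) : Vertex F := ⟦latL b l 0⟧

theorem mk_latL (b : Kinf F) (k m : ℤ) : (⟦latL b k m⟧ : Vertex F) = ballVertex b (k - m) := by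
  refine Quotient.sound ⟨(Units.mk0 _ unif_ne_zero) ^ (-m), ?_⟩
  rw [latL_map_homothety (j := -m) b k m _ (by simp)]
  congr 1
  ring

theorem Vertex.exists_eq_ballVertex (v : Vertex F) : ∃ b l, v = ballVertex b l := by
  induction v using Quotient.inductionOn with | h L => ?_
  obtain ⟨b, k, m, rfl⟩ := L.exists_eq_latL
  exact ⟨b, k - m, mk_latL b k m⟩

/-- A homothety shifts both exponents of a lattice by the same `j`; the second exponent is
normalised to zero, which forces `j = 0`. -/
theorem ballVertex_eq_iff {b b' : Kinf F} {l l' : ℤ} :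
    ballVertex b l = ballVertex b' l' ↔ l = l' ∧ ‖b - b'‖ ≤ ‖unif F‖ ^ l := by
  constructor
  · intro h
    obtain ⟨u, hu⟩ := Quotient.exact h
    obtain ⟨j, hj⟩ := norm_eq_zpow u.ne_zero
    rw [latL_map_homothety b l 0 u hj, zero_add] at hu
    obtain ⟨h1, h2, h3⟩ := latL_le_latL (congrArg Subtype.val hu).le
    obtain ⟨h4, h5, -⟩ := latL_le_latL (congrArg Subtype.val hu).ge
    obtain rfl : j = 0 := by omega
    obtain rfl : l = l' := by omega
    rw [norm_sub_rev, show l = l + 0 - 0 by ring]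
    exact ⟨rfl, h3⟩
  · rintro ⟨rfl, h⟩
    rw [ballVertex, ballVertex, latL_eq (b' := b')]
    rwa [sub_zero, norm_sub_rev]

theorem ballVertex_congr {b b' : Kinf F} {l : ℤ} (h : ‖b - b'‖ ≤ ‖unif F‖ ^ l) :
    ballVertex b l = ballVertex b' l := ballVertex_eq_iff.mpr ⟨rfl, h⟩

theorem map_actLin_latMat (b : Kinf F) (k m : ℤ) :
    (stdLattice F).map (actLin (latMat b k m)) = latL b k m := by
  refine Lattice.ext' fun v => ?_
  change _ ↔ v ∈ lat b k m
  have h3 := unif_zpow_ne_zero (F := F) k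
  have h4 := unif_zpow_ne_zero (F := F) m
  rw [Lattice.mem_map_actLin, mem_lat]
  constructor
  · rintro ⟨u, hu, rfl⟩
    rw [mem_stdLattice] at hu
    have h0 : (latMat b k m).1.mulVec u 0 - b * (latMat b k m).1.mulVec u 1 = unif F ^ k * u 0 := by
      simp [latMat, Matrix.mulVec, dotProduct, Fin.sum_univ_two]
      ring
    have h1 : (latMat b k m).1.mulVec u 1 = unif F ^ m * u 1 := by
      simp [latMat, Matrix.mulVec, dotProduct, Fin.sum_univ_two]
    rw [h0, h1, norm_mul, norm_mul, norm_zpow, norm_zpow]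
    exact ⟨mul_le_of_le_one_right (zpow_unif_pos _).le hu.1,
      mul_le_of_le_one_right (zpow_unif_pos _).le hu.2⟩
  · rintro ⟨h1, h2⟩
    refine ⟨![(v 0 - b * v 1) * (unif F ^ k)⁻¹, v 1 * (unif F ^ m)⁻¹], mem_stdLattice.mpr ⟨?_, ?_⟩, ?_⟩
    · simp only [Matrix.cons_val_zero, norm_mul, norm_inv, norm_zpow]
      exact mul_inv_le_one_of_le₀ h1 (zpow_unif_pos _).le
    · simp only [Matrix.cons_val_one, Matrix.cons_val_zero, norm_mul, norm_inv, norm_zpow]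
      exact mul_inv_le_one_of_le₀ h2 (zpow_unif_pos _).le
    · ext1 i
      fin_cases i
      · simp [latMat, Matrix.mulVec, dotProduct, Fin.sum_univ_two]
        field_simp
        ring
      · simp [latMat, Matrix.mulVec, dotProduct, Fin.sum_univ_two]
        field_simp

theorem vertexOf_latMat (b : Kinf F) (k m : ℤ) : vertexOf (latMat b k m) = ballVertex b (k - m) := by
  rw [← mk_latL, ← map_actLin_latMat]
  rfl

theorem pointVertex_eq (x : Kinf F) (n : ℕ) : pointVertex x n = ballVertex x n := by
  rw [← sub_zero (n : ℤ), ← vertexOf_latMat, pointVertex]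
  congr 1
  ext1
  simp [latMat]

theorem cuspVertex_eq (n : ℕ) : (cuspVertex n : Vertex F) = ballVertex 0 (-n) := by
  rw [← zero_sub, ← vertexOf_latMat, cuspVertex]
  congr 1
  ext1
  simp [latMat]

theorem Vertex.act_mul (g g' : GL (Fin 2) (Kinf F)) (v : Vertex F) :
    v.act (g * g') = (v.act g').act g := by
  induction v using Quotient.inductionOn with | h L => ?_
  change (⟦L.map (actLin (g * g'))⟧ : Vertex F) = ⟦(L.map (actLin g')).map (actLin g)⟧
  rw [actLin_mul, Lattice.map_map]

theorem Vertex.act_one (v : Vertex F) : v.act 1 = v := by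
  induction v using Quotient.inductionOn with | h L => ?_
  change (⟦L.map (actLin 1)⟧ : Vertex F) = ⟦L⟧
  have : actLin (1 : GL (Fin 2) (Kinf F)) = LinearEquiv.refl _ _ := by
    ext1 v
    simp [actLin_apply]
  rw [this, Lattice.map_refl]

theorem Edge.act_mul (g g' : GL (Fin 2) (Kinf F)) (e : Edge F) :
    e.act (g * g') = (e.act g').act g :=
  Edge.ext (Vertex.act_mul _ _ _) (Vertex.act_mul _ _ _)

theorem Edge.act_one (e : Edge F) : e.act 1 = e := Edge.ext (Vertex.act_one _) (Vertex.act_one _)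

/-- The element `x` generates the quotient, and its annihilator there is `π A_∞`. -/
theorem isAdj_of_latL_le {b : Kinf F} {k m k' m' : ℤ} (hle : (latL b k' m').1 ≤ (latL b k m).1)
    (x : (latL b k m).1)
    (hsurj : ∀ v ∈ lat b k m, ∃ a : Ainf F, v - a • x.1 ∈ lat b k' m')
    (hker : ∀ a : Ainf F, a • x.1 ∈ lat b k' m' ↔ ‖algebraMap (Ainf F) (Kinf F) a‖ ≤ ‖unif F‖) :
    IsAdj (ballVertex b (k - m)) (ballVertex b (k' - m')) := by
  refine ⟨latL b k m, latL b k' m', mk_latL _ _ _, mk_latL _ _ _, hle, ⟨?_⟩⟩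
  let f : Ainf F →ₗ[Ainf F] ((latL b k m).1 ⧸ (latL b k' m').1.comap (latL b k m).1.subtype) :=
    LinearMap.toSpanSingleton _ _ (Submodule.Quotient.mk x)
  have hf : Function.Surjective f := by
    intro y
    obtain ⟨⟨v, hv⟩, rfl⟩ := Submodule.Quotient.mk_surjective _ y
    obtain ⟨a, ha⟩ := hsurj v hv
    refine ⟨a, ?_⟩
    rw [LinearMap.toSpanSingleton_apply, ← Submodule.Quotient.mk_smul, eq_comm,
      Submodule.Quotient.eq]
    exact ha
  refine (LinearMap.quotKerEquivOfSurjective f hf).symm.trans (Submodule.quotEquivOfEq _ _ ?_)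
  ext a
  rw [LinearMap.mem_ker, LinearMap.toSpanSingleton_apply, ← Submodule.Quotient.mk_smul,
    Submodule.Quotient.mk_eq_zero, Ideal.mem_span_singleton, ← norm_algebraMap_Ainf_le_iff, ← hker]
  rfl

theorem isAdj_child (b : Kinf F) (l : ℤ) : IsAdj (ballVertex b l) (ballVertex b (l + 1)) := by
  have h := isAdj_of_latL_le (b := b) (k := l) (m := 0) (k' := l + 1) (m' := 0)
    (fun v hv => ⟨hv.1.trans (zpow_unif_le.mpr (by omega)), hv.2⟩)
    ⟨![unif F ^ l, 0], by
      change _ ∈ lat b l 0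
      simp [mem_lat]⟩ ?_ ?_
  · simpa using h
  · intro v hv
    obtain ⟨a, ha⟩ := exists_smul_eq_of_norm_le (hv.1.trans_eq (norm_zpow (unif F) l).symm)
    refine ⟨a, ?_⟩
    rw [mem_lat]
    simp [ha, (zpow_unif_pos _).le]
    simpa using hv.2
  · intro a
    rw [mem_lat]
    simp only [Pi.smul_apply, Matrix.cons_val_zero, Matrix.cons_val_one, mul_zero,
      sub_zero, norm_zero, (zpow_unif_pos _).le, and_true, Algebra.smul_def, norm_mul, norm_zpow]
    rw [zpow_add₀ norm_unif_pos.ne', zpow_one, mul_comm, mul_le_mul_iff_right₀ (zpow_unif_pos _)]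

theorem isAdj_parent (b : Kinf F) (l : ℤ) : IsAdj (ballVertex b (l + 1)) (ballVertex b l) := by
  have h := isAdj_of_latL_le (b := b) (k := l + 1) (m := 0) (k' := l + 1) (m' := 1)
    (fun v hv => ⟨hv.1, hv.2.trans (zpow_unif_le.mpr (by omega))⟩)
    ⟨![b, 1], by
      change _ ∈ lat b (l + 1) 0
      simp [mem_lat, (zpow_unif_pos _).le]⟩ ?_ ?_
  · simpa using h
  · intro v hv
    obtain ⟨a, ha⟩ := exists_smul_eq_of_norm_le (x := v 1) (y := (1 : Kinf F))
      (by simpa using hv.2)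
    refine ⟨a, ?_⟩
    have hab : a • b = b * v 1 := by rw [← ha, mul_smul_comm, mul_one]
    rw [mem_lat]
    simp [ha, hab, norm_unif_pos.le]
    simpa using hv.1
  · intro a
    rw [mem_lat]
    have hab : a • b - b * (a • (1 : Kinf F)) = 0 := by rw [mul_smul_comm, mul_one, sub_self]
    change ‖a • b - b * (a • (1 : Kinf F))‖ ≤ _ ∧ ‖a • (1 : Kinf F)‖ ≤ _ ↔ _
    rw [hab, norm_zero, Algebra.smul_def, mul_one, zpow_one]
    exact and_iff_right (zpow_unif_pos _).le

/-- From `πL ⊆ M ⊆ L` each of the two exponents of `M` exceeds that of `L` by zero or one. Both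
equal means `M = L`, both larger means `M = πL`, and neither has a quotient of length one. The two
mixed cases are the next smaller and the next larger ball. -/
theorem IsAdj.exists_ballVertex {v w : Vertex F} (h : IsAdj v w) : ∃ (b : Kinf F) (l : ℤ),
    (v = ballVertex b l ∧ w = ballVertex b (l + 1)) ∨
    (v = ballVertex b (l + 1) ∧ w = ballVertex b l) := by
  obtain ⟨L, M, rfl, rfl, hle, ⟨f⟩⟩ := h
  have hX : ∀ x ∈ L.1, (PowerSeries.X : Ainf F) • x ∈ M.1 := by
    intro x hx
    have h0 : (PowerSeries.X : Ainf F) •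
        (Submodule.Quotient.mk ⟨x, hx⟩ : L.1 ⧸ M.1.comap L.1.subtype) = 0 := by
      apply f.injective
      rw [map_smul, map_zero]
      obtain ⟨y, hy⟩ := Ideal.Quotient.mk_surjective (f (Submodule.Quotient.mk ⟨x, hx⟩))
      rw [← hy, ← Ideal.Quotient.mk_eq_mk, ← Submodule.Quotient.mk_smul,
        Submodule.Quotient.mk_eq_zero, smul_eq_mul]
      exact Ideal.mul_mem_right _ _ (Ideal.mem_span_singleton_self _)
    rw [← Submodule.Quotient.mk_smul, Submodule.Quotient.mk_eq_zero] at h0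
    exact h0
  have hne : ¬ L.1 ≤ M.1 := by
    intro hLM
    have h1 : f (f.symm (Submodule.Quotient.mk 1)) = 0 := by
      obtain ⟨⟨x, hx⟩, hxx⟩ := Submodule.Quotient.mk_surjective _ (f.symm (Submodule.Quotient.mk 1))
      have : (Submodule.Quotient.mk ⟨x, hx⟩ : L.1 ⧸ M.1.comap L.1.subtype) = 0 :=
        (Submodule.Quotient.mk_eq_zero _).mpr (hLM hx)
      rw [← hxx, this, map_zero]
    rw [LinearEquiv.apply_symm_apply, Submodule.Quotient.mk_eq_zero, Ideal.mem_span_singleton,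
      PowerSeries.X_dvd_iff] at h1
    simp at h1
  -- `L / M` is a line over the residue field, so two vectors of `L` are dependent modulo `M`, with
  -- coefficients that are not both divisible by `π`. For images `s`, `t` in `A_∞ / π` the relation
  -- is `t · s - s · t = 0`, unless `s = 0`.
  have hrel : ∀ x ∈ L.1, ∀ y ∈ L.1, ∃ α β : Ainf F,
      (PowerSeries.constantCoeff α ≠ 0 ∨ PowerSeries.constantCoeff β ≠ 0) ∧
      α • x + β • y ∈ M.1 := by
    intro x hx y hy
    obtain ⟨s, hs⟩ := Ideal.Quotient.mk_surjective (f (Submodule.Quotient.mk ⟨x, hx⟩))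
    obtain ⟨t, ht⟩ := Ideal.Quotient.mk_surjective (f (Submodule.Quotient.mk ⟨y, hy⟩))
    have key : ∀ α β : Ainf F, PowerSeries.constantCoeff (α * s + β * t) = 0 →
        α • x + β • y ∈ M.1 := by
      intro α β h0
      have h1 : (Submodule.Quotient.mk (α • ⟨x, hx⟩ + β • ⟨y, hy⟩) : L.1 ⧸ M.1.comap L.1.subtype) = 0 := by
        apply f.injective
        rw [Submodule.Quotient.mk_add, Submodule.Quotient.mk_smul, Submodule.Quotient.mk_smul,
          map_add, map_smul, map_smul, map_zero, ← hs, ← ht, ← Ideal.Quotient.mk_eq_mk,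
          ← Ideal.Quotient.mk_eq_mk, ← Submodule.Quotient.mk_smul, ← Submodule.Quotient.mk_smul,
          ← Submodule.Quotient.mk_add, Submodule.Quotient.mk_eq_zero, Ideal.mem_span_singleton,
          PowerSeries.X_dvd_iff]
        exact h0
      rw [Submodule.Quotient.mk_eq_zero] at h1
      exact h1
    by_cases hs0 : PowerSeries.constantCoeff s = 0
    · exact ⟨1, 0, Or.inl (by simp), key _ _ (by simp [hs0])⟩
    · refine ⟨PowerSeries.C (PowerSeries.constantCoeff t), -PowerSeries.C (PowerSeries.constantCoeff s),
        Or.inr (by simpa using hs0), key _ _ (by simp; ring)⟩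
  obtain ⟨b, k, m, rfl⟩ := L.exists_eq_latL
  obtain ⟨b', k', m', rfl⟩ := M.exists_eq_latL
  obtain ⟨h1, h2, h3⟩ := latL_le_latL hle
  have h4 := latL_le_latL (b' := b) (k' := k + 1) (m' := m + 1) (b := b') (k := k') (m := m') (by
    intro v hv
    have := hX ((unif F)⁻¹ • v) (by
      change _ ∈ lat b k m
      obtain ⟨h5, h6⟩ : v ∈ lat b (k + 1) (m + 1) := hv
      rw [zpow_add₀ norm_unif_pos.ne', zpow_one, mul_comm (_ ^ _)] at h5 h6
      rw [mem_lat]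
      simp only [Pi.smul_apply, smul_eq_mul]
      rw [mul_left_comm, ← mul_sub, norm_mul, norm_mul, norm_inv, inv_mul_le_iff₀ norm_unif_pos,
        inv_mul_le_iff₀ norm_unif_pos]
      exact ⟨h5, h6⟩)
    rwa [X_smul_eq, smul_smul, mul_inv_cancel₀ unif_ne_zero, one_smul] at this)
  obtain ⟨h5, h6, h7⟩ := h4
  rw [mk_latL, mk_latL]
  obtain rfl | rfl : k' = k ∨ k' = k + 1 := by omega
  · obtain rfl | rfl : m' = m ∨ m' = m + 1 := by omega
    · exact absurd (latL_eq h3 ▸ le_rfl) hne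
    · refine ⟨b, k' - (m + 1), Or.inr ⟨?_, ?_⟩⟩
      · congr 1; ring
      · exact ballVertex_congr h3
  · obtain rfl | rfl : m' = m ∨ m' = m + 1 := by omega
    · refine ⟨b', k - m', Or.inl ⟨?_, ?_⟩⟩
      · exact ballVertex_congr (by rwa [norm_sub_rev])
      · congr 1; ring
    -- Here `M = πL`. A relation modulo `M` between the two basis vectors of `L` would have both
    -- coefficients divisible by `π`, against `hrel`.
    · exfalso
      obtain ⟨α, β, hαβ, hmem⟩ := hrel ![unif F ^ k, 0]
        (by change _ ∈ lat b k m; simp [mem_lat, (zpow_unif_pos _).le])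
        ![b * unif F ^ m, unif F ^ m]
        (by change _ ∈ lat b k m; simp [mem_lat, (zpow_unif_pos _).le])
      change _ ∈ lat b' (k + 1) (m + 1) at hmem
      obtain ⟨h8, h9⟩ := mem_lat.mp hmem
      have hc : ∀ (a : Ainf F) (i : ℤ), ‖algebraMap (Ainf F) (Kinf F) a * unif F ^ i‖ ≤
          ‖unif F‖ ^ (i + 1) → PowerSeries.constantCoeff a = 0 := by
        intro a i hi
        rw [norm_mul, norm_zpow, zpow_add₀ norm_unif_pos.ne', zpow_one, mul_comm,
          mul_le_mul_iff_right₀ (zpow_unif_pos _), norm_algebraMap_Ainf_le_iff,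
          PowerSeries.X_dvd_iff] at hi
        exact hi
      have e1 : (α • ![unif F ^ k, 0] + β • ![b * unif F ^ m, unif F ^ m] : Vec F) 1 =
          algebraMap (Ainf F) (Kinf F) β * unif F ^ m := by
        change α • (0 : Kinf F) + β • (unif F ^ m) = _
        rw [smul_zero, zero_add, Algebra.smul_def]
      have e0 : (α • ![unif F ^ k, 0] + β • ![b * unif F ^ m, unif F ^ m] : Vec F) 0 =
          algebraMap (Ainf F) (Kinf F) α * unif F ^ k +
            algebraMap (Ainf F) (Kinf F) β * (b * unif F ^ m) := by
        change α • (unif F ^ k) + β • (b * unif F ^ m) = _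
        rw [Algebra.smul_def, Algebra.smul_def]
      rw [e0, e1] at h8
      rw [e1] at h9
      clear e0 e1 hmem
      have hβ := hc β m h9
      have hα := hc α k (by
        have e1 : algebraMap (Ainf F) (Kinf F) α * unif F ^ k =
          (algebraMap (Ainf F) (Kinf F) α * unif F ^ k +
            algebraMap (Ainf F) (Kinf F) β * (b * unif F ^ m) -
            b' * (algebraMap (Ainf F) (Kinf F) β * unif F ^ m)) +
          (b' - b) * (algebraMap (Ainf F) (Kinf F) β * unif F ^ m) := by
          generalize algebraMap (Ainf F) (Kinf F) β = y
          ring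
        rw [e1]
        refine norm_add_le_of_le' h8 ?_
        rw [norm_mul]
        rw [norm_sub_rev] at h7
        refine (mul_le_mul h7 h9 (norm_nonneg _) (zpow_unif_pos _).le).trans_eq ?_
        rw [← zpow_add₀ norm_unif_pos.ne', sub_add_cancel])
      rcases hαβ with h | h
      · exact h hα
      · exact h hβ

/-- The oriented edge from the ball of radius `|π|^(l-1)` to the ball of radius `|π|^l`. -/
def downEdge (b : Kinf F) (l : ℤ) : Edge F :=
  ⟨ballVertex b (l - 1), ballVertex b l, by simpa using isAdj_child b (l - 1)⟩

/-- The opposite of `downEdge b l`. -/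
def upEdge (b : Kinf F) (l : ℤ) : Edge F :=
  ⟨ballVertex b l, ballVertex b (l - 1), by simpa using isAdj_parent b (l - 1)⟩

theorem Edge.eq_downEdge_or_upEdge (e : Edge F) :
    ∃ b l, e = downEdge b l ∨ e = upEdge b l := by
  obtain ⟨b, l, h | h⟩ := e.adj.exists_ballVertex
  · exact ⟨b, l + 1, Or.inl (Edge.ext (by simpa [downEdge] using h.1) h.2)⟩
  · exact ⟨b, l + 1, Or.inr (Edge.ext h.1 (by simpa [upEdge] using h.2))⟩

theorem downEdge_congr {b b' : Kinf F} {l : ℤ} (h : ‖b - b'‖ ≤ ‖unif F‖ ^ l) :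
    downEdge b l = downEdge b' l :=
  Edge.ext (ballVertex_congr (h.trans (zpow_unif_le.mpr (by omega)))) (ballVertex_congr h)

theorem upEdge_congr {b b' : Kinf F} {l : ℤ} (h : ‖b - b'‖ ≤ ‖unif F‖ ^ l) :
    upEdge b l = upEdge b' l :=
  Edge.ext (ballVertex_congr h) (ballVertex_congr (h.trans (zpow_unif_le.mpr (by omega))))

end Vertices

/-! ### Ends through an edge: balls and their complements -/

section Ends
variable {F : Type*} [Field F] [Fintype F]

theorem isRay_of_downward (x : Kinf F) (l : ℤ) : IsRay fun j : ℕ => ballVertex x (l + j) where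
  adj i := by simpa [add_assoc] using isAdj_child x (l + i)
  no_backtrack i h := by
    have := (ballVertex_eq_iff.mp h).1
    push_cast at this
    omega

/-- A ball has only one next larger ball, so an upward step after a downward one would be
back-tracking. -/
theorem IsRay.down_step {r : ℕ → Vertex F} (hr : IsRay r) {i : ℕ} {b : Kinf F} {l : ℤ}
    (h0 : r i = ballVertex b l) (h1 : r (i + 1) = ballVertex b (l + 1)) :
    ∃ b', ‖b' - b‖ ≤ ‖unif F‖ ^ (l + 1) ∧ r (i + 1) = ballVertex b' (l + 1) ∧
      r (i + 2) = ballVertex b' (l + 2) := by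
  obtain ⟨b', l', h | h⟩ := (hr.adj (i + 1)).exists_ballVertex
  · obtain ⟨h2, h3⟩ := ballVertex_eq_iff.mp (h.1.symm.trans h1)
    subst h2
    exact ⟨b', h3, h.1, h.2.trans (by ring_nf)⟩
  · exfalso
    obtain ⟨h2, h3⟩ := ballVertex_eq_iff.mp (h.1.symm.trans h1)
    obtain rfl : l' = l := by omega
    refine hr.no_backtrack i ?_
    rw [h0]
    exact h.2.trans (ballVertex_congr (h3.trans (zpow_unif_le.mpr (by omega))))

theorem IsRay.down {r : ℕ → Vertex F} (hr : IsRay r) {i : ℕ} {b : Kinf F} {l : ℤ}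
    (h0 : r i = ballVertex b l) (h1 : r (i + 1) = ballVertex b (l + 1)) (k : ℕ) :
    ∃ b', ‖b' - b‖ ≤ ‖unif F‖ ^ (l + 1) ∧ r (i + k) = ballVertex b' (l + k) ∧
      r (i + k + 1) = ballVertex b' (l + k + 1) := by
  induction k with
  | zero => exact ⟨b, by simp [(zpow_unif_pos _).le], by simpa using h0, by simpa using h1⟩
  | succ k ih =>
    obtain ⟨b', hb, h2, h3⟩ := ih
    obtain ⟨b'', hb', h4, h5⟩ := hr.down_step h2 h3
    refine ⟨b'', norm_sub_le_of_le (hb'.trans (zpow_unif_le.mpr (by omega))) hb, ?_, ?_⟩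
    · rw [← add_assoc, h4]; congr 1; push_cast; ring
    · rw [← add_assoc, add_assoc (i + k), h5]; congr 1; push_cast; ring

theorem stdPath_infty (n : ℕ) : stdPath (OnePoint.infty : OnePoint (Kinf F)) n = ballVertex 0 (-n) :=
  cuspVertex_eq n

theorem stdPath_coe (x : Kinf F) (n : ℕ) : stdPath (x : OnePoint (Kinf F)) n = ballVertex x n :=
  pointVertex_eq x n

/-- The ball `B_b(|π|^l)` as a subset of `P¹(k_∞)`. -/
def ballSet (b : Kinf F) (l : ℤ) : Set (OnePoint (Kinf F)) :=
  (fun x : Kinf F => (x : OnePoint (Kinf F))) '' {x | ‖x - b‖ ≤ ‖unif F‖ ^ l}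

theorem coe_mem_ballSet {x b : Kinf F} {l : ℤ} :
    (x : OnePoint (Kinf F)) ∈ ballSet b l ↔ ‖x - b‖ ≤ ‖unif F‖ ^ l := by
  constructor
  · rintro ⟨y, hy, h⟩
    rwa [← OnePoint.coe_injective h]
  · exact fun h => ⟨x, h, rfl⟩

/-- A ray that has gone down once goes down for ever inside the ball it entered. The path of `∞`
goes up, and the path of `x` runs through balls around `x`, so `x` lies in that ball. -/
theorem ends_downEdge (b : Kinf F) (l : ℤ) : (downEdge b l).ends = ballSet b l := by
  ext P
  constructor
  · rintro ⟨r, hr, ⟨a, c, hac⟩, i, h0, h1⟩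
    have h0' : r i = ballVertex b (l - 1) := h0
    have h1' : r (i + 1) = ballVertex b (l - 1 + 1) := by
      rw [sub_add_cancel]
      exact h1
    have hd := hr.down h0' h1'
    induction P using OnePoint.rec with
    | infty =>
      exfalso
      obtain ⟨b1, -, h2, h3⟩ := hd a
      have h4 := hac i
      have h5 := hac (i + 1)
      rw [stdPath_infty, add_comm a, h2] at h4
      rw [stdPath_infty, ← add_assoc, add_comm a, h3] at h5
      have h6 := (ballVertex_eq_iff.mp h4).1
      have h7 := (ballVertex_eq_iff.mp h5).1
      push_cast at h7
      omega
    | coe x =>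
      obtain ⟨b1, hb1, h2, h3⟩ := hd (a + 1)
      have h4 := hac (i + 1)
      rw [stdPath_coe, show a + (i + 1) = i + (a + 1) by ring, h2] at h4
      obtain ⟨h5, h6⟩ := ballVertex_eq_iff.mp h4
      rw [coe_mem_ballSet]
      rw [sub_add_cancel] at hb1
      rw [norm_sub_rev] at h6
      exact norm_sub_le_of_le (h6.trans (zpow_unif_le.mpr (by push_cast; omega))) hb1
  · rintro ⟨x, hx, rfl⟩
    -- The `j`-th vertex of this ray has level `l - 1 + j`, and the `j`-th vertex of `stdPath x` has
    -- level `j`. The two truncated offsets differ by `l - 1`.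
    refine ⟨_, isRay_of_downward x (l - 1), ⟨(1 - l).toNat, (l - 1).toNat, fun j => ?_⟩, 0, ?_, ?_⟩
    · rw [stdPath_coe]
      change ballVertex x _ = _
      congr 1
      push_cast
      omega
    · simp only [Nat.cast_zero, add_zero]
      exact ballVertex_congr (hx.trans (zpow_unif_le.mpr (by omega)))
    · simp only [zero_add, Nat.cast_one, sub_add_cancel]
      exact ballVertex_congr hx

theorem isRay_upward (b : Kinf F) (l : ℤ) : IsRay fun j : ℕ => ballVertex b (l - j) where
  adj i := by
    have := isAdj_parent b (l - (i + 1 : ℕ))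
    convert this using 2
    push_cast
    ring
  no_backtrack i h := by
    have := (ballVertex_eq_iff.mp h).1
    push_cast at this
    omega

/-- The smallest ball that contains both `b` and `x` has level `m`. The ray climbs from the ball
around `b` to it and then descends towards `x`; it does not turn back because `b` and `x` lie in
different sub-balls there. -/
theorem isRay_upward_downward {b x : Kinf F} {l m : ℤ} (h : ‖x - b‖ = ‖unif F‖ ^ m) :
    IsRay fun j : ℕ => if (j : ℤ) ≤ l - m then ballVertex b (l - j)
      else ballVertex x (2 * m - l + j) where
  adj i := by
    simp only [Nat.cast_add, Nat.cast_one]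
    split_ifs with h1 h2 h2
    · convert isAdj_parent b (l - (i + 1)) using 2
      ring
    · have h3 : (i : ℤ) = l - m := by omega
      have h4 : ballVertex b (l - i) = ballVertex x m := by
        rw [show l - (i : ℤ) = m by omega]
        exact ballVertex_congr (by rw [norm_sub_rev, h])
      rw [h4]
      convert isAdj_child x m using 2
      omega
    · omega
    · convert isAdj_child x (2 * m - l + i) using 2
      ring
  no_backtrack i h' := by
    simp only [Nat.cast_add, Nat.cast_ofNat] at h'
    split_ifs at h' with h1 h2 h2
    · have := (ballVertex_eq_iff.mp h').1
      omega
    · omega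
    · obtain ⟨h3, h4⟩ := ballVertex_eq_iff.mp h'
      rw [h, zpow_unif_le] at h4
      omega
    · have := (ballVertex_eq_iff.mp h').1
      omega

theorem exists_norm_le_zpow (b : Kinf F) (l : ℤ) : ∃ c : ℕ, ‖b‖ ≤ ‖unif F‖ ^ (-c : ℤ) ∧ -l ≤ c := by
  rcases eq_or_ne b 0 with rfl | hb
  · exact ⟨(-l).toNat, by rw [norm_zero]; exact (zpow_unif_pos _).le, by omega⟩
  · obtain ⟨k, hk⟩ := norm_eq_zpow hb
    exact ⟨(max (-k) (-l)).toNat, by rw [hk, zpow_unif_le]; omega, by omega⟩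

theorem IsRay.up_step {r : ℕ → Vertex F} (hr : IsRay r) {i : ℕ} {x : Kinf F} {l : ℤ}
    (h0 : r i = ballVertex x (l + 1)) (h1 : r (i + 1) = ballVertex x l) :
    r (i + 2) = ballVertex x (l - 1) ∨ ∃ b', ¬ ‖x - b'‖ ≤ ‖unif F‖ ^ (l + 1) ∧
      r (i + 1) = ballVertex b' l ∧ r (i + 2) = ballVertex b' (l + 1) := by
  obtain ⟨b', l', h | h⟩ := (hr.adj (i + 1)).exists_ballVertex
  · right
    obtain ⟨h2, h3⟩ := ballVertex_eq_iff.mp (h.1.symm.trans h1)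
    subst h2
    refine ⟨b', fun hx => hr.no_backtrack i ?_, h.1, h.2⟩
    rw [h0]
    exact h.2.trans (ballVertex_congr (by rwa [norm_sub_rev]))
  · left
    obtain ⟨h2, h3⟩ := ballVertex_eq_iff.mp (h.1.symm.trans h1)
    obtain rfl : l' = l - 1 := by omega
    exact h.2.trans (ballVertex_congr (h3.trans (zpow_unif_le.mpr (by omega))))

theorem IsRay.up {r : ℕ → Vertex F} (hr : IsRay r) {i : ℕ} {x : Kinf F} {l : ℤ}
    (h0 : r i = ballVertex x l) (h1 : r (i + 1) = ballVertex x (l - 1)) (k : ℕ) :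
    (r (i + k) = ballVertex x (l - k) ∧ r (i + k + 1) = ballVertex x (l - k - 1)) ∨
    ∃ b' m, ¬ ‖x - b'‖ ≤ ‖unif F‖ ^ (m + 1) ∧
      r (i + k) = ballVertex b' m ∧ r (i + k + 1) = ballVertex b' (m + 1) := by
  induction k with
  | zero => exact Or.inl ⟨by simpa using h0, by simpa using h1⟩
  | succ k ih =>
    rw [← add_assoc]
    rcases ih with ⟨h2, h3⟩ | ⟨b', m, h2, h3, h4⟩
    · rcases hr.up_step (l := l - k - 1) (h2.trans (by ring_nf)) h3 with h5 | ⟨b', h5, h6, h7⟩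
      · refine Or.inl ⟨h3.trans ?_, h5.trans ?_⟩ <;> congr 1 <;> push_cast <;> ring
      · exact Or.inr ⟨b', _, h5, h6, h7⟩
    · obtain ⟨b'', h5, h6, h7⟩ := hr.down_step h3 h4
      refine Or.inr ⟨b'', m + 1, fun h8 => h2 ?_, h6, h7.trans (by ring_nf)⟩
      exact norm_sub_le_of_le (h8.trans (zpow_unif_le.mpr (by omega))) h5

/-- For a point `x` of the ball the centre may be taken to be `x`. A ray through the edge either
keeps climbing, whereas levels increase along the path of `x`, or it has turned down into balls
without `x`. -/
theorem ends_upEdge (b : Kinf F) (l : ℤ) : (upEdge b l).ends = (ballSet b l)ᶜ := by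
  ext P
  constructor
  · rintro ⟨r, hr, ⟨a, c, hac⟩, i, h0, h1⟩ ⟨x, hx, rfl⟩
    have hx' : ‖b - x‖ ≤ ‖unif F‖ ^ l := by rw [norm_sub_rev]; exact hx
    have h0' : r i = ballVertex x l := (show r i = ballVertex b l from h0).trans (ballVertex_congr hx')
    have h1' : r (i + 1) = ballVertex x (l - 1) :=
      (show r (i + 1) = ballVertex b (l - 1) from h1).trans
        (ballVertex_congr (hx'.trans (zpow_unif_le.mpr (by omega))))
    have h4 := hac i
    have h5 := hac (i + 1)
    rw [stdPath_coe, add_comm a] at h4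
    rw [stdPath_coe, ← add_assoc, add_comm a] at h5
    rcases hr.up h0' h1' a with ⟨h2, h3⟩ | ⟨b', m, h6, h2, h3⟩
    · have h6 := (ballVertex_eq_iff.mp (h2.symm.trans h4)).1
      have h7 := (ballVertex_eq_iff.mp (h3.symm.trans h5)).1
      push_cast at h7
      omega
    · obtain ⟨h7, h8⟩ := ballVertex_eq_iff.mp (h3.symm.trans h5)
      exact h6 (by rwa [norm_sub_rev])
  · intro hP
    induction P using OnePoint.rec with
    | infty =>
      obtain ⟨c, hc, hc'⟩ := exists_norm_le_zpow b l
      refine ⟨_, isRay_upward b l, ⟨(l + c).toNat, c, fun j => ?_⟩, 0, ?_, ?_⟩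
      · change ballVertex b (l - _) = _
        rw [stdPath_infty, show l - (((l + c).toNat + j : ℕ) : ℤ) = -((c + j : ℕ) : ℤ) by omega]
        refine ballVertex_congr ?_
        rw [sub_zero]
        exact hc.trans (zpow_unif_le.mpr (by omega))
      · simp [upEdge]
      · simp [upEdge]
    | coe x =>
      have hx : ¬ ‖x - b‖ ≤ ‖unif F‖ ^ l := fun h => hP (coe_mem_ballSet.mpr h)
      have hne : x - b ≠ 0 := fun h => hx (by simp [h, (zpow_unif_pos _).le])
      obtain ⟨m, hm⟩ := norm_eq_zpow hne
      rw [hm, zpow_unif_le, not_le] at hx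
      -- After the turn the level is `2m - l + j`, so the offsets must differ by `2m - l`. Adding `l
      -- - m + 1` to both makes sure that the turn has been passed.
      refine ⟨_, isRay_upward_downward (l := l) hm,
        ⟨(l - 2 * m).toNat + (l - m + 1).toNat, (2 * m - l).toNat + (l - m + 1).toNat,
          fun j => ?_⟩, 0, ?_, ?_⟩
      · change (if _ then _ else _) = _
        rw [if_neg (by omega), stdPath_coe]
        congr 1
        push_cast
        omega
      · rw [if_pos (by simp; omega)]
        simp [upEdge]
      · rw [if_pos (by simp; omega)]
        simp [upEdge]

end Ends

/-! ### The action of particular matrices on balls and edges -/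

section MatrixAction
variable {F : Type*} [Field F] [Fintype F]

/-- Matrices in `GL₂(A_∞)`. -/
def IsIntegralGL (k : GL (Fin 2) (Kinf F)) : Prop := (∀ i j, ‖k i j‖ ≤ 1) ∧ ‖k.1.det‖ = 1

theorem norm_mulVec_le_one {k : Matrix (Fin 2) (Fin 2) (Kinf F)} (hk : ∀ i j, ‖k i j‖ ≤ 1)
    {v : Vec F} (hv : ∀ i, ‖v i‖ ≤ 1) (i : Fin 2) : ‖k.mulVec v i‖ ≤ 1 := by
  rw [Matrix.mulVec, dotProduct, Fin.sum_univ_two]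
  refine norm_add_le_of_le' ?_ ?_ <;>
  · rw [norm_mul]
    exact mul_le_one₀ (hk _ _) (norm_nonneg _) (hv _)

theorem stdLattice_map_actLin {k : GL (Fin 2) (Kinf F)} (hk : IsIntegralGL k) :
    (stdLattice F).map (actLin k) = stdLattice F := by
  refine Lattice.ext' fun v => ?_
  rw [Lattice.mem_map_actLin]
  constructor
  · rintro ⟨u, hu, rfl⟩
    rw [mem_stdLattice] at hu ⊢
    have := norm_mulVec_le_one hk.1 (v := u) (by intro i; fin_cases i; exacts [hu.1, hu.2])
    exact ⟨this 0, this 1⟩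
  · intro hv
    refine ⟨k⁻¹.1.mulVec v, ?_, ?_⟩
    · rw [mem_stdLattice] at hv ⊢
      have hdet : ‖k.1.det⁻¹‖ = 1 := by rw [norm_inv, hk.2, inv_one]
      have hent : ∀ i j, ‖k⁻¹.1 i j‖ ≤ 1 := by
        intro i j
        rw [Matrix.coe_units_inv, Matrix.inv_def, Matrix.adjugate_fin_two, Matrix.smul_apply,
          Ring.inverse_eq_inv', smul_eq_mul, norm_mul, hdet, one_mul]
        fin_cases i <;> fin_cases j <;> simp only [Fin.zero_eta, Fin.mk_one, Matrix.of_apply, Matrix.cons_val', Matrix.cons_val_zero, Matrix.cons_val_one, norm_neg] <;> exact hk.1 _ _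
      have := norm_mulVec_le_one hent (v := v) (by intro i; fin_cases i; exacts [hv.1, hv.2])
      exact ⟨this 0, this 1⟩
    · rw [Matrix.mulVec_mulVec, ← Units.val_mul, mul_inv_cancel, Units.val_one, Matrix.one_mulVec]

theorem vertexOf_mul_of_isIntegral (g : GL (Fin 2) (Kinf F)) {k : GL (Fin 2) (Kinf F)}
    (hk : IsIntegralGL k) : vertexOf (g * k) = vertexOf g := by
  refine (Vertex.act_mul g k _).trans (congrArg (Vertex.act g) ?_)
  change (⟦(stdLattice F).map (actLin k)⟧ : Vertex F) = _
  rw [stdLattice_map_actLin hk]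

theorem vertexOf_one : vertexOf 1 = (ballVertex 0 0 : Vertex F) := by
  rw [← sub_zero (0 : ℤ), ← vertexOf_latMat]
  congr 1
  ext1
  simp [latMat, Matrix.one_fin_two]

theorem vertexOf_mul (g g' : GL (Fin 2) (Kinf F)) : vertexOf (g * g') = (vertexOf g').act g :=
  Vertex.act_mul _ _ _

/-- The scalar matrix `z`. -/
def scalarGL (z : (Kinf F)ˣ) : GL (Fin 2) (Kinf F) := Matrix.GeneralLinearGroup.scalar (Fin 2) z

theorem act_scalarGL (z : (Kinf F)ˣ) (v : Vertex F) : v.act (scalarGL z) = v := by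
  induction v using Quotient.inductionOn with | h L => ?_
  refine Quotient.sound (Setoid.symm ⟨z, ?_⟩)
  have : actLin (scalarGL z) = homothety z := by
    ext1 v
    rw [actLin_apply]
    change _ = (z : Kinf F) • v
    simp [scalarGL, Matrix.scalar_apply, ← Matrix.smul_one_eq_diagonal, Matrix.smul_mulVec]
  rw [this]

/-- The matrix `(0, 1; 1, 0)`. -/
def swapGL : GL (Fin 2) (Kinf F) :=
  Matrix.GeneralLinearGroup.mkOfDetNeZero !![0, 1; 1, 0] (by simp [Matrix.det_fin_two])

theorem isIntegralGL_swapGL : IsIntegralGL (swapGL : GL (Fin 2) (Kinf F)) := by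
  constructor
  · intro i j
    fin_cases i <;> fin_cases j <;> simp [swapGL]
  · simp [swapGL, Matrix.det_fin_two]

theorem ballVertex_act_latMat (b : Kinf F) (l k : ℤ) :
    (ballVertex 0 k).act (latMat b l 0) = ballVertex b (l + k) := by
  rw [← sub_zero k, ← vertexOf_latMat, ← vertexOf_mul, ← sub_zero (l + (k - 0)), ← vertexOf_latMat]
  congr 1
  ext1
  simp [latMat, zpow_add₀ unif_ne_zero]

theorem downEdge_eq_act (b : Kinf F) (l : ℤ) :
    downEdge b l = (downEdge 0 0).act (latMat b l 0) :=
  Edge.ext ((by rw [ballVertex_act_latMat]; congr 1 :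
      ballVertex b (l - 1) = (ballVertex 0 (0 - 1)).act _))
    ((congrArg _ (add_zero l).symm).trans (ballVertex_act_latMat b l 0).symm)

theorem ballVertex_act_swapGL (l : ℤ) : (ballVertex (0 : Kinf F) l).act swapGL = ballVertex 0 (-l) := by
  rw [← sub_zero l, ← vertexOf_latMat, ← vertexOf_mul, sub_zero, ← zero_sub, ← vertexOf_latMat,
    ← vertexOf_mul_of_isIntegral (latMat 0 0 l) isIntegralGL_swapGL]
  congr 1
  ext1
  simp [latMat, swapGL]

theorem downEdge_act_swapGL (l : ℤ) : (downEdge (0 : Kinf F) l).act swapGL = upEdge 0 (1 - l) :=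
  Edge.ext ((ballVertex_act_swapGL (l - 1)).trans (by rw [neg_sub]; rfl))
    ((ballVertex_act_swapGL l).trans (by
      change _ = ballVertex 0 (1 - l - 1)
      congr 1
      ring))

/-- The Iwahori subgroup. -/
def IsIwahori (k : GL (Fin 2) (Kinf F)) : Prop := IsIntegralGL k ∧ ‖k 1 0‖ ≤ ‖unif F‖

/-- An integral matrix fixes the vertex `ballVertex 0 0`. It also fixes the next larger ball because
conjugation by `diag(π⁻¹, 1)` divides the lower left entry by `π` and keeps the matrix integral. -/
theorem downEdge_act_iwahori {k : GL (Fin 2) (Kinf F)} (hk : IsIwahori k) :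
    (downEdge 0 0).act k = downEdge 0 0 := by
  have h0 : (ballVertex 0 0).act k = ballVertex 0 0 := by
    rw [← vertexOf_one, ← vertexOf_mul, mul_one, ← vertexOf_mul_of_isIntegral 1 hk.1, one_mul]
  refine Edge.ext ?_ h0
  change (ballVertex 0 (0 - 1)).act k = ballVertex 0 (0 - 1)
  have h1 : (ballVertex 0 (0 - 1) : Vertex F) = vertexOf (latMat 0 (-1) 0) := by
    rw [vertexOf_latMat]; rfl
  have h2 : k * latMat 0 (-1) 0 = latMat 0 (-1) 0 * ((latMat 0 (-1) 0)⁻¹ * k * latMat 0 (-1) 0) := by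
    group
  have h3 : (latMat 0 (-1) 0)⁻¹ * k * latMat 0 (-1) 0 =
      Matrix.GeneralLinearGroup.mkOfDetNeZero !![k 0 0, unif F * k 0 1; (unif F)⁻¹ * k 1 0, k 1 1] (by
        rw [Matrix.det_fin_two_of]
        have := k.det_ne_zero
        rw [Matrix.det_fin_two] at this
        convert this using 1
        have := unif_ne_zero (F := F)
        field_simp) := by
    rw [mul_assoc, inv_mul_eq_iff_eq_mul]
    refine Units.ext (Matrix.ext fun i j => ?_)
    have := unif_ne_zero (F := F)
    rw [Matrix.GeneralLinearGroup.coe_mul, Matrix.GeneralLinearGroup.coe_mul]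
    fin_cases i <;> fin_cases j <;> simp [latMat, Matrix.mul_apply, Fin.sum_univ_two] <;>
      field_simp
  rw [h1, ← vertexOf_mul, h2, h3]
  refine vertexOf_mul_of_isIntegral _ ⟨?_, ?_⟩
  · intro i j
    fin_cases i <;> fin_cases j
    · exact hk.1.1 0 0
    · change ‖unif F * k 0 1‖ ≤ 1
      rw [norm_mul]
      exact mul_le_one₀ norm_unif_lt_one.le (norm_nonneg _) (hk.1.1 _ _)
    · change ‖(unif F)⁻¹ * k 1 0‖ ≤ 1
      rw [norm_mul, norm_inv, inv_mul_le_iff₀ norm_unif_pos, mul_one]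
      exact hk.2
    · exact hk.1.1 1 1
  · have h4 := hk.1.2
    rw [Matrix.det_fin_two] at h4
    change ‖Matrix.det !![k 0 0, unif F * k 0 1; (unif F)⁻¹ * k 1 0, k 1 1]‖ = 1
    rw [Matrix.det_fin_two_of, ← h4]
    congr 1
    have := unif_ne_zero (F := F)
    field_simp

theorem edge_act_scalarGL (z : (Kinf F)ˣ) (e : Edge F) : e.act (scalarGL z) = e :=
  Edge.ext (act_scalarGL z _) (act_scalarGL z _)

/-- The matrix `(0, π⁻¹; 1, 0)`, which reverses the edge `downEdge 0 0`. -/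
def flipGL : GL (Fin 2) (Kinf F) := latMat 0 (-1) 0 * swapGL

theorem downEdge_act_flipGL : (downEdge (0 : Kinf F) 0).act flipGL = upEdge 0 0 := by
  rw [flipGL, Edge.act_mul, downEdge_act_swapGL]
  refine Edge.ext ((ballVertex_act_latMat 0 (-1) (1 - 0)).trans (by simp [upEdge]))
    ((ballVertex_act_latMat 0 (-1) (1 - 0 - 1)).trans (by simp [upEdge]))

end MatrixAction

/-! ### Harmonicity as additivity on balls -/

section Harmonic
variable {F : Type*} [Field F] [Fintype F]

theorem edges_into_ballVertex (b : Kinf F) (l : ℤ) : {e : Edge F | e.tgt = ballVertex b l} =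
    insert (downEdge b l) (Set.range fun ε : F => upEdge (subCenter b l ε) (l + 1)) := by
  ext e
  simp only [Set.mem_ofPred_eq, Set.mem_insert_iff, Set.mem_range]
  constructor
  · intro he
    obtain ⟨b', l', rfl | rfl⟩ := e.eq_downEdge_or_upEdge
    · obtain ⟨rfl, h⟩ := ballVertex_eq_iff.mp (show ballVertex b' l' = ballVertex b l from he)
      exact Or.inl (downEdge_congr h)
    · obtain ⟨h0, h⟩ := ballVertex_eq_iff.mp (show ballVertex b' (l' - 1) = ballVertex b l from he)
      obtain rfl : l' = l + 1 := by omega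
      rw [add_sub_cancel_right] at h
      obtain ⟨ε, hε⟩ := exists_norm_sub_subCenter_le h
      exact Or.inr ⟨ε, (upEdge_congr hε).symm⟩
  · rintro (rfl | ⟨ε, rfl⟩)
    · rfl
    · change ballVertex _ (l + 1 - 1) = _
      rw [add_sub_cancel_right]
      exact ballVertex_congr (norm_subCenter_sub_le b l ε)

theorem upEdge_subCenter_injective (b : Kinf F) (l : ℤ) :
    Function.Injective fun ε : F => upEdge (subCenter b l ε) (l + 1) := by
  intro ε ε' h
  have h1 := (ballVertex_eq_iff.mp (congrArg Edge.src h)).2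
  by_contra hne
  rw [norm_subCenter_sub_subCenter b l hne, zpow_unif_le] at h1
  omega

/-- The edges into a ball come from the next larger ball and from its `q` maximal sub-balls;
reversing the latter gives the minus sign. A zero sum is thus additivity under splitting. -/
theorem sum_edges_into_ballVertex {M : Type*} [AddCommGroup M] (c : Edge F → M) (b : Kinf F) (l : ℤ)
    (hc : ∀ e e' : Edge F, e'.src = e.tgt → e'.tgt = e.src → c e + c e' = 0) :
    ∑ e ∈ (finite_edges_into (ballVertex b l)).toFinset, c e =
      c (downEdge b l) - ∑ ε : F, c (downEdge (subCenter b l ε) (l + 1)) := by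
  classical
  have h1 : (finite_edges_into (ballVertex b l)).toFinset =
      insert (downEdge b l) (Finset.univ.image fun ε : F => upEdge (subCenter b l ε) (l + 1)) := by
    rw [← Finset.coe_inj, Set.Finite.coe_toFinset, edges_into_ballVertex]
    simp
  have h2 : downEdge b l ∉ Finset.univ.image fun ε : F => upEdge (subCenter b l ε) (l + 1) := by
    simp only [Finset.mem_image, not_exists, not_and]
    intro ε _ h
    have := (ballVertex_eq_iff.mp (congrArg Edge.src h)).1
    omega
  rw [h1, Finset.sum_insert h2, Finset.sum_image ((upEdge_subCenter_injective b l).injOn),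
    sub_eq_add_neg, ← Finset.sum_neg_distrib]
  congr 1
  refine Finset.sum_congr rfl fun ε _ => ?_
  exact eq_neg_of_add_eq_zero_left (hc _ _ rfl rfl)

end Harmonic

/-! ### Divided differences on finite sets and Newton interpolation -/

section DividedDifferences
variable {F : Type*} [Field F] [Fintype F]
open scoped Classical

/-- The embedding `k_∞ → C_∞`. -/
abbrev toC : Kinf F →+* Cinf F := algebraMap (Kinf F) (Cinf F)

theorem norm_toC (x : Kinf F) : ‖toC x‖ = ‖x‖ := norm_algebraMap_Cinf F x

theorem toC_injective : Function.Injective (toC : Kinf F → Cinf F) := RingHom.injective _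

/-- The divided difference of `f` at the points of `S`. -/
def divDiff (f : Kinf F → Cinf F) (S : Finset (Kinf F)) : Cinf F :=
  ∑ s ∈ S, f s * ∏ t ∈ S.erase s, (toC (s - t))⁻¹

theorem divDiff_congr {f g : Kinf F → Cinf F} {S : Finset (Kinf F)} (h : ∀ s ∈ S, f s = g s) :
    divDiff f S = divDiff g S :=
  Finset.sum_congr rfl fun s hs => by rw [h s hs]

theorem divDiff_add (f g : Kinf F → Cinf F) (S : Finset (Kinf F)) :
    divDiff (fun x => f x + g x) S = divDiff f S + divDiff g S := by
  simp only [divDiff, add_mul, Finset.sum_add_distrib]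

theorem divDiff_const_mul (a : Cinf F) (f : Kinf F → Cinf F) (S : Finset (Kinf F)) :
    divDiff (fun x => a * f x) S = a * divDiff f S := by
  simp only [divDiff, mul_assoc, Finset.mul_sum]

theorem divDiff_sub (f g : Kinf F → Cinf F) (S : Finset (Kinf F)) :
    divDiff (fun x => f x - g x) S = divDiff f S - divDiff g S := by
  simp only [divDiff, sub_mul, Finset.sum_sub_distrib]

theorem divDiff_zero (S : Finset (Kinf F)) : divDiff (fun _ => 0) S = 0 := by
  simp [divDiff]

theorem divDiff_singleton (f : Kinf F → Cinf F) (x : Kinf F) : divDiff f {x} = f x := by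
  simp [divDiff]

theorem divDiff_mul_sub (f : Kinf F → Cinf F) {S : Finset (Kinf F)} {u : Kinf F} (hu : u ∈ S) :
    divDiff (fun x => toC (x - u) * f x) S = divDiff f (S.erase u) := by
  rw [divDiff, ← Finset.add_sum_erase _ _ hu, sub_self, map_zero, zero_mul, zero_mul, zero_add,
    divDiff]
  refine Finset.sum_congr rfl fun s hs => ?_
  obtain ⟨hsu, hs⟩ := Finset.mem_erase.mp hs
  have hne : toC (s - u) ≠ 0 := by
    rw [Ne, map_eq_zero]
    exact sub_ne_zero.mpr hsu
  rw [Finset.erase_right_comm, ← Finset.mul_prod_erase (S.erase s) (fun t => (toC (s - t))⁻¹)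
    (Finset.mem_erase.mpr ⟨Ne.symm hsu, hu⟩)]
  field_simp

/-- Deleting the point `u` amounts to multiplying `f` by `x - u` (`divDiff_mul_sub`), and `(x - u')
- (x - u)` is the constant `u - u'`. -/
theorem divDiff_erase_sub (f : Kinf F → Cinf F) {S : Finset (Kinf F)} {u u' : Kinf F} (hu : u ∈ S)
    (hu' : u' ∈ S) : divDiff f (S.erase u') - divDiff f (S.erase u) = toC (u - u') * divDiff f S := by
  rw [← divDiff_mul_sub f hu, ← divDiff_mul_sub f hu', ← divDiff_sub, ← divDiff_const_mul]
  refine divDiff_congr fun s _ => ?_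
  simp only [map_sub]
  ring

theorem norm_divDiff_erase_sub (f : Kinf F → Cinf F) {S : Finset (Kinf F)} {u u' : Kinf F}
    (hu : u ∈ S) (hu' : u' ∈ S) :
    ‖divDiff f (S.erase u') - divDiff f (S.erase u)‖ = ‖u - u'‖ * ‖divDiff f S‖ := by
  rw [divDiff_erase_sub f hu hu', norm_mul, norm_toC]

theorem divDiff_sub_mul (f : Kinf F → Cinf F) (b : Kinf F) {S : Finset (Kinf F)} {s : Kinf F}
    (hs : s ∈ S) : divDiff (fun x => toC (x - b) * f x) S =
      toC (s - b) * divDiff f S + divDiff f (S.erase s) := by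
  rw [← divDiff_mul_sub f hs, ← divDiff_const_mul, ← divDiff_add]
  refine divDiff_congr fun s _ => ?_
  simp only [map_sub]
  ring

theorem image_removeNth {n : ℕ} {x : Fin (n + 1) → Kinf F} (hx : Function.Injective x)
    (i : Fin (n + 1)) :
    Finset.univ.image (i.removeNth x) = (Finset.univ.image x).erase (x i) := by
  ext y
  simp only [Finset.mem_image, Finset.mem_univ, true_and, Finset.mem_erase, Fin.removeNth]
  constructor
  · rintro ⟨j, rfl⟩
    exact ⟨fun h => Fin.succAbove_ne i j (hx h), _, rfl⟩
  · rintro ⟨hne, j, rfl⟩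
    obtain ⟨k, rfl⟩ := Fin.exists_succAbove_eq (x := j) (y := i) (fun h => hne (by rw [h]))
    exact ⟨k, rfl⟩

/-- Passes from tuples to sets, for which independence of the order of the points is automatic. -/
theorem diffQuot_eq_divDiff (f : Kinf F → Cinf F) {n : ℕ} {x : Fin (n + 1) → Kinf F}
    (hx : Function.Injective x) : diffQuot f n x = divDiff f (Finset.univ.image x) := by
  induction n with
  | zero =>
    rw [show Finset.univ.image x = {x 0} by
      ext y; simp, divDiff_singleton]
    rfl
  | succ n ih =>
    rw [diffQuot, ih (x := Fin.removeNth 1 x) (hx.comp Fin.succAbove_right_injective),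
      ih (x := Fin.removeNth 0 x) (hx.comp Fin.succAbove_right_injective), image_removeNth hx, image_removeNth hx,
      divDiff_erase_sub f (Finset.mem_image_of_mem x (Finset.mem_univ 0))
        (Finset.mem_image_of_mem x (Finset.mem_univ 1))]
    refine mul_div_cancel_left₀ _ ?_
    rw [Ne, map_eq_zero]
    exact sub_ne_zero.mpr (hx.ne (by simp))

/-- The interpolation polynomial of `f` with nodes `S`. -/
def interp (f : Kinf F → Cinf F) (S : Finset (Kinf F)) : Polynomial (Cinf F) :=
  Lagrange.interpolate S toC f

/-- The monic polynomial with roots `S`. -/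
def nodalPoly (S : Finset (Kinf F)) : Polynomial (Cinf F) := Lagrange.nodal S toC

theorem eval_interp (f : Kinf F → Cinf F) {S : Finset (Kinf F)} {s : Kinf F} (hs : s ∈ S) :
    (interp f S).eval (toC s) = f s :=
  Lagrange.eval_interpolate_at_node _ toC_injective.injOn hs

theorem degree_interp_lt (f : Kinf F → Cinf F) (S : Finset (Kinf F)) :
    (interp f S).degree < S.card := Lagrange.degree_interpolate_lt _ toC_injective.injOn

theorem interp_eval (p : Polynomial (Cinf F)) {S : Finset (Kinf F)} (hp : p.degree < S.card) :
    interp (fun x => p.eval (toC x)) S = p :=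
  (Lagrange.eq_interpolate toC_injective.injOn hp).symm

theorem divDiff_eq_coeff (f : Kinf F → Cinf F) (S : Finset (Kinf F)) :
    divDiff f S = (interp f S).coeff (S.card - 1) := by
  rw [interp, Lagrange.interpolate_apply, Polynomial.finsetSum_coeff, divDiff]
  refine Finset.sum_congr rfl fun s hs => ?_
  rw [Polynomial.coeff_C_mul, ← Lagrange.natDegree_basis toC_injective.injOn hs,
    Polynomial.coeff_natDegree, Lagrange.leadingCoeff_basis toC_injective.injOn hs]
  simp [Finset.prod_inv_distrib]

/-- Newton's formula. The two sides agree on `R` and have the same coefficient in degree `R.card`,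
so their difference has more zeros than its degree allows. -/
theorem interp_insert (f : Kinf F → Cinf F) {R : Finset (Kinf F)} {u : Kinf F} (hu : u ∉ R) :
    interp f (insert u R) =
      interp f R + Polynomial.C (divDiff f (insert u R)) * nodalPoly R := by
  rw [← sub_eq_zero]
  have hcard : (insert u R).card = R.card + 1 := Finset.card_insert_of_notMem hu
  refine Polynomial.eq_zero_of_degree_lt_of_eval_index_eq_zero (v := toC) (s := R)
    toC_injective.injOn ?_ ?_
  · rw [Polynomial.degree_lt_iff_coeff_zero]
    intro m hm
    have h2 : (interp f R).coeff m = 0 := Polynomial.coeff_eq_zero_of_degree_lt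
      ((degree_interp_lt f R).trans_le (by exact_mod_cast hm))
    rw [Polynomial.coeff_sub, Polynomial.coeff_add, h2, Polynomial.coeff_C_mul, zero_add]
    rcases hm.eq_or_lt with rfl | hlt
    · have h3 : (nodalPoly R).coeff R.card = 1 := by
        have := Lagrange.nodal_monic (s := R) (v := (toC : Kinf F → Cinf F))
        rwa [Polynomial.Monic, Polynomial.leadingCoeff, Lagrange.natDegree_nodal] at this
      rw [h3, mul_one, divDiff_eq_coeff, hcard, Nat.add_sub_cancel,
        sub_self]
    · have h3 : (nodalPoly R).coeff m = 0 := Polynomial.coeff_eq_zero_of_degree_lt (by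
        rw [nodalPoly, Lagrange.degree_nodal]
        exact_mod_cast hlt)
      rw [h3, mul_zero, sub_zero]
      refine Polynomial.coeff_eq_zero_of_degree_lt ((degree_interp_lt f _).trans_le ?_)
      rw [hcard]
      exact_mod_cast hlt
  · intro s hs
    rw [Polynomial.eval_sub, Polynomial.eval_add, Polynomial.eval_mul,
      eval_interp f (Finset.mem_insert_of_mem hs), eval_interp f hs, nodalPoly,
      Lagrange.eval_nodal_at_node hs]
    simp

theorem divDiff_eval_eq_zero (p : Polynomial (Cinf F)) {S : Finset (Kinf F)}
    (hp : p.natDegree + 1 < S.card) : divDiff (fun x => p.eval (toC x)) S = 0 := by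
  rw [divDiff_eq_coeff, interp_eval]
  · exact Polynomial.coeff_eq_zero_of_natDegree_lt (by omega)
  · exact Polynomial.degree_le_natDegree.trans_lt (by exact_mod_cast (by omega : p.natDegree < S.card))

/-- Comparison of two sets of the same size by exchanging one element at a time. -/
theorem norm_sub_le_of_exchange {E : Type*} [SeminormedAddCommGroup E] [IsUltrametricDist E]
    (φ : Finset (Kinf F) → E) {B : Set (Kinf F)} {k : ℕ} {M : ℝ} (hM : 0 ≤ M)
    (h : ∀ T : Finset (Kinf F), (T : Set (Kinf F)) ⊆ B → T.card = k + 1 → ∀ u ∈ T, ∀ u' ∈ T, u ≠ u' →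
      ‖φ (T.erase u) - φ (T.erase u')‖ ≤ M) {S S' : Finset (Kinf F)}
    (hS : (S : Set (Kinf F)) ⊆ B) (hS' : (S' : Set (Kinf F)) ⊆ B) (hk : S.card = k)
    (hk' : S'.card = k) : ‖φ S - φ S'‖ ≤ M := by
  obtain ⟨m, hm⟩ : ∃ m, (S \ S').card = m := ⟨_, rfl⟩
  induction m generalizing S with
  | zero =>
    have h1 : S ⊆ S' := Finset.sdiff_eq_empty_iff_subset.mp (Finset.card_eq_zero.mp hm)
    rw [Finset.eq_of_subset_of_card_le h1 (by omega), sub_self, norm_zero]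
    exact hM
  | succ m ih =>
    obtain ⟨u, hu⟩ : (S \ S').Nonempty := Finset.card_pos.mp (by omega)
    have hcard : (S' \ S).card = m + 1 := by
      have h1 := Finset.card_sdiff_add_card_inter S S'
      have h2 := Finset.card_sdiff_add_card_inter S' S
      rw [Finset.inter_comm] at h2
      omega
    obtain ⟨u', hu'⟩ : (S' \ S).Nonempty := Finset.card_pos.mp (by omega)
    rw [Finset.mem_sdiff] at hu hu'
    have hne : u' ≠ u := fun h => hu.2 (h ▸ hu'.1)
    have hT : ((insert u' S : Finset (Kinf F)) : Set (Kinf F)) ⊆ B := by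
      rw [Finset.coe_insert]
      exact Set.insert_subset (hS' hu'.1) hS
    have hS1 : (insert u' S).erase u' = S := Finset.erase_insert hu'.2
    have h1 := h (insert u' S) hT (by rw [Finset.card_insert_of_notMem hu'.2, hk]) u'
      (Finset.mem_insert_self _ _) u (Finset.mem_insert_of_mem hu.1) hne
    rw [hS1] at h1
    have h2 := ih (S := (insert u' S).erase u)
      ((Finset.coe_subset.mpr (Finset.erase_subset _ _)).trans hT) (by
        rw [Finset.card_erase_of_mem (Finset.mem_insert_of_mem hu.1),
          Finset.card_insert_of_notMem hu'.2, hk, Nat.add_sub_cancel]) (by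
        have : (insert u' S).erase u \ S' = (S \ S').erase u := by
          ext y
          simp only [Finset.mem_sdiff, Finset.mem_erase, Finset.mem_insert]
          constructor
          · rintro ⟨⟨h1, rfl | h2⟩, h3⟩
            · exact absurd hu'.1 h3
            · exact ⟨h1, h2, h3⟩
          · rintro ⟨h1, h2, h3⟩
            exact ⟨⟨h1, Or.inr h2⟩, h3⟩
        rw [this, Finset.card_erase_of_mem (Finset.mem_sdiff.mpr hu), hm, Nat.add_sub_cancel])
    rw [← sub_add_sub_cancel (φ S) (φ ((insert u' S).erase u))]
    exact (IsUltrametricDist.norm_add_le_max _ _).trans (max_le h1 h2)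

/-- All divided differences of `f` on at most `k` points of `B` are bounded by `M`. -/
def DivDiffBound (B : Set (Kinf F)) (k : ℕ) (f : Kinf F → Cinf F) (M : ℝ) : Prop :=
  ∀ S : Finset (Kinf F), (S : Set (Kinf F)) ⊆ B → S.Nonempty → S.card ≤ k → ‖divDiff f S‖ ≤ M

theorem DivDiffBound.mono {B B' : Set (Kinf F)} {k k' : ℕ} {f : Kinf F → Cinf F} {M M' : ℝ}
    (h : DivDiffBound B k f M) (hB : B' ⊆ B) (hk : k' ≤ k) (hM : M ≤ M') :
    DivDiffBound B' k' f M' :=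
  fun S hS hne hc => (h S (hS.trans hB) hne (hc.trans hk)).trans hM

theorem DivDiffBound.congr {B : Set (Kinf F)} {k : ℕ} {f g : Kinf F → Cinf F} {M : ℝ}
    (h : DivDiffBound B k f M) (hfg : ∀ x ∈ B, f x = g x) : DivDiffBound B k g M :=
  fun S hS hne hc => by
    rw [← divDiff_congr fun s hs => hfg s (hS hs)]
    exact h S hS hne hc

theorem DivDiffBound.add {B : Set (Kinf F)} {k : ℕ} {f g : Kinf F → Cinf F} {M N : ℝ}
    (hf : DivDiffBound B k f M) (hg : DivDiffBound B k g N) :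
    DivDiffBound B k (fun x => f x + g x) (max M N) := fun S hS hne hc => by
  rw [divDiff_add]
  exact (IsUltrametricDist.norm_add_le_max _ _).trans (max_le_max (hf S hS hne hc) (hg S hS hne hc))

theorem DivDiffBound.const_mul {B : Set (Kinf F)} {k : ℕ} {f : Kinf F → Cinf F} {M : ℝ} (a : Cinf F)
    (hf : DivDiffBound B k f M) : DivDiffBound B k (fun x => a * f x) (‖a‖ * M) :=
  fun S hS hne hc => by
    rw [divDiff_const_mul, norm_mul]
    exact mul_le_mul_of_nonneg_left (hf S hS hne hc) (norm_nonneg a)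

theorem divDiffBound_zero (B : Set (Kinf F)) (k : ℕ) : DivDiffBound B k (fun _ => 0) 0 :=
  fun S _ _ _ => by rw [divDiff_zero, norm_zero]

theorem DivDiffBound.sub_mul {B : Set (Kinf F)} {k : ℕ} {f : Kinf F → Cinf F} {M R : ℝ} (b : Kinf F)
    (hf : DivDiffBound B k f M) (hM : 0 ≤ M) (hR : ∀ x ∈ B, ‖x - b‖ ≤ R) :
    DivDiffBound B k (fun x => toC (x - b) * f x) (max R 1 * M) := fun S hS hne hc => by
  obtain ⟨s, hs⟩ := hne
  rw [divDiff_sub_mul f b hs]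
  refine (IsUltrametricDist.norm_add_le_max _ _).trans (max_le ?_ ?_)
  · rw [norm_mul, norm_toC]
    exact mul_le_mul ((hR s (hS hs)).trans (le_max_left _ _)) (hf S hS ⟨s, hs⟩ hc) (norm_nonneg _)
      (zero_le_one.trans (le_max_right _ _))
  · refine le_trans ?_ (le_mul_of_one_le_left hM (le_max_right _ _))
    rcases (S.erase s).eq_empty_or_nonempty with h | h
    · rw [h]
      simpa [divDiff] using hM
    · exact hf _ ((Finset.coe_subset.mpr (Finset.erase_subset _ _)).trans hS) h
        ((Finset.card_le_card (Finset.erase_subset _ _)).trans hc)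

/-- The Leibniz rule for `f = x g` is solved for the divided difference of `g` on `S`; what remains
is `g` on one point fewer. Each point costs a factor `R`. -/
theorem DivDiffBound.div {B : Set (Kinf F)} {k : ℕ} {f g : Kinf F → Cinf F} {M R : ℝ}
    (hf : DivDiffBound B k f M) (hM : 0 ≤ M) (hR : ∀ x ∈ B, ‖x‖⁻¹ ≤ R) (hR1 : 1 ≤ R)
    (h0 : (0 : Kinf F) ∉ B) (hfg : ∀ x ∈ B, f x = toC x * g x) :
    DivDiffBound B k g (R ^ k * M) := by
  have key : ∀ (m : ℕ) (S : Finset (Kinf F)), (S : Set (Kinf F)) ⊆ B → S.card = m → m ≤ k →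
      ‖divDiff g S‖ ≤ R ^ m * M := by
    intro m
    induction m with
    | zero =>
      intro S _ hc _
      rw [Finset.card_eq_zero.mp hc]
      simpa [divDiff] using hM
    | succ m ih =>
      intro S hS hc hm
      obtain ⟨s, hs⟩ : S.Nonempty := Finset.card_pos.mp (by omega)
      have h1 : divDiff f S = toC s * divDiff g S + divDiff g (S.erase s) := by
        have := divDiff_sub_mul g 0 hs
        rw [sub_zero] at this
        rw [← this]
        exact divDiff_congr fun x hx => by rw [sub_zero, hfg x (hS hx)]
      have hs0 : toC s ≠ 0 := by
        rw [Ne, map_eq_zero]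
        rintro rfl
        exact h0 (hS hs)
      have h2 : divDiff g S = (toC s)⁻¹ * (divDiff f S - divDiff g (S.erase s)) := by
        rw [h1, add_sub_cancel_right, inv_mul_cancel_left₀ hs0]
      have h3 := ih (S.erase s) ((Finset.coe_subset.mpr (Finset.erase_subset _ _)).trans hS)
        (by rw [Finset.card_erase_of_mem hs, hc, Nat.add_sub_cancel]) (by omega)
      have h4 : M ≤ R ^ m * M := le_mul_of_one_le_left hM (one_le_pow₀ hR1)
      rw [h2, norm_mul, norm_inv, norm_toC, pow_succ', mul_assoc]
      refine mul_le_mul (hR s (hS hs)) ?_ (norm_nonneg _) (zero_le_one.trans hR1)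
      rw [sub_eq_add_neg]
      refine (IsUltrametricDist.norm_add_le_max _ _).trans (max_le ?_ (by rwa [norm_neg]))
      exact (hf S hS ⟨s, hs⟩ (by omega)).trans h4
  intro S hS _ hc
  exact (key _ S hS rfl hc).trans
    (mul_le_mul_of_nonneg_right (pow_le_pow_right₀ hR1 hc) hM)

/-- If `S` meets both pieces, choose `u`, `u'` in different pieces: by `divDiff_erase_sub` the
divided difference is a difference of two on smaller sets, divided by `u - u'`, which is bounded
away from zero. -/
theorem DivDiffBound.glue {B P : Set (Kinf F)} {k : ℕ} {f : Kinf F → Cinf F} {M R : ℝ}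
    (h1 : DivDiffBound (B ∩ P) k f M) (h2 : DivDiffBound (B \ P) k f M) (hM : 0 ≤ M) (hR1 : 1 ≤ R)
    (hR : ∀ x ∈ B ∩ P, ∀ y ∈ B \ P, ‖x - y‖⁻¹ ≤ R) : DivDiffBound B k f (R ^ k * M) := by
  have key : ∀ (m : ℕ) (S : Finset (Kinf F)), (S : Set (Kinf F)) ⊆ B → S.card = m → m ≤ k →
      ‖divDiff f S‖ ≤ R ^ m * M := by
    intro m
    induction m with
    | zero =>
      intro S _ hc _
      rw [Finset.card_eq_zero.mp hc]
      simpa [divDiff] using hM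
    | succ m ih =>
      intro S hS hc hm
      have hne : S.Nonempty := Finset.card_pos.mp (by omega)
      have h4 : M ≤ R ^ (m + 1) * M := le_mul_of_one_le_left hM (one_le_pow₀ hR1)
      by_cases hP : (S : Set (Kinf F)) ⊆ P
      · exact (h1 S (Set.subset_inter hS hP) hne (by omega)).trans h4
      by_cases hP' : ∀ s ∈ S, s ∉ P
      · exact (h2 S (fun s hs => ⟨hS hs, hP' s hs⟩) hne (by omega)).trans h4
      push Not at hP'
      obtain ⟨u, hu, huP⟩ := hP'
      obtain ⟨u', hu', huP'⟩ := Set.not_subset.mp hP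
      have h5 := hR u ⟨hS hu, huP⟩ u' ⟨hS hu', huP'⟩
      have hne : u - u' ≠ 0 := sub_ne_zero.mpr fun h => huP' (h ▸ huP)
      have h6 : ∀ s ∈ S, ‖divDiff f (S.erase s)‖ ≤ R ^ m * M := fun s hs =>
        ih (S.erase s) ((Finset.coe_subset.mpr (Finset.erase_subset _ _)).trans hS)
          (by rw [Finset.card_erase_of_mem hs, hc, Nat.add_sub_cancel]) (by omega)
      have h7 : divDiff f S = (toC (u - u'))⁻¹ *
          (divDiff f (S.erase u') - divDiff f (S.erase u)) := by
        rw [divDiff_erase_sub f hu hu', inv_mul_cancel_left₀]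
        rwa [Ne, map_eq_zero]
      rw [h7, norm_mul, norm_inv, norm_toC, pow_succ', mul_assoc]
      refine mul_le_mul h5 ?_ (norm_nonneg _) (zero_le_one.trans hR1)
      rw [sub_eq_add_neg]
      refine (IsUltrametricDist.norm_add_le_max _ _).trans (max_le (h6 u' hu') ?_)
      rw [norm_neg]
      exact h6 u hu
  intro S hS _ hc
  exact (key _ S hS rfl hc).trans
    (mul_le_mul_of_nonneg_right (pow_le_pow_right₀ hR1 hc) hM)

/-- For every `k` the divided differences of `f` on at most `k` points of `B` are bounded. -/
def DivDiffBounded (B : Set (Kinf F)) (f : Kinf F → Cinf F) : Prop :=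
  ∀ k, ∃ M, 0 ≤ M ∧ DivDiffBound B k f M

theorem norm_divDiff_one_le {S : Finset (Kinf F)} (hS : 2 ≤ S.card) :
    divDiff (fun _ => (1 : Cinf F)) S = 0 := by
  have := divDiff_eval_eq_zero (1 : Polynomial (Cinf F)) (S := S) (by simpa using (show 1 < S.card from hS))
  simpa using this

/-- By the Leibniz rule each factor `x - b` either contributes `r` or removes a point. The factor `r
^ m` on the left avoids negative exponents and the case `r = 0`. -/
theorem norm_divDiff_pow_mul_le {b : Kinf F} {r : ℝ} (i m : ℕ) {S : Finset (Kinf F)} (hr : 0 ≤ r)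
    (hS : ∀ s ∈ S, ‖s - b‖ ≤ r) (hc : S.card = m + 1) :
    ‖divDiff (fun x => toC (x - b) ^ i) S‖ * r ^ m ≤ r ^ i := by
  induction i generalizing S m with
  | zero =>
    simp only [pow_zero]
    rcases m with _ | m
    · obtain ⟨s, rfl⟩ := Finset.card_eq_one.mp hc
      simp [divDiff_singleton]
    · rw [norm_divDiff_one_le (by omega), norm_zero, zero_mul]
      exact zero_le_one
  | succ i ih =>
    obtain ⟨s, hs⟩ : S.Nonempty := Finset.card_pos.mp (by omega)
    have h1 := divDiff_sub_mul (fun x => toC (x - b) ^ i) b hs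
    simp only [← pow_succ'] at h1
    have h2 : ‖toC (s - b) * divDiff (fun x => toC (x - b) ^ i) S‖ * r ^ m ≤ r ^ (i + 1) := by
      rw [norm_mul, norm_toC, mul_assoc, pow_succ']
      exact mul_le_mul (hS s hs) (ih m hS hc)
        (mul_nonneg (norm_nonneg _) (pow_nonneg hr _)) hr
    have h3 : ‖divDiff (fun x => toC (x - b) ^ i) (S.erase s)‖ * r ^ m ≤ r ^ (i + 1) := by
      rcases m with _ | m
      · obtain ⟨s', rfl⟩ := Finset.card_eq_one.mp hc
        obtain rfl := Finset.mem_singleton.mp hs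
        simp [divDiff, pow_nonneg hr]
      · have := ih m (S := S.erase s) (fun x hx => hS x (Finset.mem_of_mem_erase hx))
          (by rw [Finset.card_erase_of_mem hs, hc, Nat.add_sub_cancel])
        rw [pow_succ, ← mul_assoc, pow_succ]
        exact mul_le_mul_of_nonneg_right this hr
    rw [h1]
    calc _ ≤ max ‖toC (s - b) * divDiff (fun x => toC (x - b) ^ i) S‖
            ‖divDiff (fun x => toC (x - b) ^ i) (S.erase s)‖ * r ^ m :=
          mul_le_mul_of_nonneg_right (IsUltrametricDist.norm_add_le_max _ _) (pow_nonneg hr _)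
      _ ≤ r ^ (i + 1) := by
          rw [max_mul_of_nonneg _ _ (pow_nonneg hr _)]
          exact max_le h2 h3

end DividedDifferences

/-! ### `C^h` functions in terms of divided differences -/

section SmoothFunctions
variable {F : Type*} [Field F] [Fintype F]
open scoped Classical

theorem exists_enum {S : Finset (Kinf F)} {k : ℕ} (hk : S.card = k) :
    ∃ x : Fin k → Kinf F, Function.Injective x ∧ Finset.univ.image x = S := by
  refine ⟨fun i => ((S.equivFinOfCardEq hk).symm i : Kinf F),
    Subtype.val_injective.comp (Equiv.injective _), ?_⟩
  ext y
  simp only [Finset.mem_image, Finset.mem_univ, true_and]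
  constructor
  · rintro ⟨i, rfl⟩
    exact Subtype.property _
  · intro hy
    exact ⟨S.equivFinOfCardEq hk ⟨y, hy⟩, by simp⟩

theorem exists_enum_subtype {B : Set (Kinf F)} {S : Finset (Kinf F)} {k : ℕ}
    (hS : (S : Set (Kinf F)) ⊆ B) (hk : S.card = k) :
    ∃ x : Fin k → B, Function.Injective x ∧ Finset.univ.image (fun i => (x i : Kinf F)) = S := by
  obtain ⟨x, hx, rfl⟩ := exists_enum hk
  exact ⟨fun i => ⟨x i, hS (Finset.mem_image_of_mem _ (Finset.mem_univ i))⟩,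
    fun i j hij => hx (congrArg Subtype.val hij), rfl⟩

theorem cnNormOn_le {h : ℕ} {B : Set (Kinf F)} {f : Kinf F → Cinf F} {M : ℝ} (hM : 0 ≤ M)
    (hf : DivDiffBound B (h + 1) f M) : cnNormOn h B f ≤ M := by
  refine Real.iSup_le (fun p => ?_) hM
  have hinj : Function.Injective fun i => (p.2 i : Kinf F) :=
    Subtype.val_injective.comp p.2.injective
  rw [diffQuot_eq_divDiff f hinj]
  refine hf _ ?_ ?_ ?_
  · simp only [Finset.coe_image, Finset.coe_univ, Set.image_univ]
    rintro _ ⟨i, rfl⟩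
    exact (p.2 i).2
  · exact ⟨_, Finset.mem_image_of_mem _ (Finset.mem_univ 0)⟩
  · rw [Finset.card_image_of_injective _ hinj, Finset.card_fin]
    have := p.1.2
    omega

theorem DivDiffBound.cnNormOn {h : ℕ} {B : Set (Kinf F)} {f : Kinf F → Cinf F} {M : ℝ}
    (hf : DivDiffBound B (h + 1) f M) : DivDiffBound B (h + 1) f (cnNormOn h B f) := by
  intro S hS hne hc
  have hbdd : BddAbove (Set.range fun p : (j : Fin (h + 1)) × (Fin (j + 1) ↪ B) =>
      ‖diffQuot f p.1 (fun i => (p.2 i : Kinf F))‖) := by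
    refine ⟨M, ?_⟩
    rintro _ ⟨p, rfl⟩
    have hinj : Function.Injective fun i => (p.2 i : Kinf F) :=
      Subtype.val_injective.comp p.2.injective
    simp only
    rw [diffQuot_eq_divDiff f hinj]
    refine hf _ ?_ ?_ ?_
    · simp only [Finset.coe_image, Finset.coe_univ, Set.image_univ]
      rintro _ ⟨i, rfl⟩
      exact (p.2 i).2
    · exact ⟨_, Finset.mem_image_of_mem _ (Finset.mem_univ 0)⟩
    · rw [Finset.card_image_of_injective _ hinj, Finset.card_fin]
      have := p.1.2
      omega
  have hcard := hne.card_pos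
  obtain ⟨x, hx, hxS⟩ := exists_enum_subtype hS (show S.card = S.card - 1 + 1 by omega)
  have := le_ciSup hbdd ⟨⟨S.card - 1, by omega⟩, ⟨x, hx⟩⟩
  simp only [Function.Embedding.coeFn_mk] at this
  rwa [diffQuot_eq_divDiff f (x := fun i => (x i : Kinf F)) (Subtype.val_injective.comp hx), hxS] at this

/-- The top order divided differences of `f` become nearly constant on small sets. -/
def DivDiffSmall (h : ℕ) (B : Set (Kinf F)) (f : Kinf F → Cinf F) : Prop :=
  ∀ ε > 0, ∃ δ > 0, ∀ T : Finset (Kinf F), (T : Set (Kinf F)) ⊆ B → T.card = h + 2 →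
    (∀ x ∈ T, ∀ y ∈ T, ‖x - y‖ ≤ δ) → ∀ u ∈ T, ∀ u' ∈ T, ‖u - u'‖ * ‖divDiff f T‖ ≤ ε

/-- The consequences of being `C^h` on a compact set which are used for integration. -/
structure IsTame (h : ℕ) (B : Set (Kinf F)) (f : Kinf F → Cinf F) : Prop where
  bound : ∃ M, 0 ≤ M ∧ DivDiffBound B (h + 1) f M
  small : DivDiffSmall h B f

theorem IsTame.mono {h : ℕ} {B B' : Set (Kinf F)} {f : Kinf F → Cinf F} (hf : IsTame h B f)
    (hB : B' ⊆ B) : IsTame h B' f where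
  bound := by
    obtain ⟨M, hM, hf⟩ := hf.bound
    exact ⟨M, hM, hf.mono hB le_rfl le_rfl⟩
  small ε hε := by
    obtain ⟨δ, hδ, h'⟩ := hf.small ε hε
    exact ⟨δ, hδ, fun T hT => h' T (hT.trans hB)⟩

theorem DivDiffBounded.isTame {B : Set (Kinf F)} {f : Kinf F → Cinf F} (hf : DivDiffBounded B f)
    (h : ℕ) : IsTame h B f where
  bound := hf (h + 1)
  small ε hε := by
    obtain ⟨M, hM, hf⟩ := hf (h + 2)
    refine ⟨ε / (M + 1), by positivity, fun T hT hc hδ u hu u' hu' => ?_⟩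
    refine (mul_le_mul (hδ u hu u' hu') (hf T hT ⟨u, hu⟩ hc.le) (norm_nonneg _)
      (by positivity)).trans ?_
    rw [div_mul_eq_mul_div, div_le_iff₀ (by positivity)]
    nlinarith

theorem IsTame.mul_toC {h : ℕ} {B : Set (Kinf F)} {f : Kinf F → Cinf F} (hf : IsTame h B f)
    {R : ℝ} (hR : ∀ x ∈ B, ‖x‖ ≤ R) : IsTame h B (fun x => toC x * f x) := by
  obtain ⟨M, hM, hb⟩ := hf.bound
  refine ⟨⟨max R 1 * M, by positivity, ?_⟩, fun ε hε => ?_⟩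
  · simpa using hb.sub_mul 0 hM (by simpa using hR)
  · have hR1 : 0 < max R 1 := lt_max_of_lt_right one_pos
    obtain ⟨δ, hδ, h'⟩ := hf.small (ε / max R 1) (by positivity)
    refine ⟨min δ (ε / (M + 1)), lt_min hδ (by positivity), fun T hT hc hd u hu u' hu' => ?_⟩
    have h1 := divDiff_sub_mul f 0 hu
    simp only [sub_zero] at h1
    have h2 := h' T hT hc (fun x hx y hy => (hd x hx y hy).trans (min_le_left _ _)) u hu u' hu'
    have hcard : (T.erase u).card = h + 1 := by
      rw [Finset.card_erase_of_mem hu, hc]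
      rfl
    have h3 := hb (T.erase u) ((Finset.coe_subset.mpr (Finset.erase_subset _ _)).trans hT)
      (Finset.card_pos.mp (by omega)) hcard.le
    rw [h1]
    refine (mul_le_mul_of_nonneg_left (IsUltrametricDist.norm_add_le_max _ _)
      (norm_nonneg _)).trans ?_
    rw [mul_max_of_nonneg _ _ (norm_nonneg _)]
    refine max_le ?_ ?_
    · rw [norm_mul, norm_toC, mul_left_comm]
      refine (mul_le_mul ((hR u (hT hu)).trans (le_max_left R 1)) h2 (by positivity) hR1.le).trans ?_
      rw [mul_div_cancel₀ _ hR1.ne']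
    · refine (mul_le_mul ((hd u hu u' hu').trans (min_le_right _ _)) h3 (norm_nonneg _)
        (by positivity)).trans ?_
      rw [div_mul_eq_mul_div, div_le_iff₀ (by positivity)]
      nlinarith

theorem IsTame.mul_toC_pow {h : ℕ} {B : Set (Kinf F)} {f : Kinf F → Cinf F} (hf : IsTame h B f)
    {R : ℝ} (hR : ∀ x ∈ B, ‖x‖ ≤ R) (k : ℕ) : IsTame h B (fun x => toC x ^ k * f x) := by
  induction k with
  | zero => simpa using hf
  | succ k ih => simpa only [pow_succ', mul_assoc] using ih.mul_toC hR

/-- On a bounded set the exchange of one point changes a divided difference by at most the diameter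
times one of the next order, so boundedness descends from the top order once a single reference set
is fixed in each order. -/
theorem DivDiffBound.of_top {h : ℕ} {B : Set (Kinf F)} {f : Kinf F → Cinf F} {M D : ℝ}
    (hf : ∀ S : Finset (Kinf F), (S : Set (Kinf F)) ⊆ B → S.card = h + 1 → ‖divDiff f S‖ ≤ M)
    (hD : ∀ x ∈ B, ∀ y ∈ B, ‖x - y‖ ≤ D) : ∃ M', 0 ≤ M' ∧ DivDiffBound B (h + 1) f M' := by
  have key : ∀ m : ℕ, m ≤ h → ∃ M', 0 ≤ M' ∧ ∀ S : Finset (Kinf F), (S : Set (Kinf F)) ⊆ B →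
      S.card = h + 1 - m → ‖divDiff f S‖ ≤ M' := by
    intro m
    induction m with
    | zero => exact fun _ => ⟨max M 0, le_max_right _ _, fun S hS hc => (hf S hS hc).trans (le_max_left _ _)⟩
    | succ m ih =>
      intro hm
      obtain ⟨M', hM', hf'⟩ := ih (by omega)
      -- Without a subset of this size there is nothing to bound.
      by_cases hex : ∃ S0 : Finset (Kinf F), (S0 : Set (Kinf F)) ⊆ B ∧ S0.card = h + 1 - (m + 1)
      · obtain ⟨S0, hS0, hc0⟩ := hex
        refine ⟨max (max D 0 * M') ‖divDiff f S0‖, le_max_of_le_right (norm_nonneg _), fun S hS hc => ?_⟩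
        rw [← sub_add_cancel (divDiff f S) (divDiff f S0)]
        refine (IsUltrametricDist.norm_add_le_max _ _).trans (max_le_max ?_ le_rfl)
        refine norm_sub_le_of_exchange (divDiff f) (by positivity) ?_ hS hS0 hc hc0
        intro T hT hTc u hu u' hu' _
        rw [norm_divDiff_erase_sub f hu' hu]
        exact mul_le_mul ((hD _ (hT hu') _ (hT hu)).trans (le_max_left _ _)) (hf' T hT (by omega)) (norm_nonneg _)
          (le_max_right _ _)
      · push Not at hex
        exact ⟨0, le_rfl, fun S hS hc => absurd hc (hex S hS)⟩
  choose! M' hM' hf' using key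
  refine ⟨∑ m ∈ Finset.range (h + 1), M' m,
    Finset.sum_nonneg fun m hm => hM' m (by simpa [Nat.lt_succ_iff] using hm), fun S hS hne hc => ?_⟩
  have hpos := hne.card_pos
  refine (hf' (h + 1 - S.card) (by omega) S hS (by omega)).trans
    (Finset.single_le_sum (f := M') (fun m hm => hM' m (by simpa [Nat.lt_succ_iff] using hm)) ?_)
  simp only [Finset.mem_range]
  omega

/-- The continuous extension is bounded and uniformly continuous on a compact set. For `T` of small
diameter, `T.erase u` and `T.erase u'` are enumerated by close tuples, and the difference of their
divided differences is `u - u'` times that of `T`. -/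
theorem IsCnOn.isTame {h : ℕ} {B : Set (Kinf F)} {f : Kinf F → Cinf F} (hB : IsCompact B)
    (hf : IsCnOn h B f) : IsTame h B f := by
  obtain ⟨g, hg, hgf⟩ := hf
  have : CompactSpace B := isCompact_iff_compactSpace.mp hB
  have hval : ∀ x : Fin (h + 1) → B, Function.Injective x →
      g x = divDiff f (Finset.univ.image fun i => (x i : Kinf F)) := fun x hx => by
    rw [hgf x hx, diffQuot_eq_divDiff f (x := fun i => (x i : Kinf F)) (Subtype.val_injective.comp hx)]
  constructor
  · obtain ⟨M, hM⟩ := (isCompact_range hg).isBounded.exists_norm_le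
    obtain ⟨D, hD⟩ := Metric.isBounded_iff.mp hB.isBounded
    refine DivDiffBound.of_top (M := M) (D := D) ?_ ?_
    · intro S hS hc
      obtain ⟨x, hx, rfl⟩ := exists_enum_subtype hS hc
      rw [← hval x hx]
      exact hM _ ⟨x, rfl⟩
    · intro x hx y hy
      rw [← dist_eq_norm]
      exact hD hx hy
  · intro ε hε
    obtain ⟨δ, hδ, hu⟩ := Metric.uniformContinuous_iff.mp
      (CompactSpace.uniformContinuous_of_continuous hg) ε hε
    refine ⟨δ / 2, by positivity, fun T hT hc hd u hu1 u' hu' => ?_⟩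
    have h1 : ∀ w ∈ T, (T.erase w).card = h + 1 := fun w hw => by
      rw [Finset.card_erase_of_mem hw, hc]
      rfl
    have h2 : ∀ w, ((T.erase w : Finset (Kinf F)) : Set (Kinf F)) ⊆ B := fun w =>
      (Finset.coe_subset.mpr (Finset.erase_subset _ _)).trans hT
    obtain ⟨x, hx, hxS⟩ := exists_enum_subtype (h2 u') (h1 u' hu')
    obtain ⟨y, hy, hyS⟩ := exists_enum_subtype (h2 u) (h1 u hu1)
    rw [← norm_divDiff_erase_sub f hu1 hu', ← hxS, ← hyS, ← hval x hx, ← hval y hy, ← dist_eq_norm]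
    refine (hu ?_).le
    refine ((dist_pi_le_iff (by positivity)).mpr fun i => ?_).trans_lt (half_lt_self hδ)
    rw [Subtype.dist_eq, dist_eq_norm]
    have hxi : (x i : Kinf F) ∈ T.erase u' := hxS ▸ Finset.mem_image_of_mem _ (Finset.mem_univ i)
    have hyi : (y i : Kinf F) ∈ T.erase u := hyS ▸ Finset.mem_image_of_mem _ (Finset.mem_univ i)
    exact hd _ (Finset.mem_of_mem_erase hxi) _ (Finset.mem_of_mem_erase hyi)

theorem exists_injective_near {B : Set (Kinf F)}
    (hB : ∀ x ∈ B, ∀ δ > 0, {y ∈ B | ‖y - x‖ ≤ δ}.Infinite) {n : ℕ} (x : Fin n → B)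
    (A : Finset (Kinf F)) {δ : ℝ} (hδ : 0 < δ) :
    ∃ z : Fin n → B, Function.Injective z ∧ (∀ i, (z i : Kinf F) ∉ A) ∧
      ∀ i, ‖(z i : Kinf F) - x i‖ ≤ δ := by
  induction n generalizing A with
  | zero => exact ⟨x, fun i => i.elim0, fun i => i.elim0, fun i => i.elim0⟩
  | succ n ih =>
    obtain ⟨y, hy, hyA⟩ := (hB (x 0) (x 0).2 δ hδ).exists_notMem_finset A
    obtain ⟨z, hz, hzA, hzx⟩ := ih (fun i => x i.succ) (insert y A)
    refine ⟨Fin.cons ⟨y, hy.1⟩ z, ?_, ?_, ?_⟩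
    · rw [Fin.cons_injective_iff]
      refine ⟨?_, hz⟩
      rintro ⟨i, hi⟩
      exact hzA i (by rw [hi]; exact Finset.mem_insert_self _ _)
    · intro i
      induction i using Fin.cases with
      | zero => exact hyA
      | succ i => exact fun h => hzA i (Finset.mem_insert_of_mem h)
    · intro i
      induction i using Fin.cases with
      | zero => exact hy.2
      | succ i => exact hzx i

/-- The points of `x` are replaced by those of `z` one at a time. Disjointness of the two tuples
keeps all intermediate tuples injective. -/
theorem norm_divDiff_image_sub_le {B : Set (Kinf F)} {n : ℕ} {f : Kinf F → Cinf F} {M δ : ℝ}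
    (hf : DivDiffBound B (n + 1) f M) {x z : Fin n → B} (hx : Function.Injective x)
    (hz : Function.Injective z) (hxz : ∀ i j, x i ≠ z j) (hδ : 0 ≤ δ) (hM : 0 ≤ M)
    (h : ∀ i, ‖(x i : Kinf F) - z i‖ ≤ δ) :
    ‖divDiff f (Finset.univ.image fun i => (x i : Kinf F)) -
      divDiff f (Finset.univ.image fun i => (z i : Kinf F))‖ ≤ δ * M := by
  -- The mixed tuple in which exactly the coordinates in `A` have been moved from `x` to `z`.
  let w : Finset (Fin n) → Fin n → Kinf F := fun A i => if i ∈ A then z i else x i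
  have hw : ∀ A, Function.Injective (w A) := by
    intro A i j hij
    simp only [w] at hij
    split_ifs at hij
    · exact hz (Subtype.val_injective hij)
    · exact absurd (Subtype.val_injective hij).symm (hxz _ _)
    · exact absurd (Subtype.val_injective hij) (hxz _ _)
    · exact hx (Subtype.val_injective hij)
  have hwB : ∀ A i, w A i ∈ B := by
    intro A i
    simp only [w]
    split_ifs
    · exact (z i).2
    · exact (x i).2
  have key : ∀ A : Finset (Fin n), ‖divDiff f (Finset.univ.image fun i => (x i : Kinf F)) -
      divDiff f (Finset.univ.image (w A))‖ ≤ δ * M := by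
    intro A
    induction A using Finset.induction_on with
    | empty => simpa [w] using mul_nonneg hδ hM
    | insert k A hk ih =>
      rw [← sub_add_sub_cancel _ (divDiff f (Finset.univ.image (w A)))]
      refine (IsUltrametricDist.norm_add_le_max _ _).trans (max_le ih ?_)
      have hxk : w A k = x k := if_neg hk
      have hzk : (z k : Kinf F) ∉ Finset.univ.image (w A) := by
        simp only [Finset.mem_image, Finset.mem_univ, true_and, not_exists]
        intro i hi
        simp only [w] at hi
        split_ifs at hi with hiA
        · exact hk (hz (Subtype.val_injective hi) ▸ hiA)
        · exact hxz _ _ (Subtype.val_injective hi)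
      have hTx : (x k : Kinf F) ∈ insert (z k : Kinf F) (Finset.univ.image (w A)) :=
        Finset.mem_insert_of_mem (hxk ▸ Finset.mem_image_of_mem _ (Finset.mem_univ k))
      have e2 : (insert (z k : Kinf F) (Finset.univ.image (w A))).erase (x k) =
          Finset.univ.image (w (insert k A)) := by
        ext y
        simp only [Finset.mem_erase, Finset.mem_insert, Finset.mem_image, Finset.mem_univ, true_and]
        constructor
        · rintro ⟨hy, rfl | ⟨i, rfl⟩⟩
          · exact ⟨k, if_pos (Finset.mem_insert_self _ _)⟩
          · have hik : i ≠ k := by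
              rintro rfl
              exact hy hxk
            exact ⟨i, by simp [w, hik]⟩
        · rintro ⟨i, rfl⟩
          by_cases hik : i = k
          · subst hik
            have : w (insert i A) i = z i := if_pos (Finset.mem_insert_self _ _)
            rw [this]
            exact ⟨fun h => hxz i i (Subtype.val_injective h).symm, Or.inl rfl⟩
          · have : w (insert k A) i = w A i := by simp [w, hik]
            rw [this]
            exact ⟨fun h => hik (hw A (h.trans hxk.symm)), Or.inr ⟨i, rfl⟩⟩
      have h1 := norm_divDiff_erase_sub f hTx (Finset.mem_insert_self (z k : Kinf F) _)
      rw [Finset.erase_insert hzk, e2] at h1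
      rw [h1]
      refine mul_le_mul (h k) (hf _ ?_ ⟨_, hTx⟩ ?_) (norm_nonneg _) hδ
      · intro y hy
        rcases Finset.mem_insert.mp (Finset.mem_coe.mp hy) with rfl | hy
        · exact (z k).2
        · obtain ⟨i, -, rfl⟩ := Finset.mem_image.mp hy
          exact hwB A i
      · rw [Finset.card_insert_of_notMem hzk, Finset.card_image_of_injective _ (hw A),
          Finset.card_fin]
  have := key Finset.univ
  simpa [w] using this

/-- One more order of bounded divided differences makes the order `h` quotients Lipschitz on tuples
of distinct points. These are dense as `B` has no isolated points, so the quotients extend by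
uniform continuity. -/
theorem DivDiffBound.isCnOn {h : ℕ} {B : Set (Kinf F)} {f : Kinf F → Cinf F} {M : ℝ}
    (hB : ∀ x ∈ B, ∀ δ > 0, {y ∈ B | ‖y - x‖ ≤ δ}.Infinite)
    (hM : 0 ≤ M) (hf : DivDiffBound B (h + 2) f M) : IsCnOn h B f := by
  let D : Type _ := {x : Fin (h + 1) → B // Function.Injective x}
  let φ : D → Cinf F := fun x => divDiff f (Finset.univ.image fun i => (x.1 i : Kinf F))
  have hdense : DenseRange (Subtype.val : D → (Fin (h + 1) → B)) := by
    rw [Metric.denseRange_iff]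
    intro x r hr
    obtain ⟨z, hz, -, hzx⟩ := exists_injective_near hB x ∅ (half_pos hr)
    refine ⟨⟨z, hz⟩, ((dist_pi_le_iff (by positivity)).mpr fun i => ?_).trans_lt (half_lt_self hr)⟩
    rw [dist_comm, Subtype.dist_eq, dist_eq_norm]
    exact hzx i
  have huc : UniformContinuous φ := by
    rw [Metric.uniformContinuous_iff]
    intro ε hε
    refine ⟨ε / (M + 1), by positivity, fun {x y} hxy => ?_⟩
    -- `x` and `y` may share points in different positions, so they are compared through a nearby
    -- tuple `z` disjoint from both.
    obtain ⟨z, hz, hzA, hzx⟩ := exists_injective_near hB x.1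
      (Finset.univ.image (fun i => (x.1 i : Kinf F)) ∪ Finset.univ.image (fun i => (y.1 i : Kinf F)))
      (show 0 < ε / (M + 1) / 2 by positivity)
    have hx' : ∀ i, ‖(x.1 i : Kinf F) - z i‖ ≤ ε / (M + 1) / 2 := fun i => by
      rw [norm_sub_rev]
      exact hzx i
    have hd : dist x y < ε / (M + 1) := hxy
    set η := max (dist x y) (ε / (M + 1) / 2) with hη
    have hηlt : η < ε / (M + 1) := max_lt hd (half_lt_self (by positivity))
    have hη0 : 0 ≤ η := le_max_of_le_left dist_nonneg
    have h1 := norm_divDiff_image_sub_le hf x.2 hz (fun i j hij => hzA j (by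
      rw [← hij]
      exact Finset.mem_union_left _ (Finset.mem_image_of_mem _ (Finset.mem_univ i)))) hη0 hM
      (fun i => (hx' i).trans (le_max_right _ _))
    have h2 := norm_divDiff_image_sub_le hf y.2 hz (fun i j hij => hzA j (by
      rw [← hij]
      exact Finset.mem_union_right _ (Finset.mem_image_of_mem (fun i => (y.1 i : Kinf F))
        (Finset.mem_univ i)))) hη0 hM
      (fun i => by
        refine norm_sub_le_of_le (y := (x.1 i : Kinf F)) ?_ ((hx' i).trans (le_max_right _ _))
        have := dist_le_pi_dist x.1 y.1 i
        rw [Subtype.dist_eq, dist_comm, dist_eq_norm] at this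
        exact this.trans (le_max_left _ _))
    rw [dist_eq_norm]
    refine lt_of_le_of_lt (b := η * M) ?_ ?_
    · rw [← sub_sub_sub_cancel_right _ _ (divDiff f (Finset.univ.image fun i => (z i : Kinf F))),
        sub_eq_add_neg]
      refine (IsUltrametricDist.norm_add_le_max _ _).trans (max_le h1 ?_)
      rw [norm_neg]
      exact h2
    · have : η * M ≤ ε / (M + 1) * M := mul_le_mul_of_nonneg_right hηlt.le hM
      refine this.trans_lt ?_
      rw [div_mul_eq_mul_div, div_lt_iff₀ (by positivity)]
      nlinarith
  have hui : IsUniformInducing (Subtype.val : D → (Fin (h + 1) → B)) := isUniformEmbedding_subtype_val.isUniformInducing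
  have hdi : IsDenseInducing (Subtype.val : D → (Fin (h + 1) → B)) := ⟨hui.isInducing, hdense⟩
  refine ⟨hdi.extend φ, (uniformContinuous_uniformly_extend hui hdense huc).continuous, ?_⟩
  intro x hx
  have := uniformly_extend_of_ind hui hdense huc ⟨x, hx⟩
  rw [diffQuot_eq_divDiff f (x := fun i => (x i : Kinf F)) (Subtype.val_injective.comp hx)]
  exact this

theorem infinite_near {b x : Kinf F} {l : ℤ} (hx : x ∈ Metric.closedBall b (‖unif F‖ ^ l)) {δ : ℝ}
    (hδ : 0 < δ) : {y ∈ Metric.closedBall b (‖unif F‖ ^ l) | ‖y - x‖ ≤ δ}.Infinite := by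
  obtain ⟨k, hk⟩ := exists_pow_lt_of_lt_one (lt_min hδ (zpow_unif_pos (F := F) l))
    (norm_unif_lt_one (F := F))
  have hinj : Function.Injective fun j : ℕ => x + unif F ^ (k + j) := by
    intro i j hij
    have h1 : ‖unif F‖ ^ ((k + i : ℕ) : ℤ) = ‖unif F‖ ^ ((k + j : ℕ) : ℤ) := by
      rw [zpow_natCast, zpow_natCast, ← norm_pow, ← norm_pow, add_left_cancel hij]
    have h2 := zpow_unif_le.mp h1.le
    have h3 := zpow_unif_le.mp h1.ge
    omega
  refine (Set.infinite_range_of_injective hinj).mono ?_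
  rintro _ ⟨j, rfl⟩
  have h1 : ‖x + unif F ^ (k + j) - x‖ ≤ min δ (‖unif F‖ ^ l) := by
    rw [add_sub_cancel_left, norm_pow]
    exact (pow_le_pow_of_le_one norm_unif_pos.le norm_unif_lt_one.le (by omega)).trans hk.le
  refine ⟨?_, h1.trans (min_le_left _ _)⟩
  rw [mem_closedBall_iff_norm] at hx ⊢
  exact norm_sub_le_of_le (h1.trans (min_le_right _ _)) hx

theorem DivDiffBounded.isCnOn {b : Kinf F} {l : ℤ} {f : Kinf F → Cinf F}
    (hf : DivDiffBounded (Metric.closedBall b (‖unif F‖ ^ l)) f) (h : ℕ) :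
    IsCnOn h (Metric.closedBall b (‖unif F‖ ^ l)) f := by
  obtain ⟨M, hM, hb⟩ := hf (h + 2)
  exact hb.isCnOn (fun x hx δ hδ => infinite_near hx hδ) hM

end SmoothFunctions

/-! ### Integration of `C^h` functions against moments of admissible growth -/

section Integration
variable {F : Type*} [Field F] [Fintype F]
open scoped Classical
open Filter

/-- Moments `∫_{B_b(|π|^l)} p dν` of polynomials `p` on balls: they are additive, and on polynomials of
degree at most `d` they have the growth of an `h`-admissible measure. -/
structure IsMomentData (d h : ℕ) (C : ℝ) (ν : Kinf F → ℤ → Polynomial (Cinf F) →ₗ[Cinf F] Cinf F) :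
    Prop where
  congr : ∀ b b' l, ‖b - b'‖ ≤ ‖unif F‖ ^ l → ν b l = ν b' l
  add : ∀ b l p, ν b l p = ∑ ε : F, ν (subCenter b l ε) (l + 1) p
  nonneg : 0 ≤ C
  bound : ∀ b, ∀ l ≥ 0, ∀ j ≤ d, ‖ν b l ((Polynomial.X - Polynomial.C (toC b)) ^ j)‖ ≤
    C * ‖unif F‖ ^ (l * ((j : ℤ) - h))

theorem norm_sum_le_of_le' {ι : Type*} (s : Finset ι) (f : ι → Cinf F) {M : ℝ} (hM : 0 ≤ M)
    (h : ∀ i ∈ s, ‖f i‖ ≤ M) : ‖∑ i ∈ s, f i‖ ≤ M :=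
  IsUltrametricDist.norm_sum_le_of_forall_le_of_nonneg hM h

variable {d h : ℕ} {C : ℝ} {ν : Kinf F → ℤ → Polynomial (Cinf F) →ₗ[Cinf F] Cinf F}

theorem nodalPoly_insert {R : Finset (Kinf F)} {r : Kinf F} (hr : r ∉ R) :
    nodalPoly (insert r R) = (Polynomial.X - Polynomial.C (toC r)) * nodalPoly R :=
  Lagrange.nodal_insert_eq_nodal hr

/-- Write one factor as `x - r = (x - b) + (b - r)` and use induction: the first term gains `|π|^l ≤
σ` from the growth condition, the second gains `|r - b| ≤ σ`. The nodes may lie in a larger ball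
than the one of integration. -/
theorem IsMomentData.norm_nodalPoly_le (D : IsMomentData d h C ν) {b : Kinf F} {l : ℤ} (hl : 0 ≤ l)
    {σ : ℝ} (hσ : ‖unif F‖ ^ l ≤ σ) (R : Finset (Kinf F)) (k : ℕ) (hR : ∀ r ∈ R, ‖r - b‖ ≤ σ)
    (hd : k + R.card ≤ d) :
    ‖ν b l ((Polynomial.X - Polynomial.C (toC b)) ^ k * nodalPoly R)‖ ≤
      C * ‖unif F‖ ^ (l * ((k : ℤ) - h)) * σ ^ R.card := by
  have hσ0 : 0 ≤ σ := (zpow_unif_pos l).le.trans hσ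
  have hC := D.nonneg
  induction R using Finset.induction_on generalizing k with
  | empty =>
    simpa [nodalPoly] using D.bound b l hl k (by simpa using hd)
  | insert r R hr ih =>
    rw [Finset.card_insert_of_notMem hr] at hd ⊢
    have e : (Polynomial.X - Polynomial.C (toC b)) ^ k * nodalPoly (insert r R) =
        (Polynomial.X - Polynomial.C (toC b)) ^ (k + 1) * nodalPoly R +
          toC (b - r) • ((Polynomial.X - Polynomial.C (toC b)) ^ k * nodalPoly R) := by
      rw [nodalPoly_insert hr, Polynomial.smul_eq_C_mul, map_sub, map_sub]
      ring
    have hR' : ∀ x ∈ R, ‖x - b‖ ≤ σ := fun x hx => hR x (Finset.mem_insert_of_mem hx)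
    have h1 := ih (k + 1) hR' (by omega)
    have h2 := ih k hR' (by omega)
    have hu := (zpow_unif_pos (F := F) (l * ((k : ℤ) - h))).le
    rw [e, map_add, map_smul, smul_eq_mul]
    refine (IsUltrametricDist.norm_add_le_max _ _).trans (max_le (h1.trans ?_) ?_)
    · rw [show l * (((k + 1 : ℕ) : ℤ) - h) = l * ((k : ℤ) - h) + l by push_cast; ring,
        zpow_add₀ norm_unif_pos.ne', pow_succ']
      calc C * (‖unif F‖ ^ (l * ((k : ℤ) - h)) * ‖unif F‖ ^ l) * σ ^ R.card
          = C * ‖unif F‖ ^ (l * ((k : ℤ) - h)) * (‖unif F‖ ^ l * σ ^ R.card) := by ring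
        _ ≤ C * ‖unif F‖ ^ (l * ((k : ℤ) - h)) * (σ * σ ^ R.card) := by gcongr
    · rw [norm_mul, norm_toC, norm_sub_rev, pow_succ']
      calc ‖r - b‖ * _ ≤ σ * (C * ‖unif F‖ ^ (l * ((k : ℤ) - h)) * σ ^ R.card) :=
            mul_le_mul (hR r (Finset.mem_insert_self _ _)) h2 (norm_nonneg _) hσ0
        _ = _ := by ring

/-- Nodes are added one at a time by Newton's formula; each new term is a divided difference times
the moment of a nodal polynomial. -/
theorem IsMomentData.norm_interp_sub_le (D : IsMomentData d h C ν) {b : Kinf F} {l : ℤ} (hl : 0 ≤ l)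
    (f : Kinf F → Cinf F) (R S : Finset (Kinf F)) {M : ℝ} (hM : 0 ≤ M)
    (hRS : ∀ x ∈ R ∪ S, ‖x - b‖ ≤ ‖unif F‖ ^ l) (hc : (R ∪ S).card ≤ d + 1)
    (hT : ∀ T ⊆ R ∪ S, R.card < T.card → ‖divDiff f T‖ * (‖unif F‖ ^ l) ^ (T.card - 1) ≤ M) :
    ‖ν b l (interp f (R ∪ S) - interp f R)‖ ≤ C * ‖unif F‖ ^ (-(l * h)) * M := by
  have hC := D.nonneg
  have hpos := (zpow_unif_pos (F := F) (-(l * h))).le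
  induction S using Finset.induction_on with
  | empty =>
    rw [Finset.union_empty, sub_self, map_zero, norm_zero]
    positivity
  | insert u S hu ih =>
    rw [Finset.union_insert] at hRS hc hT ⊢
    have h1 := ih (fun x hx => hRS x (Finset.mem_insert_of_mem hx))
      ((Finset.card_le_card (Finset.subset_insert _ _)).trans hc)
      (fun T hT' => hT T (hT'.trans (Finset.subset_insert _ _)))
    by_cases huR : u ∈ R ∪ S
    · rwa [Finset.insert_eq_self.mpr huR]
    · rw [interp_insert f huR, add_sub_right_comm, map_add]
      refine (IsUltrametricDist.norm_add_le_max _ _).trans (max_le h1 ?_)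
      rw [Finset.card_insert_of_notMem huR] at hc
      have h2 := D.norm_nodalPoly_le hl le_rfl (R ∪ S) 0
        (fun x hx => hRS x (Finset.mem_insert_of_mem hx)) (by omega)
      have h3 := hT _ le_rfl (by
        rw [Finset.card_insert_of_notMem huR]
        exact Nat.lt_succ_of_le (Finset.card_le_card Finset.subset_union_left))
      rw [Finset.card_insert_of_notMem huR, Nat.add_sub_cancel] at h3
      rw [pow_zero, one_mul, Nat.cast_zero, zero_sub, mul_neg] at h2
      rw [← Polynomial.smul_eq_C_mul, map_smul, smul_eq_mul, norm_mul]
      calc _ ≤ ‖divDiff f (insert u (R ∪ S))‖ *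
            (C * ‖unif F‖ ^ (-(l * h)) * (‖unif F‖ ^ l) ^ (R ∪ S).card) := by gcongr
        _ = C * ‖unif F‖ ^ (-(l * h)) *
            (‖divDiff f (insert u (R ∪ S))‖ * (‖unif F‖ ^ l) ^ (R ∪ S).card) := by ring
        _ ≤ _ := by gcongr

/-- Interpolation nodes in the ball `B_b(|π|^l)`. -/
def nodes (h : ℕ) (b : Kinf F) (l : ℤ) : Finset (Kinf F) :=
  (Finset.range (h + 1)).image fun i : ℕ => b + unif F ^ (l + i)

theorem norm_sub_le_of_mem_nodes {h : ℕ} {b x : Kinf F} {l : ℤ} (hx : x ∈ nodes h b l) :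
    ‖x - b‖ ≤ ‖unif F‖ ^ l := by
  obtain ⟨i, -, rfl⟩ := Finset.mem_image.mp hx
  rw [add_sub_cancel_left, norm_zpow, zpow_unif_le]
  omega

theorem nodes_subset (h : ℕ) (b : Kinf F) (l : ℤ) :
    (nodes h b l : Set (Kinf F)) ⊆ Metric.closedBall b (‖unif F‖ ^ l) := fun _ hx =>
  mem_closedBall_iff_norm.mpr (norm_sub_le_of_mem_nodes (Finset.mem_coe.mp hx))

theorem card_nodes (h : ℕ) (b : Kinf F) (l : ℤ) : (nodes h b l).card = h + 1 := by
  rw [nodes, Finset.card_image_of_injective, Finset.card_range]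
  intro i j hij
  have h1 : ‖unif F‖ ^ (l + i) = ‖unif F‖ ^ (l + j) := by
    rw [← norm_zpow, ← norm_zpow, add_left_cancel hij]
  have h2 := zpow_unif_le.mp h1.le
  have h3 := zpow_unif_le.mp h1.ge
  omega

theorem nodes_mono {h d : ℕ} (hd : h ≤ d) (b : Kinf F) (l : ℤ) : nodes h b l ⊆ nodes d b l :=
  Finset.image_subset_image (Finset.range_mono (by omega))

/-- When one of `h + 1` nodes is exchanged, the interpolation polynomial changes by a multiple of
the nodal polynomial of the `h` common nodes. Its coefficient is controlled by `ω`, its moment by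
`norm_nodalPoly_le` with `σ = |π|^m`. -/
theorem IsMomentData.norm_exchange_le (D : IsMomentData d h C ν) (hd : h ≤ d) {a b : Kinf F}
    {m l : ℤ} (hl : 0 ≤ l) (hml : m ≤ l) (hab : ‖a - b‖ ≤ ‖unif F‖ ^ m) (f : Kinf F → Cinf F)
    {ω : ℝ} (hω : 0 ≤ ω)
    (hT : ∀ T : Finset (Kinf F), (T : Set (Kinf F)) ⊆ Metric.closedBall a (‖unif F‖ ^ m) →
      T.card = h + 2 → ∀ u ∈ T, ∀ u' ∈ T, ‖u - u'‖ * ‖divDiff f T‖ ≤ ω)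
    {S S' : Finset (Kinf F)} (hS : (S : Set (Kinf F)) ⊆ Metric.closedBall a (‖unif F‖ ^ m))
    (hS' : (S' : Set (Kinf F)) ⊆ Metric.closedBall a (‖unif F‖ ^ m)) (hc : S.card = h + 1)
    (hc' : S'.card = h + 1) :
    ‖ν b l (interp f S) - ν b l (interp f S')‖ ≤ C * ‖unif F‖ ^ ((m - l) * h) * ω := by
  have hC := D.nonneg
  have hpos := (zpow_unif_pos (F := F) ((m - l) * h)).le
  refine norm_sub_le_of_exchange (fun S => ν b l (interp f S)) (by positivity) ?_ hS hS' hc hc'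
  intro T hTB hTc u hu u' hu' hne
  set R := (T.erase u).erase u' with hR
  have e1 : T.erase u = insert u' R :=
    (Finset.insert_erase (Finset.mem_erase.mpr ⟨hne.symm, hu'⟩)).symm
  have e2 : T.erase u' = insert u R := by
    rw [hR, Finset.erase_right_comm]
    exact (Finset.insert_erase (Finset.mem_erase.mpr ⟨hne, hu⟩)).symm
  have hRc : R.card = h := by
    rw [hR, Finset.card_erase_of_mem (Finset.mem_erase.mpr ⟨hne.symm, hu'⟩),
      Finset.card_erase_of_mem hu, hTc]
    rfl
  have hu'R : u' ∉ R := Finset.notMem_erase _ _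
  have huR : u ∉ R := by
    rw [hR, Finset.erase_right_comm]
    exact Finset.notMem_erase _ _
  have h1 : ν b l (interp f (T.erase u)) - ν b l (interp f (T.erase u')) =
      (divDiff f (T.erase u) - divDiff f (T.erase u')) * ν b l (nodalPoly R) := by
    rw [e1, e2, interp_insert f hu'R, interp_insert f huR, map_add, map_add,
      ← Polynomial.smul_eq_C_mul, ← Polynomial.smul_eq_C_mul, map_smul, map_smul, smul_eq_mul,
      smul_eq_mul]
    ring
  have h2 := D.norm_nodalPoly_le (b := b) hl (zpow_unif_le.mpr hml) R 0 (fun r hr => by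
    have hrT : r ∈ T := Finset.mem_of_mem_erase (Finset.mem_of_mem_erase hr)
    exact norm_sub_le_of_le (mem_closedBall_iff_norm.mp (hTB hrT)) hab) (by omega)
  rw [pow_zero, one_mul, Nat.cast_zero, zero_sub, hRc] at h2
  rw [h1, norm_mul, norm_divDiff_erase_sub f hu' hu]
  calc _ ≤ ω * (C * ‖unif F‖ ^ (l * -(h : ℤ)) * (‖unif F‖ ^ m) ^ h) :=
        mul_le_mul (hT T hTB hTc u' hu' u hu) h2 (norm_nonneg _) hω
    _ = _ := by
        rw [← zpow_natCast (‖unif F‖ ^ m), ← zpow_mul, mul_assoc C, ← zpow_add₀ norm_unif_pos.ne',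
          show l * -(h : ℤ) + m * h = (m - l) * h by ring]
        ring

/-- Riemann sums: on each of the balls of radius `|π|^(l+k)` in `B_b(|π|^l)` the function `f` is
replaced by an interpolation polynomial. -/
def riemannSum (ν : Kinf F → ℤ → Polynomial (Cinf F) →ₗ[Cinf F] Cinf F) (h : ℕ)
    (f : Kinf F → Cinf F) : ℕ → Kinf F → ℤ → Cinf F
  | 0, b, l => ν b l (interp f (nodes h b l))
  | k + 1, b, l => ∑ ε : F, riemannSum ν h f k (subCenter b l ε) (l + 1)

theorem closedBall_subCenter_subset (b : Kinf F) (l : ℤ) (ε : F) :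
    Metric.closedBall (subCenter b l ε) (‖unif F‖ ^ (l + 1)) ⊆
      Metric.closedBall b (‖unif F‖ ^ l) := fun _ hx =>
  mem_closedBall_iff_norm.mpr (norm_sub_le_of_norm_sub_subCenter_le (mem_closedBall_iff_norm.mp hx))

/-- On each ball of the partition, nodes of the ball are exchanged for nodes of its sub-balls, one
level deeper, which costs `|π|^(-h)`. By the ultrametric inequality the number of balls does not
matter. -/
theorem IsMomentData.norm_riemannSum_succ_sub_le (D : IsMomentData d h C ν) (hd : h ≤ d)
    (f : Kinf F → Cinf F) {ω : ℝ} (hω : 0 ≤ ω) (k : ℕ) {b : Kinf F} {l : ℤ} (hl : 0 ≤ l)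
    (hT : ∀ T : Finset (Kinf F), (T : Set (Kinf F)) ⊆ Metric.closedBall b (‖unif F‖ ^ l) →
      T.card = h + 2 → (∀ x ∈ T, ∀ y ∈ T, ‖x - y‖ ≤ ‖unif F‖ ^ (l + k)) →
      ∀ u ∈ T, ∀ u' ∈ T, ‖u - u'‖ * ‖divDiff f T‖ ≤ ω) :
    ‖riemannSum ν h f (k + 1) b l - riemannSum ν h f k b l‖ ≤ C * ‖unif F‖ ^ (-(h : ℤ)) * ω := by
  have hC := D.nonneg
  have hpos := (zpow_unif_pos (F := F) (-(h : ℤ))).le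
  induction k generalizing b l with
  | zero =>
    rw [riemannSum, riemannSum, D.add, ← Finset.sum_sub_distrib]
    refine norm_sum_le_of_le' _ _ (by positivity) fun ε _ => ?_
    have h1 := D.norm_exchange_le hd (a := b) (b := subCenter b l ε) (m := l) (l := l + 1) (by omega)
      (by omega) (by rw [norm_sub_rev]; exact norm_subCenter_sub_le b l ε) f hω
      (fun T hTB hTc => hT T hTB hTc fun x hx y hy => by
        have h2 := mem_closedBall_iff_norm.mp (hTB hx)
        have h3 := mem_closedBall_iff_norm'.mp (hTB hy)
        simpa using norm_sub_le_of_le h2 h3)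
      ((nodes_subset h _ _).trans (closedBall_subCenter_subset b l ε)) (nodes_subset h b l)
      (card_nodes _ _ _) (card_nodes _ _ _)
    rw [show (l - (l + 1)) * (h : ℤ) = -h by ring] at h1
    exact h1
  | succ k ih =>
    rw [riemannSum, riemannSum, ← Finset.sum_sub_distrib]
    refine norm_sum_le_of_le' _ _ (by positivity) fun ε _ => ih (by omega) fun T hTB hTc hTd => ?_
    refine hT T (hTB.trans (closedBall_subCenter_subset b l ε)) hTc fun x hx y hy => ?_
    rw [show l + ((k + 1 : ℕ) : ℤ) = l + 1 + k by push_cast; ring]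
    exact hTd x hx y hy

/-- The integral of `f` over `B_b(|π|^l)`. -/
def ballIntegral (ν : Kinf F → ℤ → Polynomial (Cinf F) →ₗ[Cinf F] Cinf F) (h : ℕ)
    (f : Kinf F → Cinf F) (b : Kinf F) (l : ℤ) : Cinf F :=
  limUnder atTop fun k => riemannSum ν h f k b l

/-- In a complete ultrametric group it suffices that consecutive differences tend to zero, and these
are bounded by a constant times the oscillation of the top order divided differences on small balls.
-/
theorem IsMomentData.tendsto_riemannSum (D : IsMomentData d h C ν) (hd : h ≤ d)
    {f : Kinf F → Cinf F} {b : Kinf F} {l : ℤ} (hl : 0 ≤ l)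
    (hf : IsTame h (Metric.closedBall b (‖unif F‖ ^ l)) f) :
    Tendsto (fun k => riemannSum ν h f k b l) atTop (𝓝 (ballIntegral ν h f b l)) := by
  refine CauchySeq.tendsto_limUnder ?_
  refine NonarchimedeanAddGroup.cauchySeq_of_tendsto_sub_nhds_zero ?_
  rw [Metric.tendsto_atTop]
  intro ε hε
  set A := C * ‖unif F‖ ^ (-(h : ℤ)) with hA
  have hA0 : 0 ≤ A := mul_nonneg D.nonneg (zpow_unif_pos _).le
  -- Chosen so that `A` times this bound is less than `ε`; the summand one covers `A = 0`.
  obtain ⟨δ, hδ, hs⟩ := hf.small (ε / (A + 1)) (by positivity)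
  obtain ⟨N, hN⟩ := exists_pow_lt_of_lt_one (div_pos hδ (zpow_unif_pos (F := F) l))
    (norm_unif_lt_one (F := F))
  refine ⟨N, fun k hk => ?_⟩
  rw [dist_zero_right]
  refine (D.norm_riemannSum_succ_sub_le hd f (ω := ε / (A + 1)) (by positivity) k hl
    fun T hTB hTc hTd => hs T hTB hTc fun x hx y hy => (hTd x hx y hy).trans ?_).trans_lt ?_
  · rw [zpow_add₀ norm_unif_pos.ne', mul_comm, ← le_div_iff₀ (zpow_unif_pos _), zpow_natCast]
    exact (pow_le_pow_of_le_one norm_unif_pos.le norm_unif_lt_one.le hk).trans hN.le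
  · rw [← hA, mul_div_assoc', div_lt_iff₀ (by positivity)]
    nlinarith

theorem IsMomentData.ballIntegral_eq_sum (D : IsMomentData d h C ν) (hd : h ≤ d)
    {f : Kinf F → Cinf F} {b : Kinf F} {l : ℤ} (hl : 0 ≤ l)
    (hf : IsTame h (Metric.closedBall b (‖unif F‖ ^ l)) f) :
    ballIntegral ν h f b l = ∑ ε : F, ballIntegral ν h f (subCenter b l ε) (l + 1) := by
  refine tendsto_nhds_unique ((tendsto_add_atTop_iff_nat 1).mpr (D.tendsto_riemannSum hd hl hf)) ?_
  exact tendsto_finsetSum _ fun ε _ => D.tendsto_riemannSum hd (by omega)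
    (hf.mono (closedBall_subCenter_subset b l ε))

theorem interp_congr {f g : Kinf F → Cinf F} {S : Finset (Kinf F)} (h : ∀ x ∈ S, f x = g x) :
    interp f S = interp g S := Lagrange.interpolate_eq_of_values_eq_on _ _ h

theorem riemannSum_congr {f g : Kinf F → Cinf F} (k : ℕ) {b : Kinf F} {l : ℤ}
    (hfg : ∀ x ∈ Metric.closedBall b (‖unif F‖ ^ l), f x = g x) :
    riemannSum ν h f k b l = riemannSum ν h g k b l := by
  induction k generalizing b l with
  | zero => rw [riemannSum, riemannSum, interp_congr fun x hx => hfg x (nodes_subset h b l hx)]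
  | succ k ih =>
    exact Finset.sum_congr rfl fun ε _ => ih fun x hx => hfg x (closedBall_subCenter_subset b l ε hx)

theorem ballIntegral_congr {f g : Kinf F → Cinf F} {b : Kinf F} {l : ℤ}
    (hfg : ∀ x ∈ Metric.closedBall b (‖unif F‖ ^ l), f x = g x) :
    ballIntegral ν h f b l = ballIntegral ν h g b l := by
  simp only [ballIntegral, riemannSum_congr _ hfg]

theorem riemannSum_add (f g : Kinf F → Cinf F) (k : ℕ) (b : Kinf F) (l : ℤ) :
    riemannSum ν h (fun x => f x + g x) k b l = riemannSum ν h f k b l + riemannSum ν h g k b l := by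
  induction k generalizing b l with
  | zero =>
    have : interp (fun x => f x + g x) (nodes h b l) = interp f (nodes h b l) + interp g (nodes h b l) :=
      map_add (Lagrange.interpolate (nodes h b l) toC) f g
    rw [riemannSum, this, map_add]
    rfl
  | succ k ih => simp only [riemannSum, ih, Finset.sum_add_distrib]

theorem riemannSum_const_mul (a : Cinf F) (f : Kinf F → Cinf F) (k : ℕ) (b : Kinf F) (l : ℤ) :
    riemannSum ν h (fun x => a * f x) k b l = a * riemannSum ν h f k b l := by
  induction k generalizing b l with
  | zero =>
    have : interp (fun x => a * f x) (nodes h b l) = a • interp f (nodes h b l) :=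
      map_smul (Lagrange.interpolate (nodes h b l) toC) a f
    rw [riemannSum, this, map_smul]
    rfl
  | succ k ih => simp only [riemannSum, ih, Finset.mul_sum]

theorem ballIntegral_zero (b : Kinf F) (l : ℤ) : ballIntegral ν h (fun _ => 0) b l = 0 := by
  have : ∀ k, riemannSum ν h (fun _ => 0) k b l = 0 := fun k => by
    have := riemannSum_const_mul (ν := ν) (h := h) 0 (fun _ => (0 : Cinf F)) k b l
    simpa using this
  simp only [ballIntegral, this]
  exact tendsto_const_nhds.limUnder_eq

theorem IsMomentData.ballIntegral_add (D : IsMomentData d h C ν) (hd : h ≤ d)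
    {f g : Kinf F → Cinf F} {b : Kinf F} {l : ℤ} (hl : 0 ≤ l)
    (hf : IsTame h (Metric.closedBall b (‖unif F‖ ^ l)) f)
    (hg : IsTame h (Metric.closedBall b (‖unif F‖ ^ l)) g) :
    ballIntegral ν h (fun x => f x + g x) b l = ballIntegral ν h f b l + ballIntegral ν h g b l := by
  have h1 := (D.tendsto_riemannSum hd hl hf).add (D.tendsto_riemannSum hd hl hg)
  simp only [← riemannSum_add] at h1
  exact h1.limUnder_eq

theorem IsMomentData.ballIntegral_const_mul (D : IsMomentData d h C ν) (hd : h ≤ d) (a : Cinf F)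
    {f : Kinf F → Cinf F} {b : Kinf F} {l : ℤ} (hl : 0 ≤ l)
    (hf : IsTame h (Metric.closedBall b (‖unif F‖ ^ l)) f) :
    ballIntegral ν h (fun x => a * f x) b l = a * ballIntegral ν h f b l := by
  have h1 := (D.tendsto_riemannSum hd hl hf).const_mul a
  simp only [← riemannSum_const_mul] at h1
  exact h1.limUnder_eq

/-- The zeroth Riemann sum is bounded by Newton's formula starting with no nodes, each refinement by
`norm_riemannSum_succ_sub_le`. In the ultrametric setting the same bound holds for all sums and for
the limit. -/
theorem IsMomentData.norm_ballIntegral_le (D : IsMomentData d h C ν) (hd : h ≤ d)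
    {f : Kinf F → Cinf F} {b : Kinf F} {l : ℤ} (hl : 0 ≤ l)
    (hf : IsTame h (Metric.closedBall b (‖unif F‖ ^ l)) f) {M : ℝ} (hM : 0 ≤ M)
    (hS : ∀ S : Finset (Kinf F), (S : Set (Kinf F)) ⊆ Metric.closedBall b (‖unif F‖ ^ l) →
      S.Nonempty → S.card ≤ h + 1 → ‖divDiff f S‖ * (‖unif F‖ ^ l) ^ (S.card - 1) ≤ M) :
    ‖ballIntegral ν h f b l‖ ≤ C * ‖unif F‖ ^ (-(h : ℤ)) * ‖unif F‖ ^ (-(l * h)) * M := by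
  have hC := D.nonneg
  have hpos := (zpow_unif_pos (F := F) (-(l * h)))
  have hpos' := (zpow_unif_pos (F := F) (-(h : ℤ)))
  have hone : 1 ≤ ‖unif F‖ ^ (-(h : ℤ)) := by
    rw [← zpow_zero ‖unif F‖, zpow_unif_le]
    omega
  have h0 : ‖riemannSum ν h f 0 b l‖ ≤ C * ‖unif F‖ ^ (-(h : ℤ)) * ‖unif F‖ ^ (-(l * h)) * M := by
    have h1 := D.norm_interp_sub_le hl f ∅ (nodes h b l) hM
      (fun x hx => norm_sub_le_of_mem_nodes (by simpa using hx))
      (by rw [Finset.empty_union, card_nodes]; omega) (fun T hT hTc => by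
        rw [Finset.empty_union] at hT
        refine hS T ((Finset.coe_subset.mpr hT).trans (nodes_subset h b l))
          (Finset.card_pos.mp hTc) ?_
        exact (Finset.card_le_card hT).trans (card_nodes h b l).le)
    rw [Finset.empty_union, show interp f ∅ = 0 from Lagrange.interpolate_empty _, sub_zero] at h1
    refine h1.trans ?_
    gcongr
    exact le_mul_of_one_le_right hC hone
  have hω : ∀ T : Finset (Kinf F), (T : Set (Kinf F)) ⊆ Metric.closedBall b (‖unif F‖ ^ l) →
      T.card = h + 2 → ∀ u ∈ T, ∀ u' ∈ T, ‖u - u'‖ * ‖divDiff f T‖ ≤ ‖unif F‖ ^ (-(l * h)) * M := by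
    intro T hTB hTc u hu u' hu'
    have h1 : ∀ w ∈ T, ‖divDiff f (T.erase w)‖ ≤ ‖unif F‖ ^ (-(l * h)) * M := by
      intro w hw
      have hc : (T.erase w).card = h + 1 := by rw [Finset.card_erase_of_mem hw, hTc]; rfl
      have := hS (T.erase w) ((Finset.coe_subset.mpr (Finset.erase_subset _ _)).trans hTB)
        (Finset.card_pos.mp (by omega)) hc.le
      rw [hc, Nat.add_sub_cancel, ← zpow_natCast, ← zpow_mul] at this
      rw [zpow_neg, ← div_eq_inv_mul, le_div_iff₀ (zpow_unif_pos _)]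
      exact this
    rw [← norm_divDiff_erase_sub f hu hu', sub_eq_add_neg]
    refine (IsUltrametricDist.norm_add_le_max _ _).trans (max_le (h1 u' hu') ?_)
    rw [norm_neg]
    exact h1 u hu
  have hk : ∀ k, ‖riemannSum ν h f k b l‖ ≤
      C * ‖unif F‖ ^ (-(h : ℤ)) * ‖unif F‖ ^ (-(l * h)) * M := by
    intro k
    induction k with
    | zero => exact h0
    | succ k ih =>
      rw [← sub_add_cancel (riemannSum ν h f (k + 1) b l) (riemannSum ν h f k b l)]
      refine (IsUltrametricDist.norm_add_le_max _ _).trans (max_le ?_ ih)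
      rw [mul_assoc (C * _)]
      exact D.norm_riemannSum_succ_sub_le hd f (by positivity) k hl
        fun T hTB hTc _ => hω T hTB hTc
  exact le_of_tendsto (D.tendsto_riemannSum hd hl hf).norm (Eventually.of_forall hk)

theorem divDiffBounded_eval (p : Polynomial (Cinf F)) (b : Kinf F) (l : ℤ) :
    DivDiffBounded (Metric.closedBall b (‖unif F‖ ^ l)) fun x => p.eval (toC x) := by
  intro k
  have hpow : ∀ i : ℕ, ∃ M, 0 ≤ M ∧
      DivDiffBound (Metric.closedBall b (‖unif F‖ ^ l)) k (fun x => toC x ^ i) M := by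
    intro i
    induction i with
    | zero =>
      refine ⟨1, zero_le_one, fun S _ hne _ => ?_⟩
      simp only [pow_zero]
      rcases Nat.lt_or_ge S.card 2 with h2 | h2
      · obtain ⟨s, rfl⟩ := Finset.card_eq_one.mp (show S.card = 1 by
          have := hne.card_pos
          omega)
        simp [divDiff_singleton]
      · rw [norm_divDiff_one_le h2, norm_zero]
        exact zero_le_one
    | succ i ih =>
      obtain ⟨M, hM, hb⟩ := ih
      refine ⟨max (max (‖unif F‖ ^ l) ‖b‖) 1 * M, by positivity, ?_⟩
      have := hb.sub_mul (R := max (‖unif F‖ ^ l) ‖b‖) 0 hM (fun x hx => by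
        rw [sub_zero, ← sub_add_cancel x b]
        exact (IsUltrametricDist.norm_add_le_max _ _).trans
          (max_le_max (mem_closedBall_iff_norm.mp hx) le_rfl))
      simpa only [sub_zero, ← pow_succ'] using this
  induction p using Polynomial.induction_on' with
  | add p q hp hq =>
    obtain ⟨M, hM, h1⟩ := hp
    obtain ⟨N, hN, h2⟩ := hq
    exact ⟨max M N, le_max_of_le_left hM, by simpa only [Polynomial.eval_add] using h1.add h2⟩
  | monomial i a =>
    obtain ⟨M, hM, h1⟩ := hpow i
    exact ⟨‖a‖ * M, by positivity, by simpa only [Polynomial.eval_monomial] using h1.const_mul a⟩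

/-- If `d > h` the Riemann sums of `p` use interpolants of too small degree. The error on a ball of
radius `|π|^l` comes from divided differences on at least `h + 2` points, hence is of size
`|π|^(-lh) |π|^(l(h+1)) = |π|^l`, and vanishes in the limit. -/
theorem IsMomentData.ballIntegral_eval (D : IsMomentData d h C ν) (hd : h ≤ d)
    {p : Polynomial (Cinf F)} (hp : p.natDegree ≤ d) {b : Kinf F} {l : ℤ} (hl : 0 ≤ l) :
    ballIntegral ν h (fun x => p.eval (toC x)) b l = ν b l p := by
  have hC := D.nonneg
  obtain ⟨M, hM, hb⟩ := divDiffBounded_eval p b l (d + 1)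
  have key : ∀ (k : ℕ) (b' : Kinf F) (l' : ℤ), 0 ≤ l' →
      Metric.closedBall b' (‖unif F‖ ^ l') ⊆ Metric.closedBall b (‖unif F‖ ^ l) →
      ‖riemannSum ν h (fun x => p.eval (toC x)) k b' l' - ν b' l' p‖ ≤
        C * M * ‖unif F‖ ^ (l' + k) := by
    intro k
    induction k with
    | zero =>
      intro b' l' hl' hsub
      have hle : ‖unif F‖ ^ l' ≤ 1 := by
        rw [← zpow_zero ‖unif F‖, zpow_unif_le]
        exact hl'
      have hun : nodes h b' l' ∪ nodes d b' l' = nodes d b' l' :=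
        Finset.union_eq_right.mpr (nodes_mono hd b' l')
      -- With `d + 1` nodes the interpolant is `p` itself, so passing from `h + 1` to `d + 1` nodes
      -- measures the error.
      have h1 := D.norm_interp_sub_le hl' (fun x => p.eval (toC x)) (nodes h b' l') (nodes d b' l')
        (M := M * (‖unif F‖ ^ l') ^ (h + 1)) (mul_nonneg hM (pow_nonneg (zpow_unif_pos _).le _))
        (fun x hx => norm_sub_le_of_mem_nodes (by rwa [hun] at hx))
        (by rw [hun, card_nodes]) (fun T hT hTc => by
          rw [hun] at hT
          rw [card_nodes] at hTc
          refine mul_le_mul (hb T ?_ (Finset.card_pos.mp (by omega)) ?_)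
            (pow_le_pow_of_le_one (zpow_unif_pos _).le hle (by omega))
            (pow_nonneg (zpow_unif_pos _).le _) hM
          · exact ((Finset.coe_subset.mpr hT).trans (nodes_subset d b' l')).trans hsub
          · exact (Finset.card_le_card hT).trans (card_nodes d b' l').le)
      rw [hun, interp_eval p (S := nodes d b' l') (by
        rw [card_nodes]
        exact Polynomial.degree_le_natDegree.trans_lt (by exact_mod_cast Nat.lt_succ_of_le hp)),
        map_sub, norm_sub_rev] at h1
      refine h1.trans_eq ?_
      rw [Nat.cast_zero, add_zero, ← zpow_natCast, ← zpow_mul, mul_assoc, mul_left_comm (_ ^ _),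
        ← zpow_add₀ norm_unif_pos.ne', ← mul_assoc]
      congr 2
      push_cast
      ring
    | succ k ih =>
      intro b' l' hl' hsub
      rw [riemannSum, D.add b' l' p, ← Finset.sum_sub_distrib]
      refine norm_sum_le_of_le' _ _ (mul_nonneg (mul_nonneg hC hM) (zpow_unif_pos _).le)
        fun ε _ => ?_
      rw [show l' + ((k + 1 : ℕ) : ℤ) = l' + 1 + k by push_cast; ring]
      exact ih _ _ (by omega) ((closedBall_subCenter_subset b' l' ε).trans hsub)
  have h1 := D.tendsto_riemannSum hd hl ((divDiffBounded_eval p b l).isTame h)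
  refine tendsto_nhds_unique h1 ?_
  rw [tendsto_iff_norm_sub_tendsto_zero]
  have h2 : Tendsto (fun k : ℕ => C * M * ‖unif F‖ ^ (l + k)) atTop (𝓝 0) := by
    have := (tendsto_pow_atTop_nhds_zero_of_lt_one norm_unif_pos.le
      (norm_unif_lt_one (F := F))).const_mul (C * M * ‖unif F‖ ^ l)
    rw [mul_zero] at this
    refine this.congr fun k => ?_
    rw [zpow_add₀ norm_unif_pos.ne', zpow_natCast, mul_assoc, mul_assoc]
  exact squeeze_zero (fun _ => norm_nonneg _) (fun k => key k b l hl subset_rfl) h2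

/-- The integral of a polynomial on a ball, extended by zero to a larger ball. -/
theorem IsMomentData.ballIntegral_of_eq_eval (D : IsMomentData d h C ν) (hd : h ≤ d)
    {p : Polynomial (Cinf F)} (hp : p.natDegree ≤ d) {f : Kinf F → Cinf F} {b : Kinf F} (k : ℕ)
    {a : Kinf F} {m : ℤ} (hm : 0 ≤ m) (hab : ‖b - a‖ ≤ ‖unif F‖ ^ m)
    (hf : IsTame h (Metric.closedBall a (‖unif F‖ ^ m)) f)
    (h1 : ∀ x, ‖x - b‖ ≤ ‖unif F‖ ^ (m + k) → f x = p.eval (toC x))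
    (h0 : ∀ x, ‖x - a‖ ≤ ‖unif F‖ ^ m → ¬ ‖x - b‖ ≤ ‖unif F‖ ^ (m + k) → f x = 0) :
    ballIntegral ν h f a m = ν b (m + k) p := by
  induction k generalizing a m with
  | zero =>
    rw [Nat.cast_zero, add_zero] at *
    rw [ballIntegral_congr (g := fun x => p.eval (toC x)) fun x hx => h1 x ?_,
      D.ballIntegral_eval hd hp hm, D.congr a b m (by rwa [norm_sub_rev])]
    rw [norm_sub_rev] at hab
    exact norm_sub_le_of_le (mem_closedBall_iff_norm.mp hx) hab
  | succ k ih =>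
    obtain ⟨ε, hε⟩ := exists_norm_sub_subCenter_le hab
    have e : m + ((k + 1 : ℕ) : ℤ) = m + 1 + k := by push_cast; ring
    rw [D.ballIntegral_eq_sum hd hm hf, Finset.sum_eq_single ε]
    · rw [e] at h1 h0 ⊢
      refine ih (by omega) hε (hf.mono (closedBall_subCenter_subset a m ε)) h1 fun x hx => h0 x ?_
      exact norm_sub_le_of_norm_sub_subCenter_le hx
    · intro ε' _ hne
      rw [ballIntegral_congr (g := fun _ => 0) fun x hx => ?_, ballIntegral_zero]
      rw [mem_closedBall_iff_norm] at hx
      refine h0 x (norm_sub_le_of_norm_sub_subCenter_le hx) fun hxb => hne ?_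
      refine eq_of_norm_sub_subCenter_le hx ?_
      exact norm_sub_le_of_le (hxb.trans (zpow_unif_le.mpr (by push_cast; omega))) hε
    · intro h
      exact absurd (Finset.mem_univ ε) h

end Integration

/-! ### Binary forms, polynomials and linear substitutions -/

section Forms
variable {F : Type*} [Field F] [Fintype F] {d : ℕ}

open Polynomial in
/-- `P(X, Y) ↦ P(aX + bY, cX + dY)` for a matrix `M = (a, b; c, d)` over `C_∞`. -/
def subst (d : ℕ) (M : Matrix (Fin 2) (Fin 2) (Cinf F)) : Form F d →ₗ[Cinf F] Form F d :=
  (MvPolynomial.aeval (fun i : Fin 2 =>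
    (MvPolynomial.C (M i 0) * MvPolynomial.X 0 + MvPolynomial.C (M i 1) * MvPolynomial.X 1 :
        MvPolynomial (Fin 2) (Cinf F)))).toLinearMap.restrict (by
    intro p hp
    rw [MvPolynomial.mem_homogeneousSubmodule] at hp ⊢
    have := hp.aeval (fun i : Fin 2 =>
      (MvPolynomial.C (M i 0) * MvPolynomial.X 0 + MvPolynomial.C (M i 1) * MvPolynomial.X 1 :
        MvPolynomial (Fin 2) (Cinf F))) (n := 1) (fun i => by
          refine MvPolynomial.IsHomogeneous.add ?_ ?_ <;>
          exact (MvPolynomial.isHomogeneous_X _ _).C_mul _)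
    rwa [one_mul] at this)

theorem formSubst_eq (g : GL (Fin 2) (RatFunc F)) : formSubst d g = subst d (g.1.map (kToC F)) := rfl

/-- The linear forms `aX + bY` and `cX + dY`. -/
def linForm (M : Matrix (Fin 2) (Fin 2) (Cinf F)) (i : Fin 2) : MvPolynomial (Fin 2) (Cinf F) :=
  MvPolynomial.C (M i 0) * MvPolynomial.X 0 + MvPolynomial.C (M i 1) * MvPolynomial.X 1

theorem aeval_linForm (M N : Matrix (Fin 2) (Fin 2) (Cinf F)) (i : Fin 2) :
    MvPolynomial.aeval (linForm M) (linForm N i) = linForm (N * M) i := by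
  rw [linForm, linForm, map_add, map_mul, map_mul, MvPolynomial.aeval_X, MvPolynomial.aeval_X,
    MvPolynomial.algHom_C, MvPolynomial.algHom_C, MvPolynomial.algebraMap_eq, linForm, linForm,
    Matrix.mul_apply, Matrix.mul_apply, Fin.sum_univ_two, Fin.sum_univ_two, map_add, map_add,
    map_mul, map_mul, map_mul, map_mul]
  ring

theorem subst_subst (M N : Matrix (Fin 2) (Fin 2) (Cinf F)) (P : Form F d) :
    subst d M (subst d N P) = subst d (N * M) P := by
  have h : (MvPolynomial.aeval (linForm M)).comp (MvPolynomial.aeval (linForm N)) =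
      MvPolynomial.aeval (linForm (N * M)) := MvPolynomial.algHom_ext fun i => by
    rw [AlgHom.comp_apply, MvPolynomial.aeval_X, MvPolynomial.aeval_X, aeval_linForm]
  exact Subtype.ext (DFunLike.congr_fun h P.1)

theorem subst_one (P : Form F d) : subst d 1 P = P := by
  have h : MvPolynomial.aeval (linForm 1) = AlgHom.id (Cinf F) (MvPolynomial (Fin 2) (Cinf F)) :=
    MvPolynomial.algHom_ext fun i => by
      rw [MvPolynomial.aeval_X, AlgHom.id_apply, linForm]
      fin_cases i <;> simp [Matrix.one_apply]
  exact Subtype.ext (DFunLike.congr_fun h P.1)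

/-- The form `Y^d p(X / Y)` for a polynomial `p` (terms of degree larger than `d` are dropped). -/
def hom (d : ℕ) : Polynomial (Cinf F) →ₗ[Cinf F] Form F d :=
  (Polynomial.homogenizeLM d).codRestrict _ fun p => Polynomial.isHomogeneous_homogenize p

theorem hom_coe (p : Polynomial (Cinf F)) : (hom d p).1 = p.homogenize d := rfl

theorem monomialForm_eq_hom {i : ℕ} (hi : i ≤ d) : monomialForm F d i hi = hom d (Polynomial.X ^ i) :=
  Subtype.ext (Polynomial.homogenize_X_pow hi).symm

theorem natDegree_aeval_le (P : Form F d) (u v : Polynomial (Cinf F)) (hu : u.natDegree ≤ 1)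
    (hv : v.natDegree ≤ 1) : (MvPolynomial.aeval ![u, v] P.1).natDegree ≤ d := by
  rw [P.1.as_sum, map_sum]
  refine Polynomial.natDegree_sum_le_of_forall_le _ _ fun m hm => ?_
  have h1 := P.2 (MvPolynomial.mem_support_iff.mp hm)
  rw [Finsupp.weight_apply, Finsupp.sum_fintype _ _ (by simp), Fin.sum_univ_two] at h1
  simp only [Pi.one_apply, smul_eq_mul, mul_one] at h1
  rw [MvPolynomial.aeval_monomial, Finsupp.prod_fintype _ _ (by simp), Fin.prod_univ_two]
  refine (Polynomial.natDegree_C_mul_le _ _).trans (Polynomial.natDegree_mul_le.trans ?_)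
  refine le_trans (add_le_add (Polynomial.natDegree_pow_le.trans (Nat.mul_le_mul_left _ hu))
    (Polynomial.natDegree_pow_le.trans (Nat.mul_le_mul_left _ hv))) ?_
  omega

/-- The polynomial `P(x, 1)`. -/
def dehom (P : Form F d) : Polynomial (Cinf F) := MvPolynomial.aeval ![Polynomial.X, 1] P.1

theorem hom_dehom (P : Form F d) : hom d (dehom P) = P :=
  Subtype.ext (Polynomial.homogenize_eq_of_isHomogeneous P.2 rfl)

theorem natDegree_dehom_le (P : Form F d) : (dehom P).natDegree ≤ d :=
  natDegree_aeval_le P _ _ Polynomial.natDegree_X_le (by simp)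

theorem dehom_hom {p : Polynomial (Cinf F)} (hp : p.natDegree ≤ d) : dehom (hom d p) = p :=
  Polynomial.aeval_homogenize_X_one p hp

open Polynomial in
/-- `(c x + d)^d' p((a x + b)/(c x + d))` for a polynomial `p` of degree at most `d'`. -/
def slash (d : ℕ) (M : Matrix (Fin 2) (Fin 2) (Cinf F)) (p : Polynomial (Cinf F)) :
    Polynomial (Cinf F) :=
  ∑ i ∈ Finset.range (d + 1), C (p.coeff i) * (C (M 0 0) * X + C (M 0 1)) ^ i *
    (C (M 1 0) * X + C (M 1 1)) ^ (d - i)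

theorem slashPoly_eq (g : GL (Fin 2) (RatFunc F)) (p : Polynomial (Cinf F)) :
    slashPoly d g p = slash d (g.1.map (kToC F)) p := rfl

theorem natDegree_linear_le (a b : Cinf F) :
    (Polynomial.C a * Polynomial.X + Polynomial.C b).natDegree ≤ 1 := by compute_degree

theorem natDegree_slash_le (M : Matrix (Fin 2) (Fin 2) (Cinf F)) (p : Polynomial (Cinf F)) :
    (slash d M p).natDegree ≤ d := by
  refine Polynomial.natDegree_sum_le_of_forall_le _ _ fun i hi => ?_
  have hi := Finset.mem_range.mp hi
  rw [mul_assoc]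
  refine (Polynomial.natDegree_C_mul_le _ _).trans (Polynomial.natDegree_mul_le.trans ?_)
  refine le_trans (add_le_add
    (Polynomial.natDegree_pow_le.trans (Nat.mul_le_mul_left _ (natDegree_linear_le _ _)))
    (Polynomial.natDegree_pow_le.trans (Nat.mul_le_mul_left _ (natDegree_linear_le _ _)))) ?_
  omega

theorem hom_eq_sum (p : Polynomial (Cinf F)) :
    hom d p = ∑ i ∈ Finset.range (d + 1), p.coeff i • hom d (Polynomial.X ^ i) := by
  apply Subtype.ext
  rw [hom_coe, Polynomial.homogenize, Finset.Nat.sum_antidiagonal_eq_sum_range_succ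
    (f := fun i j => MvPolynomial.monomial ((Finsupp.single 0 i).update 1 j) (p.coeff i))]
  rw [AddSubmonoidClass.coe_finsetSum]
  refine Finset.sum_congr rfl fun i hi => ?_
  have hi : i ≤ d := Nat.lt_succ_iff.mp (Finset.mem_range.mp hi)
  rw [Submodule.coe_smul, hom_coe, Polynomial.X_pow_eq_monomial, Polynomial.homogenize_monomial hi,
    MvPolynomial.smul_monomial, smul_eq_mul, mul_one]

theorem dehom_subst (M : Matrix (Fin 2) (Fin 2) (Cinf F)) (P : Form F d) :
    dehom (subst d M P) = MvPolynomial.aeval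
      (fun i => Polynomial.C (M i 0) * Polynomial.X + Polynomial.C (M i 1)) P.1 := by
  have h : (MvPolynomial.aeval ![Polynomial.X, 1]).comp (MvPolynomial.aeval (linForm M)) =
      MvPolynomial.aeval (R := Cinf F)
        (fun i => Polynomial.C (M i 0) * Polynomial.X + Polynomial.C (M i 1)) :=
    MvPolynomial.algHom_ext fun i => by
      rw [AlgHom.comp_apply, MvPolynomial.aeval_X, MvPolynomial.aeval_X, linForm, map_add, map_mul,
        map_mul, MvPolynomial.aeval_X, MvPolynomial.aeval_X, MvPolynomial.algHom_C,
        MvPolynomial.algHom_C]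
      simp [Polynomial.algebraMap_eq]
  exact DFunLike.congr_fun h P.1

theorem dehom_subst_hom (M : Matrix (Fin 2) (Fin 2) (Cinf F)) (p : Polynomial (Cinf F)) :
    dehom (subst d M (hom d p)) = slash d M p := by
  rw [hom_eq_sum, dehom_subst, slash, AddSubmonoidClass.coe_finsetSum, map_sum]
  refine Finset.sum_congr rfl fun i hi => ?_
  have hi : i ≤ d := Nat.lt_succ_iff.mp (Finset.mem_range.mp hi)
  rw [Submodule.coe_smul, map_smul, hom_coe, Polynomial.homogenize_X_pow hi, map_mul, map_pow,
    map_pow, MvPolynomial.aeval_X, MvPolynomial.aeval_X, Polynomial.smul_eq_C_mul, mul_assoc]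

theorem subst_hom (M : Matrix (Fin 2) (Fin 2) (Cinf F)) (p : Polynomial (Cinf F)) :
    subst d M (hom d p) = hom d (slash d M p) := by
  rw [← dehom_subst_hom, hom_dehom]

theorem slash_X_pow (M : Matrix (Fin 2) (Fin 2) (Cinf F)) {i : ℕ} (hi : i ≤ d) :
    slash d M (Polynomial.X ^ i) = (Polynomial.C (M 0 0) * Polynomial.X + Polynomial.C (M 0 1)) ^ i *
      (Polynomial.C (M 1 0) * Polynomial.X + Polynomial.C (M 1 1)) ^ (d - i) := by
  rw [slash, Finset.sum_eq_single_of_mem i (Finset.mem_range.mpr (by omega))]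
  · simp
  · intro j _ hj
    simp [Polynomial.coeff_X_pow, hj]

/-- The coefficients have absolute value at most one. -/
def IntegralPoly (p : Polynomial (Cinf F)) : Prop := ∀ i, ‖p.coeff i‖ ≤ 1

theorem IntegralPoly.mul {p p' : Polynomial (Cinf F)} (hp : IntegralPoly p) (hp' : IntegralPoly p') :
    IntegralPoly (p * p') := by
  intro i
  rw [Polynomial.coeff_mul]
  refine norm_sum_le_of_le' _ _ zero_le_one fun x _ => ?_
  rw [norm_mul]
  exact mul_le_one₀ (hp _) (norm_nonneg _) (hp' _)

theorem IntegralPoly.pow {p : Polynomial (Cinf F)} (hp : IntegralPoly p) (k : ℕ) :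
    IntegralPoly (p ^ k) := by
  induction k with
  | zero =>
    intro i
    rw [pow_zero, Polynomial.coeff_one]
    split_ifs <;> simp
  | succ k ih => rw [pow_succ]; exact ih.mul hp

theorem integralPoly_linear {a b : Cinf F} (ha : ‖a‖ ≤ 1) (hb : ‖b‖ ≤ 1) :
    IntegralPoly (Polynomial.C a * Polynomial.X + Polynomial.C b) := by
  intro i
  match i with
  | 0 => simpa using hb
  | 1 => simpa using ha
  | i + 2 => simp

/-- An integral substitution sends monomials to forms with integral coefficients, so it cannot
increase the maximum of a functional over the monomials. -/
theorem norm_subst_le {M : Matrix (Fin 2) (Fin 2) (Cinf F)} (hM : ∀ i j, ‖M i j‖ ≤ 1)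
    (lam : Module.Dual (Cinf F) (Form F d)) {B : ℝ}
    (hB : ∀ i ≤ d, ‖lam (hom d (Polynomial.X ^ i))‖ ≤ B) {i : ℕ} (hi : i ≤ d) :
    ‖lam (subst d M (hom d (Polynomial.X ^ i)))‖ ≤ B := by
  have hB0 : 0 ≤ B := (norm_nonneg _).trans (hB 0 (Nat.zero_le d))
  have h1 : IntegralPoly (slash d M (Polynomial.X ^ i)) := by
    rw [slash_X_pow M hi]
    exact ((integralPoly_linear (hM _ _) (hM _ _)).pow _).mul
      ((integralPoly_linear (hM _ _) (hM _ _)).pow _)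
  rw [subst_hom, hom_eq_sum, map_sum]
  refine norm_sum_le_of_le' _ _ hB0 fun j hj => ?_
  rw [map_smul, smul_eq_mul, norm_mul]
  exact (mul_le_of_le_one_left (norm_nonneg _) (h1 j)).trans
    (hB j (Nat.lt_succ_iff.mp (Finset.mem_range.mp hj)))

theorem subst_smul_one (z : Cinf F) (P : Form F d) :
    subst d (z • (1 : Matrix (Fin 2) (Fin 2) (Cinf F))) P = z ^ d • P := by
  rw [← hom_dehom P, hom_eq_sum, map_sum, Finset.smul_sum]
  refine Finset.sum_congr rfl fun i hi => ?_
  have hi : i ≤ d := Nat.lt_succ_iff.mp (Finset.mem_range.mp hi)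
  rw [map_smul, smul_comm (z ^ d), subst_hom, slash_X_pow _ hi]
  congr 1
  rw [← map_smul]
  congr 1
  simp only [Matrix.smul_apply, Matrix.one_apply_eq, smul_eq_mul, mul_one, ne_eq, zero_ne_one,
    not_false_eq_true, Matrix.one_apply_ne, mul_zero, map_zero, add_zero, one_ne_zero, zero_mul,
    zero_add]
  rw [mul_pow, mul_right_comm, ← map_pow, ← map_pow, ← map_mul, ← pow_add,
    Nat.add_sub_cancel' hi, Polynomial.smul_eq_C_mul]

end Forms


/-! ### Transport of cocycles by matrices and vanishing at `∞` -/

section Twist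
variable {F : Type*} [Field F] [Fintype F] {d : ℕ}
open scoped Classical

/-- The entries of a matrix, in `C_∞`. -/
def matC (g : GL (Fin 2) (Kinf F)) : Matrix (Fin 2) (Fin 2) (Cinf F) := g.1.map toC

theorem matC_apply (g : GL (Fin 2) (Kinf F)) (i j : Fin 2) : matC g i j = toC (g i j) := rfl

theorem matC_mul (g g' : GL (Fin 2) (Kinf F)) : matC (g * g') = matC g * matC g' :=
  Matrix.map_mul

theorem matC_one : matC (1 : GL (Fin 2) (Kinf F)) = 1 :=
  Matrix.map_one _ (map_zero _) (map_one _)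

/-- The function `e ↦ c(g e) ∘ g⁻¹`. -/
def twist (c : Edge F → Module.Dual (Cinf F) (Form F d)) (g : GL (Fin 2) (Kinf F)) :
    Edge F → Module.Dual (Cinf F) (Form F d) :=
  fun e => c (e.act g) ∘ₗ subst d (matC g⁻¹)

variable (c : Edge F → Module.Dual (Cinf F) (Form F d))

theorem twist_apply (g : GL (Fin 2) (Kinf F)) (e : Edge F) (P : Form F d) :
    twist c g e P = c (e.act g) (subst d (matC g⁻¹) P) := rfl

theorem twist_mul (g g' : GL (Fin 2) (Kinf F)) : twist c (g * g') = twist (twist c g) g' := by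
  ext1 e
  refine LinearMap.ext fun P => ?_
  rw [twist_apply, twist_apply, twist_apply, subst_subst, ← matC_mul, Edge.act_mul, mul_inv_rev]

theorem twist_subst (g : GL (Fin 2) (Kinf F)) (e : Edge F) (P : Form F d) :
    twist c g e (subst d (matC g) P) = c (e.act g) P := by
  rw [twist_apply, subst_subst, ← matC_mul, mul_inv_cancel, matC_one, subst_one]

/-- The conditions on a harmonic cocycle which do not involve the group. -/
structure IsHarmonic (c : Edge F → Module.Dual (Cinf F) (Form F d)) : Prop where
  sum : ∀ v : Vertex F, ∑ e ∈ (finite_edges_into v).toFinset, c e = 0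
  opp : ∀ e e' : Edge F, e'.src = e.tgt → e'.tgt = e.src → c e + c e' = 0

variable {c}

theorem Vertex.act_injective (g : GL (Fin 2) (Kinf F)) : Function.Injective (Vertex.act g) := by
  intro v w h
  rw [← v.act_one, ← w.act_one, ← inv_mul_cancel g, Vertex.act_mul, Vertex.act_mul, h]

theorem IsHarmonic.twist (hc : IsHarmonic c) (g : GL (Fin 2) (Kinf F)) : IsHarmonic (twist c g) where
  sum v := by
    refine LinearMap.ext fun P => ?_
    have h1 := LinearMap.congr_fun (hc.sum (v.act g)) (subst d (matC g⁻¹) P)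
    rw [LinearMap.sum_apply] at h1 ⊢
    refine Eq.trans ?_ h1
    refine Finset.sum_bij (fun e _ => e.act g) ?_ ?_ ?_ fun e _ => rfl
    · intro e he
      rw [Set.Finite.mem_toFinset] at he ⊢
      exact congrArg (Vertex.act g) he
    · intro e _ e' _ h
      exact Edge.ext (Vertex.act_injective g (congrArg Edge.src h))
        (Vertex.act_injective g (congrArg Edge.tgt h))
    · intro e he
      rw [Set.Finite.mem_toFinset] at he
      refine ⟨e.act g⁻¹, ?_, ?_⟩
      · rw [Set.Finite.mem_toFinset]
        refine (congrArg (Vertex.act g⁻¹) he).trans ?_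
        rw [← Vertex.act_mul, inv_mul_cancel, Vertex.act_one]
      · rw [← Edge.act_mul, mul_inv_cancel, Edge.act_one]
  opp e e' h h' := by
    refine LinearMap.ext fun P => ?_
    exact LinearMap.congr_fun (hc.opp (e.act g) (e'.act g) (congrArg (Vertex.act g) h)
      (congrArg (Vertex.act g) h')) (subst d (matC g⁻¹) P)

theorem IsHarmonic.eq_sum (hc : IsHarmonic c) (b : Kinf F) (l : ℤ) :
    c (downEdge b l) = ∑ ε : F, c (downEdge (subCenter b l ε) (l + 1)) := by
  rw [← sub_eq_zero, ← sum_edges_into_ballVertex c b l hc.opp, hc.sum]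

theorem IsHarmonic.upEdge (hc : IsHarmonic c) (b : Kinf F) (l : ℤ) :
    c (upEdge b l) = -c (downEdge b l) :=
  (neg_eq_of_add_eq_zero_right (hc.opp (downEdge b l) (CharPMeasure.upEdge b l) rfl rfl)).symm

theorem downEdge_act_latMat (b : Kinf F) (l k : ℤ) :
    (downEdge 0 k).act (latMat b l 0) = downEdge b (l + k) :=
  Edge.ext ((ballVertex_act_latMat b l (k - 1)).trans (by rw [← add_sub_assoc]; rfl))
    (ballVertex_act_latMat b l k)

theorem norm_polyEmb_le {p : Polynomial F} {k : ℤ} (hp : ∀ i : ℕ, k < i → p.coeff i = 0) :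
    ‖polyEmb F p‖ ≤ ‖unif F‖ ^ (-k) := by
  rw [norm_le_zpow_iff]
  intro m hm
  rcases le_or_gt m 0 with h0 | h0
  · obtain ⟨i, rfl⟩ := Int.exists_eq_neg_ofNat h0
    rw [coeff_polyEmb]
    exact hp i (by omega)
  · rw [polyEmb, Polynomial.coe_eval₂RingHom, Polynomial.eval₂_eq_sum_range, HahnSeries.coeff_sum]
    refine Finset.sum_eq_zero fun i _ => ?_
    rw [tInf, HahnSeries.single_pow, HahnSeries.C_mul_eq_smul, HahnSeries.coeff_smul,
      HahnSeries.coeff_single_of_ne, smul_zero]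
    rw [smul_neg, nsmul_one]
    omega

variable (F) in
theorem card_eq_zero_Cinf : (Fintype.card F : Cinf F) = 0 := by
  have h := congrArg (toC.comp HahnSeries.C : F →+* Cinf F) (FiniteField.cast_card_eq_zero F)
  rwa [map_natCast, map_zero] at h

theorem slash_latMat (b : Kinf F) {i : ℕ} (hi : i ≤ d) :
    slash d (matC (latMat b 0 0)) (Polynomial.X ^ i) =
      (Polynomial.X + Polynomial.C (toC b)) ^ i := by
  rw [slash_X_pow _ hi]
  simp [matC_apply, latMat]

/-- A harmonic function that is invariant under enough translations vanishes near the cusp `∞`. -/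
theorem IsHarmonic.exists_eq_zero (hc : IsHarmonic c) {N : Polynomial F} (hN : N ≠ 0)
    (hinv : ∀ a : Polynomial F, CharPMeasure.twist c (latMat (polyEmb F (a * N)) 0 0) = c) :
    ∃ L₀ : ℕ, ∀ L ≥ L₀, c (downEdge 0 (-(L : ℤ))) = 0 := by
  -- The sub-balls of the ball of radius `|π|^(-(L+1))` are translates of the ball of radius
  -- `|π|^(-L)` by elements under which the function is invariant.
  have step : ∀ L : ℕ, N.natDegree ≤ L → ∃ b : F → Kinf F, c (downEdge 0 (-((L + 1 : ℕ) : ℤ))) =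
      ∑ ε : F, c (downEdge 0 (-(L : ℤ))) ∘ₗ subst d (matC (latMat (b ε) 0 0)) := by
    intro L hL
    -- Chosen so that `a * N` has leading term `X^(L+1)`. Then `ε a N` differs from the centre of a
    -- sub-ball by a polynomial of degree at most `L`, which does not change the ball.
    set a : Polynomial F := Polynomial.C N.leadingCoeff⁻¹ * Polynomial.X ^ (L + 1 - N.natDegree)
    have haN : ∀ i, L < i → (a * N).coeff i = (Polynomial.X ^ (L + 1) : Polynomial F).coeff i := by
      intro i hi
      rw [mul_assoc, Polynomial.coeff_C_mul, mul_comm (Polynomial.X ^ _), Polynomial.coeff_X_pow]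
      split_ifs with h
      · have : i = N.natDegree + (L + 1 - N.natDegree) := by omega
        rw [this, Polynomial.coeff_mul_X_pow, Polynomial.coeff_natDegree,
          inv_mul_cancel₀ (Polynomial.leadingCoeff_ne_zero.mpr hN)]
      · rw [Polynomial.coeff_eq_zero_of_natDegree_lt, mul_zero]
        refine Polynomial.natDegree_mul_le.trans_lt ?_
        rw [Polynomial.natDegree_X_pow]
        omega
    refine ⟨fun ε => polyEmb F (Polynomial.C ε * a * N), ?_⟩
    rw [hc.eq_sum]
    refine Finset.sum_congr rfl fun ε _ => ?_
    rw [show -((L + 1 : ℕ) : ℤ) + 1 = -L by push_cast; ring]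
    have h1 : downEdge (subCenter 0 (-((L + 1 : ℕ) : ℤ)) ε) (-(L : ℤ)) =
        (downEdge 0 (-(L : ℤ))).act (latMat (polyEmb F (Polynomial.C ε * a * N)) 0 0) := by
      rw [downEdge_act_latMat, zero_add]
      refine downEdge_congr ?_
      have : subCenter 0 (-((L + 1 : ℕ) : ℤ)) ε - polyEmb F (Polynomial.C ε * a * N) =
          polyEmb F (Polynomial.C ε * (Polynomial.X ^ (L + 1) - a * N)) := by
        rw [subCenter, zero_add, mul_sub, map_sub, ← mul_assoc (Polynomial.C ε) a N,
          map_mul _ (Polynomial.C ε) (Polynomial.X ^ _), map_pow, polyEmb_C, polyEmb_X, zpow_neg,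
          inv_pow, zpow_natCast]
      rw [this]
      refine norm_polyEmb_le fun i hi => ?_
      rw [Polynomial.coeff_C_mul, Polynomial.coeff_sub, haN i (by omega), sub_self, mul_zero]
    refine LinearMap.ext fun P => ?_
    rw [h1, ← twist_subst, hinv]
    rfl
  -- Each step of the splitting lets the functional annihilate one more power of `X`.
  have key : ∀ k : ℕ, ∀ i < k, i ≤ d →
      c (downEdge 0 (-((N.natDegree + k : ℕ) : ℤ))) (hom d (Polynomial.X ^ i)) = 0 := by
    intro k
    induction k with
    | zero => intro i hi; omega
    | succ k ih =>
      intro i hi hid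
      obtain ⟨b, hb⟩ := step (N.natDegree + k) (by omega)
      rw [← add_assoc, hb, LinearMap.sum_apply]
      simp only [LinearMap.comp_apply, subst_hom, slash_latMat _ hid]
      rw [← map_sum, ← map_sum, hom_eq_sum, map_sum]
      refine Finset.sum_eq_zero fun j hj => ?_
      rw [map_smul]
      by_cases hji : j < i
      · rw [ih j (by omega) (by omega), smul_zero]
      · have h0 : (∑ ε : F, (Polynomial.X + Polynomial.C (toC (b ε))) ^ i).coeff j = 0 := by
          rw [Polynomial.finsetSum_coeff]
          simp only [Polynomial.coeff_X_add_C_pow]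
          rcases (not_lt.mp hji).lt_or_eq with h | rfl
          · simp [Nat.choose_eq_zero_of_lt h]
          · simp [card_eq_zero_Cinf]
        rw [h0, zero_smul]
  refine ⟨N.natDegree + d + 1, fun L hL => ?_⟩
  refine LinearMap.ext fun P => ?_
  rw [← hom_dehom P, hom_eq_sum, map_sum]
  refine Finset.sum_eq_zero fun i hi => ?_
  have hi := Finset.mem_range.mp hi
  have := key (L - N.natDegree) i (by omega) (by omega)
  rw [Nat.add_sub_cancel' (by omega)] at this
  rw [map_smul, this, smul_zero]

end Twist


/-! ### Reduction theory and propagation of bounds -/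

section Growth
variable {F : Type*} [Field F] [Fintype F] {d : ℕ}

variable (F) in
/-- The embedding of `SL₂(F[T])` into `GL₂(k_∞)`. -/
def slK : Matrix.SpecialLinearGroup (Fin 2) (Polynomial F) →* GL (Fin 2) (Kinf F) :=
  Matrix.SpecialLinearGroup.toGL.comp (Matrix.SpecialLinearGroup.map (polyEmb F))

theorem slK_val (δ : Matrix.SpecialLinearGroup (Fin 2) (Polynomial F)) :
    (slK F δ).1 = δ.1.map (polyEmb F) := rfl

theorem det_slK (δ : Matrix.SpecialLinearGroup (Fin 2) (Polynomial F)) : (slK F δ).1.det = 1 :=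
  (Matrix.SpecialLinearGroup.map (polyEmb F) δ).2

/-- A bound for the value of a cocycle on the edge `g e₀`, which takes the action of `g` into account. -/
def IsBoundedAt (c : Edge F → Module.Dual (Cinf F) (Form F d)) (M : ℝ) (g : GL (Fin 2) (Kinf F)) :
    Prop :=
  ∀ i ≤ d, ‖twist c g (downEdge 0 0) (hom d (Polynomial.X ^ i))‖ ^ 2 * ‖g.1.det‖ ^ d ≤ M

variable {c : Edge F → Module.Dual (Cinf F) (Form F d)} {M : ℝ} {g : GL (Fin 2) (Kinf F)}

theorem norm_det_pos (g : GL (Fin 2) (Kinf F)) : 0 < ‖g.1.det‖ :=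
  norm_pos_iff.mpr (Matrix.GeneralLinearGroup.det g).ne_zero

theorem IsBoundedAt.nonneg (h : IsBoundedAt c M g) : 0 ≤ M :=
  le_trans (by positivity) (h 0 (Nat.zero_le d))

theorem IsBoundedAt.mono {M' : ℝ} (h : IsBoundedAt c M g) (hM : M ≤ M') : IsBoundedAt c M' g :=
  fun i hi => (h i hi).trans hM

/-- Passing from `g` to `g k` composes the functional with the substitution by `k⁻¹`, which is
integral and increases nothing. Only the determinant changes the normalisation. -/
theorem IsBoundedAt.mul_of_norm_le (h : IsBoundedAt c M g) {k : GL (Fin 2) (Kinf F)}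
    (hk : ∀ i j, ‖k⁻¹ i j‖ ≤ 1)
    (he : ∀ P, ‖twist c g ((downEdge 0 0).act k) P‖ = ‖twist c g (downEdge 0 0) P‖) :
    IsBoundedAt c (M * ‖k.1.det‖ ^ d) (g * k) := by
  intro i hi
  have hD : 0 < ‖g.1.det‖ ^ d := pow_pos (norm_det_pos g) d
  have h1 : ‖twist c (g * k) (downEdge 0 0) (hom d (Polynomial.X ^ i))‖ ≤
      √(M / ‖g.1.det‖ ^ d) := by
    rw [twist_mul, twist_apply, he]
    refine norm_subst_le (fun i j => ?_) _ (fun j hj => ?_) hi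
    · rw [matC_apply, norm_toC]
      exact hk i j
    · exact Real.le_sqrt_of_sq_le ((le_div_iff₀ hD).mpr (h j hj))
  have h2 := pow_le_pow_left₀ (norm_nonneg _) h1 2
  rw [Real.sq_sqrt (div_nonneg h.nonneg hD.le)] at h2
  rw [Units.val_mul, Matrix.det_mul, norm_mul, mul_pow, ← mul_assoc]
  exact mul_le_mul_of_nonneg_right ((le_div_iff₀ hD).mp h2) (by positivity)

theorem inv_apply_fin_two (k : GL (Fin 2) (Kinf F)) : (k⁻¹).1 =
    (k.1.det)⁻¹ • !![k 1 1, -k 0 1; -k 1 0, k 0 0] := by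
  rw [Matrix.coe_units_inv, Matrix.inv_def, Matrix.adjugate_fin_two, Ring.inverse_eq_inv']

theorem IsIntegralGL.norm_inv_le {k : GL (Fin 2) (Kinf F)} (hk : IsIntegralGL k) (i j : Fin 2) :
    ‖k⁻¹ i j‖ ≤ 1 := by
  rw [inv_apply_fin_two, Matrix.smul_apply, smul_eq_mul, norm_mul, norm_inv, hk.2, inv_one, one_mul]
  fin_cases i <;> fin_cases j <;> simp [hk.1]

theorem IsBoundedAt.mul_iwahori (h : IsBoundedAt c M g) {k : GL (Fin 2) (Kinf F)}
    (hk : IsIwahori k) : IsBoundedAt c M (g * k) := by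
  have := h.mul_of_norm_le hk.1.norm_inv_le fun P => by rw [downEdge_act_iwahori hk]
  rwa [hk.1.2, one_pow, mul_one] at this

/-- A scalar `z` fixes the edge and acts on forms of degree `d` by `z^(-d)`; squared, this cancels
against `|det|^d = |z|^(2d)`. -/
theorem IsBoundedAt.mul_scalar (h : IsBoundedAt c M g) (z : (Kinf F)ˣ) :
    IsBoundedAt c M (g * scalarGL z) := by
  intro i hi
  have h1 : matC (scalarGL z)⁻¹ = toC ((z⁻¹ : (Kinf F)ˣ) : Kinf F) • (1 : Matrix (Fin 2) (Fin 2) (Cinf F)) := by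
    rw [scalarGL, ← map_inv]
    ext i j
    rw [matC_apply]
    fin_cases i <;> fin_cases j <;> simp [Matrix.GeneralLinearGroup.scalar]
  have h2 : (scalarGL z).1.det = (z : Kinf F) ^ 2 := by
    rw [scalarGL, Matrix.det_fin_two]
    simp [Matrix.GeneralLinearGroup.scalar, pow_two]
  have hz : ‖(z : Kinf F)‖ ≠ 0 := norm_ne_zero_iff.mpr z.ne_zero
  rw [twist_mul, twist_apply, edge_act_scalarGL, h1, subst_smul_one, map_smul, smul_eq_mul,
    norm_mul, norm_pow, norm_toC, Units.val_mul, Matrix.det_mul, norm_mul, h2, norm_pow, mul_pow,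
    mul_pow, Units.val_inv_eq_inv_val, norm_inv]
  refine le_of_eq_of_le ?_ (h i hi)
  have h3 : (‖(z : Kinf F)‖⁻¹ ^ d) ^ 2 * (‖(z : Kinf F)‖ ^ 2) ^ d = 1 := by
    rw [← pow_mul, ← pow_mul, mul_comm 2 d, inv_pow, inv_mul_cancel₀ (pow_ne_zero _ hz)]
  linear_combination (‖twist c g (downEdge 0 0) (hom d (Polynomial.X ^ i))‖ ^ 2 *
    ‖g.1.det‖ ^ d) * h3

theorem twist_upEdge (hc : IsHarmonic c) (b : Kinf F) (l : ℤ) :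
    twist c g (upEdge b l) = -twist c g (downEdge b l) := (hc.twist g).upEdge b l

theorem flipGL_val : (flipGL : GL (Fin 2) (Kinf F)).1 = !![0, (unif F)⁻¹; 1, 0] := by
  rw [flipGL, latMat, swapGL]
  ext i j
  fin_cases i <;> fin_cases j <;> simp [Matrix.mul_apply]

/-- `flipGL` reverses the standard edge, which changes only a sign. Its inverse is integral and its
determinant has absolute value `|π|⁻¹`, whence the constant. -/
theorem IsBoundedAt.mul_flip (hc : IsHarmonic c) (h : IsBoundedAt c M g) :
    IsBoundedAt c (M * (‖unif F‖⁻¹) ^ d) (g * flipGL) := by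
  have := h.mul_of_norm_le (k := flipGL) (fun i j => ?_) fun P => ?_
  · rwa [flipGL_val, Matrix.det_fin_two_of, zero_mul, mul_one, zero_sub, norm_neg, norm_inv] at this
  · have hu : ‖unif F‖ ≤ 1 := norm_unif_lt_one.le
    rw [inv_apply_fin_two, flipGL_val, Matrix.det_fin_two_of, Matrix.smul_apply, smul_eq_mul]
    fin_cases i <;> fin_cases j <;> simp [hu, unif_ne_zero]
  · rw [downEdge_act_flipGL, twist_upEdge hc, LinearMap.neg_apply, norm_neg]

/-- Invariance of `c` makes the bound a property of the coset of `g`. -/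
theorem IsBoundedAt.mul_left {γ : GL (Fin 2) (Kinf F)} (hγ : twist c γ = c) (hdet : γ.1.det = 1)
    (h : IsBoundedAt c M g) : IsBoundedAt c M (γ * g) := by
  intro i hi
  rw [twist_mul, hγ, Units.val_mul, Matrix.det_mul, hdet, one_mul]
  exact h i hi

/-- The translation `x ↦ x + a`. -/
def transSL (a : Polynomial F) : Matrix.SpecialLinearGroup (Fin 2) (Polynomial F) :=
  ⟨!![1, a; 0, 1], by simp [Matrix.det_fin_two]⟩

variable (F) in
/-- The inversion `x ↦ -1 / x`. -/
def invSL : Matrix.SpecialLinearGroup (Fin 2) (Polynomial F) :=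
  ⟨!![0, -1; 1, 0], by simp [Matrix.det_fin_two]⟩

theorem invSL_inv_val : ((invSL F)⁻¹).1 = !![0, 1; -1, 0] := by
  rw [Matrix.SpecialLinearGroup.coe_inv, invSL, Matrix.adjugate_fin_two_of, neg_neg]

theorem slK_transSL (a : Polynomial F) : slK F (transSL a) = latMat (polyEmb F a) 0 0 := by
  ext i j
  rw [slK_val]
  fin_cases i <;> fin_cases j <;> simp [transSL, latMat]

theorem latMat_mul_latMat_zero (b b' : Kinf F) (l : ℤ) :
    latMat b 0 0 * latMat b' l 0 = latMat (b + b') l 0 := by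
  ext i j
  simp only [latMat, Units.val_mul]
  fin_cases i <;> fin_cases j <;> simp [Matrix.mul_apply, add_comm]

theorem exists_iwahori_eq_of_norm_le {b : Kinf F} {l : ℤ} (h : ‖b‖ ≤ ‖unif F‖ ^ l) :
    ∃ k, IsIwahori k ∧ latMat b l 0 = latMat 0 l 0 * k := by
  have hu := unif_zpow_ne_zero (F := F) l
  refine ⟨latMat (b / unif F ^ l) 0 0, ⟨⟨fun i j => ?_, ?_⟩, ?_⟩, ?_⟩
  · have : ‖b‖ / ‖unif F‖ ^ l ≤ 1 := (div_le_one (zpow_unif_pos l)).mpr h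
    fin_cases i <;> fin_cases j <;> simp [latMat, this]
  · simp [latMat, Matrix.det_fin_two]
  · simp [latMat]
  · ext i j
    simp only [latMat, Units.val_mul]
    fin_cases i <;> fin_cases j <;> simp [Matrix.mul_apply]
    field_simp

/-- Every matrix with small lower left entry is, up to scalars and Iwahori matrices, of the form
`(π^l, b; 0, 1)`. -/
theorem exists_eq_latMat_mul (hg : ‖g 1 0‖ < ‖g 1 1‖) :
    ∃ (l : ℤ) (k : GL (Fin 2) (Kinf F)) (z : (Kinf F)ˣ), IsIwahori k ∧
      g = latMat (g 0 1 / g 1 1) l 0 * k * scalarGL z ∧ ‖g.1.det‖ = ‖unif F‖ ^ l * ‖g 1 1‖ ^ 2 := by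
  have hs : g 1 1 ≠ 0 := norm_pos_iff.mp ((norm_nonneg _).trans_lt hg)
  have hdet : g.1.det ≠ 0 := (Matrix.GeneralLinearGroup.det g).ne_zero
  obtain ⟨l, hl⟩ := norm_eq_zpow (div_ne_zero hdet (pow_ne_zero 2 hs))
  have hu := unif_zpow_ne_zero (F := F) l
  have hun : ‖g.1.det / (g 1 1) ^ 2 / unif F ^ l‖ = 1 := by
    rw [norm_div, hl, norm_zpow, div_self (zpow_unif_pos l).ne']
  have hr : ‖g 1 0 / g 1 1‖ ≤ ‖unif F‖ := by
    have : ‖g 1 0 / g 1 1‖ < ‖unif F‖ ^ (0 : ℤ) := by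
      rw [norm_div, zpow_zero]
      exact (div_lt_one (norm_pos_iff.mpr hs)).mpr hg
    simpa using norm_lt_zpow_iff.mp this
  refine ⟨l, Matrix.GeneralLinearGroup.mkOfDetNeZero
    !![g.1.det / (g 1 1) ^ 2 / unif F ^ l, 0; g 1 0 / g 1 1, 1] (by
      rw [Matrix.det_fin_two_of]
      simp [hs, hdet, hu]), Units.mk0 _ hs, ⟨⟨fun i j => ?_, ?_⟩, hr⟩, ?_, ?_⟩
  · have := hr.trans norm_unif_lt_one.le
    fin_cases i <;> fin_cases j
    · exact hun.le
    · simp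
    · exact this
    · simp
  · change ‖Matrix.det !![_, _; _, _]‖ = 1
    rw [Matrix.det_fin_two_of, mul_one, zero_mul, sub_zero, hun]
  · refine Units.ext (Matrix.ext fun i j => ?_)
    simp only [latMat, Units.val_mul, scalarGL]
    have hd := Matrix.det_fin_two g.1
    fin_cases i <;> fin_cases j <;>
      simp [Matrix.mul_apply, Matrix.GeneralLinearGroup.scalar, hd] <;> field_simp <;> ring
  · rw [norm_div, norm_pow, div_eq_iff (by positivity)] at hl
    exact hl

/-- Reduction theory for `SL₂(F[T])`: every edge can be moved onto the standard apartment. -/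
theorem exists_slK_mul_latMat (n : ℕ) : ∀ (l : ℤ) (b : Kinf F), l ≤ n →
    ∀ δ : Matrix.SpecialLinearGroup (Fin 2) (Polynomial F),
    ∃ (δ' : Matrix.SpecialLinearGroup (Fin 2) (Polynomial F)) (m : ℤ), ∀ M,
      IsBoundedAt c M (slK F δ' * latMat 0 m 0) → IsBoundedAt c M (slK F δ * latMat b l 0) := by
  induction n using Nat.strong_induction_on with
  | _ n ih =>
  intro l b hl δ
  -- The polynomial part of the centre is removed by a translation in `SL₂(F[T])`.
  obtain ⟨a, ha⟩ := exists_norm_sub_polyEmb_le b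
  have e1 : slK F δ * latMat b l 0 = slK F (δ * transSL a) * latMat (b - polyEmb F a) l 0 := by
    rw [map_mul, slK_transSL, mul_assoc, latMat_mul_latMat_zero, add_sub_cancel]
  rw [e1]
  generalize b - polyEmb F a = b at ha
  generalize δ * transSL a = δ
  -- If the ball contains `0` it lies on the standard apartment. Otherwise `x ↦ -1/x` is applied as
  -- in the Euclidean algorithm.
  rcases le_or_gt ‖b‖ (‖unif F‖ ^ l) with h | h
  · obtain ⟨k, hk, e⟩ := exists_iwahori_eq_of_norm_le h
    refine ⟨δ, l, fun M hM => ?_⟩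
    rw [e, ← mul_assoc]
    exact hM.mul_iwahori hk
  · have hb : b ≠ 0 := norm_pos_iff.mp ((zpow_unif_pos l).trans h)
    obtain ⟨v, hv⟩ := norm_eq_zpow hb
    have hv1 : 1 ≤ v := by
      rw [hv] at ha
      exact zpow_unif_le.mp (ha.trans_eq (zpow_one _).symm)
    have hvl : v < l := by rwa [hv, zpow_unif_lt] at h
    have hg : ‖(slK F (invSL F)⁻¹ * latMat b l 0) 1 0‖ < ‖(slK F (invSL F)⁻¹ * latMat b l 0) 1 1‖ ∧
        (slK F (invSL F)⁻¹ * latMat b l 0).1.det = unif F ^ l ∧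
        (slK F (invSL F)⁻¹ * latMat b l 0) 1 1 = -b := by
      have e0 : (slK F (invSL F)⁻¹ * latMat b l 0).1 = !![0, 1; -unif F ^ l, -b] := by
        rw [Units.val_mul, slK_val, invSL_inv_val]
        refine Matrix.ext fun i j => ?_
        fin_cases i <;> fin_cases j <;> simp [latMat, Matrix.mul_apply]
      rw [e0]
      refine ⟨?_, by simp [Matrix.det_fin_two], rfl⟩
      simpa using h
    obtain ⟨l', k, z, hk, e, hd⟩ := exists_eq_latMat_mul hg.1
    rw [hg.2.1, hg.2.2, norm_neg, norm_zpow, hv, ← zpow_natCast, ← zpow_mul,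
      ← zpow_add₀ norm_unif_pos.ne'] at hd
    have hl' : l = l' + 2 * v := by
      have h1 := zpow_unif_le.mp hd.le
      have h2 := zpow_unif_le.mp hd.ge
      push_cast at h1 h2
      omega
    -- Inversion gives a ball of level `l' = l - 2v`. Since the polynomial part was removed, `v ≥
    -- 1`, so the level drops by at least two.
    obtain ⟨δ', m, hm⟩ := ih (n - 2) (by omega) l' _ (by omega) (δ * invSL F)
    refine ⟨δ', m, fun M hM => ?_⟩
    have e2 : slK F δ * latMat b l 0 =
        slK F (δ * invSL F) * (slK F (invSL F)⁻¹ * latMat b l 0) := by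
      rw [← mul_assoc, ← map_mul, mul_inv_cancel_right]
    rw [e2, e, ← mul_assoc, ← mul_assoc]
    exact ((hm M hM).mul_iwahori hk).mul_scalar z

/-- A bound on the standard apartment for all conjugates implies a bound everywhere. -/
theorem exists_isBoundedAt_of_apartment (hc : IsHarmonic c)
    (h : ∀ δ : Matrix.SpecialLinearGroup (Fin 2) (Polynomial F), ∀ m,
      IsBoundedAt c M (slK F δ * latMat 0 m 0)) :
    ∀ g, IsBoundedAt c (M * (‖unif F‖⁻¹) ^ d) g := by
  have h0 : ∀ b l, IsBoundedAt c M (latMat b l 0) := fun b l => by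
    obtain ⟨δ', m, hm⟩ := exists_slK_mul_latMat (c := c) l.toNat l b (by omega) 1
    rw [map_one, one_mul] at hm
    exact hm M (h δ' m)
  have hM := (h0 0 0).nonneg
  have hu : 1 ≤ (‖unif F‖⁻¹) ^ d := one_le_pow₀ ((one_le_inv₀ norm_unif_pos).mpr norm_unif_lt_one.le)
  have h1 : ∀ g : GL (Fin 2) (Kinf F), ‖g 1 0‖ < ‖g 1 1‖ → IsBoundedAt c M g := fun g hg => by
    obtain ⟨l, k, z, hk, e, -⟩ := exists_eq_latMat_mul hg
    rw [e]
    exact ((h0 _ l).mul_iwahori hk).mul_scalar z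
  intro g
  rcases lt_or_ge ‖g 1 0‖ ‖g 1 1‖ with hg | hg
  · exact (h1 g hg).mono (le_mul_of_one_le_right hM hu)
  -- The square of `flipGL` is the scalar `π⁻¹`. Multiplication by `flipGL` exchanges the columns
  -- and scales one of them by `π⁻¹`, so `g * flipGL` has a strictly dominant lower right entry.
  · have e : g = g * flipGL * flipGL * scalarGL (Units.mk0 (unif F) unif_ne_zero) := by
      have : (flipGL * flipGL * scalarGL (Units.mk0 (unif F) unif_ne_zero) :
          GL (Fin 2) (Kinf F)) = 1 := by
        ext i j
        rw [Units.val_mul, Units.val_mul, flipGL_val, scalarGL]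
        fin_cases i <;> fin_cases j <;>
          simp [Matrix.mul_apply, Matrix.GeneralLinearGroup.scalar, unif_ne_zero]
      rw [mul_assoc, mul_assoc, ← mul_assoc flipGL, this, mul_one]
    rw [e]
    refine (IsBoundedAt.mul_flip hc (h1 _ ?_)).mul_scalar _
    have e1 : (g * flipGL).1 1 0 = g 1 1 := by
      rw [Units.val_mul, flipGL_val]
      simp [Matrix.mul_apply]
    have e2 : (g * flipGL).1 1 1 = g 1 0 * (unif F)⁻¹ := by
      rw [Units.val_mul, flipGL_val]
      simp [Matrix.mul_apply]
    rw [e1, e2, norm_mul, norm_inv]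
    have hpos : 0 < ‖g 1 0‖ := by
      rw [norm_pos_iff]
      intro h00
      rw [h00, norm_zero, norm_le_zero_iff] at hg
      have := (Matrix.GeneralLinearGroup.det g).ne_zero
      rw [Matrix.GeneralLinearGroup.val_det_apply, Matrix.det_fin_two, h00, hg] at this
      simp at this
    exact hg.trans_lt (lt_mul_of_one_lt_right hpos
      ((one_lt_inv₀ norm_unif_pos).mpr norm_unif_lt_one))

end Growth


/-! ### Congruence subgroups inside arithmetic groups -/

section Congruence
variable {F : Type*} [Field F]

/-- Two independent elements of `Y` form a basis of `k ⊕ k`; `D` is a common denominator of the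
coordinates of `v` in it. -/
theorem exists_smul_mem_of_finrank_eq_two {Y : Submodule (Polynomial F) (Fin 2 → RatFunc F)}
    (hY : Module.finrank (Polynomial F) Y = 2) (v : Fin 2 → RatFunc F) :
    ∃ D : Polynomial F, D ≠ 0 ∧ D • v ∈ Y := by
  obtain ⟨f, hf⟩ := exists_linearIndependent_of_le_finrank hY.ge
  have h1 := (LinearIndependent.iff_fractionRing (Polynomial F) (RatFunc F)).mp
    (hf.map' Y.subtype Y.ker_subtype)
  let B := basisOfLinearIndependentOfCardEqFinrank h1 (by simp)
  obtain ⟨D, hD⟩ := IsLocalization.exist_integer_multiples_of_finite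
    (nonZeroDivisors (Polynomial F)) (fun i => B.repr v i)
  refine ⟨D, nonZeroDivisors.coe_ne_zero D, ?_⟩
  rw [← B.sum_repr v, Finset.smul_sum]
  refine Y.sum_mem fun i _ => ?_
  obtain ⟨r, hr⟩ := hD i
  rw [← smul_assoc, ← hr, algebraMap_smul]
  refine Y.smul_mem r ?_
  simp [B]

/-- Take a nonzero element of `I` times the product of denominators for the images of finitely many
generators of `Y`. -/
theorem exists_forall_smul_mem {Y : Submodule (Polynomial F) (Fin 2 → RatFunc F)}
    {I : Ideal (Polynomial F)} (hfin : Module.Finite (Polynomial F) Y)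
    (hY : Module.finrank (Polynomial F) Y = 2) (hI : I ≠ ⊥)
    (φ : (Fin 2 → RatFunc F) →ₗ[Polynomial F] (Fin 2 → RatFunc F)) :
    ∃ D : Polynomial F, D ≠ 0 ∧ ∀ y ∈ Y, D • φ y ∈ I • Y := by
  obtain ⟨t, ht, ht0⟩ := Submodule.exists_mem_ne_zero_of_ne_bot hI
  obtain ⟨s, hs⟩ := Module.Finite.iff_fg.mp hfin
  choose D hD0 hD using fun v => exists_smul_mem_of_finrank_eq_two hY (φ v)
  refine ⟨t * ∏ y ∈ s, D y, mul_ne_zero ht0 (Finset.prod_ne_zero_iff.mpr fun y _ => hD0 y), ?_⟩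
  suffices h : Y ≤ (I • Y).comap ((t * ∏ y ∈ s, D y) • φ) from fun y hy => h hy
  rw [← hs, Submodule.span_le, hs]
  intro y hy
  obtain ⟨r, hr⟩ := Finset.dvd_prod_of_mem D hy
  change (t * ∏ y ∈ s, D y) • φ y ∈ I • Y
  rw [hr, mul_comm (D y), mul_smul, mul_smul]
  exact Submodule.smul_mem_smul ht (Y.smul_mem r (hD y))

variable (F) in
/-- The embedding of `SL₂(F[T])` into `GL₂(F(T))`. -/
def slk : Matrix.SpecialLinearGroup (Fin 2) (Polynomial F) →* GL (Fin 2) (RatFunc F) :=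
  Matrix.SpecialLinearGroup.toGL.comp
    (Matrix.SpecialLinearGroup.map (algebraMap (Polynomial F) (RatFunc F)))

theorem slk_apply (γ : Matrix.SpecialLinearGroup (Fin 2) (Polynomial F)) (i j : Fin 2) :
    (slk F γ).1 i j = algebraMap (Polynomial F) (RatFunc F) (γ.1 i j) := rfl

/-- The principal congruence subgroup of level `N`. -/
def IsCongrOne (N : Polynomial F) (γ : Matrix.SpecialLinearGroup (Fin 2) (Polynomial F)) : Prop :=
  ∀ i j, N ∣ γ.1 i j - (1 : Matrix (Fin 2) (Fin 2) (Polynomial F)) i j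

theorem IsCongrOne.inv {N : Polynomial F} {γ : Matrix.SpecialLinearGroup (Fin 2) (Polynomial F)}
    (h : IsCongrOne N γ) : IsCongrOne N γ⁻¹ := by
  intro i j
  rw [Matrix.SpecialLinearGroup.coe_inv, Matrix.adjugate_fin_two]
  have h00 := h 0 0
  have h01 := h 0 1
  have h10 := h 1 0
  have h11 := h 1 1
  fin_cases i <;> fin_cases j <;> simp_all

/-- `γ - 1` is a combination of the four matrix units with coefficients divisible by `N`. If `N`
clears the denominators of the matrix units as maps from `Y` to `I Y`, then `γ` preserves `Y` and is
trivial on `Y / I Y`; the same holds for `γ⁻¹`. -/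
theorem exists_level {G : Subgroup (GL (Fin 2) (RatFunc F))} (hG : IsArithmetic G) :
    ∃ N : Polynomial F, N ≠ 0 ∧ ∀ γ, IsCongrOne N γ → slk F γ ∈ G := by
  obtain ⟨Y, I, hfin, -, hrank, hI, -, hG⟩ := hG
  choose D hD0 hD using fun i j : Fin 2 => exists_forall_smul_mem hfin hrank hI
    ((LinearMap.single (Polynomial F) (fun _ : Fin 2 => RatFunc F) i).comp (LinearMap.proj j))
  refine ⟨∏ i, ∏ j, D i j, by simp [hD0], ?_⟩
  have key : ∀ γ, IsCongrOne (∏ i, ∏ j, D i j) γ → ∀ y ∈ Y, (slk F γ).1.mulVec y - y ∈ I • Y := by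
    intro γ hγ y hy
    have h1 : (slk F γ).1.mulVec y - y = ∑ i, ∑ j,
        (γ.1 i j - (1 : Matrix (Fin 2) (Fin 2) (Polynomial F)) i j) •
          (Pi.single i (y j) : Fin 2 → RatFunc F) := by
      funext i
      simp only [Pi.sub_apply, Matrix.mulVec, dotProduct, Fin.sum_univ_two, slk_apply]
      fin_cases i <;> simp [Algebra.smul_def] <;> ring
    rw [h1]
    refine Submodule.sum_mem _ fun i _ => Submodule.sum_mem _ fun j _ => ?_
    obtain ⟨r, hr⟩ := ((Finset.dvd_prod_of_mem (D i) (Finset.mem_univ j)).trans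
      (Finset.dvd_prod_of_mem (fun i => ∏ j, D i j) (Finset.mem_univ i))).trans (hγ i j)
    rw [hr, mul_comm, mul_smul]
    exact Submodule.smul_mem _ _ (hD i j y hy)
  have key' : ∀ γ, IsCongrOne (∏ i, ∏ j, D i j) γ → ∀ y ∈ Y, (slk F γ).1.mulVec y ∈ Y := by
    intro γ hγ y hy
    have := Y.add_mem (Submodule.smul_le_right (key γ hγ y hy)) hy
    rwa [sub_add_cancel] at this
  refine fun γ hγ => hG _ (fun y => ⟨fun h => ?_, key' γ hγ y⟩) (key γ hγ)
  have h2 := key' _ hγ.inv _ h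
  rwa [Matrix.mulVec_mulVec, ← Units.val_mul, ← map_mul, inv_mul_cancel, map_one, Units.val_one,
    Matrix.one_mulVec] at h2

theorem finite_quotient_span {N : Polynomial F} [Finite F] (hN : N ≠ 0) :
    Finite (Polynomial F ⧸ Ideal.span {N}) := by
  have := (AdjoinRoot.powerBasis hN).finite
  exact Module.finite_of_finite F (M := AdjoinRoot N)

end Congruence

/-! ### Cocycles near the cusps and their uniform bound -/

section Bounds
variable {F : Type*} [Field F] [Fintype F] {n : ℕ}

theorem toKinf_slk (γ : Matrix.SpecialLinearGroup (Fin 2) (Polynomial F)) :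
    toKinf F (slk F γ) = slK F γ := by
  refine Units.ext (Matrix.ext fun i j => ?_)
  exact IsFractionRing.lift_algebraMap (polyEmb_injective F) _

theorem matC_toKinf (g : GL (Fin 2) (RatFunc F)) : matC (toKinf F g) = g.1.map (kToC F) := rfl

theorem det_slk (γ : Matrix.SpecialLinearGroup (Fin 2) (Polynomial F)) : (slk F γ).1.det = 1 :=
  (Matrix.SpecialLinearGroup.map (algebraMap (Polynomial F) (RatFunc F)) γ).2

variable {G : Subgroup (GL (Fin 2) (RatFunc F))}

/-- Harmonic functions which are invariant under the principal congruence subgroup of level `N`. -/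
structure IsCongruenceCocycle {d : ℕ} (N : Polynomial F)
    (c : Edge F → Module.Dual (Cinf F) (Form F d)) : Prop extends IsHarmonic c where
  ne_zero : N ≠ 0
  twist_eq : ∀ γ, IsCongrOne N γ → twist c (slK F γ) = c

theorem exists_isCongruenceCocycle (hG : IsArithmetic G) (c : HarmonicCocycles G n) :
    ∃ N, IsCongruenceCocycle N c.1 := by
  obtain ⟨N, hN, hNG⟩ := exists_level hG
  refine ⟨N, ⟨c.2.1, c.2.2.1⟩, hN, fun γ hγ => ?_⟩
  funext e
  refine LinearMap.ext fun P => ?_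
  have h := c.2.2.2 _ (hNG γ hγ) e (subst _ (matC (slK F γ)⁻¹) P)
  rw [toKinf_slk] at h
  rw [twist_apply, h, det_slk, map_one, one_mul, formSubst_eq, ← matC_toKinf, toKinf_slk, subst_subst,
    ← matC_mul, inv_mul_cancel, matC_one, subst_one]

variable {d : ℕ} {N : Polynomial F} {c : Edge F → Module.Dual (Cinf F) (Form F d)}

theorem isCongrOne_transSL (N a : Polynomial F) : IsCongrOne N (transSL (a * N)) := by
  intro i j
  fin_cases i <;> fin_cases j <;> simp [transSL]

theorem isCongrOne_conj {N : Polynomial F} {γ : Matrix.SpecialLinearGroup (Fin 2) (Polynomial F)}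
    (h : IsCongrOne N γ) (δ : Matrix.SpecialLinearGroup (Fin 2) (Polynomial F)) :
    IsCongrOne N (δ * γ * δ⁻¹) := by
  intro i j
  have h1 : (δ * γ * δ⁻¹).1 - 1 = δ.1 * (γ.1 - 1) * (δ⁻¹).1 := by
    have : δ.1 * (δ⁻¹).1 = 1 := congrArg Subtype.val (mul_inv_cancel δ)
    rw [mul_sub, sub_mul, mul_one, this]
    rfl
  rw [← Matrix.sub_apply, h1, Matrix.mul_apply]
  refine Finset.dvd_sum fun k _ => Dvd.dvd.mul_right ?_ _
  rw [Matrix.mul_apply]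
  exact Finset.dvd_sum fun k' _ => Dvd.dvd.mul_left (h k' k) _

/-- A harmonic cocycle vanishes near all cusps. -/
theorem IsCongruenceCocycle.exists_twist_eq_zero (hc : IsCongruenceCocycle N c)
    (δ : Matrix.SpecialLinearGroup (Fin 2) (Polynomial F)) :
    ∃ L₀ : ℕ, ∀ L ≥ L₀, twist c (slK F δ) (downEdge 0 (-(L : ℤ))) = 0 := by
  refine (hc.toIsHarmonic.twist _).exists_eq_zero hc.ne_zero fun a => ?_
  rw [← twist_mul, ← slK_transSL, ← map_mul,
    show δ * transSL (a * N) = δ * transSL (a * N) * δ⁻¹ * δ by group, map_mul, twist_mul,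
    hc.twist_eq _ (isCongrOne_conj (isCongrOne_transSL N a) δ)]

theorem latMat_zero_comm_iwahori (m : ℤ) : ∃ k, IsIwahori k ∧
    slK F (invSL F) * latMat 0 m 0 = swapGL * latMat 0 m 0 * k := by
  refine ⟨Matrix.GeneralLinearGroup.mkOfDetNeZero !![1, 0; 0, -1] (by simp), ⟨⟨fun i j => ?_, ?_⟩, ?_⟩, ?_⟩
  · fin_cases i <;> fin_cases j <;> simp
  · simp
  · simp
  · refine Units.ext (Matrix.ext fun i j => ?_)
    rw [Units.val_mul, slK_val]
    simp only [latMat, Units.val_mul, swapGL, invSL]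
    fin_cases i <;> fin_cases j <;> simp [Matrix.mul_apply]

/-- On the standard apartment `x ↦ -1/x` acts like `x ↦ 1/x`: the two differ by `diag(1, -1)`, which
fixes the edges. -/
theorem downEdge_act_invSL (m : ℤ) :
    (downEdge 0 m).act (slK F (invSL F)) = upEdge 0 (1 - m) := by
  obtain ⟨k, hk, e⟩ := latMat_zero_comm_iwahori (F := F) m
  rw [downEdge_eq_act, ← Edge.act_mul, e, Edge.act_mul, downEdge_act_iwahori hk, Edge.act_mul,
    ← downEdge_eq_act, downEdge_act_swapGL]

/-- The two ends of the apartment are cusps, exchanged by `invSL`. The cocycle vanishes near both,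
so a maximum over finitely many edges remains. -/
theorem IsCongruenceCocycle.exists_apartment_bound (hc : IsCongruenceCocycle N c)
    (δ : Matrix.SpecialLinearGroup (Fin 2) (Polynomial F)) :
    ∃ M, ∀ m, IsBoundedAt c M (slK F δ * latMat 0 m 0) := by
  obtain ⟨L₁, h1⟩ := hc.exists_twist_eq_zero δ
  obtain ⟨L₂, h2⟩ := hc.exists_twist_eq_zero (δ * invSL F)
  have h3 : ∀ m : ℤ, (m < -L₁ ∨ L₂ + 1 ≤ m) → twist c (slK F δ) (downEdge 0 m) = 0 := by
    rintro m (hm | hm)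
    · have := h1 (-m).toNat (by omega)
      rwa [show -((-m).toNat : ℤ) = m by omega] at this
    · have h4 := h2 (m - 1).toNat (by omega)
      rw [map_mul, twist_mul, show -((m - 1).toNat : ℤ) = 1 - m by omega] at h4
      refine LinearMap.ext fun P => ?_
      have h5 := LinearMap.congr_fun h4 (subst _ (matC (slK F (invSL F))) P)
      rw [twist_subst, downEdge_act_invSL, sub_sub_cancel, (hc.toIsHarmonic.twist _).upEdge] at h5
      exact neg_eq_zero.mp h5
  have h6 : Set.Finite (((Finset.Icc (-(L₁ : ℤ)) L₂ ×ˢ Finset.range (d + 1)).image fun x : ℤ × ℕ =>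
      ‖twist c (slK F δ * latMat 0 x.1 0) (downEdge 0 0) (hom _ (Polynomial.X ^ x.2))‖ ^ 2 *
        ‖(slK F δ * latMat 0 x.1 0).1.det‖ ^ d : Finset ℝ) : Set ℝ) := Finset.finite_toSet _
  obtain ⟨M, hM⟩ := h6.bddAbove
  refine ⟨max M 0, fun m i hi => ?_⟩
  by_cases hm : m < -L₁ ∨ L₂ + 1 ≤ m
  · rw [twist_mul, twist_apply, ← downEdge_eq_act, h3 m hm]
    simp
  · refine le_max_of_le_left (hM ?_)
    refine Finset.mem_coe.mpr (Finset.mem_image.mpr ⟨(m, i), ?_, rfl⟩)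
    simp only [Finset.mem_product, Finset.mem_Icc, Finset.mem_range]
    omega

/-- The growth of a harmonic cocycle. -/
theorem IsCongruenceCocycle.exists_isBoundedAt (hc : IsCongruenceCocycle N c) :
    ∃ M, ∀ g, IsBoundedAt c M g := by
  choose M hM using hc.exists_apartment_bound
  have := finite_quotient_span hc.ne_zero
  -- Matrices congruent modulo `N` differ by a left factor in the congruence subgroup, so one
  -- representative for each of the finitely many residues suffices.
  let red : Matrix.SpecialLinearGroup (Fin 2) (Polynomial F) →
      Fin 2 → Fin 2 → Polynomial F ⧸ Ideal.span {N} := fun δ i j => Ideal.Quotient.mk _ (δ.1 i j)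
  choose s hs using fun x : Set.range red => x.2
  obtain ⟨M', hM'⟩ := (Set.finite_range fun x => M (s x)).bddAbove
  refine ⟨_, exists_isBoundedAt_of_apartment hc.toIsHarmonic (M := M') fun δ m => ?_⟩
  set δ' := s ⟨red δ, δ, rfl⟩
  have h1 : red δ' = red δ := hs ⟨red δ, δ, rfl⟩
  have h2 : IsCongrOne N (δ * δ'⁻¹) := by
    intro i j
    have h3 : (δ * δ'⁻¹).1 - 1 = (δ.1 - δ'.1) * (δ'⁻¹).1 := by
      have : δ'.1 * (δ'⁻¹).1 = 1 := congrArg Subtype.val (mul_inv_cancel δ')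
      rw [sub_mul, this]
      rfl
    rw [← Matrix.sub_apply, h3, Matrix.mul_apply]
    refine Finset.dvd_sum fun k _ => Dvd.dvd.mul_right ?_ _
    rw [Matrix.sub_apply, ← Ideal.mem_span_singleton, ← Ideal.Quotient.eq]
    exact (congrFun (congrFun h1 i) k).symm
  have h4 := ((hM δ' m).mono (hM' ⟨_, rfl⟩)).mul_left (hc.twist_eq _ h2) (det_slK _)
  rwa [← mul_assoc, ← map_mul, inv_mul_cancel_right] at h4

end Bounds


/-! ### Moments of a cocycle in the two charts of `P¹` -/

section Moments
variable {F : Type*} [Field F] [Fintype F] {d : ℕ}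

/-- The moments of the values of `c` on the edges `downEdge b l`. -/
def moment (c : Edge F → Module.Dual (Cinf F) (Form F d)) (b : Kinf F) (l : ℤ) :
    Polynomial (Cinf F) →ₗ[Cinf F] Cinf F := c (downEdge b l) ∘ₗ hom d

variable {c : Edge F → Module.Dual (Cinf F) (Form F d)}

theorem moment_apply (b : Kinf F) (l : ℤ) (p : Polynomial (Cinf F)) :
    moment c b l p = c (downEdge b l) (hom d p) := rfl

theorem slash_upper {p : Polynomial (Cinf F)} (hp : p.natDegree ≤ d)
    {M : Matrix (Fin 2) (Fin 2) (Cinf F)} (h0 : M 1 0 = 0) (h1 : M 1 1 = 1) :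
    slash d M p = p.comp (Polynomial.C (M 0 0) * Polynomial.X + Polynomial.C (M 0 1)) := by
  rw [slash, Polynomial.comp, Polynomial.eval₂_eq_sum_range' _ (Nat.lt_succ_of_le hp)]
  refine Finset.sum_congr rfl fun i _ => ?_
  simp [h0, h1]

/-- The matrix `(π^l, b; 0, 1)` carries the standard edge to the ball and turns `x - b` into `π^l
x`. -/
theorem moment_sub_pow (b : Kinf F) (l : ℤ) {j : ℕ} (hj : j ≤ d) :
    moment c b l ((Polynomial.X - Polynomial.C (toC b)) ^ j) =
      toC (unif F ^ l) ^ j * twist c (latMat b l 0) (downEdge 0 0) (hom d (Polynomial.X ^ j)) := by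
  have hdeg : ((Polynomial.X - Polynomial.C (toC b)) ^ j).natDegree ≤ d := by
    rwa [Polynomial.natDegree_pow, Polynomial.natDegree_X_sub_C, mul_one]
  rw [moment_apply, downEdge_eq_act, ← twist_subst, subst_hom,
    slash_upper hdeg (by simp [matC_apply, latMat]) (by simp [matC_apply, latMat])]
  have e : ((Polynomial.X - Polynomial.C (toC b)) ^ j).comp
      (Polynomial.C (matC (latMat b l 0) 0 0) * Polynomial.X +
        Polynomial.C (matC (latMat b l 0) 0 1)) = toC (unif F ^ l) ^ j • Polynomial.X ^ j := by
    rw [Polynomial.pow_comp, Polynomial.sub_comp, Polynomial.X_comp, Polynomial.C_comp,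
      Polynomial.smul_eq_C_mul, map_pow, ← mul_pow]
    congr 1
    simp [matC_apply, latMat]
  rw [e, map_smul, map_smul, smul_eq_mul]

/-- On the edge of level `l` the determinant has absolute value `|π|^l`, so the transported value is
at most `√M |π|^(-ld/2)`. For `l ≥ 0` the condition `d ≤ 2h` turns this into `√M |π|^(-lh)`. -/
theorem IsHarmonic.isMomentData (hc : IsHarmonic c) {M : ℝ} (hM : ∀ g, IsBoundedAt c M g) {h : ℕ}
    (hd : d ≤ 2 * h) : IsMomentData d h (√M) (moment c) where
  congr b b' l hb := by rw [moment, moment, downEdge_congr hb]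
  add b l p := by
    rw [moment_apply, hc.eq_sum, LinearMap.sum_apply]
    rfl
  nonneg := Real.sqrt_nonneg M
  bound b l hl j hj := by
    have h1 := hM (latMat b l 0) j hj
    have hdet : ‖(latMat b l 0).1.det‖ = ‖unif F‖ ^ l := by
      simp [latMat, Matrix.det_fin_two]
    have h2 : ‖unif F‖ ^ (l * (2 * h : ℤ)) ≤ (‖unif F‖ ^ l) ^ d := by
      rw [← zpow_natCast, ← zpow_mul, zpow_unif_le]
      exact mul_le_mul_of_nonneg_left (by exact_mod_cast hd) hl
    rw [hdet] at h1
    have h3 : ‖CharPMeasure.twist c (latMat b l 0) (downEdge 0 0) (hom d (Polynomial.X ^ j))‖ *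
        ‖unif F‖ ^ (l * (h : ℤ)) ≤ √M := by
      refine Real.le_sqrt_of_sq_le ?_
      rw [mul_pow, ← zpow_natCast (‖unif F‖ ^ _), ← zpow_mul,
        show l * (h : ℤ) * (2 : ℕ) = l * (2 * h) by push_cast; ring]
      exact (mul_le_mul_of_nonneg_left h2 (by positivity)).trans h1
    rw [moment_sub_pow b l hj, norm_mul, norm_pow, norm_toC, norm_zpow, mul_sub,
      sub_eq_add_neg, zpow_add₀ norm_unif_pos.ne', zpow_neg, zpow_mul, zpow_natCast, mul_left_comm]
    refine mul_le_mul_of_nonneg_left ?_ (pow_nonneg (zpow_unif_pos l).le j)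
    rwa [← div_eq_mul_inv, le_div_iff₀ (zpow_unif_pos _)]

/-- If a ball around `b` avoids `0`, then `1/x` scales distances on it by `|b|^(-2)`, which explains
the level `l - 2v`. -/
theorem downEdge_inv_act_swapGL {b : Kinf F} {l v : ℤ} (hb : ‖b‖ = ‖unif F‖ ^ v) (hv : v < l) :
    (downEdge b⁻¹ (l - 2 * v)).act swapGL = downEdge b l := by
  have e0 : (swapGL * latMat b⁻¹ (l - 2 * v) 0).1 = !![0, 1; unif F ^ (l - 2 * v), b⁻¹] := by
    rw [Units.val_mul]
    refine Matrix.ext fun i j => ?_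
    fin_cases i <;> fin_cases j <;> simp [swapGL, latMat, Matrix.mul_apply]
  obtain ⟨l', k, z, hk, e, hd⟩ := exists_eq_latMat_mul (g := swapGL * latMat b⁻¹ (l - 2 * v) 0) (by
    rw [e0]
    change ‖unif F ^ (l - 2 * v)‖ < ‖b⁻¹‖
    rw [norm_zpow, norm_inv, hb, ← zpow_neg, zpow_unif_lt]
    omega)
  rw [downEdge_eq_act, ← Edge.act_mul, e, Edge.act_mul, edge_act_scalarGL, Edge.act_mul,
    downEdge_act_iwahori hk, ← downEdge_eq_act]
  rw [e0] at hd ⊢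
  have hd' : ‖unif F‖ ^ (l - 2 * v) = ‖unif F‖ ^ l' * (‖unif F‖ ^ (-v)) ^ 2 := by
    rw [zpow_neg, ← hb, ← norm_inv]
    simpa [Matrix.det_fin_two] using hd
  rw [← zpow_natCast (‖unif F‖ ^ (-v)), ← zpow_mul, ← zpow_add₀ norm_unif_pos.ne'] at hd'
  have h1 := zpow_unif_le.mp hd'.le
  have h2 := zpow_unif_le.mp hd'.ge
  push_cast at h1 h2
  congr 1
  · simp
  · omega

theorem slash_swapGL {p : Polynomial (Cinf F)} (hp : p.natDegree ≤ d) :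
    slash d (matC swapGL) p = p.reflect d := by
  rw [slash]
  ext i
  rw [Polynomial.coeff_reflect, Polynomial.finsetSum_coeff]
  have e : ∀ j ∈ Finset.range (d + 1), (Polynomial.C (p.coeff j) *
      (Polynomial.C (matC swapGL 0 0) * Polynomial.X + Polynomial.C (matC swapGL 0 1)) ^ j *
      (Polynomial.C (matC swapGL 1 0) * Polynomial.X + Polynomial.C (matC swapGL 1 1)) ^ (d - j)).coeff i
      = if i = d - j then p.coeff j else 0 := by
    intro j _
    simp [matC_apply, swapGL, Polynomial.coeff_X_pow]
  rw [Finset.sum_congr rfl e]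
  by_cases hi : i ≤ d
  · rw [Polynomial.revAt_le hi, Finset.sum_eq_single_of_mem (d - i) (Finset.mem_range.mpr (by omega)),
      if_pos (by omega)]
    intro j hj hne
    have := Finset.mem_range.mp hj
    exact if_neg (by omega)
  · rw [Polynomial.revAt_eq_self_of_lt (by omega), Polynomial.coeff_eq_zero_of_natDegree_lt (by omega)]
    exact Finset.sum_eq_zero fun j _ => if_neg (by omega)

theorem moment_twist_swapGL {b : Kinf F} {l v : ℤ} (hb : ‖b‖ = ‖unif F‖ ^ v) (hv : v < l)
    {p : Polynomial (Cinf F)} (hp : p.natDegree ≤ d) :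
    moment (twist c swapGL) b⁻¹ (l - 2 * v) (p.reflect d) = moment c b l p := by
  rw [moment_apply, moment_apply, ← slash_swapGL hp, ← subst_hom, twist_subst,
    downEdge_inv_act_swapGL hb hv]

/-- Moments on balls in the two charts of `P¹(k_∞)`, related by `x = 1 / t`. -/
structure IsGluedData (d h : ℕ) (C : ℝ)
    (ν ν' : Kinf F → ℤ → Polynomial (Cinf F) →ₗ[Cinf F] Cinf F) : Prop where
  fin : IsMomentData d h C ν
  inf : IsMomentData d h C ν'
  glue : ∀ b l v, ‖b‖ = ‖unif F‖ ^ v → v < l → ∀ p, p.natDegree ≤ d →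
    ν' b⁻¹ (l - 2 * v) (p.reflect d) = ν b l p
  exists_fin_eq_zero : ∃ L₀ : ℕ, ∀ l : ℤ, L₀ ≤ l → ν 0 (-l) = 0
  exists_inf_eq_zero : ∃ L₀ : ℕ, ∀ l : ℤ, L₀ ≤ l → ν' 0 l = 0

theorem IsCongruenceCocycle.exists_isGluedData {N : Polynomial F} (hc : IsCongruenceCocycle N c)
    {h : ℕ} (hd : d ≤ 2 * h) :
    ∃ C, IsGluedData d h C (moment c) (moment (twist c swapGL)) := by
  obtain ⟨M, hM⟩ := hc.exists_isBoundedAt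
  obtain ⟨L₀, hL⟩ := hc.exists_twist_eq_zero 1
  have hL' : ∀ l : ℤ, L₀ ≤ l → c (downEdge 0 (-l)) = 0 := fun l hl => by
    have h1 := hL l.toNat (by omega)
    rw [show (l.toNat : ℤ) = l by omega, hc.twist_eq 1 (fun i j => by simp)] at h1
    exact h1
  refine ⟨√M, hc.toIsHarmonic.isMomentData hM hd,
    (hc.toIsHarmonic.twist swapGL).isMomentData (fun g i hi => ?_) hd,
    fun b l v hb hv p hp => moment_twist_swapGL hb hv hp,
    ⟨L₀, fun l hl => by rw [moment, hL' l hl, LinearMap.zero_comp]⟩,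
    ⟨L₀ + 1, fun l hl => ?_⟩⟩
  · have h1 := hM (swapGL * g) i hi
    rw [Units.val_mul, Matrix.det_mul, norm_mul, isIntegralGL_swapGL.2, one_mul, twist_mul] at h1
    exact h1
  · refine LinearMap.ext fun p => ?_
    -- The swap sends level `l` to the reversed edge of level `1 - l`; hence the shift of `L₀` by
    -- one.
    rw [moment_apply, twist_apply, downEdge_act_swapGL, hc.toIsHarmonic.upEdge,
      show 1 - l = -(l - 1) by ring, hL' _ (by push_cast at hl; omega)]
    simp

end Moments


/-! ### Locally polynomial functions on `P¹` are `C^h` -/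

section LocallyPolynomial
variable {F : Type*} [Field F] [Fintype F] {h : ℕ}
open scoped Classical

theorem DivDiffBounded.mono {B B' : Set (Kinf F)} {f : Kinf F → Cinf F} (hf : DivDiffBounded B f)
    (hB : B' ⊆ B) : DivDiffBounded B' f := fun k => by
  obtain ⟨M, hM, h1⟩ := hf k
  exact ⟨M, hM, h1.mono hB le_rfl le_rfl⟩

theorem DivDiffBounded.congr {B : Set (Kinf F)} {f g : Kinf F → Cinf F} (hf : DivDiffBounded B f)
    (hfg : ∀ x ∈ B, f x = g x) : DivDiffBounded B g := fun k => by
  obtain ⟨M, hM, h1⟩ := hf k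
  exact ⟨M, hM, h1.congr hfg⟩

theorem DivDiffBounded.add {B : Set (Kinf F)} {f g : Kinf F → Cinf F} (hf : DivDiffBounded B f)
    (hg : DivDiffBounded B g) : DivDiffBounded B fun x => f x + g x := fun k => by
  obtain ⟨M, hM, h1⟩ := hf k
  obtain ⟨M', hM', h1'⟩ := hg k
  exact ⟨max M M', le_max_of_le_left hM, h1.add h1'⟩

theorem DivDiffBounded.const_mul {B : Set (Kinf F)} {f : Kinf F → Cinf F} (a : Cinf F)
    (hf : DivDiffBounded B f) : DivDiffBounded B fun x => a * f x := fun k => by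
  obtain ⟨M, hM, h1⟩ := hf k
  exact ⟨‖a‖ * M, by positivity, h1.const_mul a⟩

theorem DivDiffBounded.indicator {B P : Set (Kinf F)} {f : Kinf F → Cinf F} {R : ℝ}
    (hf : DivDiffBounded (B ∩ P) f) (hR : ∀ x ∈ B ∩ P, ∀ y ∈ B \ P, ‖x - y‖⁻¹ ≤ R) :
    DivDiffBounded B fun x => if x ∈ P then f x else 0 := fun k => by
  obtain ⟨M, hM, h1⟩ := hf k
  refine ⟨max R 1 ^ k * M, by positivity, DivDiffBound.glue (P := P)
    (h1.congr fun x hx => (if_pos hx.2).symm)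
    (((divDiffBound_zero _ k).mono le_rfl le_rfl hM).congr fun x hx => (if_neg hx.2).symm) hM
    (le_max_right _ _) fun x hx y hy => (hR x hx y hy).trans (le_max_left _ _)⟩

theorem divDiffBounded_indicator_eval (b a : Kinf F) (l m : ℤ) (p : Polynomial (Cinf F)) :
    DivDiffBounded (Metric.closedBall a (‖unif F‖ ^ m))
      fun x => if ‖x - b‖ ≤ ‖unif F‖ ^ l then p.eval (toC x) else 0 := by
  refine DivDiffBounded.indicator (P := {x | ‖x - b‖ ≤ ‖unif F‖ ^ l}) (R := (‖unif F‖ ^ l)⁻¹)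
    ((divDiffBounded_eval p a m).mono Set.inter_subset_left) fun x hx y hy => ?_
  refine inv_anti₀ (zpow_unif_pos l) ?_
  by_contra hlt
  rw [not_le, norm_sub_rev] at hlt
  exact hy.2 (norm_sub_le_of_le hlt.le hx.2)

theorem divDiffBounded_inv_eval {A : Set (Kinf F)} {R : ℝ} (h0 : (0 : Kinf F) ∉ A)
    (hR : ∀ x ∈ A, ‖x‖⁻¹ ≤ R) (p : Polynomial (Cinf F)) :
    DivDiffBounded A fun x => p.eval (toC x⁻¹) := by
  have hpow : ∀ i : ℕ, DivDiffBounded A fun x => toC x⁻¹ ^ i := by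
    intro i
    induction i with
    | zero =>
      intro k
      refine ⟨1, zero_le_one, fun S _ hne _ => ?_⟩
      simp only [pow_zero]
      rcases Nat.lt_or_ge S.card 2 with hc | hc
      · have := hne.card_pos
        obtain ⟨s, rfl⟩ := Finset.card_eq_one.mp (show S.card = 1 by omega)
        simp [divDiff]
      · rw [norm_divDiff_one_le hc, norm_zero]
        exact zero_le_one
    | succ i ih =>
      intro k
      obtain ⟨M, hM, h1⟩ := ih k
      refine ⟨max R 1 ^ k * M, by positivity, h1.div hM (fun x hx => (hR x hx).trans (le_max_left _ _))
        (le_max_right _ _) h0 fun x hx => ?_⟩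
      have hx0 : x ≠ 0 := fun h => h0 (h ▸ hx)
      rw [pow_succ', ← mul_assoc, ← map_mul, mul_inv_cancel₀ hx0, map_one, one_mul]
  induction p using Polynomial.induction_on' with
  | add p q hp hq => simpa only [Polynomial.eval_add] using hp.add hq
  | monomial i a => simpa only [Polynomial.eval_monomial] using (hpow i).const_mul a

/-- Based on `|t - s|⁻¹ = |s⁻¹| |t⁻¹| / |s⁻¹ - t⁻¹|`. Either `|s⁻¹|` cancels against the
denominator, or `|s⁻¹|` is at most `ρ` by the ultrametric inequality. -/
theorem inv_norm_sub_le {s t : Kinf F} (hs : s ≠ 0) (ht : t ≠ 0) {r ρ : ℝ} (hr : 0 < r)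
    (hρ : ‖t‖⁻¹ ≤ ρ) (hst : r ≤ ‖s⁻¹ - t⁻¹‖) : ‖t - s‖⁻¹ ≤ max ρ (ρ * ρ * r⁻¹) := by
  have hpos : 0 < ‖s⁻¹ - t⁻¹‖ := hr.trans_le hst
  have hρ0 : 0 ≤ ρ := (inv_nonneg.mpr (norm_nonneg t)).trans hρ
  have e : ‖t - s‖⁻¹ = ‖s⁻¹‖ * ‖t‖⁻¹ * ‖s⁻¹ - t⁻¹‖⁻¹ := by
    have h1 := norm_ne_zero_iff.mpr hs
    have h2 := norm_ne_zero_iff.mpr ht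
    rw [inv_sub_inv hs ht, norm_div, norm_mul, norm_inv, inv_div]
    field_simp
  rw [e]
  rcases le_or_gt ‖s⁻¹‖ ‖s⁻¹ - t⁻¹‖ with h2 | h2
  · refine le_max_of_le_left ?_
    rw [← div_eq_mul_inv, div_le_iff₀ hpos, mul_comm]
    exact mul_le_mul hρ h2 (norm_nonneg _) hρ0
  · refine le_max_of_le_right ?_
    have h3 : ‖s⁻¹‖ ≤ ρ := by
      have h4 := IsUltrametricDist.norm_add_le_max (s⁻¹ - t⁻¹) t⁻¹
      rw [sub_add_cancel, le_max_iff] at h4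
      rcases h4 with h | h
      · exact absurd h (not_le.mpr h2)
      · exact h.trans (by rwa [norm_inv])
    exact mul_le_mul (mul_le_mul h3 hρ (inv_nonneg.mpr (norm_nonneg t)) hρ0)
      (inv_anti₀ hr hst) (inv_nonneg.mpr (norm_nonneg _)) (mul_nonneg hρ0 hρ0)

/-- A ball in the other chart stays away from the pole and from its complement, so inverse powers
are bounded there together with their divided differences, and extension by zero is harmless. -/
theorem divDiffBounded_indicator_inv_eval (b a : Kinf F) (l m : ℤ) (p : Polynomial (Cinf F)) :
    DivDiffBounded (Metric.closedBall a (‖unif F‖ ^ m))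
      fun t => if t ≠ 0 ∧ ‖t⁻¹ - b‖ ≤ ‖unif F‖ ^ l then p.eval (toC t⁻¹) else 0 := by
  have hρ : ∀ t : Kinf F, ‖t⁻¹ - b‖ ≤ ‖unif F‖ ^ l → ‖t‖⁻¹ ≤ max ‖b‖ (‖unif F‖ ^ l) := fun t ht => by
    rw [← norm_inv, ← sub_add_cancel t⁻¹ b]
    exact (IsUltrametricDist.norm_add_le_max _ _).trans
      (max_le (ht.trans (le_max_right _ _)) (le_max_left _ _))
  generalize max ‖b‖ (‖unif F‖ ^ l) = ρ at hρ
  have hP : ∀ t : Kinf F, t ∈ {t : Kinf F | t ≠ 0 ∧ ‖t⁻¹ - b‖ ≤ ‖unif F‖ ^ l} ↔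
      t ≠ 0 ∧ ‖t⁻¹ - b‖ ≤ ‖unif F‖ ^ l := fun t => Iff.rfl
  generalize hPdef : {t : Kinf F | t ≠ 0 ∧ ‖t⁻¹ - b‖ ≤ ‖unif F‖ ^ l} = P at hP
  have key : DivDiffBounded (Metric.closedBall a (‖unif F‖ ^ m))
      fun t => if t ∈ P then p.eval (toC t⁻¹) else 0 := by
    refine DivDiffBounded.indicator (R := max ρ (ρ * ρ * (‖unif F‖ ^ l)⁻¹))
      (divDiffBounded_inv_eval (R := ρ) (fun h0 => ((hP 0).mp h0.2).1 rfl)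
        (fun t ht => hρ t ((hP t).mp ht.2).2) p) fun t ht s hs => ?_
    have h1 := (hP t).mp ht.2
    rcases eq_or_ne s 0 with rfl | hs0
    · rw [sub_zero]
      exact (hρ t h1.2).trans (le_max_left _ _)
    · refine inv_norm_sub_le hs0 h1.1 (zpow_unif_pos l) (hρ t h1.2) ?_
      by_contra hlt
      exact hs.2 ((hP s).mpr ⟨hs0, norm_sub_le_of_le (not_le.mp hlt).le h1.2⟩)
  refine key.congr fun t _ => ?_
  simp only [hP]

/-- The polynomial `p` on the ball `B_b(|π|^l)`, and zero elsewhere. -/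
def locPoly (b : Kinf F) (l : ℤ) (p : Polynomial (Cinf F)) : P1 F → Cinf F
  | OnePoint.infty => 0
  | OnePoint.some x => if ‖x - b‖ ≤ ‖unif F‖ ^ l then p.eval (toC x) else 0

/-- The polynomial `p` in the parameter `1/x` on the ball `B_∞(|π|^l)`, and zero elsewhere. -/
def locPolyInfty (l : ℤ) (p : Polynomial (Cinf F)) : P1 F → Cinf F
  | OnePoint.infty => p.eval 0
  | OnePoint.some x => if ‖unif F‖ ^ (-l) ≤ ‖x‖ then p.eval (toC x⁻¹) else 0

theorem locPoly_coe (b : Kinf F) (l : ℤ) (p : Polynomial (Cinf F)) (x : Kinf F) :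
    locPoly b l p (x : P1 F) = if ‖x - b‖ ≤ ‖unif F‖ ^ l then p.eval (toC x) else 0 := rfl

theorem locPolyInfty_coe (l : ℤ) (p : Polynomial (Cinf F)) (x : Kinf F) :
    locPolyInfty l p (x : P1 F) = if ‖unif F‖ ^ (-l) ≤ ‖x‖ then p.eval (toC x⁻¹) else 0 := rfl

theorem zpow_neg_unif_le_iff {x : Kinf F} (hx : x ≠ 0) {l : ℤ} :
    ‖unif F‖ ^ (-l) ≤ ‖x‖ ↔ ‖x⁻¹‖ ≤ ‖unif F‖ ^ l := by
  rw [norm_inv, zpow_neg, inv_le_comm₀ (zpow_unif_pos l) (norm_pos_iff.mpr hx)]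

theorem inftyChart_locPoly (b : Kinf F) (l : ℤ) (p : Polynomial (Cinf F)) (t : Kinf F) :
    inftyChart (locPoly b l p) t =
      if t ≠ 0 ∧ ‖t⁻¹ - b‖ ≤ ‖unif F‖ ^ l then p.eval (toC t⁻¹) else 0 := by
  rw [inftyChart]
  by_cases ht : t = 0
  · rw [if_pos ht, if_neg (fun h => h.1 ht)]
    rfl
  · rw [if_neg ht, locPoly_coe]
    simp [ht]

theorem inftyChart_locPolyInfty (l : ℤ) (p : Polynomial (Cinf F)) (t : Kinf F) :
    inftyChart (locPolyInfty l p) t = if ‖t - 0‖ ≤ ‖unif F‖ ^ l then p.eval (toC t) else 0 := by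
  rw [inftyChart]
  by_cases ht : t = 0
  · rw [if_pos ht, ht, sub_zero, norm_zero, if_pos (zpow_unif_pos l).le, map_zero]
    rfl
  · rw [if_neg ht, locPolyInfty_coe, inv_inv, sub_zero]
    simp only [zpow_neg_unif_le_iff (inv_ne_zero ht), inv_inv]

theorem finiteChart_locPolyInfty (l : ℤ) (p : Polynomial (Cinf F)) (x : Kinf F) :
    finiteChart (locPolyInfty l p) x =
      if x ≠ 0 ∧ ‖x⁻¹ - 0‖ ≤ ‖unif F‖ ^ l then p.eval (toC x⁻¹) else 0 := by
  rw [finiteChart, locPolyInfty_coe]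
  by_cases hx : x = 0
  · rw [if_neg, if_neg fun h' => h'.1 hx]
    rw [hx, norm_zero, not_le]
    exact zpow_unif_pos _
  · simp only [zpow_neg_unif_le_iff hx, sub_zero, ne_eq, hx, not_false_eq_true, true_and]

theorem locPoly_mem (b : Kinf F) (l : ℤ) (p : Polynomial (Cinf F)) : locPoly b l p ∈ CnFun F h := by
  refine ⟨fun a _ => ?_, ?_⟩
  · rw [← zpow_one ‖unif F‖]
    exact (divDiffBounded_indicator_eval b a l 1 p).isCnOn h
  · rw [← zpow_one ‖unif F‖, funext (inftyChart_locPoly b l p)]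
    exact (divDiffBounded_indicator_inv_eval b 0 l 1 p).isCnOn h

theorem locPolyInfty_mem (l : ℤ) (p : Polynomial (Cinf F)) : locPolyInfty l p ∈ CnFun F h := by
  refine ⟨fun a _ => ?_, ?_⟩
  · rw [← zpow_one ‖unif F‖, funext (finiteChart_locPolyInfty l p)]
    exact (divDiffBounded_indicator_inv_eval 0 a l 1 p).isCnOn h
  · rw [← zpow_one ‖unif F‖, funext (inftyChart_locPolyInfty l p)]
    exact (divDiffBounded_indicator_eval 0 0 l 1 p).isCnOn h

theorem integral_of_mem (μ : CnDual F h) {f : P1 F → Cinf F} (hf : f ∈ CnFun F h) :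
    integral μ f = μ.1 ⟨f, hf⟩ := dif_pos hf

theorem integral_add (μ : CnDual F h) {f g : P1 F → Cinf F} (hf : f ∈ CnFun F h)
    (hg : g ∈ CnFun F h) : integral μ (f + g) = integral μ f + integral μ g := by
  rw [integral_of_mem μ hf, integral_of_mem μ hg, integral_of_mem μ (add_mem hf hg), ← map_add]
  rfl

theorem integral_smul (μ : CnDual F h) (a : Cinf F) {f : P1 F → Cinf F} (hf : f ∈ CnFun F h) :
    integral μ (a • f) = a * integral μ f := by
  rw [integral_of_mem μ hf, integral_of_mem μ (Submodule.smul_mem _ a hf), ← smul_eq_mul, ← map_smul]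
  rfl

theorem integral_sub (μ : CnDual F h) {f g : P1 F → Cinf F} (hf : f ∈ CnFun F h)
    (hg : g ∈ CnFun F h) : integral μ (f - g) = integral μ f - integral μ g := by
  rw [integral_of_mem μ hf, integral_of_mem μ hg, integral_of_mem μ (sub_mem hf hg), ← map_sub]
  rfl

theorem integral_zero (μ : CnDual F h) : integral μ 0 = 0 := by
  rw [integral_of_mem μ (Submodule.zero_mem _)]
  exact map_zero _

theorem integral_sum (μ : CnDual F h) {ι : Type*} (s : Finset ι) {f : ι → P1 F → Cinf F}
    (hf : ∀ i ∈ s, f i ∈ CnFun F h) : integral μ (∑ i ∈ s, f i) = ∑ i ∈ s, integral μ (f i) := by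
  induction s using Finset.induction_on with
  | empty => simp [integral_zero]
  | insert i s hi ih =>
    have hs : ∀ j ∈ s, f j ∈ CnFun F h := fun j hj => hf j (Finset.mem_insert_of_mem hj)
    rw [Finset.sum_insert hi, Finset.sum_insert hi,
      integral_add μ (hf i (Finset.mem_insert_self i s)) (Submodule.sum_mem _ hs), ih hs]

theorem locPoly_eq_sum (b : Kinf F) (l : ℤ) (p : Polynomial (Cinf F)) :
    locPoly b l p = ∑ ε : F, locPoly (subCenter b l ε) (l + 1) p := by
  funext P
  rw [Finset.sum_apply]
  induction P using OnePoint.rec with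
  | infty => exact (Finset.sum_eq_zero fun _ _ => rfl).symm
  | coe x =>
    simp only [locPoly_coe]
    by_cases hx : ‖x - b‖ ≤ ‖unif F‖ ^ l
    · obtain ⟨ε, hε⟩ := exists_norm_sub_subCenter_le hx
      rw [if_pos hx, Finset.sum_eq_single_of_mem ε (Finset.mem_univ _), if_pos hε]
      intro ε' _ hne
      exact if_neg fun h' => hne (eq_of_norm_sub_subCenter_le h' hε)
    · rw [if_neg hx]
      exact (Finset.sum_eq_zero fun ε _ => if_neg fun h' =>
        hx (norm_sub_le_of_norm_sub_subCenter_le h')).symm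

theorem locPoly_add (b : Kinf F) (l : ℤ) (p p' : Polynomial (Cinf F)) :
    locPoly b l (p + p') = locPoly b l p + locPoly b l p' := by
  funext P
  induction P using OnePoint.rec with
  | infty => exact (add_zero 0).symm
  | coe x =>
    rw [Pi.add_apply, locPoly_coe, locPoly_coe, locPoly_coe, Polynomial.eval_add]
    split_ifs <;> simp

theorem locPoly_smul (b : Kinf F) (l : ℤ) (a : Cinf F) (p : Polynomial (Cinf F)) :
    locPoly b l (a • p) = a • locPoly b l p := by
  funext P
  induction P using OnePoint.rec with
  | infty => exact (smul_zero a).symm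
  | coe x =>
    rw [Pi.smul_apply, locPoly_coe, locPoly_coe, Polynomial.eval_smul]
    split_ifs <;> simp

theorem kappa_coe (a : Kinf F) (l : ℤ) (j : ℕ) (x : Kinf F) :
    kappa a l j (x : P1 F) = if ‖x - a‖ ≤ ‖unif F‖ ^ l then toC (x - a) ^ j else 0 := rfl

theorem kappaInfty_coe (l : ℤ) (j : ℕ) (x : Kinf F) :
    kappaInfty l j (x : P1 F) = if ‖unif F‖ ^ (-l) ≤ ‖x‖ then toC x⁻¹ ^ j else 0 := rfl

theorem annulusPow_coe (m l : ℤ) (i : ℕ) (x : Kinf F) :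
    annulusPow m l i (x : P1 F) = if ‖unif F‖ ^ (-m) ≤ ‖x‖ ∧ ‖x‖ ≤ ‖unif F‖ ^ (-l) then
      toC x⁻¹ ^ i else 0 := rfl

theorem kappa_eq (a : Kinf F) (l : ℤ) (j : ℕ) :
    kappa a l j = locPoly a l ((Polynomial.X - Polynomial.C (toC a)) ^ j) := by
  funext P
  induction P using OnePoint.rec with
  | infty => rfl
  | coe x =>
    rw [locPoly_coe, kappa_coe]
    simp

theorem kappaInfty_eq (l : ℤ) (j : ℕ) :
    (kappaInfty l j : P1 F → Cinf F) = locPolyInfty l (Polynomial.X ^ j) := by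
  funext P
  induction P using OnePoint.rec with
  | infty =>
    change (0 : Cinf F) ^ j = (Polynomial.X ^ j).eval 0
    simp
  | coe x =>
    rw [locPolyInfty_coe, kappaInfty_coe]
    simp

/-- Absolute values are powers of `|π|`, so the complement of `|x| ≤ |π|^(-l)` is the ball of index
`l + 1` around `∞`. -/
theorem annulusPow_eq {m l : ℤ} (hml : m ≤ l) (i : ℕ) :
    (annulusPow m l i : P1 F → Cinf F) = kappaInfty m i - kappaInfty (l + 1) i := by
  funext P
  induction P using OnePoint.rec with
  | infty =>
    exact (sub_self (0 ^ i : Cinf F)).symm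
  | coe x =>
    rw [Pi.sub_apply, annulusPow_coe, kappaInfty_coe, kappaInfty_coe]
    have h1 : ‖unif F‖ ^ (-(l + 1)) ≤ ‖x‖ ↔ ¬ ‖x‖ ≤ ‖unif F‖ ^ (-l) := by
      rcases eq_or_ne x 0 with rfl | hx
      · simp [zpow_unif_pos, (zpow_unif_pos _).le]
      · obtain ⟨v, hv⟩ := norm_eq_zpow hx
        rw [hv, zpow_unif_le, zpow_unif_le]
        omega
    by_cases h2 : ‖x‖ ≤ ‖unif F‖ ^ (-l)
    · rw [if_neg (fun h' => h1.mp h' h2), sub_zero]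
      simp only [h2, and_true]
    · have h3 : ‖unif F‖ ^ (-m) ≤ ‖x‖ :=
        (zpow_unif_le.mpr (by omega)).trans (not_le.mp h2).le
      rw [if_neg (fun h' => h2 h'.2), if_pos h3, if_pos (h1.mpr h2), sub_self]

end LocallyPolynomial


/-! ### The functional attached to moments in two charts -/

section Functional
variable {F : Type*} [Field F] [Fintype F] {d h : ℕ} {C : ℝ}
  {ν ν' : Kinf F → ℤ → Polynomial (Cinf F) →ₗ[Cinf F] Cinf F}
open scoped Classical
open Filter

theorem subCenter_zero (b : Kinf F) (l : ℤ) : subCenter b l (0 : F) = b := by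
  simp [subCenter]

theorem IsMomentData.ballIntegral_of_support (D : IsMomentData d h C ν) (hd : h ≤ d)
    {f : Kinf F → Cinf F} {b : Kinf F} (k : ℕ) {m : ℤ} (hm : 0 ≤ m)
    (hf : IsTame h (Metric.closedBall b (‖unif F‖ ^ m)) f)
    (h0 : ∀ x, ‖x - b‖ ≤ ‖unif F‖ ^ m → ¬ ‖x - b‖ ≤ ‖unif F‖ ^ (m + k) → f x = 0) :
    ballIntegral ν h f b m = ballIntegral ν h f b (m + k) := by
  induction k generalizing m with
  | zero => simp
  | succ k ih =>
    have e : m + ((k + 1 : ℕ) : ℤ) = m + 1 + k := by push_cast; ring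
    have hsub := closedBall_subCenter_subset b m (0 : F)
    rw [subCenter_zero] at hsub
    rw [D.ballIntegral_eq_sum hd hm hf, Finset.sum_eq_single (0 : F), subCenter_zero, e]
    · rw [e] at h0
      exact ih (by omega) (hf.mono hsub) fun x hx => h0 x (hx.trans (zpow_unif_le.mpr (by omega)))
    · intro ε _ hne
      rw [ballIntegral_congr (g := fun _ => 0) fun x hx => ?_, ballIntegral_zero]
      rw [mem_closedBall_iff_norm] at hx
      refine h0 x (norm_sub_le_of_norm_sub_subCenter_le hx) fun hxb => hne ?_
      refine eq_of_norm_sub_subCenter_le hx ?_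
      rw [subCenter_zero]
      exact hxb.trans (zpow_unif_le.mpr (by push_cast; omega))
    · intro h'
      exact absurd (Finset.mem_univ _) h'

/-- The sum of the integrals of `f` over the balls of radius `|π|` in `P¹(k_∞)`. -/
def glueIntegral (d h : ℕ) (ν ν' : Kinf F → ℤ → Polynomial (Cinf F) →ₗ[Cinf F] Cinf F)
    (f : P1 F → Cinf F) : Cinf F :=
  ∑ ε : F, ballIntegral ν h (finiteChart f) (subCenter 0 0 ε) 1 +
    ballIntegral ν' h (fun t => toC t ^ d * inftyChart f t) 0 1

theorem norm_subCenter_zero_le (ε : F) : ‖subCenter (0 : Kinf F) 0 ε‖ ≤ 1 := by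
  simpa using norm_subCenter_sub_le (0 : Kinf F) 0 ε

theorem isTame_finiteChart {f : P1 F → Cinf F} (hf : f ∈ CnFun F h) {a : Kinf F} (ha : ‖a‖ ≤ 1) :
    IsTame h (Metric.closedBall a (‖unif F‖ ^ (1 : ℤ))) (finiteChart f) := by
  have := hf.1 a ha
  rw [← zpow_one ‖unif F‖] at this
  exact this.isTame (isCompact_closedBall a 1)

theorem isTame_inftyChart {f : P1 F → Cinf F} (hf : f ∈ CnFun F h) :
    IsTame h (Metric.closedBall 0 (‖unif F‖ ^ (1 : ℤ))) (inftyChart f) := by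
  have := hf.2
  rw [← zpow_one ‖unif F‖] at this
  exact this.isTame (isCompact_closedBall 0 1)

theorem isTame_pow_mul_inftyChart {f : P1 F → Cinf F} (hf : f ∈ CnFun F h) (k : ℕ) :
    IsTame h (Metric.closedBall 0 (‖unif F‖ ^ (1 : ℤ))) fun t => toC t ^ k * inftyChart f t :=
  (isTame_inftyChart hf).mul_toC_pow (R := ‖unif F‖ ^ (1 : ℤ))
    (fun x hx => by simpa using mem_closedBall_iff_norm.mp hx) k

theorem cnNormOn_nonneg (B : Set (Kinf F)) (f : Kinf F → Cinf F) : 0 ≤ cnNormOn h B f :=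
  Real.iSup_nonneg fun _ => norm_nonneg _

theorem cnNormOn_finiteChart_le (f : P1 F → Cinf F) {a : Kinf F} (ha : ‖a‖ ≤ 1) :
    cnNormOn h (Metric.closedBall a (‖unif F‖ ^ (1 : ℤ))) (finiteChart f) ≤ cnNorm h f := by
  have hfin : (Set.range fun ε : F =>
      cnNormOn h (Metric.closedBall (subCenter 0 0 ε) ‖unif F‖) (finiteChart f)).Finite :=
    Set.finite_range _
  refine le_max_of_le_left ?_
  rw [zpow_one]
  refine le_ciSup (f := fun a : Metric.closedBall (0 : Kinf F) 1 =>
    cnNormOn h (Metric.closedBall (a : Kinf F) ‖unif F‖) (finiteChart f)) ?_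
    ⟨a, by simpa using ha⟩
  refine hfin.bddAbove.mono ?_
  rintro _ ⟨⟨a, ha⟩, rfl⟩
  obtain ⟨ε, hε⟩ := exists_norm_sub_subCenter_le (x := a) (b := 0) (l := 0) (by
    rw [zpow_zero, ← mem_closedBall_iff_norm]
    exact ha)
  refine ⟨ε, ?_⟩
  dsimp only
  rw [IsUltrametricDist.closedBall_eq_of_mem (y := a)]
  rw [mem_closedBall_iff_norm]
  simpa using hε

theorem cnNormOn_inftyChart_le (f : P1 F → Cinf F) :
    cnNormOn h (Metric.closedBall 0 (‖unif F‖ ^ (1 : ℤ))) (inftyChart f) ≤ cnNorm h f := by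
  rw [zpow_one]
  exact le_max_right _ _

theorem DivDiffBound.mul_toC_pow {k : ℕ} {f : Kinf F → Cinf F} {M : ℝ}
    (hf : DivDiffBound (Metric.closedBall 0 (‖unif F‖ ^ (1 : ℤ))) k f M) (hM : 0 ≤ M) (i : ℕ) :
    DivDiffBound (Metric.closedBall 0 (‖unif F‖ ^ (1 : ℤ))) k (fun t => toC t ^ i * f t) M := by
  induction i with
  | zero => simpa using hf
  | succ i ih =>
    have := ih.sub_mul 0 hM (R := 1) fun x hx => (mem_closedBall_iff_norm.mp hx).trans (by
      rw [zpow_one]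
      exact norm_unif_lt_one.le)
    simpa only [max_self, one_mul, sub_zero, pow_succ', mul_assoc] using this

theorem IsMomentData.norm_ballIntegral_le_of_bound (D : IsMomentData d h C ν) (hd : h ≤ d)
    {f : Kinf F → Cinf F} {b : Kinf F} {M : ℝ} (hM : 0 ≤ M)
    (hf : IsTame h (Metric.closedBall b (‖unif F‖ ^ (1 : ℤ))) f)
    (hfM : DivDiffBound (Metric.closedBall b (‖unif F‖ ^ (1 : ℤ))) (h + 1) f M) :
    ‖ballIntegral ν h f b 1‖ ≤ C * ‖unif F‖ ^ (-(h : ℤ)) * ‖unif F‖ ^ (-(1 * (h : ℤ))) * M := by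
  refine D.norm_ballIntegral_le hd zero_le_one hf hM fun S hS hne hc => ?_
  refine (mul_le_of_le_one_right (norm_nonneg _) ?_).trans (hfM S hS hne hc)
  rw [zpow_one]
  exact pow_le_one₀ norm_unif_pos.le norm_unif_lt_one.le

theorem IsGluedData.norm_glueIntegral_le (D : IsGluedData d h C ν ν') (hd : h ≤ d)
    {f : P1 F → Cinf F} (hf : f ∈ CnFun F h) : ‖glueIntegral d h ν ν' f‖ ≤
      C * ‖unif F‖ ^ (-(h : ℤ)) * ‖unif F‖ ^ (-(1 * (h : ℤ))) * cnNorm h f := by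
  have hC := D.fin.nonneg
  have h1 := (zpow_unif_pos (F := F) (-(h : ℤ))).le
  have h2 := (zpow_unif_pos (F := F) (-(1 * (h : ℤ)))).le
  have h3 : 0 ≤ cnNorm h f := (cnNormOn_nonneg _ _).trans (cnNormOn_inftyChart_le f)
  refine (IsUltrametricDist.norm_add_le_max _ _).trans (max_le ?_ ?_)
  · refine norm_sum_le_of_le' _ _ (by positivity) fun ε _ => ?_
    have hε := norm_subCenter_zero_le ε
    obtain ⟨M, hM, hb⟩ := (isTame_finiteChart hf hε).bound
    exact D.fin.norm_ballIntegral_le_of_bound hd h3 (isTame_finiteChart hf hε)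
      (hb.cnNormOn.mono le_rfl le_rfl (cnNormOn_finiteChart_le f hε))
  · obtain ⟨M, hM, hb⟩ := (isTame_inftyChart hf).bound
    exact D.inf.norm_ballIntegral_le_of_bound hd h3 (isTame_pow_mul_inftyChart hf d)
      ((hb.cnNormOn.mono le_rfl le_rfl (cnNormOn_inftyChart_le f)).mul_toC_pow h3 d)

theorem inftyChart_add (f g : P1 F → Cinf F) (t : Kinf F) :
    inftyChart (f + g) t = inftyChart f t + inftyChart g t := by
  simp only [inftyChart, Pi.add_apply]
  split_ifs <;> rfl

theorem inftyChart_smul (a : Cinf F) (f : P1 F → Cinf F) (t : Kinf F) :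
    inftyChart (a • f) t = a * inftyChart f t := by
  simp only [inftyChart, Pi.smul_apply, smul_eq_mul]
  split_ifs <;> rfl

theorem IsGluedData.exists_functional (D : IsGluedData d h C ν ν') (hd : h ≤ d) :
    ∃ μ : CnDual F h, ∀ f ∈ CnFun F h, integral μ f = glueIntegral d h ν ν' f := by
  refine ⟨⟨⟨⟨fun f => glueIntegral d h ν ν' f.1, ?_⟩, ?_⟩, _, fun f => D.norm_glueIntegral_le hd f.2⟩,
    fun f hf => integral_of_mem _ hf⟩
  · rintro ⟨f, hf⟩ ⟨g, hg⟩
    have h1 : ∀ ε : F, ballIntegral ν h (finiteChart (f + g)) (subCenter 0 0 ε) 1 =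
        ballIntegral ν h (finiteChart f) (subCenter 0 0 ε) 1 +
          ballIntegral ν h (finiteChart g) (subCenter 0 0 ε) 1 := fun ε =>
      D.fin.ballIntegral_add hd zero_le_one (isTame_finiteChart hf (norm_subCenter_zero_le ε))
        (isTame_finiteChart hg (norm_subCenter_zero_le ε))
    change glueIntegral d h ν ν' (f + g) = _
    simp only [glueIntegral, h1, Finset.sum_add_distrib, inftyChart_add, mul_add]
    rw [D.inf.ballIntegral_add hd zero_le_one (isTame_pow_mul_inftyChart hf d)
      (isTame_pow_mul_inftyChart hg d)]
    ring
  · rintro a ⟨f, hf⟩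
    have h1 : ∀ ε : F, ballIntegral ν h (finiteChart (a • f)) (subCenter 0 0 ε) 1 =
        a * ballIntegral ν h (finiteChart f) (subCenter 0 0 ε) 1 := fun ε =>
      D.fin.ballIntegral_const_mul hd a zero_le_one (isTame_finiteChart hf (norm_subCenter_zero_le ε))
    change glueIntegral d h ν ν' (a • f) = a * _
    simp only [glueIntegral, h1, ← Finset.mul_sum, inftyChart_smul, mul_left_comm _ a]
    rw [D.inf.ballIntegral_const_mul hd a zero_le_one (isTame_pow_mul_inftyChart hf d), mul_add]

theorem eval_reflect {p : Polynomial (Cinf F)} (hp : p.natDegree ≤ d) {t : Kinf F} (ht : t ≠ 0) :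
    (p.reflect d).eval (toC t) = toC t ^ d * p.eval (toC t⁻¹) := by
  have ht' : toC t ≠ 0 := (map_ne_zero _).mpr ht
  rw [Polynomial.eval_eq_sum_range' (Nat.lt_succ_of_le (Polynomial.natDegree_le_iff_coeff_eq_zero.mpr
      fun i hi => ?_)), Polynomial.eval_eq_sum_range' (Nat.lt_succ_of_le hp), Finset.mul_sum,
    ← Finset.sum_range_reflect]
  · refine Finset.sum_congr rfl fun i hi => ?_
    have hi : i ≤ d := Nat.lt_succ_iff.mp (Finset.mem_range.mp hi)
    rw [Nat.succ_sub_one, Polynomial.coeff_reflect, Polynomial.revAt_le (Nat.sub_le d i),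
      Nat.sub_sub_self hi, map_inv₀, inv_pow, pow_sub₀ _ ht' hi]
    ring
  · rw [Polynomial.coeff_reflect, Polynomial.revAt_eq_self_of_lt hi,
      Polynomial.coeff_eq_zero_of_natDegree_lt (hp.trans_lt hi)]

theorem norm_le_of_mem_closedBall_one {a x : Kinf F} (ha : ‖a‖ ≤ 1)
    (hx : x ∈ Metric.closedBall a (‖unif F‖ ^ (1 : ℤ))) : ‖x‖ ≤ 1 := by
  rw [mem_closedBall_iff_norm, zpow_one] at hx
  rw [← sub_add_cancel x a]
  exact norm_add_le_of_le' (hx.trans norm_unif_lt_one.le) ha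

theorem natDegree_reflect_le {p : Polynomial (Cinf F)} (hp : p.natDegree ≤ d) :
    (p.reflect d).natDegree ≤ d := by
  rw [Polynomial.natDegree_le_iff_coeff_eq_zero]
  intro i hi
  rw [Polynomial.coeff_reflect, Polynomial.revAt_eq_self_of_lt hi,
    Polynomial.coeff_eq_zero_of_natDegree_lt (hp.trans_lt hi)]

/-- On both balls `|t| = |b|⁻¹`, and then `|t - b⁻¹| = |t⁻¹ - b| |b|^(-2)`. -/
theorem inv_norm_sub_le_zpow_iff {b : Kinf F} {v l : ℤ} (hv : ‖b‖ = ‖unif F‖ ^ v) (hvl : v < l)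
    (t : Kinf F) : (t ≠ 0 ∧ ‖t⁻¹ - b‖ ≤ ‖unif F‖ ^ l) ↔ ‖t - b⁻¹‖ ≤ ‖unif F‖ ^ (l - 2 * v) := by
  have hb0 : b ≠ 0 := norm_pos_iff.mp (hv ▸ zpow_unif_pos v)
  have hbn : ‖b⁻¹‖ = ‖unif F‖ ^ (-v) := by rw [norm_inv, hv, zpow_neg]
  have key : ∀ t : Kinf F, t ≠ 0 → ‖t‖ = ‖unif F‖ ^ (-v) →
      ‖t - b⁻¹‖ = ‖t⁻¹ - b‖ * ‖unif F‖ ^ (-v - v) := by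
    intro t ht htn
    have : t - b⁻¹ = -((t⁻¹ - b) * (t * b⁻¹)) := by field_simp; ring
    rw [this, norm_neg, norm_mul, norm_mul, htn, hbn, ← zpow_add₀ norm_unif_pos.ne']
    rfl
  have hlv : ‖unif F‖ ^ (l - 2 * v) = ‖unif F‖ ^ l * ‖unif F‖ ^ (-v - v) := by
    rw [← zpow_add₀ norm_unif_pos.ne']
    congr 1
    ring
  have heq : ∀ x y : Kinf F, ‖x - y‖ < ‖y‖ → ‖x‖ = ‖y‖ := fun x y hxy => by
    rw [← sub_add_cancel x y]
    exact (IsUltrametricDist.norm_add_eq_max_of_norm_ne_norm hxy.ne).trans (max_eq_right hxy.le)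
  constructor
  · rintro ⟨ht, htb⟩
    have htn : ‖t‖ = ‖unif F‖ ^ (-v) := by
      rw [← hbn, norm_inv, ← heq t⁻¹ b (htb.trans_lt (by rw [hv]; exact zpow_unif_lt.mpr hvl)),
        norm_inv, inv_inv]
    rw [key t ht htn, hlv]
    exact mul_le_mul_of_nonneg_right htb (zpow_unif_pos _).le
  · intro htb
    have htn : ‖t‖ = ‖unif F‖ ^ (-v) := by
      rw [← hbn]
      exact heq t b⁻¹ (htb.trans_lt (by rw [hbn]; exact zpow_unif_lt.mpr (by omega)))
    have ht : t ≠ 0 := norm_pos_iff.mp (htn ▸ zpow_unif_pos _)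
    rw [key t ht htn, hlv] at htb
    exact ⟨ht, le_of_mul_le_mul_right htb (zpow_unif_pos _)⟩

/-- A ball of radius at most `|π|` lies in one member of the decomposition. If it is a ball in the
chart at `∞`, the weight `t^d` makes the integrand the reversed polynomial, and the gluing condition
returns to `ν`. -/
theorem IsGluedData.glueIntegral_locPoly_of_pos (D : IsGluedData d h C ν ν') (hd : h ≤ d)
    (b : Kinf F) {l : ℤ} (hl : 1 ≤ l) {p : Polynomial (Cinf F)} (hp : p.natDegree ≤ d) :
    glueIntegral d h ν ν' (locPoly b l p) = ν b l p := by
  have hmem : locPoly b l p ∈ CnFun F h := locPoly_mem b l p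
  have hf : ∀ x, finiteChart (locPoly b l p) x =
      if ‖x - b‖ ≤ ‖unif F‖ ^ l then p.eval (toC x) else 0 := fun x => rfl
  have hl1 : ‖unif F‖ ^ l ≤ ‖unif F‖ ^ (1 : ℤ) := zpow_unif_le.mpr hl
  rcases le_or_gt ‖b‖ 1 with hb | hb
  · obtain ⟨ε, hε⟩ := exists_norm_sub_subCenter_le (x := b) (b := 0) (l := 0) (by simpa using hb)
    have h1 : ballIntegral ν' h (fun t => toC t ^ d * inftyChart (locPoly b l p) t) 0 1 = 0 := by
      rw [ballIntegral_congr (g := fun _ => 0) fun t ht => ?_, ballIntegral_zero]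
      rw [inftyChart_locPoly, if_neg, mul_zero]
      rintro ⟨ht0, htb⟩
      have h2 := norm_add_le_of_le' ((htb.trans hl1).trans (by
        rw [zpow_one]; exact norm_unif_lt_one.le)) hb
      rw [sub_add_cancel, norm_inv, inv_le_one₀ (norm_pos_iff.mpr ht0)] at h2
      rw [mem_closedBall_iff_norm, sub_zero, zpow_one] at ht
      exact absurd (h2.trans ht) (not_le.mpr norm_unif_lt_one)
    rw [glueIntegral, h1, add_zero, Finset.sum_eq_single ε]
    · have h3 := D.fin.ballIntegral_of_eq_eval hd hp (f := finiteChart (locPoly b l p)) (b := b)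
        (l - 1).toNat (a := subCenter 0 0 ε) (m := 1) zero_le_one (by simpa using hε)
        (isTame_finiteChart hmem (norm_subCenter_zero_le ε))
      rw [show 1 + ((l - 1).toNat : ℤ) = l by omega] at h3
      exact h3 (fun x hx => by rw [hf, if_pos hx]) fun x _ hx => by rw [hf, if_neg hx]
    · intro ε' _ hne
      rw [ballIntegral_congr (g := fun _ => 0) fun x hx => ?_, ballIntegral_zero]
      rw [hf, if_neg]
      intro hxb
      refine hne (eq_of_norm_sub_subCenter_le (mem_closedBall_iff_norm.mp hx) ?_)
      exact norm_sub_le_of_le (hxb.trans hl1) hε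
    · exact fun h' => absurd (Finset.mem_univ _) h'
  · have hb0 : b ≠ 0 := norm_pos_iff.mp (one_pos.trans hb)
    obtain ⟨v, hv⟩ := norm_eq_zpow hb0
    have hv0 : v < 0 := by
      rwa [hv, ← zpow_zero ‖unif F‖, zpow_unif_lt] at hb
    have h1 : ∀ ε : F, ballIntegral ν h (finiteChart (locPoly b l p)) (subCenter 0 0 ε) 1 = 0 := by
      intro ε
      rw [ballIntegral_congr (g := fun _ => 0) fun x hx => ?_, ballIntegral_zero]
      rw [hf, if_neg]
      intro hxb
      rw [norm_sub_rev] at hxb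
      have h2 := norm_add_le_of_le' ((hxb.trans hl1).trans (by
        rw [zpow_one]; exact norm_unif_lt_one.le))
        (norm_le_of_mem_closedBall_one (norm_subCenter_zero_le ε) hx)
      rw [sub_add_cancel] at h2
      exact absurd h2 (not_le.mpr hb)
    have hvl : v < l := by omega
    have hball := inv_norm_sub_le_zpow_iff hv hvl
    rw [glueIntegral, Finset.sum_eq_zero fun ε _ => h1 ε, zero_add, ← D.glue b l v hv hvl p hp]
    have h3 := D.inf.ballIntegral_of_eq_eval hd (natDegree_reflect_le hp)
      (f := fun t => toC t ^ d * inftyChart (locPoly b l p) t) (b := b⁻¹)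
      (l - 2 * v - 1).toNat (a := 0) (m := 1) zero_le_one (by
        rw [sub_zero, norm_inv, hv, ← zpow_neg, zpow_unif_le]
        omega) (isTame_pow_mul_inftyChart hmem d)
    rw [show 1 + ((l - 2 * v - 1).toNat : ℤ) = l - 2 * v by omega] at h3
    refine h3 (fun t ht => ?_) fun t _ ht => ?_
    · have h4 := (hball t).mpr ht
      rw [inftyChart_locPoly, if_pos h4, eval_reflect hp h4.1]
    · rw [inftyChart_locPoly, if_neg fun h4 => ht ((hball t).mp h4), mul_zero]

/-- Large balls are split until all radii are at most `|π|`; both sides are additive. -/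
theorem integral_locPoly_of_pos {μ : CnDual F h} (hadd : ∀ b l p,
    ν b l p = ∑ ε : F, ν (subCenter b l ε) (l + 1) p) {p : Polynomial (Cinf F)}
    (hp : ∀ b, ∀ l ≥ 1, integral μ (locPoly b l p) = ν b l p) (b : Kinf F) (l : ℤ) :
    integral μ (locPoly b l p) = ν b l p := by
  have key : ∀ (k : ℕ) (b : Kinf F) (l : ℤ), 1 - (k : ℤ) ≤ l →
      integral μ (locPoly b l p) = ν b l p := by
    intro k
    induction k with
    | zero => exact fun b l hl => hp b l (by simpa using hl)
    | succ k ih =>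
      intro b l hl
      rw [locPoly_eq_sum, integral_sum μ _ fun ε _ => locPoly_mem _ _ _, hadd]
      exact Finset.sum_congr rfl fun ε _ => ih _ _ (by push_cast at hl; omega)
  exact key (1 - l).toNat b l (by omega)

theorem IsGluedData.glueIntegral_locPolyInfty (D : IsGluedData d h C ν ν') (hd : h ≤ d)
    {l : ℤ} (hl : 1 ≤ l) (j : ℕ) :
    glueIntegral d h ν ν' (locPolyInfty l (Polynomial.X ^ j)) =
      ballIntegral ν' h (fun t => (Polynomial.X ^ (d + j) : Polynomial (Cinf F)).eval (toC t)) 0 l := by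
  have hmem : locPolyInfty l (Polynomial.X ^ j) ∈ CnFun F h := locPolyInfty_mem l _
  have h1 : ∀ ε : F, ballIntegral ν h (finiteChart (locPolyInfty l (Polynomial.X ^ j)))
      (subCenter 0 0 ε) 1 = 0 := by
    intro ε
    rw [ballIntegral_congr (g := fun _ => 0) fun x hx => ?_, ballIntegral_zero]
    rw [finiteChart, locPolyInfty_coe, if_neg]
    rw [not_le]
    refine (norm_le_of_mem_closedBall_one (norm_subCenter_zero_le ε) hx).trans_lt ?_
    rw [← zpow_zero ‖unif F‖, zpow_unif_lt]
    omega
  have h2 := D.inf.ballIntegral_of_support hd (l - 1).toNat zero_le_one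
    (isTame_pow_mul_inftyChart hmem d) fun t ht ht' => by
      rw [inftyChart_locPolyInfty, if_neg, mul_zero]
      rwa [show 1 + ((l - 1).toNat : ℤ) = l by omega] at ht'
  rw [show 1 + ((l - 1).toNat : ℤ) = l by omega] at h2
  rw [glueIntegral, Finset.sum_eq_zero fun ε _ => h1 ε, zero_add, h2]
  refine ballIntegral_congr fun t ht => ?_
  rw [inftyChart_locPolyInfty, if_pos (mem_closedBall_iff_norm.mp ht), Polynomial.eval_pow,
    Polynomial.eval_pow, Polynomial.eval_X, pow_add]

theorem IsMomentData.norm_ballIntegral_pow_le (D : IsMomentData d h C ν) (hd : h ≤ d) {l : ℤ}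
    (hl : 0 ≤ l) (i : ℕ) :
    ‖ballIntegral ν h (fun t => (Polynomial.X ^ i : Polynomial (Cinf F)).eval (toC t)) 0 l‖ ≤
      C * ‖unif F‖ ^ (-(h : ℤ)) * ‖unif F‖ ^ (l * ((i : ℤ) - h)) := by
  have h1 := D.norm_ballIntegral_le hd (f := fun t => (Polynomial.X ^ i).eval (toC t)) (b := 0) hl
    ((divDiffBounded_eval _ 0 l).isTame h) (M := (‖unif F‖ ^ l) ^ i)
    (pow_nonneg (zpow_unif_pos l).le i) fun S hS hne _ => by
      have h2 := norm_divDiff_pow_mul_le (b := 0) i (S.card - 1) (zpow_unif_pos (F := F) l).le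
        (fun s hs => mem_closedBall_iff_norm.mp (hS hs)) (by have := hne.card_pos; omega)
      simpa using h2
  refine h1.trans_eq ?_
  rw [mul_assoc, ← zpow_natCast (‖unif F‖ ^ l), ← zpow_mul, ← zpow_add₀ norm_unif_pos.ne']
  congr 2
  ring

theorem tendsto_zpow_unif : Tendsto (fun l : ℤ => ‖unif F‖ ^ l) atTop (𝓝 0) := by
  have h1 : Tendsto Int.toNat atTop atTop := tendsto_atTop.mpr fun b => by
    filter_upwards [eventually_ge_atTop (b : ℤ)] with l hl
    omega
  refine ((tendsto_pow_atTop_nhds_zero_of_lt_one norm_unif_pos.le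
    (norm_unif_lt_one (F := F))).comp h1).congr' ?_
  filter_upwards [eventually_ge_atTop 0] with l hl
  rw [Function.comp_apply, ← zpow_natCast, Int.toNat_of_nonneg hl]

/-- The weight `t^d` improves the growth condition at `∞` by `|π|^(ld)`, so admissibility follows
there from that of `ν'`. Condition (∗) says that the integral of `x^(-i)` over shrinking balls
around `∞` tends to zero. -/
theorem IsGluedData.exists_measure (D : IsGluedData d h C ν ν') (hd : h ≤ d) : ∃ μ : CnDual F h,
    (∀ b l p, p.natDegree ≤ d → integral μ (locPoly b l p) = ν b l p) ∧
      HasLimitIntegralsAtInfty μ ∧ IsAdmissible μ := by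
  obtain ⟨μ, hμ⟩ := D.exists_functional hd
  have hC := D.fin.nonneg
  have hloc : ∀ b l p, p.natDegree ≤ d → integral μ (locPoly b l p) = ν b l p := fun b l p hp =>
    integral_locPoly_of_pos D.fin.add (fun b l hl => by
      rw [hμ _ (locPoly_mem b l p), D.glueIntegral_locPoly_of_pos hd b hl hp]) b l
  have hinf : ∀ l ≥ 1, ∀ j, integral μ (kappaInfty l j) =
      ballIntegral ν' h (fun t => (Polynomial.X ^ (d + j)).eval (toC t)) 0 l := fun l hl j => by
    rw [kappaInfty_eq, hμ _ (locPolyInfty_mem l _), D.glueIntegral_locPolyInfty hd hl]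
  refine ⟨μ, hloc, fun m i => ?_, C * ‖unif F‖ ^ (-(h : ℤ)), 1, fun l hl j hj => ⟨fun a => ?_, ?_⟩⟩
  · have h0 : Tendsto (fun l : ℤ => integral μ (kappaInfty (l + 1) i)) atTop (𝓝 0) := by
      -- The bound `|π|^(l(d+i-h))` tends to zero for `i ≥ 1`, but not for `i = 0` if `d = h`. There
      -- the vanishing of the moments near the cusp is used.
      rcases Nat.eq_zero_or_pos i with rfl | hi
      · obtain ⟨L, hL⟩ := D.exists_inf_eq_zero
        refine tendsto_const_nhds.congr' ?_
        filter_upwards [eventually_ge_atTop (L : ℤ)] with l hl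
        rw [hinf _ (by omega), D.inf.ballIntegral_eval hd (by simp) (by omega), hL _ (by omega)]
        rfl
      · have h1 : Tendsto (fun l : ℤ => C * ‖unif F‖ ^ (-(h : ℤ)) * ‖unif F‖ ^ l) atTop (𝓝 0) := by
          simpa using (tendsto_zpow_unif (F := F)).const_mul (C * ‖unif F‖ ^ (-(h : ℤ)))
        refine squeeze_zero_norm' ?_ h1
        filter_upwards [eventually_ge_atTop 0] with l hl
        rw [hinf _ (by omega)]
        refine (D.inf.norm_ballIntegral_pow_le hd (by omega) _).trans ?_
        have h2 : ‖unif F‖ ^ ((l + 1) * (((d + i : ℕ) : ℤ) - h)) ≤ ‖unif F‖ ^ l := by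
          rw [zpow_unif_le]
          have h4 : (1 : ℤ) ≤ ((d + i : ℕ) : ℤ) - h := by push_cast; omega
          nlinarith
        have h3 := (zpow_unif_pos (F := F) (-(h : ℤ))).le
        gcongr
    have h2 := (tendsto_const_nhds (x := integral μ (kappaInfty m i))).sub h0
    rw [sub_zero] at h2
    refine h2.congr' ?_
    filter_upwards [eventually_ge_atTop m] with l hl
    rw [annulusPow_eq hl, integral_sub μ]
    · rw [kappaInfty_eq]; exact locPolyInfty_mem _ _
    · rw [kappaInfty_eq]; exact locPolyInfty_mem _ _
  · rw [kappa_eq, hloc _ _ _ (by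
      rw [Polynomial.natDegree_pow, Polynomial.natDegree_X_sub_C]; omega)]
    refine (D.fin.bound a l (by omega) j (by omega)).trans ?_
    refine mul_le_mul_of_nonneg_right (le_mul_of_one_le_right hC ?_) (zpow_unif_pos _).le
    rw [← zpow_zero ‖unif F‖, zpow_unif_le]
    omega
  · rw [hinf l hl]
    refine (D.inf.norm_ballIntegral_pow_le hd (by omega) _).trans ?_
    have h2 : ‖unif F‖ ^ (l * (((d + j : ℕ) : ℤ) - h)) ≤ ‖unif F‖ ^ (l * ((j : ℤ) - h)) := by
      rw [zpow_unif_le]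
      refine mul_le_mul_of_nonneg_left ?_ (by omega)
      push_cast; omega
    have h3 := (zpow_unif_pos (F := F) (-(h : ℤ))).le
    gcongr

end Functional


/-! ### Density of piecewise polynomial functions -/

section Approximation
variable {F : Type*} [Field F] [Fintype F] {h : ℕ}
open scoped Classical

/-- Compare with divided differences on zeros of `r`, which vanish. Exchanging points costs `ω` in
the top order and a further factor `ρ`, the diameter, each time the order drops. -/
theorem norm_divDiff_le_of_zeros {r : Kinf F → Cinf F} {B : Set (Kinf F)} {ρ ω : ℝ} (hω : 0 ≤ ω)
    (hρ : 0 ≤ ρ) (hB : ∀ x ∈ B, ∀ y ∈ B, ‖x - y‖ ≤ ρ) {N : Finset (Kinf F)}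
    (hN : (N : Set (Kinf F)) ⊆ B) (hNc : N.card = h + 1) (hr : ∀ x ∈ N, r x = 0)
    (hT : ∀ T : Finset (Kinf F), (T : Set (Kinf F)) ⊆ B → T.card = h + 2 →
      ∀ u ∈ T, ∀ u' ∈ T, ‖u - u'‖ * ‖divDiff r T‖ ≤ ω) (i : ℕ) :
    ∀ S : Finset (Kinf F), (S : Set (Kinf F)) ⊆ B → S.card + i = h + 1 →
      ‖divDiff r S‖ ≤ ω * ρ ^ i := by
  have hzero : ∀ N' ⊆ N, divDiff r N' = 0 := fun N' hN' => by
    rw [divDiff_congr (g := fun _ => 0) fun x hx => hr x (hN' hx), divDiff_zero]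
  induction i with
  | zero =>
    intro S hS hc
    have h1 := norm_sub_le_of_exchange (divDiff r) (B := B) (k := h + 1) hω
      (fun T hTB hTc u hu u' hu' _ => by
        rw [norm_divDiff_erase_sub r hu' hu]
        exact hT T hTB hTc u' hu' u hu) hS hN hc hNc
    rw [hzero N subset_rfl, sub_zero] at h1
    simpa using h1
  | succ i ih =>
    intro S hS hc
    obtain ⟨N', hN', hN'c⟩ := Finset.exists_subset_card_eq (s := N) (n := S.card) (by omega)
    have h1 := norm_sub_le_of_exchange (divDiff r) (B := B) (k := S.card) (M := ω * ρ ^ (i + 1))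
      (by positivity)
      (fun T hTB hTc u hu u' hu' _ => by
        rw [norm_divDiff_erase_sub r hu' hu, pow_succ', mul_left_comm]
        exact mul_le_mul (hB _ (hTB hu') _ (hTB hu)) (ih T hTB (by omega)) (norm_nonneg _) hρ)
      hS ((Finset.coe_subset.mpr hN').trans hN) rfl hN'c
    rwa [hzero N' hN', sub_zero] at h1

/-- If two points of `S` are more than `ρ` apart, the divided difference is a difference of two on
fewer points divided by more than `ρ`, which fits the shape of the bound. Otherwise `S` lies in one
ball of radius `ρ`. -/
theorem norm_divDiff_le_of_local {r : Kinf F → Cinf F} {B : Set (Kinf F)} {ρ ω : ℝ}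
    (hρ : 0 < ρ) (hloc : ∀ x ∈ B, ∀ i, ∀ S : Finset (Kinf F),
      (S : Set (Kinf F)) ⊆ B ∩ Metric.closedBall x ρ → S.card + i = h + 1 → ‖divDiff r S‖ ≤ ω * ρ ^ i)
    (m : ℕ) : ∀ i, ∀ S : Finset (Kinf F), (S : Set (Kinf F)) ⊆ B → S.card = m + 1 →
      S.card + i = h + 1 → ‖divDiff r S‖ ≤ ω * ρ ^ i := by
  induction m with
  | zero =>
    intro i S hS hc hi
    obtain ⟨s, rfl⟩ := Finset.card_eq_one.mp hc
    refine hloc s (hS (by simp)) i _ ?_ hi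
    simpa [hρ.le] using hS
  | succ m ih =>
    intro i S hS hc hi
    by_cases hfar : ∃ u ∈ S, ∃ u' ∈ S, ρ < ‖u - u'‖
    · obtain ⟨u, hu, u', hu', huu⟩ := hfar
      have hcard : ∀ v ∈ S, (S.erase v).card = m + 1 := fun v hv => by
        rw [Finset.card_erase_of_mem hv, hc]
        rfl
      have hS' : ∀ v ∈ S, ‖divDiff r (S.erase v)‖ ≤ ω * ρ ^ (i + 1) := fun v hv =>
        ih _ _ ((Finset.coe_subset.mpr (Finset.erase_subset v S)).trans hS) (hcard v hv) (by
          rw [hcard v hv]; omega)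
      have h1 : ‖u - u'‖ * ‖divDiff r S‖ ≤ ω * ρ ^ (i + 1) := by
        rw [← norm_divDiff_erase_sub r hu hu', sub_eq_add_neg]
        refine (IsUltrametricDist.norm_add_le_max _ _).trans (max_le (hS' u' hu') ?_)
        rw [norm_neg]
        exact hS' u hu
      have h2 : ρ * ‖divDiff r S‖ ≤ ρ * (ω * ρ ^ i) := by
        refine (mul_le_mul_of_nonneg_right huu.le (norm_nonneg _)).trans (h1.trans_eq ?_)
        ring
      exact le_of_mul_le_mul_left h2 hρ
    · push Not at hfar
      obtain ⟨s, hs⟩ : S.Nonempty := Finset.card_pos.mp (by omega)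
      refine hloc s (hS hs) i S (fun x hx => ⟨hS hx, ?_⟩) hi
      exact mem_closedBall_iff_norm.mpr (hfar x hx s hs)

/-- On each small ball `f - g` vanishes at the nodes, and divided differences on `h + 2` points do
not see the polynomial `g` of degree at most `h`. Then the local estimate is made global. -/
theorem divDiffBound_sub_of_piecewise {f g : Kinf F → Cinf F} {B : Set (Kinf F)} {ρ ω : ℝ}
    (hω : 0 ≤ ω) (hρ : 0 < ρ) (hρ1 : ρ ≤ 1)
    (hf : ∀ T : Finset (Kinf F), (T : Set (Kinf F)) ⊆ B → T.card = h + 2 →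
      (∀ x ∈ T, ∀ y ∈ T, ‖x - y‖ ≤ ρ) → ∀ u ∈ T, ∀ u' ∈ T, ‖u - u'‖ * ‖divDiff f T‖ ≤ ω)
    (hg : ∀ x ∈ B, ∃ (N : Finset (Kinf F)) (p : Polynomial (Cinf F)),
      (N : Set (Kinf F)) ⊆ B ∩ Metric.closedBall x ρ ∧ N.card = h + 1 ∧ p.natDegree ≤ h ∧
      (∀ y ∈ N, f y = p.eval (toC y)) ∧
      ∀ y ∈ B ∩ Metric.closedBall x ρ, g y = p.eval (toC y)) :
    DivDiffBound B (h + 1) (fun x => f x - g x) ω := by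
  have hball : ∀ x : Kinf F, ∀ y ∈ Metric.closedBall x ρ, ∀ z ∈ Metric.closedBall x ρ,
      ‖y - z‖ ≤ ρ := fun x y hy z hz =>
    norm_sub_le_of_le (mem_closedBall_iff_norm.mp hy) (mem_closedBall_iff_norm'.mp hz)
  have key := norm_divDiff_le_of_local (h := h) (r := fun x => f x - g x) (B := B) (ω := ω) hρ
    fun x hx i => by
      obtain ⟨N, p, hN, hNc, hp, hfp, hgp⟩ := hg x hx
      refine norm_divDiff_le_of_zeros hω hρ.le (fun y hy z hz => hball x y hy.2 z hz.2) hN hNc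
        (fun y hy => by rw [hfp y hy, hgp y (hN hy), sub_self]) (fun T hTB hTc u hu u' hu' => ?_) i
      have h1 : divDiff (fun x => f x - g x) T = divDiff f T := by
        rw [divDiff_sub, divDiff_congr (f := g) fun y hy => hgp y (hTB hy),
          divDiff_eval_eq_zero p (by omega), sub_zero]
      rw [h1]
      exact hf T (fun y hy => (hTB hy).1) hTc (fun y hy z hz => hball x y (hTB hy).2 z (hTB hz).2)
        u hu u' hu'
  intro S hS hne hc
  have h1 := hne.card_pos
  refine (key (S.card - 1) (h + 1 - S.card) S hS (by omega) (by omega)).trans ?_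
  exact mul_le_of_le_one_right hω (pow_le_one₀ hρ.le hρ1)

/-- The function which is given on each of the balls `B_{b'}(|π|^(l+k))` in `B_b(|π|^l)` by an
interpolation polynomial of `f`, where `loc b' l' p` is used for the restriction of `p` to a ball. -/
def approx {X : Type*} (loc : Kinf F → ℤ → Polynomial (Cinf F) → X → Cinf F) (h : ℕ)
    (f : Kinf F → Cinf F) : ℕ → Kinf F → ℤ → X → Cinf F
  | 0, b, l => loc b l (interp f (nodes h b l))
  | k + 1, b, l => ∑ ε : F, approx loc h f k (subCenter b l ε) (l + 1)

/-- The restriction of a polynomial to a ball in `k_∞`, extended by zero. -/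
def locK (b : Kinf F) (l : ℤ) (p : Polynomial (Cinf F)) (x : Kinf F) : Cinf F :=
  if ‖x - b‖ ≤ ‖unif F‖ ^ l then p.eval (toC x) else 0

theorem natDegree_interp_nodes_le (f : Kinf F → Cinf F) (b : Kinf F) (l : ℤ) :
    (interp f (nodes h b l)).natDegree ≤ h := by
  have h1 := degree_interp_lt f (nodes h b l)
  rw [card_nodes] at h1
  exact Polynomial.natDegree_le_iff_coeff_eq_zero.mpr fun i hi =>
    Polynomial.coeff_eq_zero_of_degree_lt (h1.trans_le (by exact_mod_cast hi))

/-- Allows the approximation to be built once and read in any chart: an additive map that matches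
the local pieces matches the approximations. -/
theorem approx_comp {X X' : Type*} {loc : Kinf F → ℤ → Polynomial (Cinf F) → X → Cinf F}
    {loc' : Kinf F → ℤ → Polynomial (Cinf F) → X' → Cinf F}
    (T : (X → Cinf F) → X' → Cinf F) (h0 : T 0 = 0) (hT : ∀ u v, T (u + v) = T u + T v)
    {b₀ : Kinf F} {l₀ : ℤ} (hloc : ∀ b l p, p.natDegree ≤ h → l₀ ≤ l →
      ‖b - b₀‖ ≤ ‖unif F‖ ^ l₀ → T (loc b l p) = loc' b l p) (f : Kinf F → Cinf F) (k : ℕ) {b : Kinf F} {l : ℤ} (hl : l₀ ≤ l)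
    (hb : ‖b - b₀‖ ≤ ‖unif F‖ ^ l₀) : T (approx loc h f k b l) = approx loc' h f k b l := by
  induction k generalizing b l with
  | zero => exact hloc _ _ _ (natDegree_interp_nodes_le f b l) hl hb
  | succ k ih =>
    have hsum : ∀ s : Finset F, T (∑ ε ∈ s, approx loc h f k (subCenter b l ε) (l + 1)) =
        ∑ ε ∈ s, approx loc' h f k (subCenter b l ε) (l + 1) := by
      intro s
      induction s using Finset.induction_on with
      | empty => simpa using h0
      | insert ε s hε ihs =>
        rw [Finset.sum_insert hε, Finset.sum_insert hε, hT, ihs, ih (by omega)]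
        exact norm_sub_le_of_le ((norm_subCenter_sub_le b l ε).trans (zpow_unif_le.mpr hl)) hb
    exact hsum Finset.univ

theorem approx_locK_eq_zero (f : Kinf F → Cinf F) (k : ℕ) {b x : Kinf F} {l : ℤ}
    (hx : ¬ ‖x - b‖ ≤ ‖unif F‖ ^ l) : approx locK h f k b l x = 0 := by
  induction k generalizing b l with
  | zero => exact if_neg hx
  | succ k ih =>
    rw [approx, Finset.sum_apply]
    exact Finset.sum_eq_zero fun ε _ => ih fun h' => hx (norm_sub_le_of_norm_sub_subCenter_le h')

theorem exists_approx_locK_eq (f : Kinf F → Cinf F) (k : ℕ) {b x : Kinf F} {l : ℤ}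
    (hx : ‖x - b‖ ≤ ‖unif F‖ ^ l) : ∃ b', ‖x - b'‖ ≤ ‖unif F‖ ^ (l + k) ∧
      ‖b' - b‖ ≤ ‖unif F‖ ^ l ∧ ∀ y, ‖y - b'‖ ≤ ‖unif F‖ ^ (l + k) →
        approx locK h f k b l y = (interp f (nodes h b' (l + k))).eval (toC y) := by
  induction k generalizing b l with
  | zero =>
    refine ⟨b, by simpa using hx, by simp [(zpow_unif_pos l).le], fun y hy => ?_⟩
    rw [Nat.cast_zero, add_zero] at hy ⊢
    exact if_pos hy
  | succ k ih =>
    obtain ⟨ε, hε⟩ := exists_norm_sub_subCenter_le hx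
    obtain ⟨b', h1, h2, h3⟩ := ih hε
    have e : l + ((k + 1 : ℕ) : ℤ) = l + 1 + k := by push_cast; ring
    rw [e]
    refine ⟨b', h1, norm_sub_le_of_norm_sub_subCenter_le h2, fun y hy => ?_⟩
    rw [approx, Finset.sum_apply, Finset.sum_eq_single_of_mem ε (Finset.mem_univ _), h3 y hy]
    intro ε' _ hne
    refine approx_locK_eq_zero f k fun h' => hne (eq_of_norm_sub_subCenter_le h' ?_)
    exact norm_sub_le_of_le (hy.trans (zpow_unif_le.mpr (by omega))) h2

/-- Density of locally polynomial functions. -/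
theorem exists_divDiffBound_sub_approx {f : Kinf F → Cinf F} {b : Kinf F} {l : ℤ} (hl : 0 ≤ l)
    (hf : DivDiffSmall h (Metric.closedBall b (‖unif F‖ ^ l)) f) {ω : ℝ} (hω : 0 < ω) :
    ∃ k₀ : ℕ, ∀ k ≥ k₀, DivDiffBound (Metric.closedBall b (‖unif F‖ ^ l)) (h + 1)
      (fun x => f x - approx locK h f k b l x) ω := by
  obtain ⟨δ, hδ, hs⟩ := hf ω hω
  obtain ⟨k₀, hk₀⟩ := exists_pow_lt_of_lt_one hδ (norm_unif_lt_one (F := F))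
  refine ⟨k₀, fun k hk => ?_⟩
  have hρ : ‖unif F‖ ^ (l + k) ≤ δ := by
    refine le_trans (zpow_unif_le.mpr (by omega : (k₀ : ℤ) ≤ l + k)) ?_
    rw [zpow_natCast]
    exact hk₀.le
  refine divDiffBound_sub_of_piecewise (ρ := ‖unif F‖ ^ (l + k)) hω.le (zpow_unif_pos _)
    (by rw [← zpow_zero ‖unif F‖, zpow_unif_le]; omega)
    (fun T hT hc hd => hs T hT hc fun x hx y hy => (hd x hx y hy).trans hρ) fun x hx => ?_
  obtain ⟨b', h1, h2, h3⟩ := exists_approx_locK_eq (h := h) f k (mem_closedBall_iff_norm.mp hx)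
  refine ⟨nodes h b' (l + k), _, fun y hy => ?_, card_nodes _ _ _, natDegree_interp_nodes_le f b' _,
    fun y hy => (eval_interp f hy).symm, fun y hy => h3 y ?_⟩
  · have hyb := norm_sub_le_of_mem_nodes (Finset.mem_coe.mp hy)
    refine ⟨mem_closedBall_iff_norm.mpr ?_, mem_closedBall_iff_norm.mpr ?_⟩
    · exact norm_sub_le_of_le (hyb.trans (zpow_unif_le.mpr (by omega))) h2
    · rw [norm_sub_rev] at h1
      exact norm_sub_le_of_le hyb h1
  · exact norm_sub_le_of_le (mem_closedBall_iff_norm.mp hy.2) h1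

theorem approx_eq_zero {X : Type*} {loc : Kinf F → ℤ → Polynomial (Cinf F) → X → Cinf F} {P : X}
    {b₀ : Kinf F} {l₀ : ℤ} (hloc : ∀ b l p, l₀ ≤ l → ‖b - b₀‖ ≤ ‖unif F‖ ^ l₀ → loc b l p P = 0)
    (f : Kinf F → Cinf F) (k : ℕ) {b : Kinf F} {l : ℤ} (hl : l₀ ≤ l)
    (hb : ‖b - b₀‖ ≤ ‖unif F‖ ^ l₀) : approx loc h f k b l P = 0 := by
  induction k generalizing b l with
  | zero => exact hloc _ _ _ hl hb
  | succ k ih =>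
    rw [approx, Finset.sum_apply]
    exact Finset.sum_eq_zero fun ε _ => ih (by omega)
      (norm_sub_le_of_le ((norm_subCenter_sub_le b l ε).trans (zpow_unif_le.mpr hl)) hb)

theorem approx_mem_and_integral_eq_zero {κ : CnDual F h}
    {loc : Kinf F → ℤ → Polynomial (Cinf F) → P1 F → Cinf F} (f : Kinf F → Cinf F) {b₀ : Kinf F}
    {l₀ : ℤ} (hmem : ∀ b l p, loc b l p ∈ CnFun F h) (h0 : ∀ b l p, p.natDegree ≤ h → l₀ ≤ l →
      ‖b - b₀‖ ≤ ‖unif F‖ ^ l₀ → integral κ (loc b l p) = 0) (k : ℕ) {b : Kinf F} {l : ℤ}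
    (hl : l₀ ≤ l) (hb : ‖b - b₀‖ ≤ ‖unif F‖ ^ l₀) :
    approx loc h f k b l ∈ CnFun F h ∧ integral κ (approx loc h f k b l) = 0 := by
  induction k generalizing b l with
  | zero => exact ⟨hmem _ _ _, h0 _ _ _ (natDegree_interp_nodes_le f b l) hl hb⟩
  | succ k ih =>
    have h1 := fun ε : F => ih (b := subCenter b l ε) (l := l + 1) (by omega)
      (norm_sub_le_of_le ((norm_subCenter_sub_le b l ε).trans (zpow_unif_le.mpr hl)) hb)
    exact ⟨Submodule.sum_mem _ fun ε _ => (h1 ε).1,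
      (integral_sum κ _ fun ε _ => (h1 ε).1).trans (Finset.sum_eq_zero fun ε _ => (h1 ε).2)⟩

end Approximation


/-! ### A functional is determined by its integrals on balls in `k_∞` -/

section Uniqueness
variable {F : Type*} [Field F] [Fintype F] {h : ℕ}
open scoped Classical
open Filter

/-- The polynomial `q` in the parameter `t = 1/x` on the ball `|t - b| ≤ |π|^l`, and zero elsewhere. -/
def locPolyInv (b : Kinf F) (l : ℤ) (q : Polynomial (Cinf F)) : P1 F → Cinf F
  | OnePoint.infty => locK b l q 0
  | OnePoint.some x => if x = 0 then 0 else locK b l q x⁻¹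

theorem locPolyInv_coe (b : Kinf F) (l : ℤ) (q : Polynomial (Cinf F)) (x : Kinf F) :
    locPolyInv b l q (x : P1 F) = if x = 0 then 0 else locK b l q x⁻¹ := rfl

theorem inftyChart_locPolyInv (b : Kinf F) (l : ℤ) (q : Polynomial (Cinf F)) :
    inftyChart (locPolyInv b l q) = locK b l q := by
  funext t
  rw [inftyChart]
  by_cases ht : t = 0
  · rw [if_pos ht, ht]
    rfl
  · rw [if_neg ht, locPolyInv_coe, if_neg (inv_ne_zero ht), inv_inv]

theorem finiteChart_locPolyInv (b : Kinf F) (l : ℤ) (q : Polynomial (Cinf F)) (x : Kinf F) :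
    finiteChart (locPolyInv b l q) x =
      if x ≠ 0 ∧ ‖x⁻¹ - b‖ ≤ ‖unif F‖ ^ l then q.eval (toC x⁻¹) else 0 := by
  rw [finiteChart, locPolyInv_coe, locK]
  by_cases hx : x = 0 <;> simp [hx]

theorem locPolyInv_mem (b : Kinf F) (l : ℤ) (q : Polynomial (Cinf F)) :
    locPolyInv b l q ∈ CnFun F h := by
  refine ⟨fun a _ => ?_, ?_⟩
  · rw [← zpow_one ‖unif F‖, funext (finiteChart_locPolyInv b l q)]
    exact (divDiffBounded_indicator_inv_eval b a l 1 q).isCnOn h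
  · rw [← zpow_one ‖unif F‖, inftyChart_locPolyInv]
    exact (divDiffBounded_indicator_eval b 0 l 1 q).isCnOn h

theorem eq_of_inftyChart_eq {f g : P1 F → Cinf F} (h0 : f ((0 : Kinf F) : P1 F) = g ((0 : Kinf F) : P1 F))
    (hfg : inftyChart f = inftyChart g) : f = g := by
  funext P
  induction P using OnePoint.rec with
  | infty => simpa [inftyChart] using congrFun hfg 0
  | coe x =>
    rcases eq_or_ne x 0 with rfl | hx
    · exact h0
    · simpa [inftyChart, hx] using congrFun hfg x⁻¹

theorem locPolyInv_zero_left (l : ℤ) (q : Polynomial (Cinf F)) :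
    locPolyInv 0 l q = locPolyInfty l q := by
  refine eq_of_inftyChart_eq ?_ ?_
  · rw [locPolyInv_coe, locPolyInfty_coe, if_pos rfl, if_neg]
    rw [norm_zero, not_le]
    exact zpow_unif_pos _
  · rw [inftyChart_locPolyInv, funext (inftyChart_locPolyInfty l q)]
    rfl

theorem locPolyInv_congr {b b' : Kinf F} {l : ℤ} (hb : ‖b - b'‖ ≤ ‖unif F‖ ^ l)
    (q : Polynomial (Cinf F)) : locPolyInv b l q = locPolyInv b' l q := by
  refine eq_of_inftyChart_eq (by simp [locPolyInv_coe]) ?_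
  rw [inftyChart_locPolyInv, inftyChart_locPolyInv]
  funext t
  simp only [locK]
  congr 1
  refine propext ⟨fun h1 => norm_sub_le_of_le h1 hb, fun h1 => norm_sub_le_of_le h1 ?_⟩
  rwa [norm_sub_rev]

theorem locPolyInv_eq_sum (b : Kinf F) (l : ℤ) (q : Polynomial (Cinf F)) :
    locPolyInv b l q = ∑ ε : F, locPolyInv (subCenter b l ε) (l + 1) q := by
  have key : ∀ t : Kinf F, locK b l q t = ∑ ε : F, locK (subCenter b l ε) (l + 1) q t := fun t => by
    have := congrFun (locPoly_eq_sum b l q) (t : P1 F)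
    rwa [Finset.sum_apply] at this
  funext P
  rw [Finset.sum_apply]
  induction P using OnePoint.rec with
  | infty => exact key 0
  | coe x =>
    simp only [locPolyInv_coe]
    split_ifs
    · simp
    · exact key _

theorem locPolyInfty_add (l : ℤ) (p q : Polynomial (Cinf F)) :
    (locPolyInfty l (p + q) : P1 F → Cinf F) = locPolyInfty l p + locPolyInfty l q := by
  funext P
  induction P using OnePoint.rec with
  | infty => exact Polynomial.eval_add
  | coe x =>
    rw [Pi.add_apply, locPolyInfty_coe, locPolyInfty_coe, locPolyInfty_coe, Polynomial.eval_add]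
    split_ifs <;> simp

theorem locPolyInfty_smul (l : ℤ) (a : Cinf F) (p : Polynomial (Cinf F)) :
    (locPolyInfty l (a • p) : P1 F → Cinf F) = a • locPolyInfty l p := by
  funext P
  induction P using OnePoint.rec with
  | infty => exact Polynomial.eval_smul ..
  | coe x =>
    rw [Pi.smul_apply, locPolyInfty_coe, locPolyInfty_coe, Polynomial.eval_smul]
    split_ifs <;> simp

theorem cnNorm_le {f : P1 F → Cinf F} {M : ℝ} (hM : 0 ≤ M)
    (h1 : ∀ a, ‖a‖ ≤ 1 → DivDiffBound (Metric.closedBall a (‖unif F‖ ^ (1 : ℤ))) (h + 1)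
      (finiteChart f) M)
    (h2 : DivDiffBound (Metric.closedBall 0 (‖unif F‖ ^ (1 : ℤ))) (h + 1) (inftyChart f) M) :
    cnNorm h f ≤ M := by
  rw [zpow_one] at h2
  refine max_le (Real.iSup_le (fun a => ?_) hM) (cnNormOn_le hM h2)
  have := h1 a (mem_closedBall_zero_iff.mp a.2)
  rw [zpow_one] at this
  exact cnNormOn_le hM this

theorem integral_eq_zero_of_approx (κ : CnDual F h) {f : P1 F → Cinf F} (hf : f ∈ CnFun F h) (A : ℝ)
    (H : ∀ ω > 0, ∃ g ∈ CnFun F h, integral κ g = 0 ∧ cnNorm h (f - g) ≤ A * ω) :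
    integral κ f = 0 := by
  obtain ⟨M, hM⟩ := κ.2
  have key : ∀ ω > 0, ‖integral κ f‖ ≤ max M 0 * A * ω := fun ω hω => by
    obtain ⟨g, hg, h0, h1⟩ := H ω hω
    have h2 : integral κ f = integral κ (f - g) := by rw [integral_sub κ hf hg, h0, sub_zero]
    rw [h2, integral_of_mem κ (sub_mem hf hg), mul_assoc]
    have h3 : 0 ≤ cnNorm h (f - g) := (cnNormOn_nonneg _ _).trans (cnNormOn_inftyChart_le _)
    refine (hM _).trans ((mul_le_mul_of_nonneg_right (le_max_left M 0) h3).trans ?_)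
    exact mul_le_mul_of_nonneg_left h1 (le_max_right _ _)
  have h4 : Tendsto (fun ω : ℝ => max M 0 * A * ω) (𝓝[>] 0) (𝓝 0) := by
    have : Tendsto (fun ω : ℝ => max M 0 * A * ω) (𝓝 0) (𝓝 (max M 0 * A * 0)) :=
      tendsto_id.const_mul _
    rw [mul_zero] at this
    exact this.mono_left nhdsWithin_le_nhds
  refine norm_le_zero_iff.mp (ge_of_tendsto h4 ?_)
  filter_upwards [self_mem_nhdsWithin] with ω hω using key ω hω

theorem DivDiffBound.div_pow {B : Set (Kinf F)} {k : ℕ} {f : Kinf F → Cinf F} {M R : ℝ} (hM : 0 ≤ M)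
    (hR : ∀ x ∈ B, ‖x‖⁻¹ ≤ R) (hR1 : 1 ≤ R) (h0 : (0 : Kinf F) ∉ B) (i : ℕ)
    (hf : DivDiffBound B k (fun t => toC t ^ i * f t) M) : DivDiffBound B k f ((R ^ k) ^ i * M) := by
  induction i generalizing M with
  | zero => simpa using hf
  | succ i ih =>
    rw [pow_succ, mul_assoc]
    exact ih (by positivity) (hf.div hM hR hR1 h0 fun x _ => by ring)

theorem inftyChart_zero_left (f : P1 F → Cinf F) : inftyChart f 0 = f OnePoint.infty := if_pos rfl

/-- The degree of `q` may exceed `h`, so `κ` is not directly known. As the ball avoids `t = 0`,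
approximate `t^h q` by polynomials of degree at most `h` in `t` and divide by `t^h`; the result is
piecewise a polynomial of degree at most `h` in `x`, which `κ` annihilates. -/
theorem integral_locPolyInv_of_lt {κ : CnDual F h}
    (hκ : ∀ b l p, p.natDegree ≤ h → integral κ (locPoly b l p) = 0) {b : Kinf F} {v l : ℤ}
    (hv : ‖b‖ = ‖unif F‖ ^ v) (hv1 : 1 ≤ v) (hvl : v < l) (q : Polynomial (Cinf F)) :
    integral κ (locPolyInv b l q) = 0 := by
  have hb' : ∀ {b' : Kinf F}, ‖b' - b‖ ≤ ‖unif F‖ ^ l → ‖b'‖ = ‖unif F‖ ^ v := fun {b'} h1 => by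
    have h2 : ‖b' - b‖ < ‖b‖ := h1.trans_lt (by rw [hv]; exact zpow_unif_lt.mpr hvl)
    rw [← hv, ← sub_add_cancel b' b]
    exact (IsUltrametricDist.norm_add_eq_max_of_norm_ne_norm h2.ne).trans (max_eq_right h2.le)
  have hiff : ∀ {b' : Kinf F} {l' : ℤ}, ‖b' - b‖ ≤ ‖unif F‖ ^ l → l ≤ l' → ∀ t : Kinf F,
      (t ≠ 0 ∧ ‖t⁻¹ - b'⁻¹‖ ≤ ‖unif F‖ ^ (l' - 2 * v)) ↔ ‖t - b'‖ ≤ ‖unif F‖ ^ l' := by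
    intro b' l' h1 hl t
    have h2 := inv_norm_sub_le_zpow_iff (b := b'⁻¹) (v := -v) (l := l' - 2 * v)
      (by rw [norm_inv, hb' h1, zpow_neg]) (by omega) t
    rwa [inv_inv, show l' - 2 * v - 2 * -v = l' by ring] at h2
  set B := Metric.closedBall b (‖unif F‖ ^ l) with hB
  have htame : DivDiffSmall h B fun t => toC t ^ h * q.eval (toC t) := by
    have h1 := ((divDiffBounded_eval (Polynomial.X ^ h * q) b l).isTame h).small
    simpa only [Polynomial.eval_mul, Polynomial.eval_pow, Polynomial.eval_X] using h1
  -- The ball `|t - b'| ≤ |π|^l'` and the function `t^(-h) p(t)` on it, expressed in `x = 1/t`.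
  let loc : Kinf F → ℤ → Polynomial (Cinf F) → P1 F → Cinf F := fun b' l' p =>
    locPoly b'⁻¹ (l' - 2 * v) (p.reflect h)
  have hbb : ‖b - b‖ ≤ ‖unif F‖ ^ l := by simp [(zpow_unif_pos l).le]
  have hRl : 1 ≤ ‖unif F‖ ^ (-l) := by rw [← zpow_zero ‖unif F‖, zpow_unif_le]; omega
  have hR1 : 1 ≤ ‖unif F‖ ^ (-v) := by rw [← zpow_zero ‖unif F‖, zpow_unif_le]; omega
  -- The second factor is the cost of dividing `h` times by `t` with `|t| = |π|^v`, the first that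
  -- of extending by zero from a ball of radius `|π|^l`.
  refine integral_eq_zero_of_approx κ (locPolyInv_mem b l q)
    ((‖unif F‖ ^ (-l)) ^ (h + 1) * ((‖unif F‖ ^ (-v)) ^ (h + 1)) ^ h) fun ω hω => ?_
  obtain ⟨k, hk⟩ := exists_divDiffBound_sub_approx (by omega) htame hω
  specialize hk k le_rfl
  set f : Kinf F → Cinf F := fun t => toC t ^ h * q.eval (toC t)
  obtain ⟨hg, hg0⟩ := approx_mem_and_integral_eq_zero (κ := κ) (loc := loc) f (b₀ := b) (l₀ := l)
    (fun b l p => locPoly_mem _ _ _) (fun b l p hp _ _ => hκ _ _ _ (natDegree_reflect_le hp)) k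
    le_rfl hbb
  refine ⟨_, hg, hg0, ?_⟩
  have hT := approx_comp (h := h) (loc := loc) (loc' := locK) (fun u t => toC t ^ h * inftyChart u t)
    (by funext t; simp [inftyChart]) (fun u v => by funext t; simp [inftyChart_add, mul_add])
    (b₀ := b) (l₀ := l) (fun b' l' p hp hl hbl => by
      funext t
      rw [inftyChart_locPoly, locK]
      by_cases ht : ‖t - b'‖ ≤ ‖unif F‖ ^ l'
      · have h1 := (hiff hbl hl t).mpr ht
        have h2 := eval_reflect hp (inv_ne_zero h1.1)
        rw [if_pos ht, if_pos h1, h2, inv_inv, ← mul_assoc, ← mul_pow, ← map_mul,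
          mul_inv_cancel₀ h1.1, map_one, one_pow, one_mul]
      · rw [if_neg ht, if_neg fun h1 => ht ((hiff hbl hl t).mp h1), mul_zero]) f k le_rfl hbb
  have hfar : ∀ (x : Kinf F), ‖x‖ ≤ 1 → ∀ b', ‖b' - b‖ ≤ ‖unif F‖ ^ l → ∀ l' ≥ l,
      ¬ ‖x - b'⁻¹‖ ≤ ‖unif F‖ ^ (l' - 2 * v) := by
    intro x hx b' hbl l' hl h1
    have h2 : ‖b'⁻¹‖ = ‖unif F‖ ^ (-v) := by rw [norm_inv, hb' hbl, zpow_neg]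
    have h3 : ‖x - b'⁻¹‖ < ‖b'⁻¹‖ := h1.trans_lt (by rw [h2]; exact zpow_unif_lt.mpr (by omega))
    have h4 : ‖x‖ = ‖b'⁻¹‖ := by
      conv_lhs => rw [← sub_add_cancel x b'⁻¹]
      exact (IsUltrametricDist.norm_add_eq_max_of_norm_ne_norm h3.ne).trans (max_eq_right h3.le)
    rw [h4, h2, ← zpow_zero ‖unif F‖, zpow_unif_le] at hx
    omega
  have hBn : ∀ x ∈ B, ‖x‖ = ‖unif F‖ ^ v := fun x hx => hb' (mem_closedBall_iff_norm.mp hx)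
  have h0B : (0 : Kinf F) ∉ B := fun h0 => by
    have := hBn 0 h0
    rw [norm_zero] at this
    exact (zpow_unif_pos v).ne this
  have hge : ∀ t, inftyChart (locPolyInv b l q - approx loc h f k b l) t =
      locK b l q t - inftyChart (approx loc h f k b l) t := fun t => by
    rw [← inftyChart_locPolyInv]
    simp only [inftyChart, Pi.sub_apply]
    split_ifs <;> rfl
  refine cnNorm_le (by positivity) (fun a ha => ?_) ?_
  · refine ((divDiffBound_zero _ (h + 1)).mono le_rfl le_rfl (by positivity)).congr fun x hx => ?_
    have hx1 := norm_le_of_mem_closedBall_one ha hx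
    have h1 : finiteChart (locPolyInv b l q) x = 0 := by
      rw [finiteChart_locPolyInv, if_neg]
      rintro ⟨hx0, hxb⟩
      have h2 := hb' hxb
      rw [norm_inv, inv_eq_iff_eq_inv, ← zpow_neg] at h2
      rw [h2, ← zpow_zero ‖unif F‖, zpow_unif_le] at hx1
      omega
    have h2 : finiteChart (approx loc h f k b l) x = 0 :=
      approx_eq_zero (P := (x : P1 F)) (b₀ := b) (l₀ := l)
        (fun b' l' p hl hbl => if_neg (hfar x hx1 b' hbl l' hl)) f k le_rfl hbb
    change 0 = finiteChart (locPolyInv b l q) x - finiteChart (approx loc h f k b l) x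
    rw [h1, h2, sub_zero]
  · rw [mul_assoc]
    refine DivDiffBound.glue (P := B) ?_ ?_ (by positivity) hRl (fun x hx y hy => ?_)
    · refine (DivDiffBound.div_pow hω.le (fun x hx => ?_) hR1 h0B h ?_).mono Set.inter_subset_right
        le_rfl le_rfl
      · rw [hBn x hx, zpow_neg]
      · refine hk.congr fun t ht => ?_
        have h1 := congrFun hT t
        rw [hge, mul_sub, h1, locK, if_pos (mem_closedBall_iff_norm.mp ht)]
    · refine ((divDiffBound_zero _ (h + 1)).mono le_rfl le_rfl (by positivity)).congr fun t ht => ?_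
      have htB : ¬ ‖t - b‖ ≤ ‖unif F‖ ^ l := fun h1 => ht.2 (mem_closedBall_iff_norm.mpr h1)
      rw [hge, locK, if_neg htB, zero_sub, eq_comm, neg_eq_zero]
      rcases eq_or_ne t 0 with rfl | ht0
      · rw [inftyChart_zero_left]
        exact approx_eq_zero (P := (OnePoint.infty : P1 F)) (b₀ := b) (l₀ := l)
          (fun b' l' p hl hbl => rfl) f k le_rfl hbb
      · have h1 := congrFun hT t
        rw [approx_locK_eq_zero f k htB] at h1
        exact (mul_eq_zero.mp h1).resolve_left (pow_ne_zero _ ((map_ne_zero _).mpr ht0))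
    · have h1 : ‖unif F‖ ^ l ≤ ‖x - y‖ := by
        by_contra hlt
        refine hy.2 (mem_closedBall_iff_norm.mpr (norm_sub_le_of_le ?_
          (mem_closedBall_iff_norm.mp hx.2)))
        rw [norm_sub_rev]
        exact (not_le.mp hlt).le
      rw [zpow_neg]
      exact inv_anti₀ (zpow_unif_pos l) h1

/-- All sub-balls of a ball around `∞` other than the one containing `∞` integrate to zero, so the
integral does not depend on the radius. Integrals over annuli are then zero, and (∗) makes the
integral over the ball their limit. -/
theorem integral_locPolyInfty_eq_zero {κ : CnDual F h}
    (hκ : ∀ b l p, p.natDegree ≤ h → integral κ (locPoly b l p) = 0)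
    (hlim : HasLimitIntegralsAtInfty κ) {m : ℤ} (hm : 1 ≤ m) (q : Polynomial (Cinf F)) :
    integral κ (locPolyInfty m q) = 0 := by
  have hstep : ∀ l ≥ 1, ∀ q, integral κ (locPolyInfty l q) = integral κ (locPolyInfty (l + 1) q) := by
    intro l hl q
    rw [← locPolyInv_zero_left, locPolyInv_eq_sum, integral_sum κ _ fun ε _ => locPolyInv_mem _ _ _,
      Finset.sum_eq_single_of_mem (0 : F) (Finset.mem_univ _), subCenter_zero, locPolyInv_zero_left]
    intro ε _ hε
    refine integral_locPolyInv_of_lt hκ (v := l) ?_ hl (by omega) q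
    have := norm_subCenter_sub_subCenter (0 : Kinf F) l hε
    rwa [subCenter_zero, sub_zero] at this
  have hconst : ∀ l ≥ m, ∀ q, integral κ (locPolyInfty m q) = integral κ (locPolyInfty l q) := by
    intro l hl q
    induction l, hl using Int.leInduction with
    | base => rfl
    | succ l hl ih => rw [ih, hstep l (by omega)]
  have hpow : ∀ i, integral κ (locPolyInfty m (Polynomial.X ^ i)) = 0 := by
    intro i
    have h1 := hlim m i
    rw [kappaInfty_eq] at h1
    refine tendsto_nhds_unique h1 (tendsto_const_nhds.congr' ?_)
    filter_upwards [eventually_ge_atTop m] with l hl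
    rw [annulusPow_eq hl, kappaInfty_eq, kappaInfty_eq,
      integral_sub κ (locPolyInfty_mem _ _) (locPolyInfty_mem _ _), ← hconst (l + 1) (by omega), sub_self]
  induction q using Polynomial.induction_on' with
  | add p q hp hq =>
    rw [locPolyInfty_add, integral_add κ (locPolyInfty_mem _ _) (locPolyInfty_mem _ _), hp, hq, add_zero]
  | monomial i a =>
    rw [← mul_one a, ← smul_eq_mul, ← Polynomial.smul_monomial, ← Polynomial.X_pow_eq_monomial,
      locPolyInfty_smul, integral_smul κ _ (locPolyInfty_mem _ _), hpow, mul_zero]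

theorem integral_locPolyInv_eq_zero {κ : CnDual F h}
    (hκ : ∀ b l p, p.natDegree ≤ h → integral κ (locPoly b l p) = 0)
    (hlim : HasLimitIntegralsAtInfty κ) {b : Kinf F} (hb : ‖b‖ ≤ ‖unif F‖ ^ (1 : ℤ)) {l : ℤ}
    (hl : 1 ≤ l) (q : Polynomial (Cinf F)) : integral κ (locPolyInv b l q) = 0 := by
  rcases le_or_gt ‖b‖ (‖unif F‖ ^ l) with h1 | h1
  · rw [locPolyInv_congr (b' := 0) (by rwa [sub_zero]), locPolyInv_zero_left]
    exact integral_locPolyInfty_eq_zero hκ hlim hl q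
  · obtain ⟨v, hv⟩ := norm_eq_zpow (norm_pos_iff.mp ((zpow_unif_pos l).trans h1))
    rw [hv, zpow_unif_lt] at h1
    rw [hv, zpow_unif_le] at hb
    exact integral_locPolyInv_of_lt hκ hv hb h1 q

theorem locPolyInv_coe_of_norm_le_one {b x : Kinf F} {l : ℤ} (hb : ‖b‖ ≤ ‖unif F‖ ^ (1 : ℤ))
    (hl : 1 ≤ l) (hx : ‖x‖ ≤ 1) (q : Polynomial (Cinf F)) : locPolyInv b l q (x : P1 F) = 0 := by
  rw [locPolyInv_coe]
  split_ifs with hx0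
  · rfl
  refine if_neg fun h1 => ?_
  have h2 := norm_add_le_of_le' (h1.trans (zpow_unif_le.mpr hl)) hb
  rw [sub_add_cancel, norm_inv, zpow_one] at h2
  exact absurd (((one_le_inv₀ (norm_pos_iff.mpr hx0)).mpr hx).trans h2) (not_le.mpr norm_unif_lt_one)

theorem inftyChart_locPoly_of_norm_le {b t : Kinf F} {l : ℤ} (hb : ‖b‖ ≤ 1) (hl : 0 ≤ l)
    (ht : ‖t‖ ≤ ‖unif F‖ ^ (1 : ℤ)) (p : Polynomial (Cinf F)) : inftyChart (locPoly b l p) t = 0 := by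
  rw [inftyChart_locPoly, if_neg]
  rintro ⟨ht0, h1⟩
  have h2 := norm_add_le_of_le' (h1.trans (by rw [← zpow_zero ‖unif F‖]; exact zpow_unif_le.mpr hl)) hb
  rw [sub_add_cancel, norm_inv, inv_le_one₀ (norm_pos_iff.mpr ht0)] at h2
  rw [zpow_one] at ht
  exact absurd (h2.trans ht) (not_le.mpr norm_unif_lt_one)

/-- A functional is determined by its values on the functions which are given by polynomials of
degree at most `h` on balls. -/
theorem eq_zero_of_integral_locPoly {κ : CnDual F h}
    (hκ : ∀ b l p, p.natDegree ≤ h → integral κ (locPoly b l p) = 0)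
    (hlim : HasLimitIntegralsAtInfty κ) : κ = 0 := by
  refine Subtype.ext (LinearMap.ext fun ⟨f, hf⟩ => ?_)
  change κ.1 ⟨f, hf⟩ = 0
  rw [← integral_of_mem κ hf]
  refine integral_eq_zero_of_approx κ hf 1 fun ω hω => ?_
  rw [one_mul]
  have hself : ∀ b : Kinf F, ‖b - b‖ ≤ ‖unif F‖ ^ (1 : ℤ) := fun b => by
    rw [sub_self, norm_zero]
    exact (zpow_unif_pos 1).le
  have hc := norm_subCenter_zero_le (F := F)
  -- The depth of the approximation may be chosen separately on each ball of the decomposition.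
  choose k hk using fun ε : F =>
    exists_divDiffBound_sub_approx zero_le_one (isTame_finiteChart hf (hc ε)).small hω
  obtain ⟨k', hk'⟩ := exists_divDiffBound_sub_approx zero_le_one (isTame_inftyChart hf).small hω
  have hg := fun ε : F => approx_mem_and_integral_eq_zero (κ := κ) (loc := locPoly) (finiteChart f)
    (b₀ := subCenter 0 0 ε) (l₀ := 1) locPoly_mem (fun b l p hp _ _ => hκ _ _ _ hp) (k ε) le_rfl
    (hself _)
  obtain ⟨hg'm, hg'0⟩ := approx_mem_and_integral_eq_zero (κ := κ) (loc := locPolyInv) (inftyChart f)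
    (b₀ := 0) (l₀ := 1) locPolyInv_mem (fun b l p _ hl hb =>
      integral_locPolyInv_eq_zero hκ hlim (by rwa [sub_zero] at hb) hl p) k' le_rfl (hself 0)
  set g := fun ε : F => approx locPoly h (finiteChart f) (k ε) (subCenter 0 0 ε) 1 with hgdef
  set g' := approx locPolyInv h (inftyChart f) k' (0 : Kinf F) 1 with hg'def
  have hgs : ∑ ε : F, g ε ∈ CnFun F h := Submodule.sum_mem _ fun ε _ => (hg ε).1
  refine ⟨∑ ε : F, g ε + g', add_mem hgs hg'm, ?_, cnNorm_le hω.le (fun a ha => ?_) ?_⟩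
  · rw [integral_add κ hgs hg'm, hg'0, integral_sum κ _ fun ε _ => (hg ε).1,
      Finset.sum_eq_zero fun ε _ => (hg ε).2, add_zero]
  · obtain ⟨ε, hε⟩ := exists_norm_sub_subCenter_le (x := a) (b := 0) (l := 0) (by simpa using ha)
    rw [IsUltrametricDist.closedBall_eq_of_mem (y := subCenter 0 0 ε) (by
      rw [mem_closedBall_iff_norm']
      exact hε)]
    refine (hk ε _ le_rfl).congr fun x hx => ?_
    have hloc : ∀ ε' : F, g ε' (x : P1 F) =
        approx locK h (finiteChart f) (k ε') (subCenter 0 0 ε') 1 x := fun ε' =>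
      congrFun (approx_comp (h := h) (loc := locPoly) (fun u => finiteChart u) rfl (fun _ _ => rfl)
        (b₀ := subCenter 0 0 ε') (l₀ := 1) (fun b l p _ _ _ => rfl) (finiteChart f) (k ε') le_rfl
        (hself _)) x
    have h1 : ∑ ε' : F, g ε' (x : P1 F) = g ε (x : P1 F) := by
      refine Finset.sum_eq_single_of_mem ε (Finset.mem_univ _) fun ε' _ hne => ?_
      rw [hloc]
      exact approx_locK_eq_zero _ _ fun h2 =>
        hne (eq_of_norm_sub_subCenter_le h2 (mem_closedBall_iff_norm.mp hx))
    have h2 : g' (x : P1 F) = 0 :=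
      approx_eq_zero (b₀ := 0) (l₀ := 1) (fun b l p hl hb => locPolyInv_coe_of_norm_le_one
        (by rwa [sub_zero] at hb) hl (norm_le_of_mem_closedBall_one (hc ε) hx) p) _ _ le_rfl (hself 0)
    change _ = f (x : P1 F) - ((∑ ε : F, g ε) (x : P1 F) + g' (x : P1 F))
    rw [Finset.sum_apply, h1, h2, add_zero, hloc]
    rfl
  · refine (hk' _ le_rfl).congr fun t ht => ?_
    have ht1 : ‖t‖ ≤ ‖unif F‖ ^ (1 : ℤ) := by simpa using mem_closedBall_iff_norm.mp ht
    have h1 : ∀ ε : F, inftyChart (g ε) t = 0 := by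
      intro ε
      have h2 := congrFun (approx_comp (h := h) (loc := locPoly) (loc' := fun _ _ _ _ => 0)
        (X' := Unit) (fun u _ => inftyChart u t) (by funext; simp [inftyChart])
        (fun _ _ => by funext; simp [inftyChart_add])
        (b₀ := subCenter 0 0 ε) (l₀ := 1) (fun b l p _ hl hb => by
          funext
          refine inftyChart_locPoly_of_norm_le ?_ (by omega) ht1 p
          exact norm_le_of_mem_closedBall_one (hc ε) (mem_closedBall_iff_norm.mpr hb))
        (finiteChart f) (k ε) le_rfl (hself _)) ()
      exact h2.trans (approx_eq_zero (P := ()) (loc := fun _ _ _ _ => 0) (l₀ := 1) (b₀ := subCenter 0 0 ε) (fun _ _ _ _ _ => rfl) _ _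
        le_rfl (hself _))
    have h3 := congrFun (approx_comp (h := h) (loc := locPolyInv) (fun u => inftyChart u)
      (by funext; simp [inftyChart]) (fun _ _ => by funext; simp [inftyChart_add])
      (b₀ := 0) (l₀ := 1) (fun b l p _ _ _ => inftyChart_locPolyInv b l p) (inftyChart f) k' le_rfl
      (hself 0)) t
    have h4 : inftyChart (∑ ε : F, g ε) t = 0 := by
      rw [← Finset.sum_const_zero (ι := F) (s := Finset.univ), ← Finset.sum_congr rfl fun ε _ => h1 ε]
      simp only [inftyChart, Finset.sum_apply]
      split_ifs <;> rfl
    have h5 : inftyChart (f - (∑ ε : F, g ε + g')) t =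
        inftyChart f t - (inftyChart (∑ ε : F, g ε) t + inftyChart g' t) := by
      simp only [inftyChart, Pi.sub_apply, Pi.add_apply]
      split_ifs <;> rfl
    rw [h5, h4, zero_add, ← h3]

end Uniqueness


/-! ### Integrals over the sets `U(e)` and the correspondence with cocycles -/

section PolynomialIntegrals
variable {F : Type*} [Field F] [Fintype F] {h n : ℕ}
open scoped Classical
open Filter

theorem truncPoly_coe (U : Set (P1 F)) (f : Polynomial (Cinf F)) (L : ℤ) (x : Kinf F) :
    truncPoly U f L (x : P1 F) =
      if (x : P1 F) ∈ U ∧ ‖x‖ ≤ ‖unif F‖ ^ (-L) then f.eval (toC x) else 0 := rfl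

theorem truncPoly_univ (f : Polynomial (Cinf F)) (L : ℤ) :
    truncPoly Set.univ f L = locPoly 0 (-L) f := by
  funext P
  induction P using OnePoint.rec with
  | infty => rfl
  | coe x => simp only [truncPoly_coe, locPoly_coe, Set.mem_univ, true_and, sub_zero]

theorem eventually_norm_le_of_norm_sub_le (b : Kinf F) (l : ℤ) :
    ∀ᶠ L : ℤ in atTop, ∀ x : Kinf F, ‖x - b‖ ≤ ‖unif F‖ ^ l → ‖x‖ ≤ ‖unif F‖ ^ (-L) := by
  obtain ⟨c, hc, hl⟩ := exists_norm_le_zpow b l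
  filter_upwards [eventually_ge_atTop (c : ℤ)] with L hL x hx
  rw [← sub_add_cancel x b]
  exact norm_add_le_of_le' (hx.trans (zpow_unif_le.mpr (by omega)))
    (hc.trans (zpow_unif_le.mpr (by omega)))

theorem eventually_truncPoly_ballSet (b : Kinf F) (l : ℤ) (f : Polynomial (Cinf F)) :
    ∀ᶠ L : ℤ in atTop, truncPoly (ballSet b l) f L = locPoly b l f := by
  filter_upwards [eventually_norm_le_of_norm_sub_le b l] with L hL
  funext P
  induction P using OnePoint.rec with
  | infty => rfl
  | coe x =>
    simp only [truncPoly_coe, locPoly_coe, coe_mem_ballSet]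
    congr 1
    exact propext ⟨fun h1 => h1.1, fun h1 => ⟨h1, hL x h1⟩⟩

theorem eventually_truncPoly_compl (b : Kinf F) (l : ℤ) (f : Polynomial (Cinf F)) :
    ∀ᶠ L : ℤ in atTop, truncPoly (ballSet b l)ᶜ f L = truncPoly Set.univ f L - locPoly b l f := by
  filter_upwards [eventually_norm_le_of_norm_sub_le b l] with L hL
  funext P
  rw [Pi.sub_apply]
  induction P using OnePoint.rec with
  | infty => exact (sub_zero 0).symm
  | coe x =>
    simp only [truncPoly_coe, locPoly_coe, Set.mem_compl_iff, coe_mem_ballSet, Set.mem_univ, true_and]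
    by_cases h1 : ‖x - b‖ ≤ ‖unif F‖ ^ l
    · rw [if_neg fun h2 => h2.1 h1, if_pos (hL x h1), if_pos h1, sub_self]
    · simp only [h1, not_false_eq_true, true_and, if_false, sub_zero]

theorem HasPolyIntegral.unique {μ : CnDual F h} {U : Set (P1 F)} {f : Polynomial (Cinf F)}
    {I J : Cinf F} (hI : HasPolyIntegral μ U f I) (hJ : HasPolyIntegral μ U f J) : I = J :=
  tendsto_nhds_unique hI hJ

/-- A ball in `k_∞` is bounded, so truncation near `∞` eventually has no effect. -/
theorem hasPolyIntegral_downEdge (μ : CnDual F h) (b : Kinf F) (l : ℤ) (f : Polynomial (Cinf F)) :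
    HasPolyIntegral μ (downEdge b l).ends f (integral μ (locPoly b l f)) := by
  rw [ends_downEdge]
  refine tendsto_const_nhds.congr' ?_
  filter_upwards [eventually_truncPoly_ballSet b l f] with L hL
  rw [hL]

/-- Truncated far enough out, the complement of a ball is the truncated line minus the ball, and the
total tends to zero. -/
theorem HasPolyIntegral.upEdge {μ : CnDual F h} {f : Polynomial (Cinf F)}
    (hf : HasPolyIntegral μ Set.univ f 0) (b : Kinf F) (l : ℤ) :
    HasPolyIntegral μ (upEdge b l).ends f (-integral μ (locPoly b l f)) := by
  rw [ends_upEdge, ← zero_sub]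
  refine (Tendsto.sub_const hf _).congr' ?_
  filter_upwards [eventually_truncPoly_compl b l f] with L hL
  rw [hL, integral_sub μ _ (locPoly_mem _ _ _)]
  rw [truncPoly_univ]
  exact locPoly_mem _ _ _

theorem integral_add_left (μ μ' : CnDual F h) (f : P1 F → Cinf F) :
    integral (μ + μ') f = integral μ f + integral μ' f := by
  rw [integral, integral, integral]
  split_ifs
  · rfl
  · exact (add_zero 0).symm

theorem integral_sub_left (μ μ' : CnDual F h) (f : P1 F → Cinf F) :
    integral (μ - μ') f = integral μ f - integral μ' f := by
  rw [integral, integral, integral]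
  split_ifs
  · rfl
  · exact (sub_zero 0).symm

theorem integral_smul_left (a : Cinf F) (μ : CnDual F h) (f : P1 F → Cinf F) :
    integral (a • μ) f = a * integral μ f := by
  rw [integral, integral]
  split_ifs
  · rfl
  · exact (mul_zero a).symm

section MeasureOf
variable {c c' : Edge F → Module.Dual (Cinf F) (Form F (n - 2))} {μ μ' : CnDual F h}

theorem IsMeasureOf.add (hc : IsMeasureOf c μ) (hc' : IsMeasureOf c' μ') :
    IsMeasureOf (c + c') (μ + μ') := by
  refine ⟨fun e i hi => ?_, fun m i => ?_⟩
  · refine (Tendsto.add (hc.1 e i hi) (hc'.1 e i hi)).congr fun L => ?_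
    rw [integral_add_left]
  · rw [integral_add_left]
    refine (Tendsto.add (hc.2 m i) (hc'.2 m i)).congr fun L => ?_
    rw [integral_add_left]

theorem IsMeasureOf.smul (a : Cinf F) (hc : IsMeasureOf c μ) : IsMeasureOf (a • c) (a • μ) := by
  refine ⟨fun e i hi => ?_, fun m i => ?_⟩
  · refine (Tendsto.const_mul a (hc.1 e i hi)).congr fun L => ?_
    rw [integral_smul_left]
  · rw [integral_smul_left]
    refine (Tendsto.const_mul a (hc.2 m i)).congr fun L => ?_
    rw [integral_smul_left]

theorem IsMeasureOf.integral_locPoly (hc : IsMeasureOf c μ) (b : Kinf F) (l : ℤ)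
    {p : Polynomial (Cinf F)} (hp : p.natDegree ≤ n - 2) :
    integral μ (locPoly b l p) = moment c b l p := by
  refine Polynomial.induction_with_natDegree_le
    (fun p => integral μ (locPoly b l p) = moment c b l p) (n - 2) ?_ ?_ ?_ p hp
  · have h1 := locPoly_smul b l (0 : Cinf F) 0
    rw [zero_smul, zero_smul] at h1
    rw [h1, integral_zero, map_zero]
  · intro i a _ hi
    rw [← Polynomial.smul_eq_C_mul, locPoly_smul, integral_smul μ a (locPoly_mem _ _ _), map_smul,
      smul_eq_mul, moment_apply, ← monomialForm_eq_hom hi]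
    exact congrArg (a * ·) ((hasPolyIntegral_downEdge μ b l _).unique (hc.1 _ i hi))
  · intro p q _ _ hp hq
    rw [locPoly_add, integral_add μ (locPoly_mem _ _ _) (locPoly_mem _ _ _), hp, hq, map_add]

theorem IsMeasureOf.sub (hc : IsMeasureOf c μ) (hc' : IsMeasureOf c' μ') :
    IsMeasureOf (c - c') (μ - μ') := by
  refine ⟨fun e i hi => ?_, fun m i => ?_⟩
  · refine (Tendsto.sub (hc.1 e i hi) (hc'.1 e i hi)).congr fun L => ?_
    rw [integral_sub_left]
  · rw [integral_sub_left]
    refine (Tendsto.sub (hc.2 m i) (hc'.2 m i)).congr fun L => ?_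
    rw [integral_sub_left]

/-- The difference has zero moments up to degree `n - 2`, in particular up to degree `h`, and (∗) is
linear. -/
theorem IsMeasureOf.unique (hh : h ≤ n - 2) (hc : IsMeasureOf c μ) (hc' : IsMeasureOf c μ') :
    μ = μ' := by
  have h1 := hc.sub hc'
  rw [sub_self] at h1
  exact sub_eq_zero.mp (eq_zero_of_integral_locPoly
    (fun b l p hp => (h1.integral_locPoly b l (hp.trans hh)).trans rfl) h1.2)

theorem IsHarmonic.isMeasureOf_ext (hc : IsHarmonic c) (hc' : IsHarmonic c') (h1 : IsMeasureOf c μ)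
    (h2 : IsMeasureOf c' μ) : c = c' := by
  have hdown : ∀ b l, c (downEdge b l) = c' (downEdge b l) := fun b l =>
    LinearMap.ext fun P => by
      rw [← hom_dehom P, ← moment_apply, ← moment_apply,
        ← h1.integral_locPoly b l (natDegree_dehom_le P),
        ← h2.integral_locPoly b l (natDegree_dehom_le P)]
  funext e
  obtain ⟨b, l, rfl | rfl⟩ := e.eq_downEdge_or_upEdge
  · exact hdown b l
  · rw [hc.upEdge, hc'.upEdge, hdown]

/-- `∫_{U(e)} f dμ = c(e)(Y^(n-2) f(X / Y))` for all edges `e` and all polynomials `f` of degree at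
most `n - 2`, and the total integral of `f` is zero. -/
structure HasIntegrals (c : Edge F → Module.Dual (Cinf F) (Form F (n - 2))) (μ : CnDual F h) :
    Prop where
  edge : ∀ (e : Edge F) (f : Polynomial (Cinf F)), f.natDegree ≤ n - 2 →
    HasPolyIntegral μ e.ends f (c e (hom (n - 2) f))
  zeroTotal : HasZeroTotal n μ

theorem HasIntegrals.isMeasureOf (H : HasIntegrals c μ) (hlim : HasLimitIntegralsAtInfty μ) :
    IsMeasureOf c μ :=
  ⟨fun e i hi => by
    rw [monomialForm_eq_hom]
    exact H.edge e _ (by simpa using hi), hlim⟩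

theorem hom_C_mul (d : ℕ) (a : Cinf F) (p : Polynomial (Cinf F)) :
    hom d (Polynomial.C a * p) = a • hom d p := by
  rw [← Polynomial.smul_eq_C_mul, LinearMap.map_smul]

theorem natDegree_slashPoly_le {d : ℕ} (g : GL (Fin 2) (RatFunc F)) (f : Polynomial (Cinf F)) :
    (slashPoly d g f).natDegree ≤ d := by
  rw [slashPoly_eq]
  exact natDegree_slash_le _ f

theorem HasIntegrals.edge_slashPoly (H : HasIntegrals c μ) (g : GL (Fin 2) (RatFunc F)) (e : Edge F)
    (f : Polynomial (Cinf F)) :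
    HasPolyIntegral μ e.ends (Polynomial.C (kToC F g.1.det) * slashPoly (n - 2) g f)
      (kToC F g.1.det * c e (formSubst (n - 2) g (hom (n - 2) f))) := by
  have h1 := H.edge e (Polynomial.C (kToC F g.1.det) * slashPoly (n - 2) g f)
    ((Polynomial.natDegree_C_mul_le _ _).trans (natDegree_slashPoly_le g f))
  have h2 : hom (n - 2) (Polynomial.C (kToC F g.1.det) * slashPoly (n - 2) g f) =
      kToC F g.1.det • formSubst (n - 2) g (hom (n - 2) f) := by
    rw [hom_C_mul, formSubst_eq, subst_hom, slashPoly_eq]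
  rwa [h2, (c e).map_smul, smul_eq_mul] at h1

theorem HasIntegrals.isEquivariant (H : HasIntegrals c μ) {G : Subgroup (GL (Fin 2) (RatFunc F))}
    (hc : c ∈ HarmonicCocycles G n) : IsEquivariant G n μ := by
  intro g hg e f hf
  refine ⟨_, H.edge _ f hf, ?_⟩
  rw [hc.2.2 g hg e]
  exact H.edge_slashPoly g e f

/-- The total integral is the limit of the moments on the balls of radius `|π|^(-L)` around `0`,
which vanish for large `L` because `c` vanishes near the cusp `∞`. This gives the values on
complements of balls. -/
theorem exists_hasIntegrals {G : Subgroup (GL (Fin 2) (RatFunc F))} (hG : IsArithmetic G)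
    (hd : n - 2 ≤ 2 * h) (hh : h ≤ n - 2) (c : HarmonicCocycles G n) : ∃ μ : CnDual F h,
      HasIntegrals c.1 μ ∧ HasLimitIntegralsAtInfty μ ∧ IsAdmissible μ := by
  obtain ⟨N, hN⟩ := exists_isCongruenceCocycle hG c
  obtain ⟨C, D⟩ := hN.exists_isGluedData hd
  obtain ⟨μ, hμ, hlim, hadm⟩ := D.exists_measure hh
  have h0 : HasZeroTotal n μ := fun f hf => by
    obtain ⟨L₀, hL⟩ := D.exists_fin_eq_zero
    refine tendsto_const_nhds.congr' ?_
    filter_upwards [eventually_ge_atTop (L₀ : ℤ)] with L hL'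
    rw [truncPoly_univ, hμ _ _ _ hf, hL L hL']
    rfl
  refine ⟨μ, ⟨fun e f hf => ?_, h0⟩, hlim, hadm⟩
  obtain ⟨b, l, rfl | rfl⟩ := e.eq_downEdge_or_upEdge
  · rw [← moment_apply, ← hμ b l f hf]
    exact hasPolyIntegral_downEdge μ b l f
  · rw [hN.toIsHarmonic.upEdge, LinearMap.neg_apply, ← moment_apply, ← hμ b l f hf]
    exact (h0 f hf).upEdge b l

/-- The integral over the ball `B_b(|π|^l)` as a functional on forms of degree `d`. -/
def ballFunctional (μ : CnDual F h) (d : ℕ) (b : Kinf F) (l : ℤ) :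
    Module.Dual (Cinf F) (Form F d) where
  toFun P := integral μ (locPoly b l (dehom P))
  map_add' P Q := by
    rw [← integral_add μ (locPoly_mem _ _ _) (locPoly_mem _ _ _), ← locPoly_add]
    congr 2
    exact map_add (MvPolynomial.aeval _) P.1 Q.1
  map_smul' a P := by
    rw [RingHom.id_apply, smul_eq_mul, ← integral_smul μ a (locPoly_mem _ _ _), ← locPoly_smul]
    congr 2
    exact map_smul (MvPolynomial.aeval _) a P.1

theorem ballFunctional_hom (μ : CnDual F h) {d : ℕ} (b : Kinf F) (l : ℤ) {f : Polynomial (Cinf F)}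
    (hf : f.natDegree ≤ d) : ballFunctional μ d b l (hom d f) = integral μ (locPoly b l f) :=
  congrArg (fun f => integral μ (locPoly b l f)) (dehom_hom hf)

/-- The converse construction. Zero total makes the integrals over all `U(e)` exist; they are linear
in the polynomial and so define a functional on forms. -/
theorem HasZeroTotal.exists_hasIntegrals (h0 : HasZeroTotal n μ) :
    ∃ c : Edge F → Module.Dual (Cinf F) (Form F (n - 2)), HasIntegrals c μ := by
  have h1 : ∀ e : Edge F, ∃ φ : Module.Dual (Cinf F) (Form F (n - 2)), ∀ f : Polynomial (Cinf F),
      f.natDegree ≤ n - 2 → HasPolyIntegral μ e.ends f (φ (hom (n - 2) f)) := by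
    intro e
    obtain ⟨b, l, rfl | rfl⟩ := e.eq_downEdge_or_upEdge
    · refine ⟨ballFunctional μ _ b l, fun f hf => ?_⟩
      rw [ballFunctional_hom μ b l hf]
      exact hasPolyIntegral_downEdge μ b l f
    · refine ⟨-ballFunctional μ _ b l, fun f hf => ?_⟩
      rw [LinearMap.neg_apply, ballFunctional_hom μ b l hf]
      exact (h0 f hf).upEdge b l
  choose c hc using h1
  exact ⟨c, hc, h0⟩

theorem HasIntegrals.ext_hom (H : HasIntegrals c μ) {e : Edge F}
    {φ : Module.Dual (Cinf F) (Form F (n - 2))} (hφ : ∀ f : Polynomial (Cinf F),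
      f.natDegree ≤ n - 2 → HasPolyIntegral μ e.ends f (φ (hom (n - 2) f))) : c e = φ :=
  LinearMap.ext fun P => by
    rw [← hom_dehom P]
    exact (H.edge e _ (natDegree_dehom_le P)).unique (hφ _ (natDegree_dehom_le P))

theorem HasIntegrals.downEdge (H : HasIntegrals c μ) (b : Kinf F) (l : ℤ) :
    c (downEdge b l) = ballFunctional μ _ b l :=
  H.ext_hom fun f hf => by
    rw [ballFunctional_hom μ b l hf]
    exact hasPolyIntegral_downEdge μ b l f

theorem HasIntegrals.upEdge (H : HasIntegrals c μ) (b : Kinf F) (l : ℤ) :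
    c (upEdge b l) = -ballFunctional μ _ b l :=
  H.ext_hom fun f hf => by
    rw [LinearMap.neg_apply, ballFunctional_hom μ b l hf]
    exact (H.zeroTotal f hf).upEdge b l

theorem ballFunctional_eq_sum (μ : CnDual F h) (d : ℕ) (b : Kinf F) (l : ℤ) :
    ballFunctional μ d b l = ∑ ε : F, ballFunctional μ d (subCenter b l ε) (l + 1) :=
  LinearMap.ext fun P => by
    rw [LinearMap.sum_apply]
    change integral μ _ = ∑ ε : F, integral μ (locPoly (subCenter b l ε) (l + 1) (dehom P))
    rw [locPoly_eq_sum, integral_sum μ _ fun ε _ => locPoly_mem _ _ _]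

/-- Opposite edges have complementary sets of ends, and the integral over a ball is the sum over its
sub-balls. -/
theorem HasIntegrals.isHarmonic (H : HasIntegrals c μ) : IsHarmonic c := by
  have hopp : ∀ e e' : Edge F, e'.src = e.tgt → e'.tgt = e.src → c e + c e' = 0 := by
    intro e e' h1 h2
    obtain ⟨b, l, rfl | rfl⟩ := e.eq_downEdge_or_upEdge
    · rw [show e' = CharPMeasure.upEdge b l from Edge.ext h1 h2, H.downEdge, H.upEdge, add_neg_cancel]
    · rw [show e' = CharPMeasure.downEdge b l from Edge.ext h1 h2, H.downEdge, H.upEdge,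
        neg_add_cancel]
  refine ⟨fun v => ?_, hopp⟩
  obtain ⟨b, l, rfl⟩ := v.exists_eq_ballVertex
  rw [sum_edges_into_ballVertex c b l hopp, H.downEdge, ballFunctional_eq_sum, sub_eq_zero]
  exact Finset.sum_congr rfl fun ε _ => (H.downEdge _ _).symm

/-- Every form is homogenised from a polynomial, and limits are unique, so equality of integrals
gives equality of the values of `c`. -/
theorem HasIntegrals.mem_harmonicCocycles (H : HasIntegrals c μ)
    {G : Subgroup (GL (Fin 2) (RatFunc F))} (hμ : IsEquivariant G n μ) :
    c ∈ HarmonicCocycles G n := by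
  refine ⟨H.isHarmonic.sum, H.isHarmonic.opp, fun g hg e P => ?_⟩
  obtain ⟨I, h1, h2⟩ := hμ g hg e (dehom P) (natDegree_dehom_le P)
  have h3 := (H.edge _ _ (natDegree_dehom_le P)).unique h1
  have h4 := (H.edge_slashPoly g e (dehom P)).unique h2
  rw [hom_dehom] at h3 h4
  exact h3.trans h4.symm

end MeasureOf

end PolynomialIntegrals

end CharPMeasure

end

theorem mainTheorem9 {F : Type*} [Field F] [Fintype F]
    (G : Subgroup (GL (Fin 2) (RatFunc F))) (hG : IsArithmetic G)
    (n : ℕ) (hn : 2 ≤ n) (h : ℕ) (hh : h = ⌈((n : ℝ) - 2) / 2⌉₊) :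
    ∃ Φ : HarmonicCocycles G n →ₗ[Cinf F] CnDual F h,
      (∀ (c : HarmonicCocycles G n) (μ : CnDual F h), IsMeasureOf c.1 μ ↔ μ = Φ c) ∧
      Function.Injective Φ ∧
      Set.range Φ = {μ | IsAdmissible μ ∧ HasLimitIntegralsAtInfty μ ∧
        IsEquivariant G n μ ∧ HasZeroTotal n μ} := by
  have hcast : ((n : ℝ) - 2) = ((n - 2 : ℕ) : ℝ) := by push_cast [Nat.cast_sub hn]; ring
  rw [hcast] at hh
  -- Rounding up gives the growth of order `h`.
  have hd : n - 2 ≤ 2 * h := by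
    have h1 := Nat.le_ceil (((n - 2 : ℕ) : ℝ) / 2)
    rw [← hh, div_le_iff₀ two_pos, mul_comm] at h1
    exact_mod_cast h1
  -- This ensures that interpolation polynomials of degree `h` have prescribed moments.
  have hle : h ≤ n - 2 := by
    rw [hh, Nat.ceil_le]
    exact half_le_self (Nat.cast_nonneg _)
  choose Φ hΦ hlim hadm using exists_hasIntegrals (F := F) hG hd hle
  have hΦ' := fun c => (hΦ c).isMeasureOf (hlim c)
  -- Linearity of the chosen `Φ` and the description of its range both follow from this
  -- characterisation.
  have hiff : ∀ (c : HarmonicCocycles G n) (μ : CnDual F h), IsMeasureOf c.1 μ ↔ μ = Φ c :=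
    fun c μ => ⟨fun hμ => hμ.unique hle (hΦ' c), fun hμ => hμ ▸ hΦ' c⟩
  refine ⟨⟨⟨Φ, fun c c' => ?_⟩, fun a c => ?_⟩, hiff, fun c c' hcc => ?_, Set.ext fun μ =>
    ⟨?_, ?_⟩⟩
  · exact ((hiff _ _).mp ((hΦ' c).add (hΦ' c'))).symm
  · exact ((hiff _ _).mp ((hΦ' c).smul a)).symm
  · have h1 : IsMeasureOf c'.1 (Φ c) := (hiff _ _).mpr hcc
    exact Subtype.ext (IsHarmonic.isMeasureOf_ext ⟨c.2.1, c.2.2.1⟩ ⟨c'.2.1, c'.2.2.1⟩ (hΦ' c) h1)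
  · rintro ⟨c, rfl⟩
    exact ⟨hadm c, hlim c, (hΦ c).isEquivariant c.2, (hΦ c).zeroTotal⟩
  · rintro ⟨_, h1, h2, h3⟩
    obtain ⟨c, hc⟩ := h3.exists_hasIntegrals
    exact ⟨⟨c, hc.mem_harmonicCocycles h2⟩, ((hiff _ _).mp (hc.isMeasureOf h1)).symm⟩
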